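/- **Setting.** Let $X$ be a tempered stable Lévy process (TSP) with Brownian component: a càdlàg process with $X(0)=0$ and independent stationary increments such that $E e^{iuX(t)}=e^{t\psi(u)}$ with $$\psi(u)=-\tfrac12\sigma^2u(u+i)+\int_{\mathbb R}\bigl(e^{iux}-1-iu(e^x-1)\bigr)\nu(dx),\qquad \nu(dx)=\Bigl(\tfrac{c_+e^{-\kappa_+x}}{x^{\alpha+1}}1_{x>0}+\tfrac{c_-e^{-\kappa_-|x|}}{|x|^{\alpha+1}}1_{x<0}\Bigr)dx,$$ where $\sigma\ge0$, $\kappa_+\ge1$, $\kappa_-\ge0$, $c_\pm\ge0$, $c_++c_->0$; the asset is $F(t)=F(0)e^{X(t)}$. Four cases are considered: (A) $\alpha\in(0,1),\sigma=0$; (B) $\alpha\in(1,2),\sigma=0$; (C) $\alpha\in(0,1),\sigma>0$; (D) $\alpha\in(1,2),\sigma>0$. Put $\mathsf C(\tau,k)=E(e^{X(\tau)}-e^k)^+$ and let $\sigma_{imp}(\tau,k)\ge 0$ be the implied volatility, i.e. $\mathsf C(\tau,k)=\mathsf C^{BS}(\sigma_{imp}^2\tau,k)$, where $\mathsf C^{BS}(v,k)=\Phi(d_+)-e^k\Phi(d_-)$,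 $d_\pm=(-k\pm v/2)/\sqrt v$ for $v>0$, $\mathsf C^{BS}(0,k)=(1-e^k)^+$, and $\Phi$ is the standard normal distribution function. Let $\Sigma(\tau,\Delta)=\sigma_{imp}(\tau,k)$ for the $k$ with $\sigma_{imp}(\tau,k)>0$ and $\Phi(d_+)=\Delta$ at $v=\sigma_{imp}(\tau,k)^2\tau$. Define the 25-delta risk reversal and butterfly and their leading (slope and convexity) approximations $$RR(\tau)=\Sigma(\tau,\tfrac34)-\Sigma(\tau,\tfrac14),\qquad BF(\tau)=\tfrac12\bigl(\Sigma(\tau,\tfrac34)+\Sigma(\tau,\tfrac14)-2\Sigma(\tau,\tfrac12)\bigr),$$ $$\widehat{RR}(\tau)=\tfrac12\,\partial_\Delta\Sigma(\tau,\tfrac12),\qquad \widehat{BF}(\tau)=\tfrac1{32}\,\partial^2_\Delta\Sigma(\tau,\tfrac12).$$ **Constants.** $\alpha'=1/\alpha$, $a_\pm=\Gamma(-\alpha)c_\pm$, $\gamma=a_+(\kappa_+^\alpha-(\kappa_+-1)^\alpha)+a_-(\kappa_-^\alpha-(\kappa_-+1)^\alpha)$, $\delta=-a_+\kappa_+^\alpha-a_-\kappa_-^\alpha$,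 $\varrho=a_+\kappa_+^\alpha+a_-(\kappa_-+1)^\alpha$, $p=(a_++a_-)\cos\frac{\pi\alpha}2$, $q=-(a_+-a_-)\sin\frac{\pi\alpha}2$, $r=\sqrt{p^2+q^2}$, $\chi=\arctan(-q/p)$, and - $C_L^{(A)}=-(\min(\gamma,0)+\delta+\varrho)$, $C_M^{(A)}=-\frac12\operatorname{sign}\gamma$; - $C_L^{(B)}=\frac1\pi\Gamma(1-\alpha')r^{\alpha'}\cos(\alpha'\chi)$, $C_M^{(B)}=-\frac1\pi\alpha'\chi$, $C_N^{(B)}=\frac1\pi\Gamma(1+\alpha')r^{-\alpha'}\cos(\alpha'\chi)$; - $C_L^{(C)}=-(\frac12\gamma+\delta+\varrho)$, $C_M^{(C)}=-\frac{\gamma}{\sqrt{2\pi}\,\sigma}$; - $C_L^{(D)}=-\frac1\pi2^{(\alpha-3)/2}\Gamma(\frac{\alpha-1}2)p\,\sigma^{1-\alpha}$, $C_M^{(D)}=-\frac1\pi2^{(\alpha-2)/2}\Gamma(\frac\alpha2)q\,\sigma^{-\alpha}$, $C_N^{(D)}=\frac1\pi2^{(\alpha-1)/2}\Gamma(\frac{\alpha+1}2)p\,\sigma^{-(\alpha+1)}$.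 **Proposition.** In cases (A)–(D), for every $\tau>0$, $\sigma_{imp}(\tau,k)$ exists and is unique for every $k$, each $\Delta\in(0,1)$ is the delta of exactly one $k$, and $\Sigma(\tau,\cdot)$ is twice continuously differentiable near $\frac12$. As $\tau\to0+$, with $f\sim c\,\tau^e$ meaning $f=c\,\tau^e+o(\tau^e)$: - (A) if $\gamma\neq0$, $\widehat{RR}\sim-\sqrt{2\pi^3}\,C_L^{(A)}C_M^{(A)}\tau^{1/2}$ (no claim for the butterfly in this degenerate case); - (B) $\widehat{RR}\sim-\sqrt{2\pi^3}\,C_L^{(B)}C_M^{(B)}\tau^{\alpha'-1/2}$ and $\widehat{BF}\sim\frac{\sqrt{2\pi^3}}{16}C_L^{(B)}\bigl(-1+2\pi C_L^{(B)}C_N^{(B)}+4\pi(C_M^{(B)})^2\bigr)\tau^{\alpha'-1/2}$; - (C) $\widehat{RR}\sim-\pi\sigma C_M^{(C)}\tau^{1/2}$ and $\widehat{BF}\sim\frac{\sqrt{2\pi^3}}{16}C_L^{(C)}\tau^{1/2}$; - (D) $\widehat{RR}\sim-\pi\sigma C_M^{(D)}\tau^{(2-\alpha)/2}$ and $\widehat{BF}\sim\frac{\sqrt{2\pi^3}}{16}\bigl(C_L^{(D)}+\sigma^2C_N^{(D)}\bigr)\tau^{(2-\alpha)/2}$.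 Moreover $RR$ and (in cases (B)–(D)) $BF$ themselves are $O$ of the same powers of $\tau$. In particular, in the non-degenerate cases (B), (C), (D) all of $\widehat{RR},\widehat{BF},RR,BF$ tend to $0$, so TSPs cannot produce nonzero finite short-time limits of risk reversals and butterflies. -/

import Mathlib

open MeasureTheory ProbabilityTheory Filter Topology Asymptotics
open scoped NNReal

noncomputable section

namespace TSP

/-! ### Tempered stable processes -/

/-- Parameters of a tempered stable Lévy process with an added Brownian component: stability index
`α < 2`, diffusion volatility `σ`, jump intensities `c₊`, `c₋` and tempering rates `κ₊ ≥ 1`,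
`κ₋ ≥ 0`. -/
structure Params where
  α : ℝ
  σ : ℝ
  cPos : ℝ
  cNeg : ℝ
  κPos : ℝ
  κNeg : ℝ
  α_lt_two : α < 2
  σ_nonneg : 0 ≤ σ
  cPos_nonneg : 0 ≤ cPos
  cNeg_nonneg : 0 ≤ cNeg
  one_le_κPos : 1 ≤ κPos
  κNeg_nonneg : 0 ≤ κNeg

namespace Params

variable (θ : Params)

/-- Density of the Lévy measure. -/
def levyDensity (x : ℝ) : ℝ :=
  if 0 < x then θ.cPos / x ^ (θ.α + 1) * Real.exp (-θ.κPos * x)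
  else if x < 0 then θ.cNeg / |x| ^ (θ.α + 1) * Real.exp (-θ.κNeg * |x|)
  else 0

/-- The Lévy measure `ν`. -/
def levyMeasure : Measure ℝ :=
  volume.withDensity fun x => ENNReal.ofReal (θ.levyDensity x)

/-- The Lévy exponent, in the Lévy–Khinchine form in which the drift is fixed by the martingale
condition `E exp (X t) = 1`:
`ψ(u) = -σ²/2 u(u+i) + ∫ (exp(iux) - 1 - iu (exp x - 1)) ν(dx)`. -/
def levyExponent (u : ℝ) : ℂ :=
  -(1 / 2) * (θ.σ : ℂ) ^ 2 * u * (u + Complex.I)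
    + ∫ x : ℝ, (Complex.exp (Complex.I * u * x) - 1 - Complex.I * u * (Complex.exp x - 1))
        ∂θ.levyMeasure

end Params

/-- A real Lévy process: starts at `0`, independent and stationary increments, càdlàg paths. -/
structure IsLevyProcess {Ω : Type*} [MeasurableSpace Ω] (X : ℝ≥0 → Ω → ℝ) (P : Measure Ω) :
    Prop where
  measurable : ∀ t, Measurable (X t)
  start : ∀ᵐ ω ∂P, X 0 ω = 0
  indep : HasIndepIncrements X P
  stationary : ∀ s h, P.map (fun ω => X (s + h) ω - X s ω) = P.map (X h)
  cadlag : ∀ᵐ ω ∂P, ∀ t, ContinuousWithinAt (fun s => X s ω) (Set.Ici t) t ∧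
    ∃ l, Tendsto (fun s => X s ω) (𝓝[<] t) (𝓝 l)

/-- `X` is the tempered stable Lévy process (with Brownian component) with parameters `θ`. -/
structure IsTSP {Ω : Type*} [MeasurableSpace Ω] (θ : Params) (X : ℝ≥0 → Ω → ℝ) (P : Measure Ω) :
    Prop extends IsLevyProcess X P where
  charFun_eq : ∀ (t : ℝ≥0) (u : ℝ),
    charFun (P.map (X t)) u = Complex.exp ((t : ℂ) * θ.levyExponent u)

/-! ### The Black–Scholes formula and the smile as a function of delta -/

/-- Standard normal distribution function. -/
def Phi (x : ℝ) : ℝ := cdf (gaussianReal 0 1) x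

/-- `d₊` as a function of total variance `v = σ²τ` and log-moneyness `k = log (K / F)`. -/
def dPlus (v k : ℝ) : ℝ := (-k + v / 2) / √v

/-- `d₋` as a function of total variance `v = σ²τ` and log-moneyness `k = log (K / F)`. -/
def dMinus (v k : ℝ) : ℝ := (-k - v / 2) / √v

/-- Normalized Black–Scholes call price `C / F`, with its limit `(1 - exp k)⁺` at `v = 0`. -/
def bsCall (v k : ℝ) : ℝ :=
  if 0 < v then Phi (dPlus v k) - Real.exp k * Phi (dMinus v k) else max (1 - Real.exp k) 0

section Smile

variable {Ω : Type*} [MeasurableSpace Ω] (P : Measure Ω) (X : ℝ≥0 → Ω → ℝ)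

/-- Normalized price `C / F` of a call with time to expiry `τ` and log-moneyness `k` when the
asset is `F(t) = F(0) exp (X t)`. -/
def callPrice (τ k : ℝ) : ℝ :=
  ∫ ω, max (Real.exp (X τ.toNNReal ω) - Real.exp k) 0 ∂P

/-- `s` is an implied volatility of the call with time to expiry `τ` and log-moneyness `k`. -/
def IsImpliedVol (τ k s : ℝ) : Prop := 0 ≤ s ∧ bsCall (s ^ 2 * τ) k = callPrice P X τ k

/-- Implied volatility `σ_imp(τ, k)`. -/
def impliedVol (τ k : ℝ) : ℝ := Classical.epsilon fun s => IsImpliedVol P X τ k s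

/-- The call with time to expiry `τ` and log-moneyness `k` has (forward) delta
`Φ(d₊) = Δ`. -/
def HasDelta (τ k Δ : ℝ) : Prop :=
  0 < impliedVol P X τ k ∧ Phi (dPlus (impliedVol P X τ k ^ 2 * τ) k) = Δ

/-- The log-moneyness of the call with time to expiry `τ` and delta `Δ`. -/
def deltaStrike (τ Δ : ℝ) : ℝ := Classical.epsilon fun k => HasDelta P X τ k Δ

/-- The smile in delta coordinates, `Σ(τ, Δ)`. -/
def smile (τ Δ : ℝ) : ℝ := impliedVol P X τ (deltaStrike P X τ Δ)

/-- The 25-delta risk reversal `Σ(τ, 0.75) - Σ(τ, 0.25)`. -/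
def RR (τ : ℝ) : ℝ := smile P X τ (3 / 4) - smile P X τ (1 / 4)

/-- The 25-delta butterfly `(Σ(τ, 0.75) + Σ(τ, 0.25) - 2 Σ(τ, 0.5)) / 2`. -/
def BF (τ : ℝ) : ℝ :=
  1 / 2 * (smile P X τ (3 / 4) + smile P X τ (1 / 4) - 2 * smile P X τ (1 / 2))

/-- The risk reversal to leading order in the width of the delta interval,
`(1/2) ∂Σ/∂Δ` at `Δ = 1/2`. -/
def slopeRR (τ : ℝ) : ℝ := 1 / 2 * deriv (smile P X τ) (1 / 2)

/-- The butterfly to leading order in the width of the delta interval,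
`(1/32) ∂²Σ/∂Δ²` at `Δ = 1/2`. -/
def convexityBF (τ : ℝ) : ℝ := 1 / 32 * iteratedDeriv 2 (smile P X τ) (1 / 2)

/-- The quantities above are well defined at every time to expiry: implied volatilities exist and
are unique, every delta in `(0, 1)` is attained at exactly one strike, and the smile is twice
continuously differentiable in delta at `1/2`. -/
def SmileWellDefined : Prop :=
  ∀ τ : ℝ, 0 < τ →
    (∀ k : ℝ, ∃! s : ℝ, IsImpliedVol P X τ k s) ∧
    (∀ Δ : ℝ, 0 < Δ → Δ < 1 → ∃! k : ℝ, HasDelta P X τ k Δ) ∧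
    ContDiffAt ℝ 2 (smile P X τ) (1 / 2)

end Smile

/-! ### The four cases and the constants -/

namespace Params

variable (θ : Params)

def CaseA : Prop := 0 < θ.α ∧ θ.α < 1 ∧ θ.σ = 0
def CaseB : Prop := 1 < θ.α ∧ θ.α < 2 ∧ θ.σ = 0
def CaseC : Prop := 0 < θ.α ∧ θ.α < 1 ∧ 0 < θ.σ
def CaseD : Prop := 1 < θ.α ∧ θ.α < 2 ∧ 0 < θ.σ

def aPos : ℝ := Real.Gamma (-θ.α) * θ.cPos
def aNeg : ℝ := Real.Gamma (-θ.α) * θ.cNeg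

def γ : ℝ :=
  θ.aPos * (θ.κPos ^ θ.α - (θ.κPos - 1) ^ θ.α) + θ.aNeg * (θ.κNeg ^ θ.α - (θ.κNeg + 1) ^ θ.α)

def δ : ℝ := -(θ.aPos * θ.κPos ^ θ.α) - θ.aNeg * θ.κNeg ^ θ.α

/-- The closed form of `(1/π) Re ∫₀^∞ (∑ₛ aₛ (κₛ - s (iu + 1/2))^α) / (u² + 1/4) du`. -/
def ϱ : ℝ := θ.aPos * θ.κPos ^ θ.α + θ.aNeg * (θ.κNeg + 1) ^ θ.α

def p : ℝ := (θ.aPos + θ.aNeg) * Real.cos (Real.pi * θ.α / 2)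
def q : ℝ := -(θ.aPos - θ.aNeg) * Real.sin (Real.pi * θ.α / 2)
def r : ℝ := √(θ.p ^ 2 + θ.q ^ 2)
def χ : ℝ := Real.arctan (-θ.q / θ.p)

/-- Here `(γ)⁻ = min γ 0`. -/
def LA : ℝ := -(min θ.γ 0 + θ.δ + θ.ϱ)
def MA : ℝ := -(1 / 2) * Real.sign θ.γ

def LB : ℝ := 1 / Real.pi * Real.Gamma (1 - 1 / θ.α) * θ.r ^ (1 / θ.α) * Real.cos (1 / θ.α * θ.χ)
def MB : ℝ := -(1 / Real.pi) * (1 / θ.α) * θ.χ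
def NB : ℝ :=
  1 / Real.pi * Real.Gamma (1 + 1 / θ.α) * θ.r ^ (-(1 / θ.α)) * Real.cos (1 / θ.α * θ.χ)

def LC : ℝ := -(1 / 2 * θ.γ + θ.δ + θ.ϱ)
def MC : ℝ := -(1 / √(2 * Real.pi)) * θ.γ / θ.σ

def LD : ℝ :=
  -(1 / Real.pi) * 2 ^ ((θ.α - 3) / 2) * Real.Gamma ((θ.α - 1) / 2) * θ.p * θ.σ ^ (-(θ.α - 1))
def MD : ℝ :=
  -(1 / Real.pi) * 2 ^ ((θ.α - 2) / 2) * Real.Gamma (θ.α / 2) * θ.q * θ.σ ^ (-θ.α)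
def ND : ℝ :=
  1 / Real.pi * 2 ^ ((θ.α - 1) / 2) * Real.Gamma ((θ.α + 1) / 2) * θ.p * θ.σ ^ (-(θ.α + 1))

end Params

/-- `f(τ) = c τ^e + o(τ^e)` as `τ → 0+`. -/
def LeadingTerm (f : ℝ → ℝ) (c e : ℝ) : Prop :=
  (fun τ => f τ - c * τ ^ e) =o[𝓝[>] 0] fun τ => τ ^ e

/-- `f(τ) = O(τ^e)` as `τ → 0+`. -/
def HasRate (f : ℝ → ℝ) (e : ℝ) : Prop := f =O[𝓝[>] 0] fun τ => τ ^ e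

/-- `f(τ) → 0` as `τ → 0+`. -/
def Vanishes (f : ℝ → ℝ) : Prop := Tendsto f (𝓝[>] 0) (𝓝 0)

end TSP

end

open MeasureTheory ProbabilityTheory Filter Topology Asymptotics
open scoped NNReal

noncomputable section

namespace TSP

/-! ### The standard normal distribution function -/

/-! Write Δ = Φ(d). At total volatility w the call with d₊ = d has log-strike k = w²/2 − wd, so the
total implied volatility at that delta (`volAt`) is the zero in w of `deltaGap`, the model price
minus the Black–Scholes price along these strikes. The w-derivative of `deltaGap` is −e^k(φ(d₋) +
d₋(Φ(d₋) − T(k))), with T the tail probability, and φ(x) + x(Φ(x) − P) > 0 whenever 0 ≤ P ≤ 1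
(`mills_pos_of_mem`). So every arbitrage-free price curve has exactly one strike per delta, the
implicit function theorem makes `volAt` twice continuously differentiable, and implicit
differentiation gives its first two derivatives in terms of price, tail and density
(`hasDerivAt_volAt`, `hasDerivAt_deriv_volAt`). Since Σ(τ, Φ(d)) = volAt(d)/√τ (`smile_Phi`), slope
and convexity at Δ = 1/2 reduce to short-time limits at the strike w²/2: L for the price, M for the
tail, N for the density.

This reduction comes in two forms. Without diffusion, w is of the order τ^β of the at-the-money
price (`slopeRR_leadingTerm_of_tendsto`, `convexityBF_leadingTerm_of_tendsto`). With diffusion, w =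
σ√τ + O(τ^(1/2+e)) and L, M, N measure the deviation from Black–Scholes
(`slopeRR_leadingTerm_of_diffusive`, `convexityBF_leadingTerm_of_diffusive`). The bounds on RR and
BF follow from bounds on `volAt` at the fixed deltas.

Price, tail and density are Fourier integrals of E exp((1/2 + iu)X) against 1/(u² + 1/4), 1/(1/2 +
iu) and 1 (`callCurve_of_law`). The hypothesis only gives the characteristic function on the real
line. Its analytic continuation to the strip 0 ≤ Re z ≤ 1 is bounded by 1; Gaussian smoothing, a
contour shift and Fourier inversion identify it with E exp(zX) inside the strip, and Fatou together
with dominated convergence gives E exp X = 1 (`StripExtension.integral_exp`). The exponent itself is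
computed from Gamma integrals (`psi_eq`); its jump part grows like u^α(p + iq) with p < 0, which
makes the transform integrable.

The four cases are dominated convergence at different scales. For α < 1 the transform is Gaussian
part times drift times 1 + O(t), so the drift γt acts as a shift of the strike and the rest
contributes an explicit term of order t; in case A the tail is squeezed between chords of the convex
price function. In case B, frequencies of order t^(−1/α) lead to a stable law whose integrals are
explicit. In cases C and D, frequencies of order t^(−1/2) turn the difference from Black–Scholes
into Gaussian moments of the leading non-Gaussian exponent (the price in case C instead comes from
the expansion for α < 1). -/

/-- Standard normal density. -/
def gpdf (x : ℝ) : ℝ := Real.exp (-x ^ 2 / 2) / √(2 * Real.pi)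

lemma gpdf_eq (x : ℝ) : gpdf x = gaussianPDFReal 0 1 x := by
  simp [gpdf, gaussianPDFReal, div_eq_inv_mul]

lemma gpdf_pos (x : ℝ) : 0 < gpdf x := by unfold gpdf; positivity

lemma gpdf_neg (x : ℝ) : gpdf (-x) = gpdf x := by simp [gpdf]

lemma gpdf_zero : gpdf 0 = 1 / √(2 * Real.pi) := by simp [gpdf]

lemma hasDerivAt_gpdf (x : ℝ) : HasDerivAt gpdf (-x * gpdf x) x := by
  have h : HasDerivAt (fun x : ℝ => -x ^ 2 / 2) (-x) x := by
    have := ((hasDerivAt_id x).pow 2).neg.div_const 2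
    refine this.congr_deriv ?_
    simp
    ring
  refine (h.exp.div_const √(2 * Real.pi)).congr_deriv ?_
  rw [gpdf]
  ring

lemma continuous_gpdf : Continuous gpdf :=
  continuous_iff_continuousAt.2 fun x => (hasDerivAt_gpdf x).continuousAt

lemma contDiff_gpdf {n : WithTop ℕ∞} : ContDiff ℝ n gpdf := by
  unfold gpdf
  exact (((contDiff_id.pow 2).neg.div_const 2).exp).div_const _

lemma gpdf_le_of_abs_le {x y : ℝ} (h : |x| ≤ y) : gpdf y ≤ gpdf x := by
  unfold gpdf
  have : x ^ 2 ≤ y ^ 2 := sq_le_sq' (by linarith [neg_abs_le x]) ((le_abs_self x).trans h)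
  exact div_le_div_of_nonneg_right (Real.exp_le_exp.2 (by linarith)) (Real.sqrt_nonneg _)

lemma gpdf_le_zero (x : ℝ) : gpdf x ≤ gpdf 0 := by
  unfold gpdf
  exact div_le_div_of_nonneg_right (Real.exp_le_exp.2 (by nlinarith [sq_nonneg x]))
    (Real.sqrt_nonneg _)

/-- The identity `exp k φ(d₋) = φ(d₊)`. -/
lemma exp_mul_gpdf (w d : ℝ) : Real.exp (w ^ 2 / 2 - w * d) * gpdf (d - w) = gpdf d := by
  unfold gpdf
  rw [← mul_div_assoc, ← Real.exp_add]
  congr 2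
  ring

lemma integrable_gpdf : Integrable gpdf := by
  have := integrable_gaussianPDFReal 0 1
  exact this.congr (Eventually.of_forall fun x => (gpdf_eq x).symm)

lemma Phi_eq_integral (x : ℝ) : Phi x = ∫ y in Set.Iic x, gpdf y := by
  rw [Phi, cdf_eq_real, Measure.real, gaussianReal_apply_eq_integral 0 (by norm_num) (Set.Iic x),
    ENNReal.toReal_ofReal]
  · simp_rw [gpdf_eq]
  · exact integral_nonneg fun y => gaussianPDFReal_nonneg 0 1 y

lemma hasDerivAt_Phi (x : ℝ) : HasDerivAt Phi (gpdf x) x := by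
  have h : ∀ y, Phi y = Phi 0 + ∫ z in (0 : ℝ)..y, gpdf z := fun y => by
    rw [Phi_eq_integral, Phi_eq_integral, ← intervalIntegral.integral_Iic_sub_Iic
      integrable_gpdf.integrableOn integrable_gpdf.integrableOn]
    ring
  rw [show Phi = fun y => Phi 0 + ∫ z in (0 : ℝ)..y, gpdf z from funext h]
  exact (intervalIntegral.integral_hasDerivAt_right (continuous_gpdf.intervalIntegrable _ _)
    (continuous_gpdf.stronglyMeasurableAtFilter _ _) continuous_gpdf.continuousAt).const_add _

lemma continuous_Phi : Continuous Phi :=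
  continuous_iff_continuousAt.2 fun x => (hasDerivAt_Phi x).continuousAt

lemma deriv_Phi : deriv Phi = gpdf := funext fun x => (hasDerivAt_Phi x).deriv

lemma contDiff_Phi : ContDiff ℝ 2 Phi := by
  have : (2 : WithTop ℕ∞) = 1 + 1 := by norm_num
  rw [this, contDiff_succ_iff_deriv]
  refine ⟨fun x => (hasDerivAt_Phi x).differentiableAt, by simp, ?_⟩
  rw [deriv_Phi]
  exact contDiff_gpdf

lemma Phi_strictMono : StrictMono Phi :=
  strictMono_of_deriv_pos fun x => by rw [deriv_Phi]; exact gpdf_pos x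

lemma Phi_tendsto_atBot : Tendsto Phi atBot (𝓝 0) := tendsto_cdf_atBot _

lemma Phi_tendsto_atTop : Tendsto Phi atTop (𝓝 1) := tendsto_cdf_atTop _

lemma Phi_pos (x : ℝ) : 0 < Phi x :=
  (cdf_nonneg _ (x - 1)).trans_lt (Phi_strictMono (by linarith))

lemma Phi_lt_one (x : ℝ) : Phi x < 1 :=
  (Phi_strictMono (by linarith : x < x + 1)).trans_le (cdf_le_one _ _)

lemma Phi_neg (x : ℝ) : Phi (-x) = 1 - Phi x := by
  have hd : ∀ y, HasDerivAt (fun y => Phi (-y) + Phi y) 0 y := fun y => by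
    have h1 : HasDerivAt (fun y => Phi (-y)) (gpdf (-y) * -1) y :=
      (hasDerivAt_Phi (-y)).comp y (hasDerivAt_neg y)
    have := h1.add (hasDerivAt_Phi y)
    rw [gpdf_neg] at this
    exact this.congr_deriv (by ring)
  have hc : ∀ y, Phi (-y) + Phi y = Phi (-x) + Phi x := fun y =>
    is_const_of_deriv_eq_zero (fun y => (hd y).differentiableAt) (fun y => (hd y).deriv) y x
  have h1 : Tendsto (fun y => Phi (-y) + Phi y) atTop (𝓝 (0 + 1)) :=
    (Phi_tendsto_atBot.comp tendsto_neg_atTop_atBot).add Phi_tendsto_atTop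
  have h2 := tendsto_nhds_unique h1 (by simp only [hc]; exact tendsto_const_nhds)
  linarith

lemma Phi_zero : Phi 0 = 1 / 2 := by
  have := Phi_neg 0
  rw [neg_zero] at this
  linarith

lemma exists_Phi_eq {Δ : ℝ} (h0 : 0 < Δ) (h1 : Δ < 1) : ∃ d, Phi d = Δ := by
  obtain ⟨a, ha⟩ := (Phi_tendsto_atBot.eventually (gt_mem_nhds h0)).exists
  obtain ⟨b, hb⟩ := (Phi_tendsto_atTop.eventually (lt_mem_nhds h1)).exists
  obtain ⟨d, -, hd⟩ := intermediate_value_univ₂ (f := Phi) (g := fun _ => Δ) continuous_Phi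
    continuous_const ha.le hb.le |>.imp fun d hd => (⟨trivial, hd⟩ : True ∧ _)
  exact ⟨d, hd⟩

lemma tendsto_gpdf_atBot : Tendsto gpdf atBot (𝓝 0) := by
  have h : Tendsto (fun x : ℝ => x ^ 2) atBot atTop := by
    have := (tendsto_pow_atTop (α := ℝ) two_ne_zero).comp tendsto_neg_atBot_atTop
    simpa [Function.comp_def] using this
  have h1 : Tendsto (fun x : ℝ => -x ^ 2 / 2) atBot atBot := by
    have := tendsto_neg_atTop_atBot.comp (h.atTop_div_const (by norm_num : (0 : ℝ) < 2))
    simpa [Function.comp_def, neg_div] using this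
  have := (Real.tendsto_exp_atBot.comp h1).div_const √(2 * Real.pi)
  rw [zero_div] at this
  exact this

/-- Only x < 0 needs an argument: φ(x) is the integral of −yφ(y) over (−∞, x], where −y ≥ −x. -/
lemma mills_nonneg (x : ℝ) : 0 ≤ gpdf x + x * Phi x := by
  have hid : Tendsto (fun y => -y * gpdf y) atBot (𝓝 0) := by
    have h := (Real.tendsto_pow_mul_exp_neg_atTop_nhds_zero 1).comp tendsto_neg_atBot_atTop
    have h' := h.div_const √(2 * Real.pi)
    rw [zero_div] at h'
    refine tendsto_of_tendsto_of_tendsto_of_le_of_le' tendsto_const_nhds h' ?_ ?_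
    · filter_upwards [eventually_le_atBot 0] with y hy
      exact mul_nonneg (by linarith) (gpdf_pos y).le
    · filter_upwards [eventually_le_atBot (-2)] with y hy
      simp only [Function.comp, pow_one, gpdf, ← mul_div_assoc]
      have : (0 : ℝ) ≤ -y := by linarith
      gcongr
      nlinarith
  have hint : Integrable fun y => -y * gpdf y := by
    have := (integrable_mul_exp_neg_mul_sq (half_pos one_pos : (0 : ℝ) < 1 / 2)).const_mul
      (-(1 / √(2 * Real.pi)))
    refine this.congr (Eventually.of_forall fun y => ?_)
    simp only [gpdf]
    rw [show -(1 / 2) * y ^ 2 = -y ^ 2 / 2 by ring]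
    ring
  rcases le_or_gt 0 x with hx | hx
  · have := mul_nonneg hx (Phi_pos x).le
    linarith [gpdf_pos x]
  have hint' : IntegrableOn (fun y => -y * gpdf y) (Set.Iic x) := hint.integrableOn
  have h1 : ∫ y in Set.Iic x, -y * gpdf y = gpdf x - 0 :=
    integral_Iic_of_hasDerivAt_of_tendsto' (fun y _ => hasDerivAt_gpdf y) hint' tendsto_gpdf_atBot
  have h2 : ∫ y in Set.Iic x, -x * gpdf y ≤ ∫ y in Set.Iic x, -y * gpdf y := by
    refine setIntegral_mono_on (integrable_gpdf.integrableOn.const_mul _) hint' measurableSet_Iic ?_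
    intro y hy
    exact mul_le_mul_of_nonneg_right (neg_le_neg hy) (gpdf_pos y).le
  rw [integral_const_mul, ← Phi_eq_integral, h1] at h2
  linarith

lemma hasDerivAt_mills (x : ℝ) : HasDerivAt (fun x => gpdf x + x * Phi x) (Phi x) x := by
  have := (hasDerivAt_gpdf x).add ((hasDerivAt_id x).mul (hasDerivAt_Phi x))
  refine this.congr_deriv ?_
  simp only [id]
  ring

/-- The derivative of the left side is Φ > 0, so the weak inequality at x − 1 gives the strict one
at x. -/
lemma mills_pos (x : ℝ) : 0 < gpdf x + x * Phi x := by
  have hm : StrictMono fun x => gpdf x + x * Phi x :=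
    strictMono_of_deriv_pos fun x => by rw [(hasDerivAt_mills x).deriv]; exact Phi_pos x
  exact (mills_nonneg (x - 1)).trans_lt (hm (by linarith))

/-- The expression is affine in P, and at the endpoints P = 0 and P = 1 it is the Mills inequality
at x and at −x. With P a tail probability this is what makes `deltaGap` strictly monotone. -/
lemma mills_pos_of_mem {x P : ℝ} (h0 : 0 ≤ P) (h1 : P ≤ 1) :
    0 < gpdf x + x * (Phi x - P) := by
  have h2 := mills_pos x
  have h3 := mills_pos (-x)
  rw [gpdf_neg, Phi_neg] at h3
  have e : gpdf x + x * (Phi x - P) =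
      (1 - P) * (gpdf x + x * Phi x) + P * (gpdf x + -x * (1 - Phi x)) := by ring
  rw [e]
  rcases eq_or_lt_of_le h0 with rfl | h0
  · simpa using h2
  · have := mul_nonneg (by linarith : 0 ≤ 1 - P) h2.le
    have := mul_pos h0 h3
    linarith

/-! ### The Black–Scholes call as a function of total volatility -/

/-- Black–Scholes call price at total volatility `w` and log-moneyness `k`. -/
def bsw (w k : ℝ) : ℝ := Phi (-k / w + w / 2) - Real.exp k * Phi (-k / w - w / 2)

lemma bsCall_sq {w : ℝ} (hw : 0 < w) (k : ℝ) : bsCall (w ^ 2) k = bsw w k := by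
  rw [bsCall, if_pos (by positivity), dPlus, dMinus, Real.sqrt_sq hw.le, bsw]
  congr 2 <;> [skip; congr 1] <;> field_simp

lemma dPlus_sq {w : ℝ} (hw : 0 < w) (k : ℝ) : dPlus (w ^ 2) k = -k / w + w / 2 := by
  rw [dPlus, Real.sqrt_sq hw.le]
  field_simp

lemma exp_mul_gpdf' {w : ℝ} (hw : w ≠ 0) (k : ℝ) :
    Real.exp k * gpdf (-k / w - w / 2) = gpdf (-k / w + w / 2) := by
  have := exp_mul_gpdf w (-k / w + w / 2)
  rw [← this]
  congr 2
  · field_simp; ring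
  · ring

/-- The log-strike w²/2 − wd is the one with d₊ = d, and then d₋ = d − w. The right side makes sense
at w = 0 as well, which is why `deltaGap` is written with it. -/
lemma bsw_delta {w : ℝ} (hw : w ≠ 0) (d : ℝ) :
    bsw w (w ^ 2 / 2 - w * d) = Phi d - Real.exp (w ^ 2 / 2 - w * d) * Phi (d - w) := by
  rw [bsw]
  congr 2 <;> [skip; congr 1] <;> field_simp <;> ring

lemma hasDerivAt_bsw_vol {w : ℝ} (hw : w ≠ 0) (k : ℝ) :
    HasDerivAt (fun w => bsw w k) (gpdf (-k / w + w / 2)) w := by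
  have h1 : HasDerivAt (fun w => -k / w + w / 2) (k / w ^ 2 + 1 / 2) w := by
    have := ((hasDerivAt_inv hw).const_mul (-k)).add ((hasDerivAt_id w).div_const 2)
    refine this.congr_deriv ?_
    field_simp
  have h2 : HasDerivAt (fun w => -k / w - w / 2) (k / w ^ 2 - 1 / 2) w := by
    have := ((hasDerivAt_inv hw).const_mul (-k)).sub ((hasDerivAt_id w).div_const 2)
    refine this.congr_deriv ?_
    field_simp
  have := ((hasDerivAt_Phi _).comp w h1).sub (((hasDerivAt_Phi _).comp w h2).const_mul (Real.exp k))
  refine this.congr_deriv ?_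
  rw [← mul_assoc, exp_mul_gpdf' hw]
  ring

lemma hasDerivAt_bsw_strike {w : ℝ} (hw : w ≠ 0) (k : ℝ) :
    HasDerivAt (fun k => bsw w k) (-(Real.exp k * Phi (-k / w - w / 2))) k := by
  have h1 : HasDerivAt (fun k => -k / w + w / 2) (-1 / w) k :=
    ((hasDerivAt_neg k).div_const w).add_const _
  have h2 : HasDerivAt (fun k => -k / w - w / 2) (-1 / w) k :=
    ((hasDerivAt_neg k).div_const w).sub_const _
  have := ((hasDerivAt_Phi _).comp k h1).sub
    ((Real.hasDerivAt_exp k).mul ((hasDerivAt_Phi _).comp k h2))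
  refine this.congr_deriv ?_
  simp only [Function.comp]
  rw [← mul_assoc, exp_mul_gpdf' hw]
  ring

lemma bsw_strictMonoOn (k : ℝ) : StrictMonoOn (fun w => bsw w k) (Set.Ioi 0) := by
  refine strictMonoOn_of_deriv_pos (convex_Ioi 0) ?_ ?_
  · exact fun w hw => (hasDerivAt_bsw_vol (ne_of_gt hw) k).continuousAt.continuousWithinAt
  · intro w hw
    rw [interior_Ioi] at hw
    rw [(hasDerivAt_bsw_vol (ne_of_gt hw) k).deriv]
    exact gpdf_pos _

lemma tendsto_bsw_zero (k : ℝ) :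
    Tendsto (fun w => bsw w k) (𝓝[>] 0) (𝓝 (max (1 - Real.exp k) 0)) := by
  have hw : Tendsto (fun w : ℝ => w / 2) (𝓝[>] 0) (𝓝 0) := by
    have : Tendsto (fun w : ℝ => w / 2) (𝓝 0) (𝓝 (0 / 2)) := tendsto_id.div_const 2
    rw [zero_div] at this
    exact this.mono_left nhdsWithin_le_nhds
  rcases lt_trichotomy k 0 with hk | rfl | hk
  · have h : Tendsto (fun w : ℝ => -k / w) (𝓝[>] 0) atTop :=
      tendsto_inv_nhdsGT_zero.const_mul_atTop (by linarith : 0 < -k)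
    have h1 := Phi_tendsto_atTop.comp (h.atTop_add hw)
    have h2 := Phi_tendsto_atTop.comp (h.atTop_add hw.neg)
    have := h1.sub (h2.const_mul (Real.exp k))
    rw [max_eq_left (by linarith [Real.exp_le_one_iff.2 hk.le])]
    simpa [bsw, Function.comp_def, sub_eq_add_neg] using this
  · have h1 := (continuous_Phi.tendsto 0).comp hw
    have h2 := (continuous_Phi.tendsto (-0)).comp hw.neg
    have := h1.sub h2
    simpa [bsw, Function.comp_def] using this
  · have h : Tendsto (fun w : ℝ => -k / w) (𝓝[>] 0) atBot :=
      tendsto_inv_nhdsGT_zero.const_mul_atTop_of_neg (by linarith : -k < 0)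
    have h1 := Phi_tendsto_atBot.comp (h.atBot_add hw)
    have h2 := Phi_tendsto_atBot.comp (h.atBot_add hw.neg)
    have := h1.sub (h2.const_mul (Real.exp k))
    rw [max_eq_right (by linarith [Real.one_le_exp hk.le])]
    simpa [bsw, Function.comp_def, sub_eq_add_neg] using this

lemma tendsto_bsw_atTop (k : ℝ) : Tendsto (fun w => bsw w k) atTop (𝓝 1) := by
  have h : Tendsto (fun w : ℝ => -k / w) atTop (𝓝 0) := tendsto_const_nhds.div_atTop tendsto_id
  have hw : Tendsto (fun w : ℝ => w / 2) atTop atTop := tendsto_id.atTop_div_const (by norm_num)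
  have h1 := Phi_tendsto_atTop.comp (h.add_atTop hw)
  have h2 := Phi_tendsto_atBot.comp (h.add_atBot (tendsto_neg_atTop_atBot.comp hw))
  have := h1.sub (h2.const_mul (Real.exp k))
  simpa [bsw, Function.comp_def, sub_eq_add_neg] using this

lemma intrinsic_lt_bsw {w : ℝ} (hw : 0 < w) (k : ℝ) : max (1 - Real.exp k) 0 < bsw w k := by
  refine lt_of_le_of_lt ?_
    (bsw_strictMonoOn k (by simpa using half_pos hw : w / 2 ∈ Set.Ioi 0) hw (half_lt_self hw))
  refine le_of_tendsto (tendsto_bsw_zero k) ?_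
  filter_upwards [Ioo_mem_nhdsGT (half_pos hw)] with x hx
  exact (bsw_strictMonoOn k hx.1 (half_pos hw) hx.2).le

/-- Every price strictly between the intrinsic value and the forward has a Black–Scholes
volatility. -/
lemma exists_bsw_eq {k c : ℝ} (h0 : max (1 - Real.exp k) 0 < c) (h1 : c < 1) :
    ∃ w, 0 < w ∧ bsw w k = c := by
  obtain ⟨a, ha0, ha⟩ := (((tendsto_bsw_zero k).eventually (gt_mem_nhds h0)).and
    self_mem_nhdsWithin).exists.imp fun a h => (⟨h.2, h.1⟩ : a ∈ Set.Ioi (0 : ℝ) ∧ bsw a k < c)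
  obtain ⟨b, hb, hab⟩ := (((tendsto_bsw_atTop k).eventually (lt_mem_nhds h1)).and
    (eventually_ge_atTop a)).exists
  have hcont : ContinuousOn (fun w => bsw w k) (Set.Icc a b) := fun w hw =>
    (hasDerivAt_bsw_vol (ne_of_gt (lt_of_lt_of_le ha0 hw.1)) k).continuousAt.continuousWithinAt
  obtain ⟨w, hw, hwc⟩ := intermediate_value_Icc hab hcont ⟨ha.le, hb.le⟩
  exact ⟨w, lt_of_lt_of_le ha0 hw.1, hwc⟩

/-! ### The smile in delta coordinates of an abstract call price curve -/

/-- A twice continuously differentiable arbitrage-free curve `k ↦ C k` of normalized call prices,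
with tail probabilities `T` and density `f`. -/
structure CallCurve (C T f : ℝ → ℝ) : Prop where
  hasDerivAt_price : ∀ k, HasDerivAt C (-(Real.exp k * T k)) k
  hasDerivAt_tail : ∀ k, HasDerivAt T (-f k) k
  continuous_density : Continuous f
  tail_nonneg : ∀ k, 0 ≤ T k
  tail_le_one : ∀ k, T k ≤ 1
  intrinsic_le : ∀ k, max (1 - Real.exp k) 0 ≤ C k
  lt_one : ∀ k, C k < 1
  pos_zero : 0 < C 0
  tendsto_atTop : Tendsto C atTop (𝓝 0)

/-- The difference between the price and the Black–Scholes price with total volatility `w` at the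
strike whose Black–Scholes `d₊` is `d`. -/
def deltaGap (C : ℝ → ℝ) (w d : ℝ) : ℝ :=
  C (w ^ 2 / 2 - w * d) - (Phi d - Real.exp (w ^ 2 / 2 - w * d) * Phi (d - w))

/-- The total implied volatility at the strike with `d₊ = d`. -/
def volAt (C : ℝ → ℝ) (d : ℝ) : ℝ := Classical.epsilon fun w => 0 < w ∧ deltaGap C w d = 0

namespace CallCurve

variable {C T f : ℝ → ℝ}

/-- Along the moving strike k(w) = w²/2 − wd one has k' = w − d = −d₋, so all terms share the factor
e^k and the Mills expression with P = T(k) remains. -/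
lemma hasDerivAt_deltaGap (h : CallCurve C T f) (d w : ℝ) :
    HasDerivAt (fun w => deltaGap C w d)
      (-(Real.exp (w ^ 2 / 2 - w * d) *
        (gpdf (d - w) + (d - w) * (Phi (d - w) - T (w ^ 2 / 2 - w * d))))) w := by
  have hk : HasDerivAt (fun w : ℝ => w ^ 2 / 2 - w * d) (w - d) w := by
    have := (((hasDerivAt_id w).pow 2).div_const 2).sub ((hasDerivAt_id w).mul_const d)
    refine this.congr_deriv ?_
    simp
  have hm : HasDerivAt (fun w : ℝ => d - w) (-1) w := (hasDerivAt_id w).const_sub d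
  have h1 := (h.hasDerivAt_price (w ^ 2 / 2 - w * d)).comp w hk
  have h2 := (hk.exp).mul ((hasDerivAt_Phi (d - w)).comp w hm)
  refine (h1.sub (h2.const_sub (Phi d))).congr_deriv ?_
  simp only [Function.comp]
  ring

lemma strictAnti_deltaGap (h : CallCurve C T f) (d : ℝ) :
    StrictAnti fun w => deltaGap C w d := by
  refine strictAnti_of_deriv_neg fun w => ?_
  rw [(h.hasDerivAt_deltaGap d w).deriv]
  have := mills_pos_of_mem (x := d - w) (h.tail_nonneg (w ^ 2 / 2 - w * d))
    (h.tail_le_one (w ^ 2 / 2 - w * d))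
  have := mul_pos (Real.exp_pos (w ^ 2 / 2 - w * d)) this
  linarith

lemma deltaGap_zero (d : ℝ) : deltaGap C 0 d = C 0 := by simp [deltaGap]

/-- The strike tends to infinity, so the price vanishes; the term e^kΦ(d − w) is at most φ(d)/(w −
d) by the Mills inequality and e^kφ(d₋) = φ(d₊). -/
lemma tendsto_deltaGap (h : CallCurve C T f) (d : ℝ) :
    Tendsto (fun w => deltaGap C w d) atTop (𝓝 (-Phi d)) := by
  have hk : Tendsto (fun w : ℝ => w ^ 2 / 2 - w * d) atTop atTop := by
    have h1 : Tendsto (fun w : ℝ => w * (w / 2 + -d)) atTop atTop :=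
      tendsto_id.atTop_mul_atTop₀
        (tendsto_atTop_add_const_right _ _ (tendsto_id.atTop_div_const (by norm_num)))
    exact h1.congr fun w => by ring
  have hz : Tendsto (fun w => Real.exp (w ^ 2 / 2 - w * d) * Phi (d - w)) atTop (𝓝 0) := by
    have hb : Tendsto (fun w : ℝ => gpdf d / (w - d)) atTop (𝓝 0) :=
      tendsto_const_nhds.div_atTop (tendsto_atTop_add_const_right _ _ tendsto_id)
    refine tendsto_of_tendsto_of_tendsto_of_le_of_le' tendsto_const_nhds hb ?_ ?_
    · exact Eventually.of_forall fun w => (mul_pos (Real.exp_pos _) (Phi_pos _)).le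
    · filter_upwards [eventually_gt_atTop d] with w hw
      have h1 := mills_pos (d - w)
      have h2 : (0 : ℝ) < w - d := by linarith
      rw [le_div_iff₀ h2, ← exp_mul_gpdf w d, mul_assoc]
      exact mul_le_mul_of_nonneg_left (by linarith) (Real.exp_pos _).le
  have := (h.tendsto_atTop.comp hk).sub (hz.const_sub (Phi d))
  simpa [deltaGap] using this

lemma exists_deltaGap_eq_zero (h : CallCurve C T f) (d : ℝ) : ∃ w, 0 < w ∧ deltaGap C w d = 0 := by
  obtain ⟨b, hb, hb0⟩ := (((h.tendsto_deltaGap d).eventually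
    (gt_mem_nhds (neg_lt_zero.2 (Phi_pos d)))).and (eventually_ge_atTop 0)).exists
  have hcont : ContinuousOn (fun w => deltaGap C w d) (Set.Icc 0 b) := fun w _ =>
    (h.hasDerivAt_deltaGap d w).continuousAt.continuousWithinAt
  have h0 : (0 : ℝ) ∈ Set.Icc (deltaGap C b d) (deltaGap C 0 d) :=
    ⟨hb.le, by rw [deltaGap_zero]; exact h.pos_zero.le⟩
  obtain ⟨w, hw, hwc⟩ := intermediate_value_Icc' hb0 hcont h0
  refine ⟨w, lt_of_le_of_ne hw.1 fun h0 => ?_, hwc⟩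
  simp only at hwc
  rw [← h0, deltaGap_zero] at hwc
  exact h.pos_zero.ne' hwc

lemma volAt_spec (h : CallCurve C T f) (d : ℝ) : 0 < volAt C d ∧ deltaGap C (volAt C d) d = 0 :=
  Classical.epsilon_spec (h.exists_deltaGap_eq_zero d)

lemma volAt_pos (h : CallCurve C T f) (d : ℝ) : 0 < volAt C d := (h.volAt_spec d).1

lemma eq_volAt (h : CallCurve C T f) {w d : ℝ} (hw : deltaGap C w d = 0) : w = volAt C d :=
  (h.strictAnti_deltaGap d).injective (hw.trans (h.volAt_spec d).2.symm)

lemma volAt_le (h : CallCurve C T f) {w d : ℝ} (hw : deltaGap C w d ≤ 0) : volAt C d ≤ w :=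
  (h.strictAnti_deltaGap d).le_iff_ge.1 (hw.trans (h.volAt_spec d).2.ge)

/-- The price at the strike with `d₊ = d`. -/
lemma price_volAt (h : CallCurve C T f) (d : ℝ) :
    C (volAt C d ^ 2 / 2 - volAt C d * d) =
      bsw (volAt C d) (volAt C d ^ 2 / 2 - volAt C d * d) := by
  have := (h.volAt_spec d).2
  rw [bsw_delta (h.volAt_pos d).ne']
  rw [deltaGap] at this
  linarith

/-! #### Smoothness -/

lemma contDiff_price (h : CallCurve C T f) : ContDiff ℝ 2 C := by
  have hT : ContDiff ℝ 1 T := by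
    rw [contDiff_one_iff_deriv]
    refine ⟨fun k => (h.hasDerivAt_tail k).differentiableAt, ?_⟩
    rw [show deriv T = fun k => -f k from funext fun k => (h.hasDerivAt_tail k).deriv]
    exact h.continuous_density.neg
  have : (2 : WithTop ℕ∞) = 1 + 1 := by norm_num
  rw [this, contDiff_succ_iff_deriv]
  refine ⟨fun k => (h.hasDerivAt_price k).differentiableAt, by simp, ?_⟩
  rw [show deriv C = fun k => -(Real.exp k * T k) from
    funext fun k => (h.hasDerivAt_price k).deriv]
  exact (Real.contDiff_exp.mul hT).neg

/-- The implicit function theorem applies because the w-derivative of `deltaGap` never vanishes.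
Uniqueness of the zero identifies the local implicit function with `volAt`. -/
lemma contDiffAt_volAt (h : CallCurve C T f) (d₀ : ℝ) : ContDiffAt ℝ 2 (volAt C) d₀ := by
  set w₀ := volAt C d₀ with hw₀
  let F : ℝ × ℝ → ℝ := fun v => deltaGap C v.2 v.1
  have hF : ContDiff ℝ 2 F := by
    have hk : ContDiff ℝ 2 fun v : ℝ × ℝ => v.2 ^ 2 / 2 - v.2 * v.1 := by fun_prop
    have hm : ContDiff ℝ 2 fun v : ℝ × ℝ => v.1 - v.2 := by fun_prop
    exact (h.contDiff_price.comp hk).sub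
      ((contDiff_Phi.comp contDiff_fst).sub ((Real.contDiff_exp.comp hk).mul (contDiff_Phi.comp hm)))
  have hd : HasDerivAt (fun w => deltaGap C w d₀)
      (fderiv ℝ F (d₀, w₀) (ContinuousLinearMap.inr ℝ ℝ ℝ 1)) w₀ := by
    have h1 : HasFDerivAt F (fderiv ℝ F (d₀, w₀)) (d₀, w₀) :=
      (hF.differentiable (by norm_num) _).hasFDerivAt
    have h2 : HasDerivAt (fun w : ℝ => (d₀, w)) ((0 : ℝ), (1 : ℝ)) w₀ :=
      (hasDerivAt_const w₀ d₀).prodMk (hasDerivAt_id w₀)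
    exact h1.comp_hasDerivAt w₀ h2
  have hne : fderiv ℝ F (d₀, w₀) (ContinuousLinearMap.inr ℝ ℝ ℝ 1) ≠ 0 := by
    rw [hd.unique (h.hasDerivAt_deltaGap d₀ w₀)]
    have := mills_pos_of_mem (x := d₀ - w₀) (h.tail_nonneg (w₀ ^ 2 / 2 - w₀ * d₀))
      (h.tail_le_one (w₀ ^ 2 / 2 - w₀ * d₀))
    exact (neg_lt_zero.2 (mul_pos (Real.exp_pos _) this)).ne
  have hinv : (fderiv ℝ F (d₀, w₀) ∘L ContinuousLinearMap.inr ℝ ℝ ℝ).IsInvertible := by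
    refine ⟨ContinuousLinearEquiv.unitsEquivAut ℝ (Units.mk0 _ hne), ?_⟩
    ext
    simp
  have hcd : ContDiffAt ℝ 2 F (d₀, w₀) := hF.contDiffAt
  have h2 : (2 : WithTop ℕ∞) ≠ 0 := by norm_num
  have hI := hcd.contDiffAt_implicitFunction h2 hinv
  have hF0 : F (d₀, w₀) = 0 := (h.volAt_spec d₀).2
  refine hI.congr_of_eventuallyEq ?_
  have hs := hcd.eventually_apply_implicitFunction h2 hinv
  filter_upwards [hs] with d hd
  rw [hF0] at hd
  exact (h.eq_volAt hd).symm

/-- The excess of the normal distribution function at `d₋` over the tail probability. -/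
def tailGap (C T : ℝ → ℝ) (d : ℝ) : ℝ :=
  Phi (d - volAt C d) - T (volAt C d ^ 2 / 2 - volAt C d * d)

/-- The denominator in the formula for the derivative of `volAt`. -/
def slopeDenom (C T : ℝ → ℝ) (d : ℝ) : ℝ :=
  gpdf (d - volAt C d) + (d - volAt C d) * tailGap C T d

lemma slopeDenom_pos (h : CallCurve C T f) (d : ℝ) : 0 < slopeDenom C T d :=
  mills_pos_of_mem (h.tail_nonneg _) (h.tail_le_one _)

/-- Implicit differentiation of deltaGap(volAt d, d) = 0. Writing φ(d) as e^kφ(d₋) lets the factor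
e^k be divided out. -/
lemma hasDerivAt_volAt (h : CallCurve C T f) (d : ℝ) :
    HasDerivAt (volAt C) (-(volAt C d * tailGap C T d) / slopeDenom C T d) d := by
  have hW : HasDerivAt (volAt C) (deriv (volAt C) d) d :=
    ((h.contDiffAt_volAt d).differentiableAt (by norm_num)).hasDerivAt
  set W := volAt C with hWdef
  set w' := deriv W d
  have hk : HasDerivAt (fun d => W d ^ 2 / 2 - W d * d) (W d * w' - (w' * d + W d)) d := by
    refine (((hW.pow 2).div_const 2).sub (hW.mul (hasDerivAt_id d))).congr_deriv ?_
    simp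
    ring
  have hm : HasDerivAt (fun d => d - W d) (1 - w') d := (hasDerivAt_id d).sub hW
  have h1 := (h.hasDerivAt_price _).comp d hk
  have h2 := hk.exp.mul ((hasDerivAt_Phi _).comp d hm)
  have h3 := h1.sub ((hasDerivAt_Phi d).sub h2)
  have h0 : HasDerivAt (fun d => deltaGap C (W d) d) 0 d :=
    (hasDerivAt_const d (0 : ℝ)).congr_of_eventuallyEq
      (Eventually.of_forall fun d => (h.volAt_spec d).2)
  have h4 := h0.unique h3
  have hD := h.slopeDenom_pos d
  refine hW.congr_deriv ?_
  rw [eq_div_iff hD.ne']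
  rw [← exp_mul_gpdf (W d) d] at h4
  simp only [Function.comp] at h4
  have he := Real.exp_pos (W d ^ 2 / 2 - W d * d)
  have h5 : Real.exp (W d ^ 2 / 2 - W d * d) *
      (w' * slopeDenom C T d + W d * tailGap C T d) = 0 := by
    simp only [slopeDenom, tailGap, ← hWdef]
    linear_combination h4
  rcases mul_eq_zero.1 h5 with h6 | h6
  · exact absurd h6 he.ne'
  · linarith

/-- The second derivative of `volAt` at `0`. -/
lemma hasDerivAt_deriv_volAt (h : CallCurve C T f) :
    let w := volAt C 0
    let Q := tailGap C T 0
    let D := slopeDenom C T 0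
    let w' := -(w * Q) / D
    let φ := gpdf w
    let g := f (w ^ 2 / 2)
    HasDerivAt (deriv (volAt C))
      (-(w' * Q + w * ((1 - w') * (φ - w * g))) / D +
        w * Q * ((1 - w') * (Q + w ^ 2 * g)) / D ^ 2) 0 := by
  intro w Q D w' φ g
  have hW : HasDerivAt (volAt C) w' 0 := h.hasDerivAt_volAt 0
  have hk : HasDerivAt (fun d => volAt C d ^ 2 / 2 - volAt C d * d) (w * (w' - 1)) 0 := by
    refine (((hW.pow 2).div_const 2).sub (hW.mul (hasDerivAt_id 0))).congr_deriv ?_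
    simp only [id, w]
    push_cast
    ring
  have hm : HasDerivAt (fun d => d - volAt C d) (1 - w') 0 := (hasDerivAt_id 0).sub hW
  have hm0 : (0 : ℝ) - volAt C 0 = -w := by simp [w]
  have hk0 : volAt C 0 ^ 2 / 2 - volAt C 0 * 0 = w ^ 2 / 2 := by simp [w]
  have hQ : HasDerivAt (tailGap C T) ((1 - w') * (φ - w * g)) 0 := by
    have h1 := (hasDerivAt_Phi _).comp 0 hm
    have h2 := (h.hasDerivAt_tail _).comp 0 hk
    refine (h1.sub h2).congr_deriv ?_
    rw [hm0, hk0, gpdf_neg]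
    ring
  have hD : HasDerivAt (slopeDenom C T) ((1 - w') * (Q + w ^ 2 * g)) 0 := by
    have h1 := (hasDerivAt_gpdf _).comp 0 hm
    refine (h1.add (hm.mul hQ)).congr_deriv ?_
    rw [hm0, gpdf_neg]
    ring
  have hD0 : D ≠ 0 := (h.slopeDenom_pos 0).ne'
  have hdW : deriv (volAt C) = fun d => -(volAt C d * tailGap C T d) / slopeDenom C T d :=
    funext fun d => (h.hasDerivAt_volAt d).deriv
  rw [hdW]
  refine ((hW.mul hQ).neg.div hD hD0).congr_deriv ?_
  change (-(w' * Q + w * ((1 - w') * (φ - w * g))) * D - -(w * Q) * _) / D ^ 2 = _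
  field_simp
  ring

/-- A bound for the total implied volatility by the at-the-money price. -/
lemma volAt_le_of_price_zero (h : CallCurve C T f) {d : ℝ}
    (hd : 2 * C 0 / gpdf (3 / 2 + 2 * |d|) ≤ 1) :
    volAt C d ≤ 2 * C 0 / gpdf (3 / 2 + 2 * |d|) := by
  set g := gpdf (3 / 2 + 2 * |d|) with hg
  have hgpos : 0 < g := gpdf_pos _
  -- Chosen so that, with vega at least `g`, raising the volatility from w/2 to w adds at least
  -- g·w/2 = `C 0` to the Black–Scholes price, which is as much as the time value of the curve can
  -- be.
  set w := 2 * C 0 / g with hw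
  have hwpos : 0 < w := div_pos (by linarith [h.pos_zero]) hgpos
  refine h.volAt_le ?_
  set k := w ^ 2 / 2 - w * d with hk
  have hbs := bsw_delta hwpos.ne' d
  have hk2 : |k| ≤ w * (w / 2 + |d|) := by
    rw [hk]
    calc |w ^ 2 / 2 - w * d| ≤ |w ^ 2 / 2| + |w * d| := abs_sub _ _
      _ = w * (w / 2 + |d|) := by
          rw [abs_mul, abs_of_pos hwpos, abs_of_pos (by positivity : 0 < w ^ 2 / 2)]; ring
  -- the Black–Scholes time value exceeds the at-the-money price
  have h1 : bsw (w / 2) k + C 0 ≤ bsw w k := by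
    have hmvt := (convex_Icc (w / 2) w).mul_sub_le_image_sub_of_le_deriv
      (f := fun x => bsw x k) (C := g) (fun x hx =>
        (hasDerivAt_bsw_vol (by linarith [hx.1] : 0 < x).ne' k).continuousAt.continuousWithinAt)
      (fun x hx => by
        rw [interior_Icc] at hx
        exact (hasDerivAt_bsw_vol (by linarith [hx.1] : 0 < x).ne'
          k).differentiableAt.differentiableWithinAt)
      (fun x hx => by
        rw [interior_Icc] at hx
        have hx0 : 0 < x := by linarith [hx.1]
        rw [(hasDerivAt_bsw_vol hx0.ne' k).deriv]
        refine gpdf_le_of_abs_le ?_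
        -- Here x > w/2 and |k| ≤ w(w/2 + |d|). Together with w ≤ 1 and x/2 ≤ 1/2 this explains the
        -- argument 3/2 + 2|d| of `g`.
        have h2 : |-k / x| ≤ w + 2 * |d| := by
          rw [abs_div, abs_neg, abs_of_pos hx0, div_le_iff₀ hx0]
          have := mul_le_mul_of_nonneg_left hx.1.le (by positivity : 0 ≤ w + 2 * |d|)
          nlinarith
        have h3 : |x / 2| ≤ 1 / 2 := by rw [abs_of_pos (by positivity)]; linarith [hx.2]
        calc |-k / x + x / 2| ≤ |-k / x| + |x / 2| := abs_add_le _ _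
          _ ≤ _ := by linarith)
      (w / 2) (Set.left_mem_Icc.2 (by linarith)) w (Set.right_mem_Icc.2 (by linarith)) (by linarith)
    have : g * (w - w / 2) = C 0 := by rw [hw]; field_simp; ring
    linarith
  have h2 := (intrinsic_lt_bsw (half_pos hwpos) k).le
  -- the time value of the curve is largest at the money
  have h3 : C k ≤ max (1 - Real.exp k) 0 + C 0 := by
    rcases le_total 0 k with hk0 | hk0
    · have : Antitone C := antitone_of_deriv_nonpos
        (fun x => (h.hasDerivAt_price x).differentiableAt) fun x => by
          rw [(h.hasDerivAt_price x).deriv]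
          have := mul_nonneg (Real.exp_pos x).le (h.tail_nonneg x)
          linarith
      linarith [this hk0, le_max_right (1 - Real.exp k) 0]
    · have hd : ∀ x, HasDerivAt (fun x => C x + Real.exp x) (-(Real.exp x * T x) + Real.exp x) x :=
        fun x => (h.hasDerivAt_price x).add (Real.hasDerivAt_exp x)
      have : Monotone fun x => C x + Real.exp x := monotone_of_deriv_nonneg
        (fun x => (hd x).differentiableAt) fun x => by
          rw [(hd x).deriv]
          have := mul_nonneg (Real.exp_pos x).le (sub_nonneg.2 (h.tail_le_one x))
          linarith
      have := this hk0
      simp only [Real.exp_zero] at this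
      linarith [le_max_left (1 - Real.exp k) 0]
  rw [deltaGap, ← hk, ← hbs]
  linarith

end CallCurve

/-! ### The smile of a model in terms of its call price curve -/

section Smile

variable {Ω : Type*} [MeasurableSpace Ω] {P : Measure Ω} {X : ℝ≥0 → Ω → ℝ} {τ : ℝ} {T f : ℝ → ℝ}

lemma bsCall_zero (k : ℝ) : bsCall 0 k = max (1 - Real.exp k) 0 := by simp [bsCall]

lemma bsCall_sq_mul {s : ℝ} (hs : 0 < s) (hτ : 0 < τ) (k : ℝ) :
    bsCall (s ^ 2 * τ) k = bsw (s * √τ) k := by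
  rw [← bsCall_sq (by positivity), mul_pow, Real.sq_sqrt hτ.le]

/-- The intrinsic value is attained by s = 0 alone, since a positive volatility has positive time
value; any price strictly between the intrinsic value and 1 is inverted by strict monotonicity in
the volatility. -/
lemma existsUnique_isImpliedVol (hτ : 0 < τ) (h : CallCurve (callPrice P X τ) T f) (k : ℝ) :
    ∃! s, IsImpliedVol P X τ k s := by
  have hsτ : 0 < √τ := Real.sqrt_pos.2 hτ
  rcases eq_or_lt_of_le (h.intrinsic_le k) with he | hl
  · refine ⟨0, ⟨le_rfl, by simp [bsCall_zero, he]⟩, fun s hs => ?_⟩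
    by_contra hne
    have hspos := lt_of_le_of_ne hs.1 (Ne.symm hne)
    have := hs.2
    rw [bsCall_sq_mul hspos hτ, ← he] at this
    exact (intrinsic_lt_bsw (mul_pos hspos hsτ) k).ne' this
  · obtain ⟨w, hw, hwc⟩ := exists_bsw_eq hl (h.lt_one k)
    refine ⟨w / √τ, ⟨by positivity, ?_⟩, fun s hs => ?_⟩
    · rw [bsCall_sq_mul (by positivity) hτ, div_mul_cancel₀ _ hsτ.ne', hwc]
    · rcases eq_or_lt_of_le hs.1 with h0 | hspos
      · have := hs.2
        rw [← h0] at this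
        simp only [ne_eq, OfNat.ofNat_ne_zero, not_false_eq_true, zero_pow, zero_mul,
          bsCall_zero] at this
        exact absurd this hl.ne
      · have := hs.2
        rw [bsCall_sq_mul hspos hτ, ← hwc] at this
        rw [eq_div_iff hsτ.ne']
        exact (bsw_strictMonoOn k).injOn (mul_pos hspos hsτ) hw this

lemma impliedVol_eq (hτ : 0 < τ) (h : CallCurve (callPrice P X τ) T f) {k s : ℝ}
    (hs : IsImpliedVol P X τ k s) : impliedVol P X τ k = s :=
  (existsUnique_isImpliedVol hτ h k).unique (Classical.epsilon_spec ⟨s, hs⟩) hs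

lemma impliedVol_volAt (hτ : 0 < τ) (h : CallCurve (callPrice P X τ) T f) (d : ℝ) :
    impliedVol P X τ (volAt (callPrice P X τ) d ^ 2 / 2 - volAt (callPrice P X τ) d * d) =
      volAt (callPrice P X τ) d / √τ := by
  have hw := h.volAt_pos d
  have hsτ : 0 < √τ := Real.sqrt_pos.2 hτ
  refine impliedVol_eq hτ h ⟨by positivity, ?_⟩
  rw [bsCall_sq_mul (by positivity) hτ, div_mul_cancel₀ _ hsτ.ne', h.price_volAt]

/-- A strike of delta Φ(d) and implied total volatility w satisfies k = w²/2 − wd, so w is a zero of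
`deltaGap`; uniqueness of the strike is uniqueness of that zero. -/
lemma hasDelta_iff (hτ : 0 < τ) (h : CallCurve (callPrice P X τ) T f) (k d : ℝ) :
    HasDelta P X τ k (Phi d) ↔
      k = volAt (callPrice P X τ) d ^ 2 / 2 - volAt (callPrice P X τ) d * d := by
  have hsτ : 0 < √τ := Real.sqrt_pos.2 hτ
  constructor
  · rintro ⟨hpos, hd⟩
    set s := impliedVol P X τ k with hs
    have hspec : IsImpliedVol P X τ k s :=
      Classical.epsilon_spec (existsUnique_isImpliedVol hτ h k).exists
    have hwpos : 0 < s * √τ := mul_pos hpos hsτ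
    have hd' := Phi_strictMono.injective hd
    have hsq : s ^ 2 * τ = (s * √τ) ^ 2 := by rw [mul_pow, Real.sq_sqrt hτ.le]
    rw [hsq, dPlus_sq hwpos] at hd'
    have hk : k = (s * √τ) ^ 2 / 2 - (s * √τ) * d := by
      rw [← hd']
      field_simp
      ring
    have hw : s * √τ = volAt (callPrice P X τ) d := by
      refine h.eq_volAt ?_
      rw [deltaGap, ← bsw_delta hwpos.ne', ← hk, ← hspec.2, bsCall_sq_mul hpos hτ, sub_self]
    rw [← hw]
    exact hk
  · rintro rfl
    have hw := h.volAt_pos d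
    have hv := impliedVol_volAt hτ h d
    refine ⟨?_, ?_⟩
    · rw [hv]
      positivity
    · rw [hv, div_pow, Real.sq_sqrt hτ.le, div_mul_cancel₀ _ hτ.ne', dPlus_sq hw]
      congr 1
      field_simp
      ring

lemma smile_Phi (hτ : 0 < τ) (h : CallCurve (callPrice P X τ) T f) (d : ℝ) :
    smile P X τ (Phi d) = volAt (callPrice P X τ) d / √τ := by
  have : HasDelta P X τ (deltaStrike P X τ (Phi d)) (Phi d) :=
    Classical.epsilon_spec (p := fun k => HasDelta P X τ k (Phi d))
      ⟨_, (hasDelta_iff hτ h _ d).2 rfl⟩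
  rw [smile, (hasDelta_iff hτ h _ d).1 this, impliedVol_volAt hτ h]

/-- Near Φ(d) the smile is `volAt` composed with a local inverse of Φ, which is C² because φ(d) > 0.
-/
lemma contDiffAt_smile (hτ : 0 < τ) (h : CallCurve (callPrice P X τ) T f) (d : ℝ) :
    ContDiffAt ℝ 2 (smile P X τ) (Phi d) := by
  have h2 : (2 : WithTop ℕ∞) ≠ 0 := by norm_num
  have hΦ : ContDiffAt ℝ 2 Phi d := contDiff_Phi.contDiffAt
  let e := ContinuousLinearEquiv.unitsEquivAut ℝ (Units.mk0 (gpdf d) (gpdf_pos d).ne')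
  have hΦ' : HasFDerivAt Phi (e : ℝ →L[ℝ] ℝ) d := by
    have he : (e : ℝ →L[ℝ] ℝ) = ContinuousLinearMap.toSpanSingleton ℝ (gpdf d) := by
      ext
      simp [e]
    rw [he]
    exact (hasDerivAt_Phi d).hasFDerivAt
  have hinv := hΦ.to_localInverse hΦ' h2
  have hst := hΦ.hasStrictFDerivAt' hΦ' h2
  have hW : ContDiffAt ℝ 2 (fun d => volAt (callPrice P X τ) d / √τ)
      (hΦ.localInverse hΦ' h2 (Phi d)) := by
    rw [ContDiffAt.localInverse_apply_image]
    exact (h.contDiffAt_volAt d).div_const _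
  refine (hW.comp (Phi d) hinv).congr_of_eventuallyEq ?_
  filter_upwards [hst.eventually_right_inverse] with Δ hΔ
  rw [Function.comp, ← smile_Phi hτ h]
  exact congrArg _ hΔ.symm

lemma deriv_smile_Phi (hτ : 0 < τ) (h : CallCurve (callPrice P X τ) T f) (d : ℝ) :
    deriv (smile P X τ) (Phi d) = deriv (volAt (callPrice P X τ)) d / √τ / gpdf d := by
  have h1 := ((contDiffAt_smile hτ h d).differentiableAt (by norm_num)).hasDerivAt.comp d
    (hasDerivAt_Phi d)
  have h2 := (h.hasDerivAt_volAt d).differentiableAt.hasDerivAt.div_const √τ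
  have := (h1.congr_of_eventuallyEq (Eventually.of_forall fun x => (smile_Phi hτ h x).symm)).unique h2
  rw [← this, mul_div_cancel_right₀ _ (gpdf_pos d).ne']

lemma slopeRR_eq (hτ : 0 < τ) (h : CallCurve (callPrice P X τ) T f) :
    slopeRR P X τ = 1 / 2 * √(2 * Real.pi) * deriv (volAt (callPrice P X τ)) 0 / √τ := by
  rw [slopeRR, ← Phi_zero, deriv_smile_Phi hτ h, gpdf_zero, Phi_zero]
  field_simp

/-- Because φ'(0) = 0, passing from d to Δ at the centre only divides the second derivative by φ(0)²
= 1/(2π); then 2π/32 = π/16. -/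
lemma convexityBF_eq (hτ : 0 < τ) (h : CallCurve (callPrice P X τ) T f) :
    convexityBF P X τ = Real.pi / 16 * deriv (deriv (volAt (callPrice P X τ))) 0 / √τ := by
  have hg : HasDerivAt gpdf 0 0 := by simpa using hasDerivAt_gpdf 0
  have hC : ContDiffAt ℝ 1 (deriv (smile P X τ)) (Phi 0) := by
    have := ((contDiffAt_smile hτ h 0).fderiv_right (m := 1) (by norm_num)).clm_apply
      (contDiffAt_const (c := (1 : ℝ)))
    exact this
  have h1 := (hC.differentiableAt (by norm_num)).hasDerivAt.comp 0 (hasDerivAt_Phi 0)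
  have h2 := (h.hasDerivAt_deriv_volAt.differentiableAt.hasDerivAt.div_const √τ).div hg
    (gpdf_pos 0).ne'
  have h3 := (h1.congr_of_eventuallyEq
    (Eventually.of_forall fun x => (deriv_smile_Phi hτ h x).symm)).unique h2
  rw [convexityBF, iteratedDeriv_succ, iteratedDeriv_one, ← Phi_zero]
  have h4 := gpdf_pos 0
  rw [mul_zero, sub_zero] at h3
  have h5 : deriv (deriv (smile P X τ)) (Phi 0) =
      deriv (deriv (volAt (callPrice P X τ))) 0 / √τ / gpdf 0 ^ 2 := by
    field_simp at h3 ⊢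
    linarith
  rw [h5, gpdf_zero, div_pow, Real.sq_sqrt (by positivity)]
  field_simp
  ring

theorem smileWellDefined_of_callCurve
    (h : ∀ τ, 0 < τ → ∃ T f, CallCurve (callPrice P X τ) T f) : SmileWellDefined P X := by
  intro τ hτ
  obtain ⟨T, f, hC⟩ := h τ hτ
  refine ⟨existsUnique_isImpliedVol hτ hC, fun Δ h0 h1 => ?_, ?_⟩
  · obtain ⟨d, rfl⟩ := exists_Phi_eq h0 h1
    exact ⟨_, (hasDelta_iff hτ hC _ d).2 rfl, fun k hk => (hasDelta_iff hτ hC k d).1 hk⟩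
  · rw [← Phi_zero]
    exact contDiffAt_smile hτ hC 0

end Smile

/-! ### From short-time limits of prices to short-time limits of the smile -/

lemma leadingTerm_of_tendsto {g : ℝ → ℝ} {c e : ℝ}
    (h : Tendsto (fun τ => g τ / τ ^ e) (𝓝[>] 0) (𝓝 c)) : LeadingTerm g c e := by
  rw [LeadingTerm, isLittleO_iff_tendsto']
  · have := h.sub_const c
    rw [sub_self] at this
    refine this.congr' ?_
    filter_upwards [self_mem_nhdsWithin] with τ hτ
    have : (τ : ℝ) ^ e ≠ 0 := (Real.rpow_pos_of_pos hτ e).ne'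
    field_simp
  · filter_upwards [self_mem_nhdsWithin] with τ hτ h0
    exact absurd h0 (Real.rpow_pos_of_pos hτ e).ne'

lemma tendsto_rpow_zero {e : ℝ} (he : 0 < e) : Tendsto (fun τ : ℝ => τ ^ e) (𝓝[>] 0) (𝓝 0) := by
  have := (Real.continuousAt_rpow_const 0 e (Or.inr he.le)).tendsto
  rw [Real.zero_rpow he.ne'] at this
  exact this.mono_left nhdsWithin_le_nhds

lemma HasRate.vanishes {g : ℝ → ℝ} {e : ℝ} (h : HasRate g e) (he : 0 < e) : Vanishes g :=
  h.trans_tendsto (tendsto_rpow_zero he)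

lemma LeadingTerm.vanishes {g : ℝ → ℝ} {c e : ℝ} (h : LeadingTerm g c e) (he : 0 < e) :
    Vanishes g := by
  have h1 := h.isBigO.trans_tendsto (tendsto_rpow_zero he)
  have h2 := h1.add ((tendsto_rpow_zero he).const_mul c)
  simpa [Vanishes] using h2

lemma rpow_sub_half {τ : ℝ} (hτ : 0 < τ) (b : ℝ) : τ ^ (b - 1 / 2) = τ ^ b / √τ := by
  rw [Real.rpow_sub hτ, Real.sqrt_eq_rpow]

lemma rpow_half_add {τ : ℝ} (hτ : 0 < τ) (b : ℝ) : τ ^ (1 / 2 + b) = √τ * τ ^ b := by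
  rw [Real.rpow_add hτ, Real.sqrt_eq_rpow]

lemma tendsto_sqrt_zero : Tendsto (fun τ : ℝ => √τ) (𝓝[>] 0) (𝓝 0) := by
  have := Real.continuous_sqrt.tendsto 0
  rw [Real.sqrt_zero] at this
  exact this.mono_left nhdsWithin_le_nhds

lemma sqrt_two_pi_cubed : √(2 * Real.pi ^ 3) = Real.pi * √(2 * Real.pi) := by
  rw [show 2 * Real.pi ^ 3 = Real.pi ^ 2 * (2 * Real.pi) by ring,
    Real.sqrt_mul (by positivity), Real.sqrt_sq Real.pi_pos.le]

/-- C decreases while C + exp increases, because the tail lies in [0, 1]. -/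
lemma CallCurve.abs_price_sub_zero_le {C T f : ℝ → ℝ} (h : CallCurve C T f) {k : ℝ} (hk : 0 ≤ k) :
    |C k - C 0| ≤ Real.exp k - 1 := by
  have hd : ∀ x, HasDerivAt (fun x => C x + Real.exp x) (-(Real.exp x * T x) + Real.exp x) x :=
    fun x => (h.hasDerivAt_price x).add (Real.hasDerivAt_exp x)
  have h1 : Monotone fun x => C x + Real.exp x := monotone_of_deriv_nonneg
    (fun x => (hd x).differentiableAt) fun x => by
      rw [(hd x).deriv]
      have := mul_nonneg (Real.exp_pos x).le (sub_nonneg.2 (h.tail_le_one x))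
      linarith
  have h2 : Antitone C := antitone_of_deriv_nonpos
    (fun x => (h.hasDerivAt_price x).differentiableAt) fun x => by
      rw [(h.hasDerivAt_price x).deriv]
      have := mul_nonneg (Real.exp_pos x).le (h.tail_nonneg x)
      linarith
  have h3 := h1 hk
  have h4 := h2 hk
  simp only [Real.exp_zero] at h3
  rw [abs_of_nonpos (by linarith)]
  linarith

lemma CallCurve.volAt_zero_eq {C T f : ℝ → ℝ} (h : CallCurve C T f) :
    C (volAt C 0 ^ 2 / 2) = 1 / 2 - Real.exp (volAt C 0 ^ 2 / 2) * Phi (-volAt C 0) := by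
  have := (h.volAt_spec 0).2
  simp only [deltaGap, mul_zero, sub_zero, zero_sub, Phi_zero] at this
  linarith

/-! ### Order of the implied volatility from the at-the-money price. -/

section Rates

variable {C T f : ℝ → ℝ → ℝ} (hC : ∀ τ, 0 < τ → CallCurve (C τ) (T τ) (f τ))
include hC

/-- Once `C τ 0` is small, `volAt_le_of_price_zero` bounds the volatility at any fixed d by a
constant, depending on d, times `C τ 0`. -/
lemma volAt_isBigO {β : ℝ} (hβ : 0 < β)
    (hb : (fun τ => C τ 0) =O[𝓝[>] 0] fun τ => τ ^ β) (d : ℝ) :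
    (fun τ => volAt (C τ) d) =O[𝓝[>] 0] fun τ => τ ^ β := by
  have h0 := hb.trans_tendsto (tendsto_rpow_zero hβ)
  set g := gpdf (3 / 2 + 2 * |d|)
  have h1 : Tendsto (fun τ => 2 * C τ 0 / g) (𝓝[>] 0) (𝓝 0) := by
    simpa using (h0.const_mul 2).div_const g
  have h2 : (fun τ => volAt (C τ) d) =O[𝓝[>] 0] fun τ => 2 * C τ 0 / g := by
    refine IsBigO.of_bound 1 ?_
    filter_upwards [h1.eventually (ge_mem_nhds one_pos), self_mem_nhdsWithin] with τ h hτ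
    have hle := (hC τ hτ).volAt_le_of_price_zero h
    have hpos := (hC τ hτ).volAt_pos d
    rw [one_mul, Real.norm_of_nonneg hpos.le, Real.norm_of_nonneg (hpos.le.trans hle)]
    exact hle
  refine h2.trans (IsBigO.trans ?_ hb)
  have : (fun τ => 2 * C τ 0 / g) = fun τ => (2 / g) * C τ 0 := by ext; ring
  rw [this]
  exact isBigO_const_mul_self _ _ _

/-- At-the-money price asymptotics determine the asymptotics of the volatility at `Δ = 1/2`. -/
lemma tendsto_volAt_zero {β L : ℝ} (hβ : 0 < β)
    (hL : Tendsto (fun τ => C τ 0 / τ ^ β) (𝓝[>] 0) (𝓝 L)) :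
    Tendsto (fun τ => volAt (C τ) 0 / τ ^ β) (𝓝[>] 0) (𝓝 (√(2 * Real.pi) * L)) := by
  have hne : ∀ᶠ τ : ℝ in 𝓝[>] 0, (τ : ℝ) ^ β ≠ 0 := by
    filter_upwards [self_mem_nhdsWithin] with τ hτ using (Real.rpow_pos_of_pos hτ β).ne'
  have hb : (fun τ => C τ 0) =O[𝓝[>] 0] fun τ => τ ^ β :=
    isBigO_of_div_tendsto_nhds (hne.mono fun τ h h0 => absurd h0 h) L hL
  have hWO := volAt_isBigO hC hβ hb 0
  have hW0 : Tendsto (fun τ => volAt (C τ) 0) (𝓝[>] 0) (𝓝 0) :=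
    hWO.trans_tendsto (tendsto_rpow_zero hβ)
  have hWpos : ∀ᶠ τ in 𝓝[>] 0, 0 < volAt (C τ) 0 := by
    filter_upwards [self_mem_nhdsWithin] with τ hτ using (hC τ hτ).volAt_pos 0
  -- the price at the strike with `Δ = 1/2`
  have hk : (fun τ => C τ (volAt (C τ) 0 ^ 2 / 2) - C τ 0) =o[𝓝[>] 0] fun τ => τ ^ β := by
    have h1 : (fun τ => C τ (volAt (C τ) 0 ^ 2 / 2) - C τ 0) =O[𝓝[>] 0]
        fun τ => Real.exp (volAt (C τ) 0 ^ 2 / 2) - 1 := by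
      refine IsBigO.of_bound 1 ?_
      filter_upwards [self_mem_nhdsWithin] with τ hτ
      rw [one_mul]
      exact ((hC τ hτ).abs_price_sub_zero_le (by positivity)).trans (le_abs_self _)
    have h2 : (fun x : ℝ => Real.exp x - 1) =O[𝓝 0] fun x => x := by
      have := (Real.hasDerivAt_exp 0).isBigO_sub
      simpa using this
    have hk0 : Tendsto (fun τ => volAt (C τ) 0 ^ 2 / 2) (𝓝[>] 0) (𝓝 0) := by
      simpa using (hW0.pow 2).div_const 2
    have h3 := h1.trans (h2.comp_tendsto hk0)
    refine h3.trans_isLittleO ?_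
    have h4 : (fun τ => volAt (C τ) 0 ^ 2 / 2) =o[𝓝[>] 0] fun τ => 1 * τ ^ β := by
      have h5 : (fun τ => volAt (C τ) 0 / 2) =o[𝓝[>] 0] fun _ => (1 : ℝ) :=
        (isLittleO_one_iff ℝ).2 (by simpa using hW0.div_const 2)
      refine (h5.mul_isBigO hWO).congr_left fun τ => by ring
    simp only [one_mul] at h4
    exact h4
  have hCk : Tendsto (fun τ => C τ (volAt (C τ) 0 ^ 2 / 2) / τ ^ β) (𝓝[>] 0) (𝓝 L) := by
    have := hk.tendsto_div_nhds_zero.add hL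
    rw [zero_add] at this
    refine this.congr fun τ => by rw [← add_div]; ring_nf
  -- This is the Black–Scholes price at the strike with Δ = 1/2 as a function of w; its slope φ(0)
  -- at w = 0 turns the price constant L into √(2π) L.
  have hder : HasDerivAt (fun w => 1 / 2 - Real.exp (w ^ 2 / 2) * Phi (-w)) (gpdf 0) 0 := by
    have h1 : HasDerivAt (fun w : ℝ => w ^ 2 / 2) 0 0 := by
      refine (((hasDerivAt_id (0 : ℝ)).pow 2).div_const 2).congr_deriv (by simp)
    have h2 : HasDerivAt (fun w => Phi (-w)) (gpdf (-0) * -1) 0 :=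
      (hasDerivAt_Phi _).comp 0 (hasDerivAt_neg 0)
    refine ((h1.exp.mul h2).const_sub (1 / 2)).congr_deriv ?_
    simp
  have hslope := hder.tendsto_slope
  have hW0' : Tendsto (fun τ => volAt (C τ) 0) (𝓝[>] 0) (𝓝[≠] 0) :=
    tendsto_nhdsWithin_iff.2 ⟨hW0, hWpos.mono fun τ h => h.ne'⟩
  have hs := hslope.comp hW0'
  have := hCk.div hs (gpdf_pos 0).ne'
  rw [gpdf_zero] at this
  have e : L / (1 / √(2 * Real.pi)) = √(2 * Real.pi) * L := by field_simp
  rw [e] at this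
  refine this.congr' ?_
  filter_upwards [self_mem_nhdsWithin, hWpos] with τ hτ hw
  have hvz := (hC τ hτ).volAt_zero_eq
  have hp := Real.rpow_pos_of_pos (hτ : (0 : ℝ) < τ) β
  simp only [Pi.div_apply, Function.comp, slope_def_field]
  rw [← hvz]
  simp only [ne_eq, OfNat.ofNat_ne_zero, not_false_eq_true, zero_pow, zero_div, Real.exp_zero,
    neg_zero, Phi_zero, one_mul, sub_self, sub_zero]
  have hcpos : C τ (volAt (C τ) 0 ^ 2 / 2) ≠ 0 := by
    rw [show volAt (C τ) 0 ^ 2 / 2 = volAt (C τ) 0 ^ 2 / 2 - volAt (C τ) 0 * 0 by ring,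
      (hC τ hτ).price_volAt]
    exact ((le_max_right _ _).trans_lt (intrinsic_lt_bsw hw _)).ne'
  field_simp

end Rates

/-! ### Slope and convexity of the smile without diffusion. -/

section Degenerate

variable {Ω : Type*} [MeasurableSpace Ω] {P : Measure Ω} {X : ℝ≥0 → Ω → ℝ} {T f : ℝ → ℝ → ℝ}
  (hC : ∀ τ, 0 < τ → CallCurve (callPrice P X τ) (T τ) (f τ))
include hC

lemma smile_isBigO {β : ℝ} (hβ : 0 < β)
    (hb : (fun τ => callPrice P X τ 0) =O[𝓝[>] 0] fun τ => τ ^ β) {Δ : ℝ} (h0 : 0 < Δ)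
    (h1 : Δ < 1) : (fun τ => smile P X τ Δ) =O[𝓝[>] 0] fun τ => τ ^ (β - 1 / 2) := by
  obtain ⟨d, rfl⟩ := exists_Phi_eq h0 h1
  have h := (volAt_isBigO hC hβ hb d).mul (isBigO_refl (fun τ => (√τ)⁻¹) (𝓝[>] 0))
  refine h.congr' ?_ ?_
  · filter_upwards [self_mem_nhdsWithin] with τ hτ
    rw [smile_Phi hτ (hC τ hτ), div_eq_mul_inv]
  · filter_upwards [self_mem_nhdsWithin] with τ hτ
    rw [rpow_sub_half hτ, div_eq_mul_inv]

lemma hasRate_RR_of_isBigO {β : ℝ} (hβ : 0 < β)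
    (hb : (fun τ => callPrice P X τ 0) =O[𝓝[>] 0] fun τ => τ ^ β) :
    HasRate (RR P X) (β - 1 / 2) :=
  (smile_isBigO hC hβ hb (by norm_num) (by norm_num)).sub
    (smile_isBigO hC hβ hb (by norm_num) (by norm_num))

lemma hasRate_BF_of_isBigO {β : ℝ} (hβ : 0 < β)
    (hb : (fun τ => callPrice P X τ 0) =O[𝓝[>] 0] fun τ => τ ^ β) :
    HasRate (BF P X) (β - 1 / 2) :=
  (((smile_isBigO hC hβ hb (by norm_num) (by norm_num)).add
    (smile_isBigO hC hβ hb (by norm_num) (by norm_num))).sub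
    ((smile_isBigO hC hβ hb (by norm_num) (by norm_num)).const_mul_left 2)).const_mul_left (1 / 2)

/-- The ingredients of the slope of the smile, in a model without diffusion. -/
lemma tendsto_deriv_volAt_of_tendsto {β L M : ℝ} (hβ : 0 < β)
    (hL : Tendsto (fun τ => callPrice P X τ 0 / τ ^ β) (𝓝[>] 0) (𝓝 L))
    (hM : Tendsto (fun τ => T τ (volAt (callPrice P X τ) 0 ^ 2 / 2)) (𝓝[>] 0) (𝓝 (1 / 2 - M))) :
    Tendsto (fun τ => volAt (callPrice P X τ) 0) (𝓝[>] 0) (𝓝 0) ∧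
    Tendsto (fun τ => CallCurve.tailGap (callPrice P X τ) (T τ) 0) (𝓝[>] 0) (𝓝 M) ∧
    Tendsto (fun τ => CallCurve.slopeDenom (callPrice P X τ) (T τ) 0) (𝓝[>] 0)
      (𝓝 (1 / √(2 * Real.pi))) ∧
    Tendsto (fun τ => -(volAt (callPrice P X τ) 0 *
      CallCurve.tailGap (callPrice P X τ) (T τ) 0) /
        CallCurve.slopeDenom (callPrice P X τ) (T τ) 0 / τ ^ β) (𝓝[>] 0)
      (𝓝 (-(2 * Real.pi * L * M))) := by
  have hw := tendsto_volAt_zero hC hβ hL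
  have hw0 : Tendsto (fun τ => volAt (callPrice P X τ) 0) (𝓝[>] 0) (𝓝 0) := by
    have := hw.mul (tendsto_rpow_zero hβ)
    rw [mul_zero] at this
    refine this.congr' ?_
    filter_upwards [self_mem_nhdsWithin] with τ hτ
    exact div_mul_cancel₀ _ (Real.rpow_pos_of_pos hτ β).ne'
  have hm : Tendsto (fun τ => 0 - volAt (callPrice P X τ) 0) (𝓝[>] 0) (𝓝 0) := by
    simpa using hw0.neg
  have hQ : Tendsto (fun τ => CallCurve.tailGap (callPrice P X τ) (T τ) 0) (𝓝[>] 0) (𝓝 M) := by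
    have h1 := ((continuous_Phi.tendsto 0).comp hm).sub hM
    rw [Phi_zero, show (1 : ℝ) / 2 - (1 / 2 - M) = M by ring] at h1
    refine h1.congr fun τ => ?_
    simp [CallCurve.tailGap]
  have hD : Tendsto (fun τ => CallCurve.slopeDenom (callPrice P X τ) (T τ) 0) (𝓝[>] 0)
      (𝓝 (1 / √(2 * Real.pi))) := by
    have h1 := ((continuous_gpdf.tendsto 0).comp hm).add (hm.mul hQ)
    rw [zero_mul, add_zero, gpdf_zero] at h1
    exact h1
  refine ⟨hw0, hQ, hD, ?_⟩
  have h1 := ((hw.mul hQ).div hD (by positivity)).neg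
  have e : √(2 * Real.pi) * L * M / (1 / √(2 * Real.pi)) = 2 * Real.pi * L * M := by
    have := Real.mul_self_sqrt (by positivity : (0 : ℝ) ≤ 2 * Real.pi)
    rw [div_div_eq_mul_div, div_one]
    linear_combination L * M * this
  rw [e] at h1
  refine h1.congr fun τ => ?_
  simp only [Pi.div_apply]
  ring

/-- In the formula −wQ/D for the derivative of `volAt` at 0, w ~ √(2π) L τ^β, Q → M and D → φ(0). -/
lemma slopeRR_leadingTerm_of_tendsto {β L M : ℝ} (hβ : 0 < β)
    (hL : Tendsto (fun τ => callPrice P X τ 0 / τ ^ β) (𝓝[>] 0) (𝓝 L))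
    (hM : Tendsto (fun τ => T τ (volAt (callPrice P X τ) 0 ^ 2 / 2)) (𝓝[>] 0) (𝓝 (1 / 2 - M))) :
    LeadingTerm (slopeRR P X) (-√(2 * Real.pi ^ 3) * L * M) (β - 1 / 2) := by
  obtain ⟨-, -, -, hw'⟩ := tendsto_deriv_volAt_of_tendsto hC hβ hL hM
  refine leadingTerm_of_tendsto ?_
  have := hw'.const_mul (1 / 2 * √(2 * Real.pi))
  have e : 1 / 2 * √(2 * Real.pi) * -(2 * Real.pi * L * M) = -√(2 * Real.pi ^ 3) * L * M := by
    rw [sqrt_two_pi_cubed]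
    ring
  rw [e] at this
  refine this.congr' ?_
  filter_upwards [self_mem_nhdsWithin] with τ hτ
  rw [slopeRR_eq hτ (hC τ hτ), ((hC τ hτ).hasDerivAt_volAt 0).deriv, rpow_sub_half hτ]
  have h1 := Real.sqrt_pos.2 hτ
  have h2 := Real.rpow_pos_of_pos (hτ : (0 : ℝ) < τ) β
  field_simp

/-- The product of volatility and density converges to √(2π) L N, while w' → 0. The two summands of
`hasDerivAt_deriv_volAt` each contribute 2πM² to the bracket, and w(φ − wf) contributes −1 + 2πLN.
-/
lemma convexityBF_leadingTerm_of_tendsto {β L M N : ℝ} (hβ : 0 < β)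
    (hL : Tendsto (fun τ => callPrice P X τ 0 / τ ^ β) (𝓝[>] 0) (𝓝 L))
    (hM : Tendsto (fun τ => T τ (volAt (callPrice P X τ) 0 ^ 2 / 2)) (𝓝[>] 0) (𝓝 (1 / 2 - M)))
    (hN : Tendsto (fun τ => τ ^ β * f τ (volAt (callPrice P X τ) 0 ^ 2 / 2)) (𝓝[>] 0) (𝓝 N)) :
    LeadingTerm (convexityBF P X)
      (√(2 * Real.pi ^ 3) / 16 * L * (-1 + 2 * Real.pi * L * N + 4 * Real.pi * M ^ 2))
      (β - 1 / 2) := by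
  obtain ⟨hw0, hQ, hD, hw'⟩ := tendsto_deriv_volAt_of_tendsto hC hβ hL hM
  have hw := tendsto_volAt_zero hC hβ hL
  have hφ : Tendsto (fun τ => gpdf (volAt (callPrice P X τ) 0)) (𝓝[>] 0)
      (𝓝 (1 / √(2 * Real.pi))) := by
    have := (continuous_gpdf.tendsto 0).comp hw0
    rwa [gpdf_zero] at this
  have hw'0 : Tendsto (fun τ => -(volAt (callPrice P X τ) 0 *
      CallCurve.tailGap (callPrice P X τ) (T τ) 0) /
        CallCurve.slopeDenom (callPrice P X τ) (T τ) 0) (𝓝[>] 0) (𝓝 0) := by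
    have := ((hw0.mul hQ).neg).div hD (by positivity)
    rw [zero_mul, neg_zero, zero_div] at this
    exact this
  have hwf := hw.mul hN
  have hD0 : 1 / √(2 * Real.pi) ≠ 0 := by positivity
  have main := ((((hw'.mul hQ).add (hw.mul ((hw'0.const_sub 1).mul (hφ.sub hwf)))).neg.div hD hD0).add
    (((hw.mul hQ).mul ((hw'0.const_sub 1).mul (hQ.add (hw0.mul hwf)))).div (hD.pow 2)
      (pow_ne_zero 2 hD0))).const_mul (Real.pi / 16)
  have hs := Real.sq_sqrt (by positivity : (0 : ℝ) ≤ 2 * Real.pi)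
  have hspos : 0 < √(2 * Real.pi) := by positivity
  refine leadingTerm_of_tendsto ?_
  convert main.congr' ?_ using 2
  · rw [sqrt_two_pi_cubed]
    set s := √(2 * Real.pi) with hsdef
    have hpi : Real.pi = s ^ 2 / 2 := by rw [hs]; ring
    rw [hpi]
    field_simp
    ring
  · filter_upwards [self_mem_nhdsWithin] with τ hτ
    rw [convexityBF_eq hτ (hC τ hτ), (hC τ hτ).hasDerivAt_deriv_volAt.deriv, rpow_sub_half hτ]
    have h1 := Real.sqrt_pos.2 hτ
    have h2 := Real.rpow_pos_of_pos (hτ : (0 : ℝ) < τ) β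
    have h3 := (hC τ hτ).slopeDenom_pos 0
    simp only [Pi.div_apply]
    field_simp

end Degenerate

/-! ### Short-time limits of the smile in a model with diffusion -/

lemma abs_Phi_sub_le (a b : ℝ) : |Phi a - Phi b| ≤ gpdf 0 * |a - b| := by
  have := Convex.norm_image_sub_le_of_norm_hasDerivWithin_le (f := Phi) (f' := gpdf)
    (C := gpdf 0) (s := Set.univ) (x := b) (y := a)
    (fun x _ => (hasDerivAt_Phi x).hasDerivWithinAt)
    (fun x _ => by rw [Real.norm_of_nonneg (gpdf_pos x).le]; exact gpdf_le_zero x)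
    convex_univ trivial trivial
  simpa using this

lemma abs_gpdf_sub_le (a b : ℝ) : |gpdf a - gpdf b| ≤ |a - b| := by
  have := Convex.norm_image_sub_le_of_norm_hasDerivWithin_le (f := gpdf)
    (f' := fun x => -x * gpdf x) (C := 1) (s := Set.univ) (x := b) (y := a)
    (fun x _ => (hasDerivAt_gpdf x).hasDerivWithinAt)
    (fun x _ => by
      rw [norm_mul, norm_neg, Real.norm_of_nonneg (gpdf_pos x).le, Real.norm_eq_abs, gpdf,
        ← mul_div_assoc, div_le_one (by positivity)]
      have h1 : |x| ≤ Real.exp (x ^ 2 / 2) := by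
        have := Real.add_one_le_exp (x ^ 2 / 2)
        nlinarith [sq_nonneg (|x| - 1), sq_abs x]
      have h2 : Real.exp (x ^ 2 / 2) * Real.exp (-x ^ 2 / 2) = 1 := by
        rw [← Real.exp_add]
        ring_nf
        simp
      have h3 : (1 : ℝ) ≤ √(2 * Real.pi) := by
        rw [Real.one_le_sqrt]
        nlinarith [Real.pi_gt_three]
      calc |x| * Real.exp (-x ^ 2 / 2) ≤ Real.exp (x ^ 2 / 2) * Real.exp (-x ^ 2 / 2) := by gcongr
        _ ≤ _ := by rw [h2]; exact h3)
    convex_univ trivial trivial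
  simpa using this

/-- Mean value theorem for the Black–Scholes price as a function of the volatility. -/
lemma exists_bsw_sub_eq {s w : ℝ} (hs : 0 < s) (hw : 0 < w) (k : ℝ) :
    ∃ ξ, |ξ| ≤ |k| / min s w + max s w / 2 ∧ bsw w k - bsw s k = gpdf ξ * (w - s) := by
  have key : ∀ {a b : ℝ}, 0 < a → a < b →
      ∃ ξ, |ξ| ≤ |k| / a + b / 2 ∧ bsw b k - bsw a k = gpdf ξ * (b - a) := by
    intro a b ha hab
    obtain ⟨x, hx, hxe⟩ := exists_hasDerivAt_eq_slope (fun w => bsw w k)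
      (fun w => gpdf (-k / w + w / 2)) hab
      (fun x hx => (hasDerivAt_bsw_vol (ha.trans_le hx.1).ne' k).continuousAt.continuousWithinAt)
      (fun x hx => hasDerivAt_bsw_vol (ha.trans hx.1).ne' k)
    have hx0 : 0 < x := ha.trans hx.1
    refine ⟨-k / x + x / 2, ?_, ?_⟩
    · refine (abs_add_le _ _).trans (add_le_add ?_ ?_)
      · rw [abs_div, abs_neg, abs_of_pos hx0]
        exact div_le_div_of_nonneg_left (abs_nonneg k) ha hx.1.le
      · rw [abs_of_pos (by positivity)]
        linarith [hx.2]
    · rw [hxe, div_mul_cancel₀ _ (by linarith : b - a ≠ 0)]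
  rcases lt_trichotomy s w with h | rfl | h
  · rw [min_eq_left h.le, max_eq_right h.le]
    exact key hs h
  · exact ⟨0, by simp; positivity, by simp⟩
  · rw [min_eq_right h.le, max_eq_left h.le]
    obtain ⟨ξ, h1, h2⟩ := key hw h
    exact ⟨ξ, h1, by linarith⟩

section Diffusive

variable {C T f : ℝ → ℝ → ℝ} (hC : ∀ τ, 0 < τ → CallCurve (C τ) (T τ) (f τ))
  {σ e : ℝ} (hσ : 0 < σ) (he : 0 < e)
  (hunif : ∃ K, ∀ᶠ τ in 𝓝[>] 0, ∀ k, |k| ≤ 1 → |C τ k - bsw (σ * √τ) k| ≤ K * τ ^ (1 / 2 + e))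
include hC hσ he hunif

/-- At the money the Black–Scholes price Φ(s/2) − Φ(−s/2), with s = σ√τ, is O(√τ), and the deviation
of the model is of smaller order. -/
lemma volAt_isBigO_sqrt (d : ℝ) :
    (fun τ => volAt (C τ) d) =O[𝓝[>] 0] fun τ => τ ^ (1 / 2 : ℝ) := by
  refine volAt_isBigO hC (by norm_num) ?_ d
  obtain ⟨K, hK⟩ := hunif
  have h1 : (fun τ => C τ 0 - bsw (σ * √τ) 0) =O[𝓝[>] 0] fun τ => τ ^ (1 / 2 + e) := by
    refine IsBigO.of_bound K ?_
    filter_upwards [hK, self_mem_nhdsWithin] with τ h hτ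
    rw [Real.norm_of_nonneg (Real.rpow_pos_of_pos hτ _).le]
    exact h 0 (by simp)
  have h2 : (fun τ : ℝ => τ ^ (1 / 2 + e)) =O[𝓝[>] 0] fun τ => τ ^ (1 / 2 : ℝ) := by
    refine IsBigO.of_bound 1 ?_
    filter_upwards [Ioo_mem_nhdsGT (one_pos : (0 : ℝ) < 1)] with τ hτ
    rw [Real.norm_of_nonneg (Real.rpow_pos_of_pos hτ.1 _).le,
      Real.norm_of_nonneg (Real.rpow_pos_of_pos hτ.1 _).le, one_mul]
    exact Real.rpow_le_rpow_of_exponent_ge hτ.1 hτ.2.le (by linarith)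
  have h3 : (fun τ => bsw (σ * √τ) 0) =O[𝓝[>] 0] fun τ => τ ^ (1 / 2 : ℝ) := by
    refine IsBigO.of_bound (gpdf 0 * σ) ?_
    filter_upwards [self_mem_nhdsWithin] with τ hτ
    have hs : 0 < √τ := Real.sqrt_pos.2 hτ
    rw [← Real.sqrt_eq_rpow, Real.norm_of_nonneg hs.le]
    have := abs_Phi_sub_le (σ * √τ / 2) (-(σ * √τ / 2))
    rw [sub_neg_eq_add, add_halves, abs_of_pos (by positivity : 0 < σ * √τ)] at this
    simpa [bsw, mul_assoc, sub_eq_add_neg] using this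
  refine ((h1.trans h2).add h3).congr_left fun τ => by ring

lemma tendsto_volAt_sq_div_sqrt :
    Tendsto (fun τ => volAt (C τ) 0 ^ 2 / 2 / √τ) (𝓝[>] 0) (𝓝 0) := by
  have h := (volAt_isBigO_sqrt hC hσ he hunif 0).pow 2
  have h1 : (fun τ => volAt (C τ) 0 ^ 2 / 2 / √τ) =O[𝓝[>] 0] fun τ => √τ := by
    have h2 := (h.const_mul_left (1 / 2)).mul (isBigO_refl (fun τ : ℝ => (√τ)⁻¹) (𝓝[>] 0))
    refine (h2.congr' (Eventually.of_forall fun τ => ?_) ?_)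
    · simp only [div_eq_mul_inv]
      ring
    · filter_upwards [self_mem_nhdsWithin] with τ hτ
      have := (Real.sqrt_pos.2 hτ).ne'
      rw [← Real.sqrt_eq_rpow]
      field_simp
  exact h1.trans_tendsto tendsto_sqrt_zero

lemma exists_volAt_le (d : ℝ) :
    ∃ M, 0 < M ∧ ∀ᶠ τ in 𝓝[>] 0, volAt (C τ) d ≤ M * (σ * √τ) := by
  obtain ⟨M, hM, hb⟩ := (volAt_isBigO_sqrt hC hσ he hunif d).exists_pos
  refine ⟨M / σ, by positivity, ?_⟩
  filter_upwards [hb.bound, self_mem_nhdsWithin] with τ h hτ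
  have hs : 0 < √τ := Real.sqrt_pos.2 hτ
  rw [← Real.sqrt_eq_rpow, Real.norm_of_nonneg hs.le,
    Real.norm_of_nonneg ((hC τ hτ).volAt_pos d).le] at h
  calc _ ≤ M * √τ := h
    _ = _ := by field_simp

lemma tendsto_volAt_zero_of_diffusive (d : ℝ) :
    Tendsto (fun τ => volAt (C τ) d) (𝓝[>] 0) (𝓝 0) :=
  (volAt_isBigO_sqrt hC hσ he hunif d).trans_tendsto (tendsto_rpow_zero (by norm_num))

/-- The price difference equals vega times the volatility difference w − s, and the vega is bounded
below because d₊ stays bounded between the two volatilities. -/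
lemma volAt_sub_isBigO (d : ℝ) :
    (fun τ => volAt (C τ) d - σ * √τ) =O[𝓝[>] 0] fun τ => τ ^ (1 / 2 + e) := by
  obtain ⟨M, hM, hMw⟩ := exists_volAt_le hC hσ he hunif d
  have hw0 := tendsto_volAt_zero_of_diffusive hC hσ he hunif d
  have hk0 : Tendsto (fun τ => |volAt (C τ) d ^ 2 / 2 - volAt (C τ) d * d|) (𝓝[>] 0) (𝓝 0) := by
    simpa using (((hw0.pow 2).div_const 2).sub (hw0.mul_const d)).abs
  have hs0 : Tendsto (fun τ => σ * √τ) (𝓝[>] 0) (𝓝 0) := by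
    simpa using tendsto_sqrt_zero.const_mul σ
  obtain ⟨K, hK⟩ := hunif
  -- Bounds |d₊| at the intermediate volatility: |k| ≤ w(1 + |d|) and w ≤ (M + 1) min(s, w) bound
  -- |k| / min(s, w), and the final 1 covers max(s, w)/2.
  set R := (M + 1) * (1 + |d|) + 1 with hR
  refine IsBigO.of_bound (K / gpdf R) ?_
  filter_upwards [hK, hMw, self_mem_nhdsWithin, hk0.eventually (ge_mem_nhds one_pos),
    hw0.eventually (ge_mem_nhds one_pos), hs0.eventually (ge_mem_nhds one_pos)]
    with τ hK hMw hτ hk1 hw1 hs1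
  have h := hC τ hτ
  have hs : 0 < σ * √τ := mul_pos hσ (Real.sqrt_pos.2 hτ)
  have hw := h.volAt_pos d
  have hprice := h.price_volAt d
  set w := volAt (C τ) d
  set s := σ * √τ
  set k := w ^ 2 / 2 - w * d with hk
  obtain ⟨ξ, hξ, heq⟩ := exists_bsw_sub_eq hs hw k
  have hmin : w ≤ (M + 1) * min s w := by
    rcases le_total s w with hsw | hsw
    · rw [min_eq_left hsw]
      nlinarith
    · rw [min_eq_right hsw]
      nlinarith
  have hkw : |k| ≤ w * (1 + |d|) := by
    rw [hk]
    calc |w ^ 2 / 2 - w * d| ≤ |w ^ 2 / 2| + |w * d| := abs_sub _ _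
      _ = w * (w / 2 + |d|) := by
          rw [abs_mul, abs_of_pos hw, abs_of_pos (by positivity : 0 < w ^ 2 / 2)]; ring
      _ ≤ _ := by gcongr; linarith
  have hξR : |ξ| ≤ R := by
    refine hξ.trans ?_
    have h1 : |k| / min s w ≤ (M + 1) * (1 + |d|) := by
      rw [div_le_iff₀ (lt_min hs hw)]
      calc |k| ≤ w * (1 + |d|) := hkw
        _ ≤ ((M + 1) * min s w) * (1 + |d|) := by gcongr
        _ = _ := by ring
    have h2 : max s w / 2 ≤ 1 := by
      have := max_le hs1 hw1
      linarith
    linarith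
  have h1 := hK k hk1
  rw [hprice, heq, abs_mul, abs_of_pos (gpdf_pos _)] at h1
  rw [Real.norm_of_nonneg (Real.rpow_pos_of_pos hτ _).le, Real.norm_eq_abs, div_mul_eq_mul_div,
    le_div_iff₀ (gpdf_pos _)]
  calc |w - s| * gpdf R ≤ |w - s| * gpdf ξ := by
        gcongr
        exact gpdf_le_of_abs_le hξR
    _ ≤ _ := by linarith

lemma tendsto_volAt_div_sqrt (d : ℝ) :
    Tendsto (fun τ => volAt (C τ) d / √τ) (𝓝[>] 0) (𝓝 σ) := by
  have h := volAt_sub_isBigO hC hσ he hunif d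
  have h1 := h.mul (isBigO_refl (fun τ => (√τ)⁻¹) (𝓝[>] 0))
  have h2 : Tendsto (fun τ : ℝ => τ ^ (1 / 2 + e) * (√τ)⁻¹) (𝓝[>] 0) (𝓝 0) := by
    refine (tendsto_rpow_zero he).congr' ?_
    filter_upwards [self_mem_nhdsWithin] with τ hτ
    have hs : √τ ≠ 0 := (Real.sqrt_pos.2 hτ).ne'
    rw [rpow_half_add hτ]
    field_simp
  have h3 := (h1.trans_tendsto h2).add_const σ
  rw [zero_add] at h3
  refine h3.congr' ?_
  filter_upwards [self_mem_nhdsWithin] with τ hτ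
  have hs : √τ ≠ 0 := (Real.sqrt_pos.2 hτ).ne'
  field_simp
  ring

/-- The volatility at `Δ = 1/2` to second order. -/
lemma tendsto_volAt_sub_div {L : ℝ}
    (hL : Tendsto (fun τ => (C τ (volAt (C τ) 0 ^ 2 / 2) - bsw (σ * √τ) (volAt (C τ) 0 ^ 2 / 2)) /
      τ ^ (1 / 2 + e)) (𝓝[>] 0) (𝓝 L)) :
    Tendsto (fun τ => (volAt (C τ) 0 - σ * √τ) / τ ^ (1 / 2 + e)) (𝓝[>] 0)
      (𝓝 (√(2 * Real.pi) * L)) := by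
  obtain ⟨M, hM, hMw⟩ := exists_volAt_le hC hσ he hunif 0
  have hw0 := tendsto_volAt_zero_of_diffusive hC hσ he hunif 0
  have hs0 : Tendsto (fun τ => σ * √τ) (𝓝[>] 0) (𝓝 0) := by
    simpa using tendsto_sqrt_zero.const_mul σ
  have hex : ∀ τ, ∃ ξ, 0 < τ → |ξ| ≤ |volAt (C τ) 0 ^ 2 / 2| / min (σ * √τ) (volAt (C τ) 0) +
      max (σ * √τ) (volAt (C τ) 0) / 2 ∧
      C τ (volAt (C τ) 0 ^ 2 / 2) - bsw (σ * √τ) (volAt (C τ) 0 ^ 2 / 2) =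
        gpdf ξ * (volAt (C τ) 0 - σ * √τ) := by
    intro τ
    by_cases hτ : 0 < τ
    · obtain ⟨ξ, h1, h2⟩ := exists_bsw_sub_eq (mul_pos hσ (Real.sqrt_pos.2 hτ))
        ((hC τ hτ).volAt_pos 0) (volAt (C τ) 0 ^ 2 / 2)
      have := (hC τ hτ).price_volAt 0
      rw [mul_zero, sub_zero] at this
      exact ⟨ξ, fun _ => ⟨h1, by rw [this, h2]⟩⟩
    · exact ⟨0, fun h => absurd h hτ⟩
  choose ξ hξ using hex
  -- The strike w²/2 is quadratic in w, while w is at most a constant times the smaller of the two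
  -- volatilities; hence the intermediate d₊ tends to 0 and the vega to φ(0).
  have hξ0 : Tendsto ξ (𝓝[>] 0) (𝓝 0) := by
    have hb : Tendsto (fun τ => (M + 1) * volAt (C τ) 0 + (σ * √τ + volAt (C τ) 0)) (𝓝[>] 0)
        (𝓝 0) := by
      simpa using (hw0.const_mul (M + 1)).add (hs0.add hw0)
    refine squeeze_zero_norm' ?_ hb
    filter_upwards [hMw, self_mem_nhdsWithin] with τ hMw hτ
    have hs : 0 < σ * √τ := mul_pos hσ (Real.sqrt_pos.2 hτ)
    have hw := (hC τ hτ).volAt_pos 0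
    refine (hξ τ hτ).1.trans (add_le_add ?_ ?_)
    · rw [abs_of_pos (by positivity), div_le_iff₀ (lt_min hs hw)]
      have hmin : volAt (C τ) 0 ≤ (M + 1) * min (σ * √τ) (volAt (C τ) 0) := by
        rcases le_total (σ * √τ) (volAt (C τ) 0) with hsw | hsw
        · rw [min_eq_left hsw]
          nlinarith
        · rw [min_eq_right hsw]
          nlinarith
      nlinarith
    · have : max (σ * √τ) (volAt (C τ) 0) ≤ σ * √τ + volAt (C τ) 0 :=
        max_le (by linarith) (by linarith)
      linarith
  have hg : Tendsto (fun τ => gpdf (ξ τ)) (𝓝[>] 0) (𝓝 (1 / √(2 * Real.pi))) := by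
    have := (continuous_gpdf.tendsto 0).comp hξ0
    rwa [gpdf_zero] at this
  have := hL.div hg (by positivity)
  have e1 : L / (1 / √(2 * Real.pi)) = √(2 * Real.pi) * L := by field_simp
  rw [e1] at this
  refine this.congr' ?_
  filter_upwards [self_mem_nhdsWithin] with τ hτ
  have hgp := gpdf_pos (ξ τ)
  simp only [Pi.div_apply]
  rw [(hξ τ hτ).2]
  field_simp

end Diffusive

/-! ### Slope and convexity of the smile with diffusion. -/

section DiffusiveModel

variable {Ω : Type*} [MeasurableSpace Ω] {P : Measure Ω} {X : ℝ≥0 → Ω → ℝ} {T f : ℝ → ℝ → ℝ}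
  (hC : ∀ τ, 0 < τ → CallCurve (callPrice P X τ) (T τ) (f τ))
  {σ e : ℝ} (hσ : 0 < σ) (he : 0 < e)
  (hunif : ∃ K, ∀ᶠ τ in 𝓝[>] 0, ∀ k, |k| ≤ 1 →
    |callPrice P X τ k - bsw (σ * √τ) k| ≤ K * τ ^ (1 / 2 + e))
include hC hσ he hunif

lemma smile_sub_isBigO {Δ : ℝ} (h0 : 0 < Δ) (h1 : Δ < 1) :
    (fun τ => smile P X τ Δ - σ) =O[𝓝[>] 0] fun τ => τ ^ e := by
  obtain ⟨d, rfl⟩ := exists_Phi_eq h0 h1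
  have h := (volAt_sub_isBigO hC hσ he hunif d).mul (isBigO_refl (fun τ => (√τ)⁻¹) (𝓝[>] 0))
  refine h.congr' ?_ ?_
  · filter_upwards [self_mem_nhdsWithin] with τ hτ
    have hs : √τ ≠ 0 := (Real.sqrt_pos.2 hτ).ne'
    rw [smile_Phi hτ (hC τ hτ)]
    field_simp
  · filter_upwards [self_mem_nhdsWithin] with τ hτ
    have hs : √τ ≠ 0 := (Real.sqrt_pos.2 hτ).ne'
    rw [rpow_half_add hτ]
    field_simp

lemma hasRate_RR_of_diffusive : HasRate (RR P X) e := by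
  have h := (smile_sub_isBigO hC hσ he hunif (Δ := 3 / 4) (by norm_num) (by norm_num)).sub
    (smile_sub_isBigO hC hσ he hunif (Δ := 1 / 4) (by norm_num) (by norm_num))
  exact h.congr_left fun τ => by rw [RR]; ring

lemma hasRate_BF_of_diffusive : HasRate (BF P X) e := by
  have h := (((smile_sub_isBigO hC hσ he hunif (Δ := 3 / 4) (by norm_num) (by norm_num)).add
    (smile_sub_isBigO hC hσ he hunif (Δ := 1 / 4) (by norm_num) (by norm_num))).sub
    ((smile_sub_isBigO hC hσ he hunif (Δ := 1 / 2) (by norm_num)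
      (by norm_num)).const_mul_left 2)).const_mul_left (1 / 2)
  exact h.congr_left fun τ => by rw [BF]; ring

variable {L M N : ℝ}
  (hL : Tendsto (fun τ => (callPrice P X τ (volAt (callPrice P X τ) 0 ^ 2 / 2) -
    bsw (σ * √τ) (volAt (callPrice P X τ) 0 ^ 2 / 2)) / τ ^ (1 / 2 + e)) (𝓝[>] 0) (𝓝 L))
  (hM : Tendsto (fun τ => (T τ (volAt (callPrice P X τ) 0 ^ 2 / 2) -
    Phi (-(volAt (callPrice P X τ) 0 ^ 2 / 2) / (σ * √τ) - σ * √τ / 2)) / τ ^ e)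
    (𝓝[>] 0) (𝓝 (-M)))
include hL hM

/-- The ingredients of the slope and the convexity of the smile, in a model with diffusion. -/
lemma tendsto_tailGap_of_diffusive :
    Tendsto (fun τ => ((-volAt (callPrice P X τ) 0) -
      (-(volAt (callPrice P X τ) 0 ^ 2 / 2) / (σ * √τ) - σ * √τ / 2)) / τ ^ e) (𝓝[>] 0) (𝓝 0) ∧
    Tendsto (fun τ => CallCurve.tailGap (callPrice P X τ) (T τ) 0 / τ ^ e) (𝓝[>] 0) (𝓝 M) ∧
    Tendsto (fun τ => CallCurve.tailGap (callPrice P X τ) (T τ) 0) (𝓝[>] 0) (𝓝 0) ∧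
    Tendsto (fun τ => CallCurve.slopeDenom (callPrice P X τ) (T τ) 0) (𝓝[>] 0)
      (𝓝 (1 / √(2 * Real.pi))) := by
  have hw0 := tendsto_volAt_zero_of_diffusive hC hσ he hunif 0
  have hw2 := tendsto_volAt_sub_div hC hσ he hunif hL
  have hgap : Tendsto (fun τ => ((-volAt (callPrice P X τ) 0) -
      (-(volAt (callPrice P X τ) 0 ^ 2 / 2) / (σ * √τ) - σ * √τ / 2)) / τ ^ e)
      (𝓝[>] 0) (𝓝 0) := by
    -- With s = σ√τ the gap between the two values of d₋ is exactly (w − s)²/(2s), hence of second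
    -- order in w − s.
    have h1 := ((hw2.pow 2).mul ((tendsto_rpow_zero he).mul tendsto_sqrt_zero)).div_const (2 * σ)
    rw [mul_zero, mul_zero, zero_div] at h1
    refine h1.congr' ?_
    filter_upwards [self_mem_nhdsWithin] with τ hτ
    have hs : √τ ≠ 0 := (Real.sqrt_pos.2 hτ).ne'
    have hp := (Real.rpow_pos_of_pos (hτ : (0 : ℝ) < τ) e).ne'
    rw [rpow_half_add hτ]
    field_simp
    ring
  have hQe : Tendsto (fun τ => CallCurve.tailGap (callPrice P X τ) (T τ) 0 / τ ^ e) (𝓝[>] 0)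
      (𝓝 M) := by
    have h1 : Tendsto (fun τ => (Phi (-volAt (callPrice P X τ) 0) -
        Phi (-(volAt (callPrice P X τ) 0 ^ 2 / 2) / (σ * √τ) - σ * √τ / 2)) / τ ^ e)
        (𝓝[>] 0) (𝓝 0) := by
      have h2 := hgap.abs.const_mul (gpdf 0)
      rw [abs_zero, mul_zero] at h2
      refine squeeze_zero_norm' ?_ h2
      filter_upwards [self_mem_nhdsWithin] with τ hτ
      rw [Real.norm_eq_abs, abs_div, abs_div, ← mul_div_assoc]
      exact div_le_div_of_nonneg_right (abs_Phi_sub_le _ _) (abs_nonneg _)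
    have h3 := h1.sub hM
    rw [zero_sub, neg_neg] at h3
    refine h3.congr fun τ => ?_
    simp only [CallCurve.tailGap, zero_sub, mul_zero, sub_zero]
    ring
  have hQ : Tendsto (fun τ => CallCurve.tailGap (callPrice P X τ) (T τ) 0) (𝓝[>] 0) (𝓝 0) := by
    have h1 := hQe.mul (tendsto_rpow_zero he)
    rw [mul_zero] at h1
    refine h1.congr' ?_
    filter_upwards [self_mem_nhdsWithin] with τ hτ
    exact div_mul_cancel₀ _ (Real.rpow_pos_of_pos hτ e).ne'
  have hm : Tendsto (fun τ => 0 - volAt (callPrice P X τ) 0) (𝓝[>] 0) (𝓝 0) := by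
    simpa using hw0.neg
  refine ⟨hgap, hQe, hQ, ?_⟩
  have h1 := ((continuous_gpdf.tendsto 0).comp hm).add (hm.mul hQ)
  rw [zero_mul, add_zero, gpdf_zero] at h1
  exact h1

/-- Roles are exchanged compared with the model without diffusion: now w/√τ → σ, and the order τ^e
comes from the tail gap Q ~ M τ^e. -/
lemma slopeRR_leadingTerm_of_diffusive :
    LeadingTerm (slopeRR P X) (-Real.pi * σ * M) e := by
  obtain ⟨-, hQe, -, hD⟩ := tendsto_tailGap_of_diffusive hC hσ he hunif hL hM
  have hw := tendsto_volAt_div_sqrt hC hσ he hunif 0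
  have main := ((hw.mul hQe).neg.div hD (by positivity)).const_mul (1 / 2 * √(2 * Real.pi))
  have hs := Real.mul_self_sqrt (by positivity : (0 : ℝ) ≤ 2 * Real.pi)
  refine leadingTerm_of_tendsto ?_
  convert main.congr' ?_ using 2
  · rw [div_div_eq_mul_div, div_one]
    linear_combination (1 / 2 * σ * M) * hs
  · filter_upwards [self_mem_nhdsWithin] with τ hτ
    rw [slopeRR_eq hτ (hC τ hτ), ((hC τ hτ).hasDerivAt_volAt 0).deriv]
    have h1 := Real.sqrt_pos.2 hτ
    have h2 := Real.rpow_pos_of_pos (hτ : (0 : ℝ) < τ) e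
    have h3 := (hC τ hτ).slopeDenom_pos 0
    simp only [Pi.div_apply]
    field_simp

/-- The convexity is carried by φ(w) − wf, whose leading parts cancel. With s = σ√τ and b the
Black–Scholes d₋ at volatility s, it splits into φ(w) − φ(b), which is negligible, −φ(b)(w − s)/s,
which gives −L/σ, and −w(f − φ(b)/s), which gives −σN. -/
lemma convexityBF_leadingTerm_of_diffusive
    (hN : Tendsto (fun τ => τ ^ (1 / 2 - e) * (f τ (volAt (callPrice P X τ) 0 ^ 2 / 2) -
      gpdf (-(volAt (callPrice P X τ) 0 ^ 2 / 2) / (σ * √τ) - σ * √τ / 2) / (σ * √τ)))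
      (𝓝[>] 0) (𝓝 N)) :
    LeadingTerm (convexityBF P X) (√(2 * Real.pi ^ 3) / 16 * (L + σ ^ 2 * N)) e := by
  obtain ⟨hgap, hQe, hQ, hD⟩ := tendsto_tailGap_of_diffusive hC hσ he hunif hL hM
  have hw0 := tendsto_volAt_zero_of_diffusive hC hσ he hunif 0
  have hw := tendsto_volAt_div_sqrt hC hσ he hunif 0
  have hw2 := tendsto_volAt_sub_div hC hσ he hunif hL
  set w := fun τ => volAt (callPrice P X τ) 0 with hwdef
  set b := fun τ => -(w τ ^ 2 / 2) / (σ * √τ) - σ * √τ / 2 with hb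
  have hs := Real.sq_sqrt (by positivity : (0 : ℝ) ≤ 2 * Real.pi)
  have hspos : 0 < √(2 * Real.pi) := by positivity
  have hb0 : Tendsto b (𝓝[>] 0) (𝓝 0) := by
    have h1 := (hw0.neg).sub (hgap.mul (tendsto_rpow_zero he))
    rw [neg_zero, mul_zero, sub_zero] at h1
    refine h1.congr' ?_
    filter_upwards [self_mem_nhdsWithin] with τ hτ
    rw [div_mul_cancel₀ _ (Real.rpow_pos_of_pos hτ e).ne']
    ring
  have hgb : Tendsto (fun τ => gpdf (b τ)) (𝓝[>] 0) (𝓝 (1 / √(2 * Real.pi))) := by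
    have := (continuous_gpdf.tendsto 0).comp hb0
    rwa [gpdf_zero] at this
  have hgw : Tendsto (fun τ => gpdf (w τ)) (𝓝[>] 0) (𝓝 (1 / √(2 * Real.pi))) := by
    have := (continuous_gpdf.tendsto 0).comp hw0
    rwa [gpdf_zero] at this
  -- the density term
  have hA : Tendsto (fun τ => (gpdf (w τ) - w τ * f τ (w τ ^ 2 / 2)) / τ ^ e) (𝓝[>] 0)
      (𝓝 (-(L / σ + σ * N))) := by
    have h1 : Tendsto (fun τ => (gpdf (-w τ) - gpdf (b τ)) / τ ^ e) (𝓝[>] 0) (𝓝 0) := by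
      have h2 := hgap.abs
      rw [abs_zero] at h2
      refine squeeze_zero_norm' ?_ h2
      filter_upwards [self_mem_nhdsWithin] with τ hτ
      rw [Real.norm_eq_abs, abs_div, abs_div]
      exact div_le_div_of_nonneg_right (abs_gpdf_sub_le _ _) (abs_nonneg _)
    have h3 := (h1.sub ((hgb.mul hw2).div_const σ)).sub (hw.mul hN)
    convert h3.congr' ?_ using 2
    · field_simp
      ring
    · filter_upwards [self_mem_nhdsWithin] with τ hτ
      have hsq : 0 < √τ := Real.sqrt_pos.2 hτ
      have hp := Real.rpow_pos_of_pos (hτ : (0 : ℝ) < τ) e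
      have e1 : τ ^ (1 / 2 - e) = √τ / τ ^ e := by
        rw [Real.rpow_sub hτ, Real.sqrt_eq_rpow]
      have e2 : τ ^ (1 / 2 + e) = √τ * τ ^ e := rpow_half_add hτ e
      rw [e1, e2, gpdf_neg]
      change (gpdf (w τ) - gpdf (b τ)) / τ ^ e - gpdf (b τ) * ((w τ - σ * √τ) / (√τ * τ ^ e)) / σ -
        w τ / √τ * (√τ / τ ^ e * (f τ (w τ ^ 2 / 2) - gpdf (b τ) / (σ * √τ))) = _
      generalize gpdf (b τ) = B
      field_simp
      ring
  have hwf : Tendsto (fun τ => w τ * f τ (w τ ^ 2 / 2)) (𝓝[>] 0) (𝓝 (1 / √(2 * Real.pi))) := by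
    have h1 := hgw.sub (hA.mul (tendsto_rpow_zero he))
    rw [mul_zero, sub_zero] at h1
    refine h1.congr' ?_
    filter_upwards [self_mem_nhdsWithin] with τ hτ
    rw [div_mul_cancel₀ _ (Real.rpow_pos_of_pos hτ e).ne']
    ring
  have hD0 : 1 / √(2 * Real.pi) ≠ 0 := by positivity
  have hw' : Tendsto (fun τ => -(w τ * CallCurve.tailGap (callPrice P X τ) (T τ) 0) /
      CallCurve.slopeDenom (callPrice P X τ) (T τ) 0) (𝓝[>] 0) (𝓝 0) := by
    have := ((hw0.mul hQ).neg).div hD hD0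
    rw [mul_zero, neg_zero, zero_div] at this
    exact this
  have hw's : Tendsto (fun τ => -(w τ / √τ * CallCurve.tailGap (callPrice P X τ) (T τ) 0) /
      CallCurve.slopeDenom (callPrice P X τ) (T τ) 0) (𝓝[>] 0) (𝓝 0) := by
    have := ((hw.mul hQ).neg).div hD hD0
    rw [mul_zero, neg_zero, zero_div] at this
    exact this
  have main := ((((hw's.mul hQe).add (hw.mul ((hw'.const_sub 1).mul hA))).neg.div hD hD0).add
    (((hw.mul hQe).mul ((hw'.const_sub 1).mul (hQ.add (hw0.mul hwf)))).div (hD.pow 2)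
      (pow_ne_zero 2 hD0))).const_mul (Real.pi / 16)
  refine leadingTerm_of_tendsto ?_
  convert main.congr' ?_ using 2
  · rw [sqrt_two_pi_cubed]
    field_simp
    ring
  · filter_upwards [self_mem_nhdsWithin] with τ hτ
    rw [convexityBF_eq hτ (hC τ hτ), (hC τ hτ).hasDerivAt_deriv_volAt.deriv]
    have h1 := Real.sqrt_pos.2 hτ
    have h2 := Real.rpow_pos_of_pos (hτ : (0 : ℝ) < τ) e
    have h3 := (hC τ hτ).slopeDenom_pos 0
    simp only [Pi.div_apply, hwdef]
    field_simp

end DiffusiveModel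

/-! ### Fourier integrals -/

open scoped FourierTransform in
/-- The Fourier transform of the Laplace kernel. -/
lemma fourier_laplace (ξ : ℝ) :
    𝓕 (fun y : ℝ => Complex.exp (-(|y| : ℝ) / 2)) ξ =
      (((2 * Real.pi * ξ) ^ 2 + 1 / 4 : ℝ) : ℂ)⁻¹ := by
  rw [Real.fourier_real_eq_integral_exp_smul]
  set c : ℂ := (2 * Real.pi * ξ : ℝ) * Complex.I with hc
  have hre : c.re = 0 := by simp [hc]
  have e1 : ∀ y ∈ Set.Iic (0 : ℝ), Complex.exp (↑(-2 * Real.pi * y * ξ) * Complex.I) •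
      Complex.exp (-(|y| : ℝ) / 2) = Complex.exp ((1 / 2 - c) * y) := by
    intro y hy
    rw [smul_eq_mul, ← Complex.exp_add, abs_of_nonpos hy, hc]
    push_cast
    ring_nf
  have e2 : ∀ y ∈ Set.Ioi (0 : ℝ), Complex.exp (↑(-2 * Real.pi * y * ξ) * Complex.I) •
      Complex.exp (-(|y| : ℝ) / 2) = Complex.exp ((-1 / 2 - c) * y) := by
    intro y hy
    rw [smul_eq_mul, ← Complex.exp_add, abs_of_pos hy, hc]
    push_cast
    ring_nf
  have r1 : 0 < (1 / 2 - c).re := by rw [Complex.sub_re, hre]; norm_num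
  have r2 : (-1 / 2 - c).re < 0 := by rw [Complex.sub_re, hre]; norm_num
  have i1 : IntegrableOn (fun y : ℝ => Complex.exp (↑(-2 * Real.pi * y * ξ) * Complex.I) •
      Complex.exp (-(|y| : ℝ) / 2)) (Set.Iic 0) :=
    (integrableOn_exp_mul_complex_Iic r1 0).congr_fun (fun y hy => (e1 y hy).symm) measurableSet_Iic
  have i2 : IntegrableOn (fun y : ℝ => Complex.exp (↑(-2 * Real.pi * y * ξ) * Complex.I) •
      Complex.exp (-(|y| : ℝ) / 2)) (Set.Ioi 0) :=
    (integrableOn_exp_mul_complex_Ioi r2 0).congr_fun (fun y hy => (e2 y hy).symm) measurableSet_Ioi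
  rw [← intervalIntegral.integral_Iic_add_Ioi i1 i2, setIntegral_congr_fun measurableSet_Iic e1,
    setIntegral_congr_fun measurableSet_Ioi e2, integral_exp_mul_complex_Iic r1,
    integral_exp_mul_complex_Ioi r2]
  have n1 : (1 / 2 - c) ≠ 0 := fun h => by rw [h] at r1; simp at r1
  have n2 : (-1 / 2 - c) ≠ 0 := fun h => by rw [h] at r2; simp at r2
  have hI : c ^ 2 = -((2 * Real.pi * ξ : ℝ) : ℂ) ^ 2 := by
    rw [hc, mul_pow, Complex.I_sq]; ring
  have n3 : (((2 * Real.pi * ξ) ^ 2 + 1 / 4 : ℝ) : ℂ) ≠ 0 := by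
    exact_mod_cast (by positivity : (2 * Real.pi * ξ) ^ 2 + 1 / 4 ≠ 0)
  have e3 : (((2 * Real.pi * ξ) ^ 2 + 1 / 4 : ℝ) : ℂ) = -(1 / 2 - c) * (-1 / 2 - c) := by
    rw [Complex.ofReal_add, Complex.ofReal_pow, ← neg_eq_iff_eq_neg.2 hI]
    push_cast
    ring
  rw [e3]
  simp only [Complex.ofReal_zero, mul_zero, Complex.exp_zero]
  have hAB : (1 / 2 - c) - (-1 / 2 - c) = 1 := by ring
  generalize 1 / 2 - c = A at *
  generalize -1 / 2 - c = B at *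
  field_simp
  linear_combination -hAB

/-- The kernel `1 / (u² + 1/4)`. -/
def kern (u : ℝ) : ℂ := ((u ^ 2 + 1 / 4 : ℝ) : ℂ)⁻¹

lemma norm_kern (u : ℝ) : ‖kern u‖ = (u ^ 2 + 1 / 4)⁻¹ := by
  rw [kern, norm_inv, Complex.norm_real, Real.norm_of_nonneg (by positivity)]

lemma continuous_kern : Continuous kern := by
  unfold kern
  refine Continuous.inv₀ (by fun_prop) fun u => ?_
  exact_mod_cast (by positivity : u ^ 2 + 1 / 4 ≠ 0)

lemma integrable_inv_sq_add : Integrable fun u : ℝ => (u ^ 2 + 1 / 4)⁻¹ := by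
  have h := integrable_inv_one_add_sq.const_mul 4
  refine h.mono' ?_ (Eventually.of_forall fun u => ?_)
  · exact (Continuous.inv₀ (by fun_prop) fun u => by positivity).aestronglyMeasurable
  · rw [Real.norm_of_nonneg (by positivity), inv_eq_one_div, ← div_eq_mul_inv,
      div_le_div_iff₀ (by positivity) (by positivity)]
    nlinarith [sq_nonneg u]

lemma integrable_kern : Integrable kern :=
  integrable_inv_sq_add.mono' continuous_kern.aestronglyMeasurable
    (Eventually.of_forall fun u => (norm_kern u).le)

-- Fourier inversion of `fourier_laplace`, legitimate because the Laplace kernel is continuous and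
-- integrable with integrable transform. The factor 2π comes from the normalization of the
-- frequency.
open scoped FourierTransform in
lemma integral_exp_mul_kern (y : ℝ) :
    ∫ u : ℝ, Complex.exp (Complex.I * u * y) * kern u = 2 * Real.pi * Complex.exp (-(|y| : ℝ) / 2) := by
  have hf : Continuous fun y : ℝ => Complex.exp (-(|y| : ℝ) / 2) := by fun_prop
  have hi : Integrable fun y : ℝ => Complex.exp (-(|y| : ℝ) / 2) := by
    rw [← integrableOn_univ, ← Set.Iic_union_Ioi (a := (0 : ℝ)), integrableOn_union]
    constructor
    · refine (integrableOn_exp_mul_complex_Iic (a := 1 / 2) (by norm_num) 0).congr_fun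
        (fun y hy => ?_) measurableSet_Iic
      simp only [abs_of_nonpos (Set.mem_Iic.1 hy)]
      push_cast
      ring_nf
    · refine (integrableOn_exp_mul_complex_Ioi (a := -1 / 2) (by norm_num) 0).congr_fun
        (fun y hy => ?_) measurableSet_Ioi
      simp only [abs_of_pos (Set.mem_Ioi.1 hy)]
      ring_nf
  have hF : 𝓕 (fun y : ℝ => Complex.exp (-(|y| : ℝ) / 2)) = fun ξ => kern (2 * Real.pi * ξ) :=
    funext fourier_laplace
  have hFi : Integrable (𝓕 fun y : ℝ => Complex.exp (-(|y| : ℝ) / 2)) := by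
    rw [hF]
    exact integrable_kern.comp_mul_left' (by positivity)
  have h := congrFun (hf.fourierInv_fourier_eq hi hFi) y
  rw [hF, Real.fourierInv_eq'] at h
  have h2 := Measure.integral_comp_mul_left
    (fun u : ℝ => Complex.exp (Complex.I * u * y) * kern u) (2 * Real.pi)
  have h3 : ∫ ξ : ℝ, Complex.exp (↑(2 * Real.pi * inner ℝ ξ y) * Complex.I) •
      kern (2 * Real.pi * ξ) = ∫ ξ : ℝ, Complex.exp (Complex.I * ↑(2 * Real.pi * ξ) * y) *
        kern (2 * Real.pi * ξ) := by
    congr 1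
    ext ξ
    rw [smul_eq_mul]
    congr 2
    simp
    ring
  rw [h3, h2, abs_of_pos (by positivity), Complex.real_smul] at h
  rw [← h]
  push_cast
  have : (2 * Real.pi : ℂ) ≠ 0 := by
    exact_mod_cast (by positivity : (2 * Real.pi : ℝ) ≠ 0)
  rw [mul_inv_cancel_left₀ this]

/-- The real part of the inverse Fourier transform of `h`. -/
def fint (h : ℝ → ℂ) (k : ℝ) : ℝ :=
  1 / (2 * Real.pi) * (∫ u : ℝ, Complex.exp (-(Complex.I * u * k)) * h u).re

lemma norm_exp_I_mul (u k : ℝ) : ‖Complex.exp (-(Complex.I * u * k))‖ = 1 := by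
  rw [Complex.norm_exp]
  simp

lemma continuous_exp_I_mul (k : ℝ) :
    Continuous fun u : ℝ => Complex.exp (-(Complex.I * u * k)) := by fun_prop

lemma integrable_exp_I_mul {h : ℝ → ℂ} (hh : Integrable h) (k : ℝ) :
    Integrable fun u : ℝ => Complex.exp (-(Complex.I * u * k)) * h u :=
  hh.bdd_mul (continuous_exp_I_mul k).aestronglyMeasurable
    (Eventually.of_forall fun u => (norm_exp_I_mul u k).le)

lemma fint_add {g h : ℝ → ℂ} (hg : Integrable g) (hh : Integrable h) (k : ℝ) :
    fint (fun u => g u + h u) k = fint g k + fint h k := by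
  simp only [fint, mul_add]
  rw [integral_add (integrable_exp_I_mul hg k) (integrable_exp_I_mul hh k), Complex.add_re]
  ring

lemma fint_sub {g h : ℝ → ℂ} (hg : Integrable g) (hh : Integrable h) (k : ℝ) :
    fint (fun u => g u - h u) k = fint g k - fint h k := by
  simp only [fint, mul_sub]
  rw [integral_sub (integrable_exp_I_mul hg k) (integrable_exp_I_mul hh k), Complex.sub_re]
  ring

lemma fint_const_mul (c : ℝ) (h : ℝ → ℂ) (k : ℝ) :
    fint (fun u => c * h u) k = c * fint h k := by
  simp only [fint, mul_left_comm _ (c : ℂ)]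
  rw [integral_const_mul, Complex.re_ofReal_mul]
  ring

lemma abs_fint_le {h : ℝ → ℂ} (k : ℝ) : |fint h k| ≤ 1 / (2 * Real.pi) * ∫ u, ‖h u‖ := by
  rw [fint, abs_mul, abs_of_pos (by positivity : (0 : ℝ) < 1 / (2 * Real.pi))]
  gcongr
  refine (Complex.abs_re_le_norm _).trans ((norm_integral_le_integral_norm _).trans_eq ?_)
  simp only [norm_mul, norm_exp_I_mul, one_mul]

lemma hasDerivAt_fint {h : ℝ → ℂ} (hh : Integrable h) (hh' : Integrable fun u : ℝ => (u : ℂ) * h u)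
    (k : ℝ) : HasDerivAt (fint h) (fint (fun u => -(Complex.I * u) * h u) k) k := by
  have key := hasDerivAt_integral_of_dominated_loc_of_deriv_le (μ := volume)
    (F := fun (k : ℝ) (u : ℝ) => Complex.exp (-(Complex.I * u * k)) * h u)
    (F' := fun (k : ℝ) (u : ℝ) => Complex.exp (-(Complex.I * u * k)) * (-(Complex.I * u) * h u))
    (x₀ := k) (s := Set.univ) (bound := fun (u : ℝ) => ‖(u : ℂ) * h u‖) Filter.univ_mem
    (Eventually.of_forall fun k => (integrable_exp_I_mul hh k).aestronglyMeasurable)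
    (integrable_exp_I_mul hh k)
    (by
      have := (integrable_exp_I_mul (hh'.const_mul (-Complex.I)) k).aestronglyMeasurable
      refine this.congr (Eventually.of_forall fun u => ?_)
      simp only
      ring)
    (Eventually.of_forall fun u k _ => by
      rw [norm_mul, norm_exp_I_mul, one_mul, norm_mul, norm_mul, norm_neg, norm_mul,
        Complex.norm_I, one_mul])
    hh'.norm
    (Eventually.of_forall fun (u : ℝ) k _ => by
      have h1 : HasDerivAt (fun k : ℝ => -(Complex.I * u * k)) (-(Complex.I * u)) k := by
        have := ((hasDerivAt_id k).ofReal_comp.const_mul (Complex.I * u)).neg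
        refine this.congr_deriv ?_
        simp
      refine (h1.cexp.mul_const (h u)).congr_deriv ?_
      ring)
  have h2 := (Complex.reCLM.hasFDerivAt.comp_hasDerivAt k key.2).const_mul (1 / (2 * Real.pi))
  exact h2

lemma continuous_fint {h : ℝ → ℂ} (hh : Integrable h) : Continuous (fint h) := by
  refine continuous_const.mul (Complex.continuous_re.comp ?_)
  refine continuous_of_dominated (bound := fun u => ‖h u‖)
    (fun k => (integrable_exp_I_mul hh k).aestronglyMeasurable)
    (fun k => Eventually.of_forall fun u => ?_) hh.norm (Eventually.of_forall fun u => ?_)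
  · rw [norm_mul, norm_exp_I_mul, one_mul]
  · fun_prop

/-! ### Option prices as Fourier integrals -/

/-- The price curve with tilted characteristic function `φ(u) = E exp ((1/2 + iu) X)`. -/
def fprice (φ : ℝ → ℂ) (k : ℝ) : ℝ := 1 - Real.exp (k / 2) * fint (fun u => φ u * kern u) k

/-- The tail probabilities in terms of the tilted characteristic function. -/
def ftail (φ : ℝ → ℂ) (k : ℝ) : ℝ :=
  Real.exp (-k / 2) * fint (fun u => φ u * (1 / 2 + Complex.I * u)⁻¹) k

/-- The density in terms of the tilted characteristic function. -/
def fdens (φ : ℝ → ℂ) (k : ℝ) : ℝ := Real.exp (-k / 2) * fint φ k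

lemma half_add_ne_zero (u : ℝ) : (1 / 2 + Complex.I * u : ℂ) ≠ 0 := fun h => by
  have := congrArg Complex.re h
  simp at this

lemma kern_eq (u : ℝ) :
    kern u = (1 / 2 + Complex.I * u : ℂ)⁻¹ * (1 / 2 - Complex.I * u : ℂ)⁻¹ := by
  rw [kern, ← mul_inv]
  congr 1
  push_cast
  linear_combination ((u : ℂ) ^ 2) * Complex.I_sq

lemma half_sub_ne_zero (u : ℝ) : (1 / 2 - Complex.I * u : ℂ) ≠ 0 := fun h => by
  have := congrArg Complex.re h
  simp at this

lemma half_sub_mul_kern (u : ℝ) :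
    (1 / 2 - Complex.I * u) * kern u = (1 / 2 + Complex.I * u : ℂ)⁻¹ := by
  rw [kern_eq, mul_comm, mul_assoc, inv_mul_cancel₀ (half_sub_ne_zero u), mul_one]

lemma norm_half_add (u : ℝ) : ‖(1 / 2 + Complex.I * u : ℂ)‖ = √(u ^ 2 + 1 / 4) := by
  rw [Complex.norm_eq_sqrt_sq_add_sq]
  simp
  norm_num
  ring_nf

lemma norm_inv_half_add_le (u : ℝ) : ‖(1 / 2 + Complex.I * u : ℂ)⁻¹‖ ≤ 2 := by
  rw [norm_inv, norm_half_add, inv_le_comm₀ (by positivity) (by norm_num)]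
  refine Real.le_sqrt_of_sq_le ?_
  nlinarith [sq_nonneg u]

lemma abs_le_norm_half_add (u : ℝ) : |u| ≤ ‖(1 / 2 + Complex.I * u : ℂ)‖ := by
  rw [norm_half_add]
  refine Real.le_sqrt_of_sq_le ?_
  rw [sq_abs]
  linarith

lemma continuous_inv_half_add : Continuous fun u : ℝ => (1 / 2 + Complex.I * u : ℂ)⁻¹ :=
  Continuous.inv₀ (by fun_prop) half_add_ne_zero

section

variable {φ : ℝ → ℂ} (hφ : Integrable φ)
include hφ

lemma integrable_mul_inv_half_add :
    Integrable fun u : ℝ => φ u * (1 / 2 + Complex.I * u : ℂ)⁻¹ :=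
  hφ.mul_bdd (c := 2) continuous_inv_half_add.aestronglyMeasurable
    (Eventually.of_forall norm_inv_half_add_le)

lemma integrable_mul_kern : Integrable fun u : ℝ => φ u * kern u := by
  refine hφ.mul_bdd (c := 4) continuous_kern.aestronglyMeasurable (Eventually.of_forall fun u => ?_)
  rw [norm_kern, inv_le_comm₀ (by positivity) (by norm_num)]
  nlinarith [sq_nonneg u]

lemma integrable_id_mul_inv_half_add :
    Integrable fun u : ℝ => (u : ℂ) * (φ u * (1 / 2 + Complex.I * u : ℂ)⁻¹) := by
  have h := hφ.mul_bdd (g := fun u : ℝ => (u : ℂ) * (1 / 2 + Complex.I * u : ℂ)⁻¹) (c := 1)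
    (Complex.continuous_ofReal.mul continuous_inv_half_add).aestronglyMeasurable
    (Eventually.of_forall fun u => by
      rw [norm_mul, norm_inv, Complex.norm_real, ← div_eq_mul_inv]
      exact div_le_one_of_le₀ (abs_le_norm_half_add u) (norm_nonneg _))
  exact h.congr (Eventually.of_forall fun u => by simp only; ring)

lemma integrable_id_mul_kern : Integrable fun u : ℝ => (u : ℂ) * (φ u * kern u) := by
  have h := (integrable_id_mul_inv_half_add hφ).mul_bdd
    (g := fun u : ℝ => (1 / 2 - Complex.I * u : ℂ)⁻¹) (c := 2)
    (Continuous.inv₀ (by fun_prop) half_sub_ne_zero).aestronglyMeasurable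
    (Eventually.of_forall fun u => by
      have := norm_inv_half_add_le (-u)
      simpa [sub_eq_add_neg] using this)
  refine h.congr (Eventually.of_forall fun u => ?_)
  simp only
  rw [kern_eq]
  ring

/-- Differentiating e^(k/2)e^(−iuk) produces the factor 1/2 − iu, which cancels one of the two
factors of `kern`. -/
lemma hasDerivAt_fprice (k : ℝ) :
    HasDerivAt (fprice φ) (-(Real.exp k * ftail φ k)) k := by
  have h1 : HasDerivAt (fun k : ℝ => Real.exp (k / 2)) (Real.exp (k / 2) * (1 / 2)) k :=
    ((hasDerivAt_id k).div_const 2).exp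
  have h2 := hasDerivAt_fint (integrable_mul_kern hφ) (integrable_id_mul_kern hφ) k
  refine ((h1.mul h2).const_sub 1).congr_deriv ?_
  have e : fint (fun u => φ u * (1 / 2 + Complex.I * u)⁻¹) k =
      1 / 2 * fint (fun u => φ u * kern u) k +
        fint (fun u => -(Complex.I * u) * (φ u * kern u)) k := by
    have hi : Integrable fun u : ℝ => -(Complex.I * u) * (φ u * kern u) :=
      ((integrable_id_mul_kern hφ).const_mul (-Complex.I)).congr
        (Eventually.of_forall fun u => by simp only; ring)
    rw [← fint_const_mul, ← fint_add ((integrable_mul_kern hφ).const_mul _) hi]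
    congr 1
    ext u
    rw [← half_sub_mul_kern]
    push_cast
    ring
  rw [ftail, e, ← mul_assoc, ← Real.exp_add, show k + -k / 2 = k / 2 by ring]
  ring

/-- Differentiating e^(−k/2)e^(−iuk) produces −(1/2 + iu), which cancels the remaining denominator.
-/
lemma hasDerivAt_ftail (k : ℝ) : HasDerivAt (ftail φ) (-fdens φ k) k := by
  have h1 : HasDerivAt (fun k : ℝ => Real.exp (-k / 2)) (Real.exp (-k / 2) * (-1 / 2)) k :=
    ((hasDerivAt_neg k).div_const 2).exp
  have h2 := hasDerivAt_fint (integrable_mul_inv_half_add hφ) (integrable_id_mul_inv_half_add hφ) k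
  refine (h1.mul h2).congr_deriv ?_
  have e : -fint φ k = -1 / 2 * fint (fun u => φ u * (1 / 2 + Complex.I * u)⁻¹) k +
        fint (fun u => -(Complex.I * u) * (φ u * (1 / 2 + Complex.I * u)⁻¹)) k := by
    have hi : Integrable fun u : ℝ => -(Complex.I * u) * (φ u * (1 / 2 + Complex.I * u)⁻¹) :=
      ((integrable_id_mul_inv_half_add hφ).const_mul (-Complex.I)).congr
        (Eventually.of_forall fun u => by simp only; ring)
    rw [← fint_const_mul, ← fint_add ((integrable_mul_inv_half_add hφ).const_mul _) hi,
      neg_eq_neg_one_mul, ← fint_const_mul]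
    congr 1
    ext u
    have hA := mul_inv_cancel₀ (half_add_ne_zero u)
    push_cast
    linear_combination φ u * hA
  rw [fdens]
  linear_combination Real.exp (-k / 2) * (-e)

lemma continuous_fdens : Continuous (fdens φ) :=
  (Real.continuous_exp.comp (by fun_prop)).mul (continuous_fint hφ)

end

lemma Monotone.hasDerivAt_nonneg {g : ℝ → ℝ} (hg : Monotone g) {x g' : ℝ} (h : HasDerivAt g g' x) :
    0 ≤ g' := by
  refine ge_of_tendsto h.tendsto_slope (eventually_of_mem self_mem_nhdsWithin fun y hy => ?_)
  rw [slope_def_field]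
  rcases lt_or_gt_of_ne (hy : y ≠ x) with hlt | hgt
  · exact div_nonneg_of_nonpos (sub_nonpos.2 (hg hlt.le)) (sub_nonpos.2 hlt.le)
  · exact div_nonneg (sub_nonneg.2 (hg hgt.le)) (sub_nonneg.2 hgt.le)

/-! ### Price curves of laws with E exp X = 1. -/

section Law

variable {μ : Measure ℝ} [IsProbabilityMeasure μ] (hint : Integrable Real.exp μ)

include hint in
lemma integrable_exp_half : Integrable (fun x => Real.exp (x / 2)) μ := by
  refine (hint.add (integrable_const 1)).mono' (by fun_prop) (Eventually.of_forall fun x => ?_)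
  rw [Real.norm_of_nonneg (Real.exp_pos _).le]
  have : Real.exp x = Real.exp (x / 2) ^ 2 := by rw [← Real.exp_nat_mul]; ring_nf
  simp only [Pi.add_apply, this]
  nlinarith [sq_nonneg (Real.exp (x / 2) - 1), Real.exp_pos (x / 2)]

omit [IsProbabilityMeasure μ] in
include hint in
lemma integrable_payoff (k : ℝ) : Integrable (fun x => max (Real.exp x - Real.exp k) 0) μ := by
  refine hint.mono' (by fun_prop) (Eventually.of_forall fun x => ?_)
  rw [Real.norm_of_nonneg (le_max_right _ _)]
  exact max_le (by linarith [Real.exp_pos k]) (Real.exp_pos x).le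

variable {φ : ℝ → ℂ} (hφ : ∀ u : ℝ, ∫ x : ℝ, Complex.exp ((1 / 2 + Complex.I * u) * x) ∂μ = φ u)

-- Fubini: integrating the kernel against e^(iu(x − k)) first leaves 2π e^(−|x − k|/2).
include hint hφ in
lemma fint_kern_eq_integral (k : ℝ) :
    fint (fun u => φ u * kern u) k = ∫ x : ℝ, Real.exp (x / 2 - |x - k| / 2) ∂μ := by
  have hprod : Integrable (fun z : ℝ × ℝ => Complex.exp (-(Complex.I * z.1 * k)) *
      (Complex.exp ((1 / 2 + Complex.I * z.1) * z.2) * kern z.1)) (volume.prod μ) := by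
    have h1 := integrable_inv_sq_add.mul_prod (integrable_exp_half hint)
    refine h1.mono' (Continuous.aestronglyMeasurable ?_) (Eventually.of_forall fun z => ?_)
    · have := continuous_kern
      fun_prop
    · rw [norm_mul, norm_exp_I_mul, one_mul, norm_mul, norm_kern, Complex.norm_exp, mul_comm]
      refine le_of_eq ?_
      congr 2
      simp
      ring
  have hsw := integral_integral_swap (f := fun u x : ℝ => Complex.exp (-(Complex.I * u * k)) *
      (Complex.exp ((1 / 2 + Complex.I * u) * x) * kern u)) hprod
  have e1 : ∫ u : ℝ, Complex.exp (-(Complex.I * u * k)) * (φ u * kern u) =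
      ∫ x : ℝ, ((2 * Real.pi * Real.exp (x / 2 - |x - k| / 2) : ℝ) : ℂ) ∂μ := by
    calc _ = ∫ u : ℝ, ∫ x : ℝ, Complex.exp (-(Complex.I * u * k)) *
          (Complex.exp ((1 / 2 + Complex.I * u) * x) * kern u) ∂μ := by
          congr 1
          ext u
          rw [integral_const_mul, integral_mul_const, hφ]
      _ = _ := by
          rw [hsw]
          congr 1
          ext x
          have h2 := integral_exp_mul_kern (x - k)
          calc _ = ∫ u : ℝ, Complex.exp (x / 2) *
                (Complex.exp (Complex.I * u * ((x - k : ℝ) : ℂ)) * kern u) := by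
                congr 1
                ext u
                rw [← mul_assoc, ← mul_assoc, ← Complex.exp_add, ← Complex.exp_add]
                congr 2
                push_cast
                ring
            _ = _ := by
                rw [integral_const_mul, h2]
                push_cast
                rw [mul_left_comm, ← Complex.exp_add]
                congr 2
                ring
  rw [fint, e1, integral_complex_ofReal, Complex.ofReal_re, integral_const_mul]
  have := Real.pi_pos
  field_simp

variable (hone : ∫ x, Real.exp x ∂μ = 1)

-- The payoff is e^x − min(e^x, e^k), and min(e^x, e^k) = e^(k/2) e^(x/2 − |x − k|/2), whose mean is
-- `fint_kern_eq_integral`.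
include hint hφ hone in
lemma integral_payoff_eq_fprice (k : ℝ) :
    ∫ x, max (Real.exp x - Real.exp k) 0 ∂μ = fprice φ k := by
  have hi : Integrable (fun x => Real.exp (x / 2 - |x - k| / 2)) μ := by
    refine (integrable_exp_half hint).mono' (by fun_prop) (Eventually.of_forall fun x => ?_)
    rw [Real.norm_of_nonneg (Real.exp_pos _).le, Real.exp_le_exp]
    linarith [abs_nonneg (x - k)]
  have e : ∀ x, max (Real.exp x - Real.exp k) 0 =
      Real.exp x - Real.exp (k / 2) * Real.exp (x / 2 - |x - k| / 2) := by
    intro x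
    rw [← Real.exp_add]
    rcases le_total x k with h | h
    · rw [max_eq_right (sub_nonpos.2 (Real.exp_le_exp.2 h)), abs_of_nonpos (by linarith),
        show k / 2 + (x / 2 - -(x - k) / 2) = x by ring, sub_self]
    · rw [max_eq_left (sub_nonneg.2 (Real.exp_le_exp.2 h)), abs_of_nonneg (by linarith),
        show k / 2 + (x / 2 - (x - k) / 2) = k by ring]
  simp_rw [e]
  rw [integral_sub hint (hi.const_mul _), integral_const_mul, hone,
    ← fint_kern_eq_integral hint hφ, fprice]

include hint hφ hone in
/-- A law with `E exp X = 1` and integrable tilted characteristic function gives a call price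
curve. -/
theorem callCurve_of_law (hφi : Integrable φ) : CallCurve (fprice φ) (ftail φ) (fdens φ) := by
  have hrep := integral_payoff_eq_fprice hint hφ hone
  have hpay := integrable_payoff hint
  have hanti : Antitone (fprice φ) := fun k l hkl => by
    rw [← hrep, ← hrep]
    refine integral_mono (hpay l) (hpay k) fun x => ?_
    exact max_le_max_right _ (sub_le_sub_left (Real.exp_le_exp.2 hkl) _)
  have hmono : Monotone fun k => fprice φ k + Real.exp k := fun k l hkl => by
    have e : ∀ k, fprice φ k + Real.exp k = ∫ x, max (Real.exp x) (Real.exp k) ∂μ := by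
      intro k
      have h1 : ∫ _ : ℝ, Real.exp k ∂μ = Real.exp k := by simp
      have h2 := integral_add (hpay k) (integrable_const (Real.exp k))
      rw [h1, hrep] at h2
      rw [← h2]
      congr 1
      ext x
      rw [← max_add_add_right, sub_add_cancel, zero_add]
    simp only [e]
    have hi : ∀ k, Integrable (fun x => max (Real.exp x) (Real.exp k)) μ :=
      fun k => hint.sup (integrable_const _)
    exact integral_mono (hi k) (hi l) fun x => max_le_max_left _ (Real.exp_le_exp.2 hkl)
  refine ⟨hasDerivAt_fprice hφi, hasDerivAt_ftail hφi, continuous_fdens hφi, fun k => ?_,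
    fun k => ?_, fun k => ?_, fun k => ?_, ?_, ?_⟩
  · have h1 := Monotone.hasDerivAt_nonneg hanti.neg (hasDerivAt_fprice hφi k).neg
    rw [neg_neg] at h1
    exact nonneg_of_mul_nonneg_right h1 (Real.exp_pos k)
  · have h1 := Monotone.hasDerivAt_nonneg hmono
      ((hasDerivAt_fprice hφi k).add (Real.hasDerivAt_exp k))
    have h2 : 0 ≤ Real.exp k * (1 - ftail φ k) := by linarith
    linarith [nonneg_of_mul_nonneg_right h2 (Real.exp_pos k)]
  · refine max_le ?_ ?_
    · have : ∫ x, (Real.exp x - Real.exp k) ∂μ ≤ fprice φ k := by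
        rw [← hrep]
        exact integral_mono (hint.sub (integrable_const _)) (hpay k) fun x => le_max_left _ _
      rw [integral_sub hint (integrable_const _), hone] at this
      simpa using this
    · rw [← hrep]
      exact integral_nonneg fun x => le_max_right _ _
  · rw [fprice, fint_kern_eq_integral hint hφ]
    have : 0 < ∫ x : ℝ, Real.exp (x / 2 - |x - k| / 2) ∂μ := by
      refine integral_exp_pos ?_
      refine (integrable_exp_half hint).mono' (by fun_prop) (Eventually.of_forall fun x => ?_)
      rw [Real.norm_of_nonneg (Real.exp_pos _).le, Real.exp_le_exp]
      linarith [abs_nonneg (x - k)]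
    have := mul_pos (Real.exp_pos (k / 2)) this
    linarith
  · rw [← hrep]
    refine lt_of_le_of_ne (integral_nonneg fun x => le_max_right _ _) fun h0 => ?_
    -- otherwise `X ≤ 0`, hence `X = 0`, almost surely
    have h1 := (integral_eq_zero_iff_of_nonneg (fun x => le_max_right _ _) (hpay 0)).1 h0.symm
    have h2 : 0 ≤ᵐ[μ] fun x => 1 - Real.exp x := by
      filter_upwards [h1] with x hx
      have := le_max_left (Real.exp x - Real.exp 0) 0
      have hx' : max (Real.exp x - Real.exp 0) 0 = 0 := hx
      rw [hx'] at this
      simpa using this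
    have h3 : ∫ x, (1 - Real.exp x) ∂μ = 0 := by
      rw [integral_sub (integrable_const _) hint, hone]
      simp
    have h4 := (integral_eq_zero_iff_of_nonneg_ae h2 ((integrable_const 1).sub hint)).1 h3
    -- A law concentrated at 0 has constant transform, which is not integrable over the line.
    have h5 : ∀ u, φ u = 1 := fun u => by
      rw [← hφ]
      have : ∀ᵐ x : ℝ ∂μ, Complex.exp ((1 / 2 + Complex.I * u) * x) = 1 := by
        filter_upwards [h4] with x hx
        have : x = 0 := by
          rw [← Real.exp_eq_one_iff]
          simp only [Pi.zero_apply] at hx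
          linarith
        simp [this]
      rw [integral_congr_ae this]
      simp
    have h6 : Integrable (fun _ : ℝ => (1 : ℂ)) := hφi.congr (Eventually.of_forall h5)
    rw [integrable_const_iff] at h6
    rcases h6 with h6 | h6
    · exact one_ne_zero h6
    · have := h6.measure_univ_lt_top
      simp at this
  · have e : (0 : ℝ) = ∫ _, 0 ∂μ := by simp
    rw [e, ← funext hrep]
    refine tendsto_integral_filter_of_dominated_convergence Real.exp
      (Eventually.of_forall fun k => (hpay k).aestronglyMeasurable)
      (Eventually.of_forall fun k => Eventually.of_forall fun x => ?_) hint
      (Eventually.of_forall fun x => ?_)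
    · rw [Real.norm_of_nonneg (le_max_right _ _)]
      exact max_le (by linarith [Real.exp_pos k]) (Real.exp_pos x).le
    · refine tendsto_const_nhds.congr' ?_
      filter_upwards [eventually_ge_atTop x] with k hk
      rw [max_eq_right (sub_nonpos.2 (Real.exp_le_exp.2 hk))]

end Law

/-! ### The Black–Scholes curve -/

/-- The tilted characteristic function of the Black–Scholes model with total variance `v`. -/
def bsChar (v : ℝ) (u : ℝ) : ℂ := Complex.exp (-(v / 2 * (u ^ 2 + 1 / 4)))

lemma norm_bsChar (v u : ℝ) : ‖bsChar v u‖ = Real.exp (-(v / 2 * (u ^ 2 + 1 / 4))) := by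
  rw [bsChar, Complex.norm_exp]
  congr 1
  rw [show (-(v / 2 * (u ^ 2 + 1 / 4)) : ℂ) = ((-(v / 2 * (u ^ 2 + 1 / 4)) : ℝ) : ℂ) by
    push_cast; ring]
  exact Complex.ofReal_re _

lemma continuous_bsChar (v : ℝ) : Continuous (bsChar v) := by unfold bsChar; fun_prop

lemma integrable_bsChar {v : ℝ} (hv : 0 < v) : Integrable (bsChar v) := by
  refine (integrable_exp_neg_mul_sq (half_pos hv)).mono' (continuous_bsChar v).aestronglyMeasurable
    (Eventually.of_forall fun u => ?_)
  rw [norm_bsChar, Real.exp_le_exp]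
  nlinarith

/-- For X = wZ − w²/2 with Z standard normal, E exp(zX) = exp(w²z(z − 1)/2), which is `bsChar` at z
= 1/2 + iu. Both sides are the call price of this law, one by Fourier and one by integrating the
payoff. -/
lemma fprice_bsChar {w : ℝ} (hw : 0 < w) (k : ℝ) : fprice (bsChar (w ^ 2)) k = bsw w k := by
  set N := gaussianReal 0 1 with hN
  have hmeas : Measurable fun z : ℝ => w * z - w ^ 2 / 2 := by fun_prop
  set μ := N.map fun z => w * z - w ^ 2 / 2 with hμ
  have : IsProbabilityMeasure μ := Measure.isProbabilityMeasure_map hmeas.aemeasurable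
  have hm : ∀ z : ℂ, ∫ x : ℝ, Complex.exp (z * x) ∂μ = Complex.exp (w ^ 2 / 2 * (z * (z - 1))) := by
    intro z
    rw [hμ, integral_map hmeas.aemeasurable
      (Continuous.aestronglyMeasurable (by fun_prop))]
    have h1 := complexMGF_id_gaussianReal (μ := 0) (v := 1) (z * w)
    simp only [complexMGF, id] at h1
    calc _ = ∫ x : ℝ, Complex.exp (-(z * w ^ 2 / 2)) * Complex.exp (z * w * x) ∂N := by
          congr 1
          ext x
          rw [← Complex.exp_add]
          push_cast
          ring_nf
      _ = _ := by
          rw [integral_const_mul, h1, ← Complex.exp_add]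
          push_cast
          ring_nf
  have hint : Integrable Real.exp μ := by
    rw [hμ, integrable_map_measure (by fun_prop) hmeas.aemeasurable]
    have := (integrable_exp_mul_gaussianReal (μ := 0) (v := 1) w).mul_const
      (Real.exp (-(w ^ 2 / 2)))
    refine this.congr (Eventually.of_forall fun z => ?_)
    simp only [Function.comp]
    rw [← Real.exp_add, sub_eq_add_neg]
  have hone : ∫ x, Real.exp x ∂μ = 1 := by
    have h1 := hm 1
    simp only [one_mul, sub_self, mul_zero, Complex.exp_zero] at h1
    rw [← Complex.ofReal_inj, ← integral_complex_ofReal]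
    push_cast
    exact h1
  have hφ : ∀ u : ℝ, ∫ x : ℝ, Complex.exp ((1 / 2 + Complex.I * u) * x) ∂μ = bsChar (w ^ 2) u := by
    intro u
    rw [hm, bsChar]
    congr 1
    push_cast
    linear_combination ((w : ℂ) ^ 2 / 2 * u ^ 2) * Complex.I_sq
  rw [← integral_payoff_eq_fprice hint hφ hone, hμ, integral_map hmeas.aemeasurable
    (Continuous.aestronglyMeasurable (by fun_prop)), hN, integral_gaussianReal_eq_integral_smul
    one_ne_zero]
  set a := (k + w ^ 2 / 2) / w with ha
  have hpt : ∀ z, gaussianPDFReal 0 1 z • max (Real.exp (w * z - w ^ 2 / 2) - Real.exp k) 0 =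
      (Set.Ioi a).indicator (fun z => gpdf (z - w) - Real.exp k * gpdf z) z := by
    intro z
    have h1 : gpdf z * Real.exp (w * z - w ^ 2 / 2) = gpdf (z - w) := by
      rw [← exp_mul_gpdf w z, mul_right_comm, ← Real.exp_add]
      simp
    rw [← gpdf_eq, smul_eq_mul]
    by_cases hz : z ∈ Set.Ioi a
    · have h2 : k ≤ w * z - w ^ 2 / 2 := by
        have := (div_lt_iff₀ hw).1 (Set.mem_Ioi.1 hz)
        linarith
      rw [Set.indicator_of_mem hz, max_eq_left (sub_nonneg.2 (Real.exp_le_exp.2 h2)), mul_sub, h1,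
        mul_comm (gpdf z)]
    · have h2 : w * z - w ^ 2 / 2 ≤ k := by
        have := (le_div_iff₀ hw).1 (not_lt.1 (fun h => hz (Set.mem_Ioi.2 h)))
        linarith
      rw [Set.indicator_of_notMem hz, max_eq_right (sub_nonpos.2 (Real.exp_le_exp.2 h2)), mul_zero]
  simp_rw [hpt]
  rw [integral_indicator measurableSet_Ioi]
  have hder : ∀ z, HasDerivAt (fun z => Phi (z - w) - Real.exp k * Phi z)
      (gpdf (z - w) - Real.exp k * gpdf z) z := fun z => by
    have h1 : HasDerivAt (fun z => Phi (z - w)) (gpdf (z - w) * 1) z :=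
      (hasDerivAt_Phi (z - w)).comp z ((hasDerivAt_id z).sub_const w)
    rw [mul_one] at h1
    exact h1.sub ((hasDerivAt_Phi z).const_mul _)
  have hlim : Tendsto (fun z => Phi (z - w) - Real.exp k * Phi z) atTop
      (𝓝 (1 - Real.exp k * 1)) :=
    (Phi_tendsto_atTop.comp (tendsto_atTop_add_const_right _ _ tendsto_id)).sub
      (Phi_tendsto_atTop.const_mul _)
  rw [integral_Ioi_of_hasDerivAt_of_tendsto' (fun z _ => hder z)
    ((integrable_gpdf.comp_sub_right w).sub (integrable_gpdf.const_mul _)).integrableOn hlim, bsw]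
  have e1 : -k / w + w / 2 = -(a - w) := by rw [ha]; field_simp; ring
  have e2 : -k / w - w / 2 = -a := by rw [ha]; field_simp; ring
  rw [e1, e2, Phi_neg, Phi_neg]
  ring

/-- Uniqueness of the strike derivative of the price, with no further Fourier integral. -/
lemma ftail_bsChar {w : ℝ} (hw : 0 < w) (k : ℝ) :
    ftail (bsChar (w ^ 2)) k = Phi (-k / w - w / 2) := by
  have h1 := hasDerivAt_fprice (integrable_bsChar (by positivity : 0 < w ^ 2)) k
  have h2 := hasDerivAt_bsw_strike hw.ne' k
  rw [show fprice (bsChar (w ^ 2)) = fun k => bsw w k from funext (fprice_bsChar hw)] at h1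
  have := h1.unique h2
  have he := Real.exp_pos k
  exact mul_left_cancel₀ he.ne' (neg_injective this)

lemma fdens_bsChar {w : ℝ} (hw : 0 < w) (k : ℝ) :
    fdens (bsChar (w ^ 2)) k = gpdf (-k / w - w / 2) / w := by
  have h1 := hasDerivAt_ftail (integrable_bsChar (by positivity : 0 < w ^ 2)) k
  have h2 : HasDerivAt (fun k => Phi (-k / w - w / 2)) (gpdf (-k / w - w / 2) * (-1 / w)) k :=
    (hasDerivAt_Phi _).comp k (((hasDerivAt_neg k).div_const w).sub_const _)
  rw [show ftail (bsChar (w ^ 2)) = fun k => Phi (-k / w - w / 2) from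
    funext (ftail_bsChar hw)] at h1
  have := h1.unique h2
  rw [neg_eq_iff_eq_neg] at this
  rw [this]
  ring

/-! ### Exponential estimates -/

lemma norm_exp_sub_one_le_of_re_nonpos {z : ℂ} (hz : z.re ≤ 0) : ‖Complex.exp z - 1‖ ≤ ‖z‖ := by
  have := Convex.norm_image_sub_le_of_norm_hasDerivWithin_le
    (f := fun t : ℝ => Complex.exp (t * z)) (f' := fun t : ℝ => Complex.exp (t * z) * z)
    (C := ‖z‖) (s := Set.Icc 0 1) (x := 0) (y := 1)
    (fun t _ => by
      have h1 : HasDerivAt (fun t : ℝ => (t : ℂ) * z) (1 * z) t :=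
        (hasDerivAt_id t).ofReal_comp.mul_const z
      rw [one_mul] at h1
      exact h1.cexp.hasDerivWithinAt)
    (fun t ht => by
      rw [norm_mul, Complex.norm_exp, Complex.re_ofReal_mul]
      exact mul_le_of_le_one_left (norm_nonneg _)
        (Real.exp_le_one_iff.2 (mul_nonpos_of_nonneg_of_nonpos ht.1 hz)))
    (convex_Icc 0 1) (Set.left_mem_Icc.2 zero_le_one) (Set.right_mem_Icc.2 zero_le_one)
  simpa using this

lemma norm_exp_sub_one_le_two {z : ℂ} (hz : z.re ≤ 0) : ‖Complex.exp z - 1‖ ≤ 2 := by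
  refine (norm_sub_le _ _).trans ?_
  rw [Complex.norm_exp, norm_one]
  linarith [Real.exp_le_one_iff.2 hz]

/-- Mean value inequality for t ↦ e^(tz) − tz on [0, 1]; different bounds K give the linear and the
quadratic estimates below. -/
lemma norm_exp_sub_one_sub_le {z : ℂ} {K : ℝ}
    (hK : ∀ t ∈ Set.Icc (0 : ℝ) 1, ‖Complex.exp (t * z) - 1‖ ≤ K) :
    ‖Complex.exp z - 1 - z‖ ≤ K * ‖z‖ := by
  have := Convex.norm_image_sub_le_of_norm_hasDerivWithin_le
    (f := fun t : ℝ => Complex.exp (t * z) - t * z)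
    (f' := fun t : ℝ => Complex.exp (t * z) * z - z)
    (C := K * ‖z‖) (s := Set.Icc 0 1) (x := 0) (y := 1)
    (fun t _ => by
      have h1 : HasDerivAt (fun t : ℝ => (t : ℂ) * z) (1 * z) t :=
        (hasDerivAt_id t).ofReal_comp.mul_const z
      rw [one_mul] at h1
      exact (h1.cexp.sub h1).hasDerivWithinAt)
    (fun t ht => by
      rw [← sub_one_mul, norm_mul]
      exact mul_le_mul_of_nonneg_right (hK t ht) (norm_nonneg _))
    (convex_Icc 0 1) (Set.left_mem_Icc.2 zero_le_one) (Set.right_mem_Icc.2 zero_le_one)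
  simp only [Complex.ofReal_one, one_mul, Complex.ofReal_zero, zero_mul, Complex.exp_zero,
    sub_zero, norm_one, mul_one] at this
  rwa [sub_right_comm] at this

lemma norm_exp_sub_one_sub_le_two_mul {z : ℂ} (hz : z.re ≤ 0) :
    ‖Complex.exp z - 1 - z‖ ≤ 2 * ‖z‖ :=
  norm_exp_sub_one_sub_le fun t ht => norm_exp_sub_one_le_two
    (by rw [Complex.re_ofReal_mul]; exact mul_nonpos_of_nonneg_of_nonpos ht.1 hz)

lemma norm_exp_sub_one_sub_le_sq {z : ℂ} (hz : z.re ≤ 0) :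
    ‖Complex.exp z - 1 - z‖ ≤ ‖z‖ ^ 2 := by
  rw [sq]
  refine norm_exp_sub_one_sub_le fun t ht => ?_
  refine (norm_exp_sub_one_le_of_re_nonpos
    (by rw [Complex.re_ofReal_mul]; exact mul_nonpos_of_nonneg_of_nonpos ht.1 hz)).trans ?_
  rw [norm_mul, Complex.norm_real, Real.norm_of_nonneg ht.1]
  exact mul_le_of_le_one_left (norm_nonneg _) ht.2

/-! ### Gamma integrals -/

/-- The bound with x^m is used on (0, 1], the one with x^n on (1, ∞); n < b < m is what makes both
pieces converge. -/
lemma integrableOn_of_norm_le_rpow {h : ℝ → ℂ} (hm : AEStronglyMeasurable h) {K m n b : ℝ}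
    (h1 : ∀ x, 0 < x → ‖h x‖ ≤ K * x ^ m) (h2 : ∀ x, 0 < x → ‖h x‖ ≤ K * x ^ n)
    (hb : b < m) (hb' : n < b) :
    IntegrableOn (fun x : ℝ => h x * (x ^ (-b - 1) : ℝ)) (Set.Ioi 0) := by
  have hmeas : AEStronglyMeasurable (fun x : ℝ => h x * (x ^ (-b - 1) : ℝ)) :=
    hm.mul (by fun_prop)
  rw [← Set.Ioc_union_Ioi_eq_Ioi zero_le_one, integrableOn_union]
  constructor
  · have hi : IntegrableOn (fun x : ℝ => K * x ^ (m - b - 1)) (Set.Ioc 0 1) := by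
      have := intervalIntegral.intervalIntegrable_rpow' (a := 0) (b := 1)
        (by linarith : -1 < m - b - 1)
      rw [intervalIntegrable_iff_integrableOn_Ioc_of_le zero_le_one] at this
      exact this.const_mul K
    refine hi.mono' hmeas.restrict ?_
    filter_upwards [ae_restrict_mem measurableSet_Ioc] with x hx
    rw [norm_mul, Complex.norm_real, Real.norm_of_nonneg (Real.rpow_nonneg hx.1.le _)]
    calc ‖h x‖ * x ^ (-b - 1) ≤ K * x ^ m * x ^ (-b - 1) :=
          mul_le_mul_of_nonneg_right (h1 x hx.1) (Real.rpow_nonneg hx.1.le _)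
      _ = K * x ^ (m - b - 1) := by rw [mul_assoc, ← Real.rpow_add hx.1]; ring_nf
  · have hi : IntegrableOn (fun x : ℝ => K * x ^ (n - b - 1)) (Set.Ioi 1) :=
      (integrableOn_Ioi_rpow_of_lt (by linarith) one_pos).const_mul K
    refine hi.mono' hmeas.restrict ?_
    filter_upwards [ae_restrict_mem measurableSet_Ioi] with x hx
    have hx0 : 0 < x := one_pos.trans hx
    rw [norm_mul, Complex.norm_real, Real.norm_of_nonneg (Real.rpow_nonneg hx0.le _)]
    calc ‖h x‖ * x ^ (-b - 1) ≤ K * x ^ n * x ^ (-b - 1) :=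
          mul_le_mul_of_nonneg_right (h2 x hx0) (Real.rpow_nonneg hx0.le _)
      _ = K * x ^ (n - b - 1) := by rw [mul_assoc, ← Real.rpow_add hx0]; ring_nf

/-- Integration by parts against a power. -/
lemma integral_mul_rpow_eq {g g' : ℝ → ℂ} {K m b : ℝ} (hb : 0 < b) (hg : ∀ x, HasDerivAt g (g' x) x)
    (hg0 : g 0 = 0)
    (h1 : ∀ x, 0 < x → ‖g x‖ ≤ K * x ^ m) (h2 : ∀ x, 0 < x → ‖g x‖ ≤ K * x ^ (m - 1))
    (hbm : b < m) (hbm' : m - 1 < b)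
    (hi' : IntegrableOn (fun x : ℝ => g' x * (x ^ (-b) : ℝ)) (Set.Ioi 0)) :
    IntegrableOn (fun x : ℝ => g x * (x ^ (-b - 1) : ℝ)) (Set.Ioi 0) ∧
    ∫ x in Set.Ioi (0 : ℝ), g x * (x ^ (-b - 1) : ℝ) =
      (1 / b) * ∫ x in Set.Ioi (0 : ℝ), g' x * (x ^ (-b) : ℝ) := by
  have hcont : Continuous g := continuous_iff_continuousAt.2 fun x => (hg x).continuousAt
  have hi := integrableOn_of_norm_le_rpow hcont.aestronglyMeasurable h1 h2 hbm hbm'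
  refine ⟨hi, ?_⟩
  have hder : ∀ x ∈ Set.Ioi (0 : ℝ), HasDerivAt (fun x : ℝ => g x * (x ^ (-b) : ℝ))
      (g' x * (x ^ (-b) : ℝ) - b * (g x * (x ^ (-b - 1) : ℝ))) x := fun x hx => by
    have h3 := (Real.hasDerivAt_rpow_const (p := -b) (Or.inl (ne_of_gt hx))).ofReal_comp
    refine ((hg x).mul h3).congr_deriv ?_
    push_cast
    ring
  have hbound : ∀ x : ℝ, 0 < x → ‖g x * (x ^ (-b) : ℝ)‖ ≤ K * x ^ (m - b) ∧
      ‖g x * (x ^ (-b) : ℝ)‖ ≤ K * x ^ (m - 1 - b) := fun x hx => by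
    rw [norm_mul, Complex.norm_real, Real.norm_of_nonneg (Real.rpow_nonneg hx.le _)]
    constructor
    · rw [sub_eq_add_neg, Real.rpow_add hx, ← mul_assoc]
      exact mul_le_mul_of_nonneg_right (h1 x hx) (Real.rpow_nonneg hx.le _)
    · rw [sub_eq_add_neg (m - 1), Real.rpow_add hx, ← mul_assoc]
      exact mul_le_mul_of_nonneg_right (h2 x hx) (Real.rpow_nonneg hx.le _)
  have hF0 : g 0 * ((0 : ℝ) ^ (-b) : ℝ) = 0 := by rw [hg0, zero_mul]
  have hlim0 : ContinuousWithinAt (fun x : ℝ => g x * (x ^ (-b) : ℝ)) (Set.Ici 0) 0 := by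
    rw [← continuousWithinAt_Ioi_iff_Ici, ContinuousWithinAt, hF0]
    have h4 : Tendsto (fun x : ℝ => K * x ^ (m - b)) (𝓝[>] 0) (𝓝 0) := by
      simpa using (tendsto_rpow_zero (by linarith : 0 < m - b)).const_mul K
    refine squeeze_zero_norm' ?_ h4
    filter_upwards [self_mem_nhdsWithin] with x hx using (hbound x hx).1
  have hlimtop : Tendsto (fun x : ℝ => g x * (x ^ (-b) : ℝ)) atTop (𝓝 0) := by
    have h4 : Tendsto (fun x : ℝ => K * x ^ (m - 1 - b)) atTop (𝓝 0) := by
      have := (tendsto_rpow_neg_atTop (by linarith : 0 < b - (m - 1))).const_mul K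
      rw [mul_zero] at this
      refine this.congr fun x => ?_
      ring_nf
    refine squeeze_zero_norm' ?_ h4
    filter_upwards [eventually_gt_atTop 0] with x hx using (hbound x hx).2
  have key := integral_Ioi_of_hasDerivAt_of_tendsto hlim0 hder (hi'.sub (hi.const_mul _)) hlimtop
  rw [hF0, sub_zero, integral_sub hi' (hi.const_mul _), integral_const_mul, sub_eq_zero] at key
  have hbc : (b : ℂ) ≠ 0 := by exact_mod_cast hb.ne'
  rw [key]
  field_simp

/-- The Gamma integral with a complex rate. -/
lemma integral_exp_mul_rpow {a : ℝ} (ha : 0 < a) {s : ℂ} (hs : 0 < s.re) :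
    IntegrableOn (fun x : ℝ => Complex.exp (-s * x) * (x ^ (a - 1) : ℝ)) (Set.Ioi 0) ∧
    ∫ x in Set.Ioi (0 : ℝ), Complex.exp (-s * x) * (x ^ (a - 1) : ℝ) =
      Real.Gamma a * s ^ (-a : ℂ) := by
  have hint : ∀ {b c : ℝ}, 0 < b → 0 < c →
      IntegrableOn (fun x : ℝ => x ^ (b - 1) * Real.exp (-(c * x))) (Set.Ioi 0) := by
    intro b c hb hc
    refine Integrable.of_integral_ne_zero ?_
    rw [Real.integral_rpow_mul_exp_neg_mul_Ioi hb hc]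
    have := Real.Gamma_pos_of_pos hb
    positivity
  have hmeas : ∀ (b : ℝ) (s : ℂ), AEStronglyMeasurable
      (fun x : ℝ => Complex.exp (-s * x) * (x ^ b : ℝ)) (volume.restrict (Set.Ioi 0)) :=
    fun b s => by
      have h1 : Measurable fun x : ℝ => Complex.exp (-s * x) := by fun_prop
      have h2 : Measurable fun x : ℝ => ((x ^ b : ℝ) : ℂ) := by fun_prop
      exact (h1.mul h2).aestronglyMeasurable
  have hnorm : ∀ (b : ℝ) (s : ℂ) (x : ℝ), 0 < x → ‖Complex.exp (-s * x) * (x ^ b : ℝ)‖ =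
      x ^ b * Real.exp (-(s.re * x)) := fun b s x hx => by
    rw [norm_mul, Complex.norm_real, Real.norm_of_nonneg (Real.rpow_nonneg hx.le _),
      Complex.norm_exp, mul_comm]
    simp
  have hI : ∀ s : ℂ, 0 < s.re →
      IntegrableOn (fun x : ℝ => Complex.exp (-s * x) * (x ^ (a - 1) : ℝ)) (Set.Ioi 0) := by
    intro s hs
    refine (hint ha hs).mono' (hmeas _ s) ?_
    filter_upwards [ae_restrict_mem measurableSet_Ioi] with x hx
    rw [hnorm _ _ _ hx]
  refine ⟨hI s hs, ?_⟩
  let U : Set ℂ := {s | 0 < s.re}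
  have hU : IsOpen U := isOpen_lt continuous_const Complex.continuous_re
  have hUc : IsPreconnected U := (convex_halfSpace_re_gt 0).isPreconnected
  let I : ℂ → ℂ := fun s => ∫ x in Set.Ioi (0 : ℝ), Complex.exp (-s * x) * (x ^ (a - 1) : ℝ)
  have hID : DifferentiableOn ℂ I U := by
    intro s₀ hs₀
    have hc : 0 < s₀.re / 2 := half_pos hs₀
    have key := hasDerivAt_integral_of_dominated_loc_of_deriv_le
      (μ := volume.restrict (Set.Ioi (0 : ℝ)))
      (F := fun (s : ℂ) (x : ℝ) => Complex.exp (-s * x) * (x ^ (a - 1) : ℝ))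
      (F' := fun (s : ℂ) (x : ℝ) => Complex.exp (-s * x) * (-x) * (x ^ (a - 1) : ℝ))
      (x₀ := s₀) (s := {s | s₀.re / 2 < s.re})
      (bound := fun x : ℝ => x ^ (a + 1 - 1) * Real.exp (-(s₀.re / 2 * x)))
      ((isOpen_lt continuous_const Complex.continuous_re).mem_nhds
        (show s₀.re / 2 < s₀.re from half_lt_self hs₀))
      (Eventually.of_forall fun s => hmeas _ s) (hI s₀ hs₀)
      (by
        have h1 : Measurable fun x : ℝ => Complex.exp (-s₀ * x) * (-x) := by fun_prop
        have h2 : Measurable fun x : ℝ => ((x ^ (a - 1) : ℝ) : ℂ) := by fun_prop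
        exact (h1.mul h2).aestronglyMeasurable)
      (by
        filter_upwards [ae_restrict_mem measurableSet_Ioi] with x hx s hs
        have hx0 : (0 : ℝ) < x := hx
        rw [mul_right_comm, norm_mul, hnorm _ _ _ hx, norm_neg, Complex.norm_real,
          Real.norm_of_nonneg hx0.le, mul_right_comm, show a + 1 - 1 = (a - 1) + 1 by ring,
          Real.rpow_add_one hx0.ne']
        have : -(s.re * x) ≤ -(s₀.re / 2 * x) :=
          neg_le_neg (mul_le_mul_of_nonneg_right (le_of_lt hs) hx0.le)
        gcongr)
      (hint (by linarith) hc)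
      (by
        filter_upwards with x s _
        have h1 : HasDerivAt (fun s : ℂ => -s * x) (-1 * x) s := (hasDerivAt_neg s).mul_const _
        refine (h1.cexp.mul_const _).congr_deriv ?_
        ring)
    exact key.2.differentiableAt.differentiableWithinAt
  have hG : DifferentiableOn ℂ (fun s : ℂ => (Real.Gamma a : ℂ) * s ^ (-a : ℂ)) U := fun s hs =>
    ((differentiableAt_id.cpow_const (Or.inl hs)).const_mul _).differentiableWithinAt
  have hreal : ∀ r : ℝ, 0 < r → I r = (Real.Gamma a : ℂ) * (r : ℂ) ^ (-a : ℂ) := by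
    intro r hr
    have h1 := Real.integral_rpow_mul_exp_neg_mul_Ioi ha hr
    have h2 : I r = ((∫ x in Set.Ioi (0 : ℝ), x ^ (a - 1) * Real.exp (-(r * x)) : ℝ) : ℂ) := by
      rw [← integral_complex_ofReal]
      refine setIntegral_congr_fun measurableSet_Ioi fun x _ => ?_
      push_cast
      rw [mul_comm]
      congr 2
      ring
    rw [h2, h1, one_div, Real.inv_rpow hr.le, ← Real.rpow_neg hr.le, mul_comm]
    push_cast
    rw [Complex.ofReal_cpow hr.le]
    push_cast
    rfl
  -- Both sides are holomorphic on the right half-plane and agree for positive real rates; the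
  -- points 1 + 1/(n + 1) accumulate at 1, so the identity theorem applies.
  have := (hID.analyticOnNhd hU).eqOn_of_preconnected_of_frequently_eq (hG.analyticOnNhd hU) hUc
    (z₀ := 1) (by simp [U]) (by
      have ht : Tendsto (fun n : ℕ => ((1 + 1 / ((n : ℝ) + 1) : ℝ) : ℂ)) atTop (𝓝[≠] 1) := by
        refine tendsto_nhdsWithin_iff.2 ⟨?_, Eventually.of_forall fun n => ?_⟩
        · have := (tendsto_one_div_add_atTop_nhds_zero_nat (𝕜 := ℝ)).const_add 1
          rw [add_zero] at this
          exact_mod_cast (Complex.continuous_ofReal.tendsto 1).comp this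
        · simp only [Set.mem_compl_iff, Set.mem_singleton_iff]
          intro h
          have : (1 + 1 / ((n : ℝ) + 1) : ℝ) = 1 := by exact_mod_cast h
          have h3 : 0 < 1 / ((n : ℝ) + 1) := by positivity
          linarith
      refine ht.frequently (Eventually.of_forall fun n => ?_).frequently
      exact hreal _ (by positivity))
  exact this hs

/-- The compensated exponential whose integral against a power is a power. -/
def cexpm (α : ℝ) (s : ℂ) (x : ℝ) : ℂ :=
  Complex.exp (-s * x) - 1 + if 1 < α then s * x else 0

/-- One integration by parts for α < 1 and two for α > 1 reduce to a convergent Gamma integral. The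
rate s = 0 is included because the rates κ₊ − 1 and κ₋ may vanish. -/
lemma integral_cexpm {α : ℝ} (h0 : 0 < α) (h2 : α < 2) (h1 : α ≠ 1) {s : ℂ}
    (hs : 0 < s.re ∨ s = 0) :
    IntegrableOn (fun x : ℝ => cexpm α s x * (x ^ (-α - 1) : ℝ)) (Set.Ioi 0) ∧
    ∫ x in Set.Ioi (0 : ℝ), cexpm α s x * (x ^ (-α - 1) : ℝ) = Real.Gamma (-α) * s ^ (α : ℂ) := by
  rcases hs with hs | rfl
  swap
  · have : ∀ x, cexpm α 0 x = 0 := fun x => by simp [cexpm]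
    have hα : (α : ℂ) ≠ 0 := by exact_mod_cast h0.ne'
    simp [this, Complex.zero_cpow hα]
  have hs0 : s ≠ 0 := fun h => by rw [h] at hs; simp at hs
  have hre : ∀ x : ℝ, 0 < x → (-s * x).re ≤ 0 := fun x hx => by
    simp only [neg_mul, Complex.neg_re, Complex.re_mul_ofReal]
    have := mul_pos hs hx
    linarith
  have hnorm : ∀ x : ℝ, 0 < x → ‖-s * x‖ = ‖s‖ * x := fun x hx => by
    rw [norm_mul, norm_neg, Complex.norm_real, Real.norm_of_nonneg hx.le]
  have hlin : ∀ x : ℝ, HasDerivAt (fun x : ℝ => -s * x) (-s) x := fun x => by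
    have := (hasDerivAt_id x).ofReal_comp.const_mul (-s)
    simpa using this
  -- the case `α < 1`
  have key : ∀ β : ℝ, 0 < β → β < 1 →
      IntegrableOn (fun x : ℝ => (Complex.exp (-s * x) - 1) * (x ^ (-β - 1) : ℝ)) (Set.Ioi 0) ∧
      ∫ x in Set.Ioi (0 : ℝ), (Complex.exp (-s * x) - 1) * (x ^ (-β - 1) : ℝ) =
        Real.Gamma (-β) * s ^ (β : ℂ) := by
    intro β hβ0 hβ1
    have hΓ := integral_exp_mul_rpow (a := 1 - β) (by linarith) hs
    have e1 : 1 - β - 1 = -β := by ring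
    rw [e1] at hΓ
    have hi : IntegrableOn (fun x : ℝ => (Complex.exp (-s * x) * -s) * (x ^ (-β) : ℝ))
        (Set.Ioi 0) := by
      refine (hΓ.1.const_mul (-s)).congr (Eventually.of_forall fun x => ?_)
      simp only
      ring
    obtain ⟨h3, h4⟩ := integral_mul_rpow_eq (g := fun x : ℝ => Complex.exp (-s * x) - 1)
      (K := max ‖s‖ 2) (m := 1) hβ0 (fun x => (hlin x).cexp.sub_const 1) (by simp)
      (fun x hx => by
        refine (norm_exp_sub_one_le_of_re_nonpos (hre x hx)).trans ?_
        rw [hnorm x hx, Real.rpow_one]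
        exact mul_le_mul_of_nonneg_right (le_max_left _ _) hx.le)
      (fun x hx => by
        refine (norm_exp_sub_one_le_two (hre x hx)).trans ?_
        simp)
      hβ1 (by linarith) hi
    refine ⟨h3, ?_⟩
    rw [h4]
    have h5 : ∫ x in Set.Ioi (0 : ℝ), (Complex.exp (-s * x) * -s) * (x ^ (-β) : ℝ) =
        -s * ∫ x in Set.Ioi (0 : ℝ), Complex.exp (-s * x) * (x ^ (-β) : ℝ) := by
      rw [← integral_const_mul]
      congr 1
      ext x
      ring
    rw [h5, hΓ.2]
    have h6 : Real.Gamma (1 - β) = -β * Real.Gamma (-β) := by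
      rw [← Real.Gamma_add_one (by linarith : -β ≠ 0)]
      ring_nf
    have h7 : s ^ (β : ℂ) = s * s ^ (-((1 - β : ℝ) : ℂ)) := by
      nth_rewrite 2 [← Complex.cpow_one s]
      rw [← Complex.cpow_add _ _ hs0]
      congr 1
      push_cast
      ring
    rw [h6, h7]
    have : (β : ℂ) ≠ 0 := by exact_mod_cast hβ0.ne'
    push_cast
    field_simp
  rcases lt_or_gt_of_ne h1 with hlt | hgt
  · have e : ∀ x, cexpm α s x = Complex.exp (-s * x) - 1 := fun x => by
      simp [cexpm, not_lt.2 hlt.le]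
    simp only [e]
    exact key α h0 hlt
  · have e : ∀ x, cexpm α s x = Complex.exp (-s * x) - 1 - (-s * x) := fun x => by
      simp [cexpm, hgt]
    simp only [e]
    obtain ⟨k1, k2⟩ := key (α - 1) (by linarith) (by linarith)
    have e1 : -(α - 1) - 1 = -α := by ring
    rw [e1] at k1 k2
    have hi : IntegrableOn (fun x : ℝ => (Complex.exp (-s * x) * -s - -s) * (x ^ (-α) : ℝ))
        (Set.Ioi 0) := by
      refine (k1.const_mul (-s)).congr (Eventually.of_forall fun x => ?_)
      simp only
      ring
    obtain ⟨h3, h4⟩ := integral_mul_rpow_eq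
      (g := fun x : ℝ => Complex.exp (-s * x) - 1 - (-s * x))
      (K := max (‖s‖ ^ 2) (2 * ‖s‖)) (m := 2) h0
      (fun x => ((hlin x).cexp.sub_const 1).sub (hlin x)) (by simp)
      (fun x hx => by
        refine (norm_exp_sub_one_sub_le_sq (hre x hx)).trans ?_
        rw [hnorm x hx, mul_pow, Real.rpow_two]
        exact mul_le_mul_of_nonneg_right (le_max_left _ _) (sq_nonneg x))
      (fun x hx => by
        refine (norm_exp_sub_one_sub_le_two_mul (hre x hx)).trans ?_
        rw [hnorm x hx, ← mul_assoc, show (2 : ℝ) - 1 = 1 by norm_num, Real.rpow_one]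
        exact mul_le_mul_of_nonneg_right (le_max_right _ _) hx.le)
      h2 (by linarith) hi
    refine ⟨h3, ?_⟩
    rw [h4]
    have h5 : ∫ x in Set.Ioi (0 : ℝ), (Complex.exp (-s * x) * -s - -s) * (x ^ (-α) : ℝ) =
        -s * ∫ x in Set.Ioi (0 : ℝ), (Complex.exp (-s * x) - 1) * (x ^ (-α) : ℝ) := by
      rw [← integral_const_mul]
      congr 1
      ext x
      ring
    rw [h5, k2]
    have h6 : Real.Gamma (-(α - 1)) = -α * Real.Gamma (-α) := by
      rw [← Real.Gamma_add_one (by linarith : -α ≠ 0)]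
      ring_nf
    have h7 : s ^ (α : ℂ) = s * s ^ ((α - 1 : ℝ) : ℂ) := by
      nth_rewrite 2 [← Complex.cpow_one s]
      rw [← Complex.cpow_add _ _ hs0]
      congr 1
      push_cast
      ring
    rw [h6, h7]
    have : (α : ℂ) ≠ 0 := by exact_mod_cast h0.ne'
    push_cast
    field_simp

/-! ### The Lévy measure -/

namespace Params

variable (θ : Params)

lemma measurable_levyDensity : Measurable θ.levyDensity := by
  unfold levyDensity
  refine Measurable.ite measurableSet_Ioi (by fun_prop)
    (Measurable.ite measurableSet_Iio (by fun_prop) measurable_const)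

lemma levyDensity_nonneg (x : ℝ) : 0 ≤ θ.levyDensity x := by
  unfold levyDensity
  have := θ.cPos_nonneg
  have := θ.cNeg_nonneg
  split_ifs with h1 h2
  · exact mul_nonneg (div_nonneg ‹_› (Real.rpow_nonneg h1.le _)) (Real.exp_pos _).le
  · exact mul_nonneg (div_nonneg ‹_› (Real.rpow_nonneg (abs_nonneg _) _)) (Real.exp_pos _).le
  · exact le_rfl

lemma levyDensity_of_pos {x : ℝ} (hx : 0 < x) :
    θ.levyDensity x = θ.cPos * Real.exp (-θ.κPos * x) * x ^ (-θ.α - 1) := by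
  rw [levyDensity, if_pos hx, show -θ.α - 1 = -(θ.α + 1) by ring, Real.rpow_neg hx.le]
  ring

lemma levyDensity_neg_of_pos {x : ℝ} (hx : 0 < x) :
    θ.levyDensity (-x) = θ.cNeg * Real.exp (-θ.κNeg * x) * x ^ (-θ.α - 1) := by
  rw [levyDensity, if_neg (by linarith), if_pos (by linarith), abs_neg, abs_of_pos hx,
    show -θ.α - 1 = -(θ.α + 1) by ring, Real.rpow_neg hx.le]
  ring

/-- Integration against the Lévy measure, one half-line at a time. -/
lemma integral_levyMeasure {F : ℝ → ℂ}
    (hP : IntegrableOn (fun x : ℝ => F x * (θ.cPos * Real.exp (-θ.κPos * x) : ℝ) *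
      (x ^ (-θ.α - 1) : ℝ)) (Set.Ioi 0))
    (hN : IntegrableOn (fun x : ℝ => F (-x) * (θ.cNeg * Real.exp (-θ.κNeg * x) : ℝ) *
      (x ^ (-θ.α - 1) : ℝ)) (Set.Ioi 0)) :
    Integrable F θ.levyMeasure ∧
    ∫ x, F x ∂θ.levyMeasure =
      (∫ x in Set.Ioi (0 : ℝ), F x * (θ.cPos * Real.exp (-θ.κPos * x) : ℝ) *
        (x ^ (-θ.α - 1) : ℝ)) +
      ∫ x in Set.Ioi (0 : ℝ), F (-x) * (θ.cNeg * Real.exp (-θ.κNeg * x) : ℝ) *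
        (x ^ (-θ.α - 1) : ℝ) := by
  let G : ℝ → ℂ := fun x => θ.levyDensity x • F x
  have eP : ∀ x ∈ Set.Ioi (0 : ℝ), F x * (θ.cPos * Real.exp (-θ.κPos * x) : ℝ) *
      (x ^ (-θ.α - 1) : ℝ) = G x := fun x hx => by
    simp only [G]
    rw [θ.levyDensity_of_pos hx, Complex.real_smul]
    push_cast
    ring
  have eN : ∀ x ∈ Set.Ioi (0 : ℝ), F (-x) * (θ.cNeg * Real.exp (-θ.κNeg * x) : ℝ) *
      (x ^ (-θ.α - 1) : ℝ) = G (-x) := fun x hx => by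
    simp only [G]
    rw [θ.levyDensity_neg_of_pos hx, Complex.real_smul]
    push_cast
    ring
  rw [integrableOn_congr_fun eP measurableSet_Ioi] at hP
  rw [integrableOn_congr_fun eN measurableSet_Ioi] at hN
  have hN' : IntegrableOn G (Set.Iic 0) := by
    rw [← (Measure.measurePreserving_neg (volume : Measure ℝ)).integrableOn_comp_preimage
      (Homeomorph.neg ℝ).measurableEmbedding]
    have : Neg.neg ⁻¹' Set.Iic (0 : ℝ) = Set.Ici 0 := by ext; simp
    rw [this, integrableOn_Ici_iff_integrableOn_Ioi]
    exact hN
  have hG : Integrable G := by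
    rw [← integrableOn_univ, ← Set.Iic_union_Ioi (a := (0 : ℝ))]
    exact hN'.union hP
  have hm : Measurable fun x => ENNReal.ofReal (θ.levyDensity x) :=
    θ.measurable_levyDensity.ennreal_ofReal
  have hlt : ∀ᵐ x ∂(volume : Measure ℝ), ENNReal.ofReal (θ.levyDensity x) < ⊤ :=
    Eventually.of_forall fun x => ENNReal.ofReal_lt_top
  have e : ∀ x, (ENNReal.ofReal (θ.levyDensity x)).toReal • F x = G x := fun x => by
    rw [ENNReal.toReal_ofReal (θ.levyDensity_nonneg x)]
  constructor
  · rw [levyMeasure, integrable_withDensity_iff_integrable_smul' hm hlt]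
    simpa only [e] using hG
  · rw [levyMeasure, integral_withDensity_eq_integral_toReal_smul hm hlt,
      setIntegral_congr_fun measurableSet_Ioi eP, setIntegral_congr_fun measurableSet_Ioi eN,
      integral_comp_neg_Ioi (f := G), neg_zero, add_comm]
    simp only [e]
    rw [← setIntegral_univ, ← Set.Iic_union_Ioi (a := (0 : ℝ)),
      setIntegral_union (Set.Iic_disjoint_Ioi le_rfl) measurableSet_Ioi hN' hP]

end Params

/-- The integrand of the Lévy–Khinchine formula at a complex argument. -/
def lkI (z : ℂ) (x : ℝ) : ℂ := Complex.exp (z * x) - 1 - z * (Complex.exp x - 1)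

/-- A majorant of `lkI` on the strip `0 ≤ Re z ≤ 1`, up to a factor depending on `z`. -/
def lkBound (x : ℝ) : ℝ := min 1 (x ^ 2) * max 1 (Real.exp x)

lemma norm_exp_sub_one_sub_le_three {z : ℂ} (hz : z.re ≤ 1) :
    ‖Complex.exp z - 1 - z‖ ≤ 3 * ‖z‖ ^ 2 := by
  have key : ∀ w : ℂ, w.re ≤ 1 → ‖Complex.exp w - 1‖ ≤ 3 * ‖w‖ := by
    intro w hw
    have := Convex.norm_image_sub_le_of_norm_hasDerivWithin_le
      (f := fun t : ℝ => Complex.exp (t * w)) (f' := fun t : ℝ => Complex.exp (t * w) * w)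
      (C := 3 * ‖w‖) (s := Set.Icc 0 1) (x := 0) (y := 1)
      (fun t _ => by
        have h1 : HasDerivAt (fun t : ℝ => (t : ℂ) * w) (1 * w) t :=
          (hasDerivAt_id t).ofReal_comp.mul_const w
        rw [one_mul] at h1
        exact h1.cexp.hasDerivWithinAt)
      (fun t ht => by
        rw [norm_mul, Complex.norm_exp, Complex.re_ofReal_mul]
        refine mul_le_mul_of_nonneg_right ?_ (norm_nonneg _)
        have h2 : t * w.re ≤ 1 := by nlinarith [ht.1, ht.2]
        have h3 := Real.exp_le_exp.2 h2
        linarith [Real.exp_one_lt_d9])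
      (convex_Icc 0 1) (Set.left_mem_Icc.2 zero_le_one) (Set.right_mem_Icc.2 zero_le_one)
    simpa using this
  rw [sq, ← mul_assoc]
  refine norm_exp_sub_one_sub_le fun t ht => (key _ ?_).trans ?_
  · rw [Complex.re_ofReal_mul]
    nlinarith [ht.1, ht.2]
  · rw [norm_mul, Complex.norm_real, Real.norm_of_nonneg ht.1]
    nlinarith [norm_nonneg z, ht.2]

/-- For |x| ≤ 1 the linear terms in x cancel and a quadratic remainder is left; for larger |x| the
condition on Re z keeps |e^(zx)| below max(1, e^x). -/
lemma norm_lkI_le {z : ℂ} (h0 : 0 ≤ z.re) (h1 : z.re ≤ 1) (x : ℝ) :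
    ‖lkI z x‖ ≤ 6 * (1 + ‖z‖) ^ 2 * lkBound x := by
  have hz := norm_nonneg z
  rcases le_or_gt |x| 1 with hx | hx
  · obtain ⟨hx1, hx2⟩ := abs_le.1 hx
    have e : lkI z x = (Complex.exp (z * x) - 1 - z * x) - z * (Complex.exp x - 1 - x) := by
      rw [lkI]; ring
    have b1 : ‖Complex.exp (z * x) - 1 - z * x‖ ≤ 3 * (‖z‖ ^ 2 * x ^ 2) := by
      refine (norm_exp_sub_one_sub_le_three (by simp; nlinarith)).trans_eq ?_
      rw [norm_mul, Complex.norm_real, Real.norm_eq_abs, mul_pow, sq_abs]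
    have b2 : ‖Complex.exp (x : ℂ) - 1 - x‖ ≤ 3 * x ^ 2 := by
      refine (norm_exp_sub_one_sub_le_three (by simpa)).trans_eq ?_
      rw [Complex.norm_real, Real.norm_eq_abs, sq_abs]
    have b3 : ‖lkI z x‖ ≤ 3 * (‖z‖ ^ 2 * x ^ 2) + ‖z‖ * (3 * x ^ 2) := by
      rw [e]
      refine (norm_sub_le _ _).trans (add_le_add b1 ?_)
      rw [norm_mul]
      exact mul_le_mul_of_nonneg_left b2 hz
    have hx3 : x ^ 2 ≤ 1 := by nlinarith
    have b4 : x ^ 2 ≤ lkBound x := by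
      rw [lkBound, min_eq_right hx3]
      exact le_mul_of_one_le_right (sq_nonneg x) (le_max_left _ _)
    calc ‖lkI z x‖ ≤ 6 * (1 + ‖z‖) ^ 2 * x ^ 2 := by
          refine b3.trans ?_
          nlinarith [sq_nonneg x, mul_nonneg hz (sq_nonneg x), mul_nonneg (sq_nonneg ‖z‖) (sq_nonneg x)]
      _ ≤ _ := mul_le_mul_of_nonneg_left b4 (by positivity)
  · have hx3 : 1 ≤ x ^ 2 := by rw [← sq_abs]; nlinarith
    have hE : ‖Complex.exp (z * x)‖ ≤ max 1 (Real.exp x) := by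
      rw [Complex.norm_exp, Complex.re_mul_ofReal]
      rcases le_total 0 x with h | h
      · exact le_max_of_le_right (Real.exp_le_exp.2 (by nlinarith))
      · exact le_max_of_le_left (Real.exp_le_one_iff.2 (by nlinarith))
    have hE' : ‖Complex.exp (x : ℂ)‖ ≤ max 1 (Real.exp x) := by
      rw [Complex.norm_exp, Complex.ofReal_re]
      exact le_max_right _ _
    have hM : 1 ≤ max 1 (Real.exp x) := le_max_left _ _
    rw [lkBound, min_eq_left hx3, one_mul]
    set m := max 1 (Real.exp x)
    have b1 : ‖Complex.exp (z * x) - 1‖ ≤ 2 * m := by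
      refine (norm_sub_le _ _).trans ?_
      rw [norm_one]; linarith
    have b2 : ‖Complex.exp (x : ℂ) - 1‖ ≤ 2 * m := by
      refine (norm_sub_le _ _).trans ?_
      rw [norm_one]; linarith
    have b3 : ‖lkI z x‖ ≤ 2 * m + ‖z‖ * (2 * m) := by
      rw [lkI]
      refine (norm_sub_le _ _).trans (add_le_add b1 ?_)
      rw [norm_mul]
      exact mul_le_mul_of_nonneg_left b2 hz
    have hm0 : 0 ≤ m := by linarith
    nlinarith [mul_nonneg hz hm0, mul_nonneg (sq_nonneg ‖z‖) hm0]

lemma measurable_lkI (z : ℂ) : Measurable (lkI z) := by unfold lkI; fun_prop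

/-- By convexity of exp, e^(x Re z) lies below the chord between 0 and x. This sign makes the
continued characteristic function bounded by 1 on the strip. -/
lemma re_lkI_nonpos {z : ℂ} (h0 : 0 ≤ z.re) (h1 : z.re ≤ 1) (x : ℝ) : (lkI z x).re ≤ 0 := by
  have e1 : (Complex.exp (x : ℂ)) = ((Real.exp x : ℝ) : ℂ) := (Complex.ofReal_exp x).symm
  have e2 : (lkI z x).re = (Complex.exp (z * x)).re - 1 - z.re * (Real.exp x - 1) := by
    rw [lkI, e1, Complex.sub_re, Complex.sub_re, ← Complex.ofReal_one, ← Complex.ofReal_sub,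
      Complex.re_mul_ofReal, Complex.ofReal_re]
  have h2 : (Complex.exp (z * x)).re ≤ Real.exp (z.re * x) := by
    refine (Complex.re_le_norm _).trans_eq ?_
    rw [Complex.norm_exp, Complex.re_mul_ofReal]
  have h3 : Real.exp (z.re * x) ≤ z.re * Real.exp x + (1 - z.re) := by
    have := convexOn_exp.2 (Set.mem_univ x) (Set.mem_univ 0) h0 (by linarith : 0 ≤ 1 - z.re)
      (by ring)
    simpa using this
  rw [e2]
  linarith

namespace Params

variable (θ : Params)

lemma integrable_lkBound (h0 : 0 < θ.α) : Integrable lkBound θ.levyMeasure := by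
  have h2 := θ.α_lt_two
  suffices h : Integrable (fun x => (lkBound x : ℂ)) θ.levyMeasure by
    simpa using h.re
  -- The exponents 1 + α/2 and α/2 both lie in [0, 2] and enclose α, as integrability against
  -- x^(−α−1) at 0 and at infinity requires.
  have hmin : ∀ x : ℝ, 0 < x → min 1 (x ^ 2) ≤ x ^ (1 + θ.α / 2) ∧
      min 1 (x ^ 2) ≤ x ^ (1 + θ.α / 2 - 1) := fun x hx => by
    rcases le_total x 1 with h | h
    · have h3 : x ^ 2 ≤ x ^ (1 + θ.α / 2) := by
        rw [← Real.rpow_two]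
        exact Real.rpow_le_rpow_of_exponent_ge hx h (by linarith)
      have h4 : x ^ 2 ≤ x ^ (1 + θ.α / 2 - 1) := by
        rw [← Real.rpow_two]
        exact Real.rpow_le_rpow_of_exponent_ge hx h (by linarith)
      exact ⟨(min_le_right _ _).trans h3, (min_le_right _ _).trans h4⟩
    · exact ⟨(min_le_left _ _).trans (Real.one_le_rpow h (by linarith)),
        (min_le_left _ _).trans (Real.one_le_rpow h (by linarith))⟩
  have hm : ∀ c κ : ℝ, Measurable fun x : ℝ => ((lkBound x : ℂ) * (c * Real.exp (-κ * x) : ℝ)) := by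
    unfold lkBound
    fun_prop
  have hm' : ∀ c κ : ℝ,
      Measurable fun x : ℝ => ((lkBound (-x) : ℂ) * (c * Real.exp (-κ * x) : ℝ)) := by
    unfold lkBound
    fun_prop
  have hn : ∀ x : ℝ, 0 ≤ min 1 (x ^ 2) := fun x => le_min zero_le_one (sq_nonneg x)
  have bP : ∀ x : ℝ, 0 < x → ‖(lkBound x : ℂ) * (θ.cPos * Real.exp (-θ.κPos * x) : ℝ)‖ ≤
      θ.cPos * min 1 (x ^ 2) := fun x hx => by
    rw [← Complex.ofReal_mul, Complex.norm_real, lkBound, max_eq_right (Real.one_le_exp hx.le),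
      Real.norm_of_nonneg (mul_nonneg (mul_nonneg (hn x) (Real.exp_pos _).le)
        (mul_nonneg θ.cPos_nonneg (Real.exp_pos _).le))]
    -- Here κ₊ ≥ 1 absorbs the growth of e^x.
    have h5 : Real.exp x * Real.exp (-θ.κPos * x) ≤ 1 := by
      rw [← Real.exp_add]
      exact Real.exp_le_one_iff.2 (by nlinarith [θ.one_le_κPos])
    calc _ = θ.cPos * min 1 (x ^ 2) * (Real.exp x * Real.exp (-θ.κPos * x)) := by ring
      _ ≤ _ := mul_le_of_le_one_right (mul_nonneg θ.cPos_nonneg (hn x)) h5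
  have bN : ∀ x : ℝ, 0 < x → ‖(lkBound (-x) : ℂ) * (θ.cNeg * Real.exp (-θ.κNeg * x) : ℝ)‖ ≤
      θ.cNeg * min 1 (x ^ 2) := fun x hx => by
    rw [← Complex.ofReal_mul, Complex.norm_real, lkBound, neg_sq,
      max_eq_left (Real.exp_le_one_iff.2 (by linarith)), mul_one,
      Real.norm_of_nonneg (mul_nonneg (hn x) (mul_nonneg θ.cNeg_nonneg (Real.exp_pos _).le))]
    have h5 : Real.exp (-θ.κNeg * x) ≤ 1 :=
      Real.exp_le_one_iff.2 (by nlinarith [θ.κNeg_nonneg])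
    calc _ = θ.cNeg * min 1 (x ^ 2) * Real.exp (-θ.κNeg * x) := by ring
      _ ≤ _ := mul_le_of_le_one_right (mul_nonneg θ.cNeg_nonneg (hn x)) h5
  refine (θ.integral_levyMeasure
    (integrableOn_of_norm_le_rpow (K := θ.cPos) (m := 1 + θ.α / 2) (n := 1 + θ.α / 2 - 1)
      (hm _ _).aestronglyMeasurable (fun x hx => ?_) (fun x hx => ?_) (by linarith) (by linarith))
    (integrableOn_of_norm_le_rpow (K := θ.cNeg) (m := 1 + θ.α / 2) (n := 1 + θ.α / 2 - 1)
      (hm' _ _).aestronglyMeasurable (fun x hx => ?_) (fun x hx => ?_) (by linarith)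
      (by linarith))).1
  · exact (bP x hx).trans (mul_le_mul_of_nonneg_left (hmin x hx).1 θ.cPos_nonneg)
  · exact (bP x hx).trans (mul_le_mul_of_nonneg_left (hmin x hx).2 θ.cPos_nonneg)
  · exact (bN x hx).trans (mul_le_mul_of_nonneg_left (hmin x hx).1 θ.cNeg_nonneg)
  · exact (bN x hx).trans (mul_le_mul_of_nonneg_left (hmin x hx).2 θ.cNeg_nonneg)

/-- The Laplace exponent `log E exp (z X(1))`. -/
def psi (z : ℂ) : ℂ := 1 / 2 * (θ.σ : ℂ) ^ 2 * (z * (z - 1)) + ∫ x, lkI z x ∂θ.levyMeasure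

lemma levyExponent_eq_psi (u : ℝ) : θ.levyExponent u = θ.psi (Complex.I * u) := by
  rw [levyExponent, psi]
  simp only [lkI]
  congr 1
  linear_combination (-(1 / 2) * (θ.σ : ℂ) ^ 2 * u ^ 2) * Complex.I_sq

lemma psi_one : θ.psi 1 = 0 := by simp [psi, lkI]

lemma integrable_lkI (h0 : 0 < θ.α) {z : ℂ} (hz0 : 0 ≤ z.re) (hz1 : z.re ≤ 1) :
    Integrable (lkI z) θ.levyMeasure :=
  ((θ.integrable_lkBound h0).const_mul (6 * (1 + ‖z‖) ^ 2)).mono'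
    (measurable_lkI z).aestronglyMeasurable (Eventually.of_forall (norm_lkI_le hz0 hz1))

lemma re_psi_nonpos (h0 : 0 < θ.α) {z : ℂ} (hz0 : 0 ≤ z.re) (hz1 : z.re ≤ 1) :
    (θ.psi z).re ≤ 0 := by
  have h1 : (∫ x, lkI z x ∂θ.levyMeasure).re ≤ 0 := by
    have := integral_re (𝕜 := ℂ) (θ.integrable_lkI h0 hz0 hz1)
    simp only [RCLike.re_to_complex] at this
    rw [← this]
    exact integral_nonpos fun x => re_lkI_nonpos hz0 hz1 x
  have h2 : (1 / 2 * (θ.σ : ℂ) ^ 2 * (z * (z - 1))).re =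
      1 / 2 * θ.σ ^ 2 * (z.re * (z.re - 1) - z.im * z.im) := by
    have : (1 / 2 * (θ.σ : ℂ) ^ 2) = ((1 / 2 * θ.σ ^ 2 : ℝ) : ℂ) := by push_cast; ring
    rw [this, Complex.re_ofReal_mul]
    simp
  rw [psi, Complex.add_re, h2]
  have h3 : z.re * (z.re - 1) - z.im * z.im ≤ 0 := by nlinarith [mul_self_nonneg z.im]
  have h4 := mul_nonpos_of_nonneg_of_nonpos (by positivity : 0 ≤ 1 / 2 * θ.σ ^ 2) h3
  linarith

lemma continuousOn_psi (h0 : 0 < θ.α) : ContinuousOn θ.psi {z | 0 ≤ z.re ∧ z.re ≤ 1} := by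
  unfold psi
  refine ContinuousOn.add (by fun_prop) fun z hz => ?_
  refine continuousWithinAt_of_dominated (bound := fun x => 6 * (1 + (‖z‖ + 1)) ^ 2 * lkBound x)
    (Eventually.of_forall fun w => (measurable_lkI w).aestronglyMeasurable) ?_
    ((θ.integrable_lkBound h0).const_mul _) (Eventually.of_forall fun x => ?_)
  · have h1 : ∀ᶠ w in 𝓝[{z : ℂ | 0 ≤ z.re ∧ z.re ≤ 1}] z, ‖w‖ < ‖z‖ + 1 :=
      nhdsWithin_le_nhds ((continuous_norm.tendsto z).eventually_lt_const (lt_add_one _))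
    filter_upwards [h1, self_mem_nhdsWithin] with w hw hw'
    refine Eventually.of_forall fun x => (norm_lkI_le hw'.1 hw'.2 x).trans ?_
    have : 0 ≤ lkBound x := mul_nonneg (le_min zero_le_one (sq_nonneg x))
      (zero_le_one.trans (le_max_left _ _))
    gcongr
  · unfold lkI
    fun_prop

lemma _root_.TSP.integral_const_mul_comb {S : Set ℝ} {f g h : ℝ → ℂ} (c w z : ℂ)
    (hf : IntegrableOn f S) (hg : IntegrableOn g S) (hh : IntegrableOn h S) :
    IntegrableOn (fun x => c * (f x + w * g x - z * h x)) S ∧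
    ∫ x in S, c * (f x + w * g x - z * h x) =
      c * ((∫ x in S, f x) + w * (∫ x in S, g x) - z * ∫ x in S, h x) := by
  have h1 : IntegrableOn (fun x => f x + w * g x) S := hf.add (hg.const_mul w)
  refine ⟨(h1.sub (hh.const_mul z)).const_mul c, ?_⟩
  rw [integral_const_mul, integral_sub h1 (hh.const_mul z), integral_add hf (hg.const_mul w),
    integral_const_mul, integral_const_mul]

/-- The Laplace exponent in closed form. -/
lemma psi_eq (h0 : 0 < θ.α) (h1 : θ.α ≠ 1) {z : ℂ} (hz0 : 0 < z.re) (hz1 : z.re < 1) :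
    θ.psi z = 1 / 2 * (θ.σ : ℂ) ^ 2 * (z * (z - 1)) + (θ.δ + θ.γ * z +
      (θ.aPos * (θ.κPos - z) ^ (θ.α : ℂ) + θ.aNeg * (θ.κNeg + z) ^ (θ.α : ℂ))) := by
  have hκ := θ.one_le_κPos
  have hκ' := θ.κNeg_nonneg
  have c := fun {s : ℂ} => integral_cexpm h0 θ.α_lt_two h1 (s := s)
  have cr : ∀ {k : ℝ}, 0 ≤ k →
      IntegrableOn (fun x : ℝ => cexpm θ.α k x * (x ^ (-θ.α - 1) : ℝ)) (Set.Ioi 0) ∧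
      ∫ x in Set.Ioi (0 : ℝ), cexpm θ.α k x * (x ^ (-θ.α - 1) : ℝ) =
        Real.Gamma (-θ.α) * ((k ^ θ.α : ℝ) : ℂ) := fun {k} hk => by
    rw [Complex.ofReal_cpow hk]
    refine c ?_
    rcases hk.eq_or_lt with h | h
    · exact Or.inr (by rw [← h, Complex.ofReal_zero])
    · exact Or.inl (by simpa)
  have p1 := c (s := θ.κPos - z) (Or.inl (by simp; linarith))
  have p2 := cr (k := θ.κPos) (by linarith)
  have p3 := cr (k := θ.κPos - 1) (by linarith)
  have n1 := c (s := θ.κNeg + z) (Or.inl (by simp; linarith))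
  have n2 := cr (k := θ.κNeg) hκ'
  have n3 := cr (k := θ.κNeg + 1) (by linarith)
  have eP : (fun x : ℝ => lkI z x * (θ.cPos * Real.exp (-θ.κPos * x) : ℝ) *
      (x ^ (-θ.α - 1) : ℝ)) = fun x : ℝ => (θ.cPos : ℂ) *
        (cexpm θ.α (θ.κPos - z) x * (x ^ (-θ.α - 1) : ℝ) +
          (z - 1) * (cexpm θ.α θ.κPos x * (x ^ (-θ.α - 1) : ℝ)) -
          z * (cexpm θ.α (θ.κPos - 1 : ℝ) x * (x ^ (-θ.α - 1) : ℝ))) := by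
    ext x
    -- The compensators cancel: the weights 1, z − 1, −z sum to 0, and so do they against the rates,
    -- since (κ − z) + (z − 1)κ − z(κ − 1) = 0. Hence the identity holds on both sides of α = 1.
    have h3 : lkI z x * Complex.exp (-θ.κPos * x) = cexpm θ.α (θ.κPos - z) x +
        (z - 1) * cexpm θ.α θ.κPos x - z * cexpm θ.α (θ.κPos - 1 : ℝ) x := by
      have e1 : Complex.exp (-(θ.κPos - z) * x) =
        Complex.exp (z * x) * Complex.exp (-θ.κPos * x) := by rw [← Complex.exp_add]; ring_nf
      have e2 : Complex.exp (-((θ.κPos - 1 : ℝ) : ℂ) * x) =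
        Complex.exp x * Complex.exp (-θ.κPos * x) := by
        rw [← Complex.exp_add]; push_cast; ring_nf
      simp only [lkI, cexpm]
      rw [e1, e2]
      split_ifs <;> push_cast <;> ring
    rw [Complex.ofReal_mul, Complex.ofReal_exp, Complex.ofReal_mul, Complex.ofReal_neg]
    linear_combination ((θ.cPos : ℂ) * (x ^ (-θ.α - 1) : ℝ)) * h3
  have eN : (fun x : ℝ => lkI z (-x) * (θ.cNeg * Real.exp (-θ.κNeg * x) : ℝ) *
      (x ^ (-θ.α - 1) : ℝ)) = fun x : ℝ => (θ.cNeg : ℂ) *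
        (cexpm θ.α (θ.κNeg + z) x * (x ^ (-θ.α - 1) : ℝ) +
          (z - 1) * (cexpm θ.α θ.κNeg x * (x ^ (-θ.α - 1) : ℝ)) -
          z * (cexpm θ.α (θ.κNeg + 1 : ℝ) x * (x ^ (-θ.α - 1) : ℝ))) := by
    ext x
    have h3 : lkI z (-x) * Complex.exp (-θ.κNeg * x) = cexpm θ.α (θ.κNeg + z) x +
        (z - 1) * cexpm θ.α θ.κNeg x - z * cexpm θ.α (θ.κNeg + 1 : ℝ) x := by
      have e1 : Complex.exp (-(θ.κNeg + z) * x) =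
        Complex.exp (z * (-x : ℝ)) * Complex.exp (-θ.κNeg * x) := by
        rw [← Complex.exp_add]; push_cast; ring_nf
      have e2 : Complex.exp (-((θ.κNeg + 1 : ℝ) : ℂ) * x) =
        Complex.exp (-x : ℝ) * Complex.exp (-θ.κNeg * x) := by
        rw [← Complex.exp_add]; push_cast; ring_nf
      simp only [lkI, cexpm]
      rw [e1, e2]
      split_ifs <;> push_cast <;> ring
    rw [Complex.ofReal_mul, Complex.ofReal_exp, Complex.ofReal_mul, Complex.ofReal_neg]
    linear_combination ((θ.cNeg : ℂ) * (x ^ (-θ.α - 1) : ℝ)) * h3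
  have hP := integral_const_mul_comb (θ.cPos : ℂ) (z - 1) z p1.1 p2.1 p3.1
  have hN := integral_const_mul_comb (θ.cNeg : ℂ) (z - 1) z n1.1 n2.1 n3.1
  have key := (θ.integral_levyMeasure (F := lkI z) (by rw [eP]; exact hP.1)
    (by rw [eN]; exact hN.1)).2
  rw [eP, eN, hP.2, hN.2] at key
  rw [p1.2, p2.2, p3.2, n1.2, n2.2, n3.2] at key
  rw [psi, key, γ, δ, aPos, aNeg]
  push_cast
  ring

lemma differentiableOn_psi (h0 : 0 < θ.α) (h1 : θ.α ≠ 1) :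
    DifferentiableOn ℂ θ.psi {z | 0 < z.re ∧ z.re < 1} := by
  refine DifferentiableOn.congr (f := fun z : ℂ => 1 / 2 * (θ.σ : ℂ) ^ 2 * (z * (z - 1)) +
    (θ.δ + θ.γ * z + (θ.aPos * (θ.κPos - z) ^ (θ.α : ℂ) +
      θ.aNeg * (θ.κNeg + z) ^ (θ.α : ℂ)))) ?_ fun z hz => θ.psi_eq h0 h1 hz.1 hz.2
  intro z hz
  refine DifferentiableAt.differentiableWithinAt ?_
  have d1 : DifferentiableAt ℂ (fun z : ℂ => (θ.κPos - z) ^ (θ.α : ℂ)) z :=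
    (differentiableAt_id.const_sub _).cpow_const
      (Or.inl (by simp; linarith [θ.one_le_κPos, hz.2]))
  have d2 : DifferentiableAt ℂ (fun z : ℂ => (θ.κNeg + z) ^ (θ.α : ℂ)) z :=
    (differentiableAt_id.const_add _).cpow_const
      (Or.inl (by simp; linarith [θ.κNeg_nonneg, hz.1]))
  fun_prop

end Params

/-! ### From the characteristic function to exponential moments -/

/-- Cauchy's theorem on the rectangles [0, a] × [−R, R]; the Gaussian bound kills the horizontal
sides as R → ∞. -/
lemma integral_vertical_eq {H : ℂ → ℂ} {K a : ℝ} (ha0 : 0 ≤ a) (ha1 : a ≤ 1)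
    (hc : ContinuousOn H {z | 0 ≤ z.re ∧ z.re ≤ 1})
    (hd : DifferentiableOn ℂ H {z | 0 < z.re ∧ z.re < 1})
    (hb : ∀ z : ℂ, 0 ≤ z.re → z.re ≤ 1 → ‖H z‖ ≤ K * Real.exp (-(z.im ^ 2 / 2))) :
    Integrable (fun u : ℝ => H (a + u * Complex.I)) ∧
    ∫ u : ℝ, H (a + u * Complex.I) = ∫ u : ℝ, H (0 + u * Complex.I) := by
  have hgi : Integrable fun u : ℝ => K * Real.exp (-(u ^ 2 / 2)) := by
    have := (integrable_exp_neg_mul_sq (by norm_num : (0 : ℝ) < 1 / 2)).const_mul K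
    refine this.congr (Eventually.of_forall fun u => ?_)
    simp only
    ring_nf
  have hint : ∀ b : ℝ, 0 ≤ b → b ≤ 1 → Integrable fun u : ℝ => H (b + u * Complex.I) := by
    intro b hb0 hb1
    have hcont : Continuous fun u : ℝ => H (b + u * Complex.I) := by
      refine hc.comp_continuous (by fun_prop) fun u => ?_
      simp [hb0, hb1]
    refine hgi.mono' hcont.aestronglyMeasurable (Eventually.of_forall fun u => ?_)
    simpa using hb (b + u * Complex.I) (by simpa) (by simpa)
  refine ⟨hint a ha0 ha1, ?_⟩
  have hI0 : Integrable fun u : ℝ => H (0 + u * Complex.I) := by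
    simpa using hint 0 le_rfl zero_le_one
  have hrect : ∀ R : ℝ, (∫ x : ℝ in (0 : ℝ)..a, H (x + (-R : ℝ) * Complex.I)) -
      (∫ x : ℝ in (0 : ℝ)..a, H (x + R * Complex.I)) +
      Complex.I * (∫ y : ℝ in (-R)..R, H (a + y * Complex.I)) -
      Complex.I * (∫ y : ℝ in (-R)..R, H (0 + y * Complex.I)) = 0 := by
    intro R
    have := Complex.integral_boundary_rect_eq_zero_of_continuousOn_of_differentiableOn H
      ⟨0, -R⟩ ⟨a, R⟩
      (hc.mono fun z hz => by
        have h1 := (Complex.mem_reProdIm.1 hz).1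
        rw [Set.uIcc_of_le ha0] at h1
        exact ⟨h1.1, h1.2.trans ha1⟩)
      (hd.mono fun z hz => by
        have h1 := (Complex.mem_reProdIm.1 hz).1
        simp only [min_eq_left ha0, max_eq_right ha0] at h1
        exact ⟨h1.1, h1.2.trans_le ha1⟩)
    simpa [smul_eq_mul] using this
  have hside : ∀ s : ℝ, s = 1 ∨ s = -1 →
      Tendsto (fun R : ℝ => ∫ x : ℝ in (0 : ℝ)..a, H (x + (s * R : ℝ) * Complex.I)) atTop (𝓝 0) := by
    intro s hs
    have hs2 : s ^ 2 = 1 := by rcases hs with rfl | rfl <;> norm_num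
    have hlim : Tendsto (fun R : ℝ => K * Real.exp (-(R ^ 2 / 2)) * |a - 0|) atTop (𝓝 0) := by
      have h1 : Tendsto (fun R : ℝ => -(R ^ 2 / 2)) atTop atBot :=
        tendsto_neg_atTop_atBot.comp ((tendsto_pow_atTop two_ne_zero).atTop_div_const two_pos)
      have := ((Real.tendsto_exp_atBot.comp h1).const_mul K).mul_const |a - 0|
      simpa using this
    refine squeeze_zero_norm (fun R => ?_) hlim
    refine intervalIntegral.norm_integral_le_of_norm_le_const fun x hx => ?_
    rw [Set.uIoc_of_le ha0] at hx
    have := hb (x + (s * R : ℝ) * Complex.I) (by simpa using hx.1.le)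
      (by simpa using hx.2.trans ha1)
    simpa [mul_pow, hs2] using this
  have hA := intervalIntegral_tendsto_integral (hint a ha0 ha1) tendsto_neg_atTop_atBot tendsto_id
  have hB := intervalIntegral_tendsto_integral hI0 tendsto_neg_atTop_atBot tendsto_id
  have hS1 := hside 1 (Or.inl rfl)
  have hS2 := hside (-1) (Or.inr rfl)
  simp only [one_mul, neg_one_mul] at hS1 hS2
  have hlim := ((hS2.sub hS1).add (hA.const_mul Complex.I)).sub (hB.const_mul Complex.I)
  have hz : Tendsto (fun _ : ℝ => (0 : ℂ)) atTop (𝓝 0) := tendsto_const_nhds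
  have := tendsto_nhds_unique (hlim.congr fun R => hrect R) hz
  rw [sub_zero, zero_add, ← mul_sub] at this
  exact sub_eq_zero.1 ((mul_eq_zero.1 this).resolve_left Complex.I_ne_zero)

/-- `f` is a bounded analytic continuation to the strip `0 ≤ Re z ≤ 1` of the characteristic
function of `μ`, and `f 1 = 1`. -/
structure StripExtension (μ : Measure ℝ) (f : ℂ → ℂ) : Prop where
  cont : ContinuousOn f {z | 0 ≤ z.re ∧ z.re ≤ 1}
  diff : DifferentiableOn ℂ f {z | 0 < z.re ∧ z.re < 1}
  norm_le : ∀ z : ℂ, 0 ≤ z.re → z.re ≤ 1 → ‖f z‖ ≤ 1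
  one : f 1 = 1
  charFun_eq : ∀ u : ℝ, ∫ x : ℝ, Complex.exp (Complex.I * u * x) ∂μ = f (Complex.I * u)

lemma ofReal_gpdf (v : ℝ) : (gpdf v : ℂ) =
    1 / (2 * Real.pi) * ∫ u : ℝ, Complex.exp (-(Complex.I * u * v)) * Complex.exp (-(u ^ 2 / 2)) := by
  have h := fourierIntegral_gaussian (b := 1 / 2) (by norm_num) (-v)
  have e1 : ∀ u : ℝ, Complex.exp (Complex.I * (-v) * u) * Complex.exp (-(1 / 2) * u ^ 2) =
      Complex.exp (-(Complex.I * u * v)) * Complex.exp (-(u ^ 2 / 2)) := fun u => by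
    congr 2 <;> ring
  simp only [e1] at h
  rw [h, gpdf]
  have e2 : ((Real.pi : ℂ) / (1 / 2)) ^ (1 / 2 : ℂ) = ((√(2 * Real.pi) : ℝ) : ℂ) := by
    rw [Real.sqrt_eq_rpow, Complex.ofReal_cpow (by positivity)]
    push_cast
    congr 1
    ring
  have e3 : Complex.exp (-(-(v : ℂ)) ^ 2 / (4 * (1 / 2))) = ((Real.exp (-v ^ 2 / 2) : ℝ) : ℂ) := by
    push_cast
    congr 1
    ring
  have h2 : (2 * Real.pi : ℝ) = √(2 * Real.pi) * √(2 * Real.pi) :=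
    (Real.mul_self_sqrt (by positivity)).symm
  have h3 : √(2 * Real.pi) ≠ 0 := by positivity
  rw [e2, e3]
  have h4 : Real.exp (-v ^ 2 / 2) / √(2 * Real.pi) =
      1 / (2 * Real.pi) * (√(2 * Real.pi) * Real.exp (-v ^ 2 / 2)) := by
    rw [h2]
    field_simp
    rw [Real.sqrt_sq (Real.sqrt_nonneg _)]
  rw [h4]
  push_cast
  ring

/-- The density of `μ` smoothed by a standard Gaussian. -/
def smoothed (μ : Measure ℝ) (x : ℝ) : ℝ := ∫ y, gpdf (x - y) ∂μ

lemma integral_exp_mul_gpdf (z : ℂ) (y : ℝ) :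
    Integrable (fun x : ℝ => Complex.exp (z * x) * gpdf (x - y)) ∧
    ∫ x : ℝ, Complex.exp (z * x) * gpdf (x - y) =
      Complex.exp (z ^ 2 / 2) * Complex.exp (z * y) := by
  have hb : (-(1 / 2) : ℂ).re < 0 := by norm_num
  have e : ∀ x : ℝ, Complex.exp (z * x) * gpdf (x - y) =
      (1 / √(2 * Real.pi) : ℝ) *
        Complex.exp (-(1 / 2) * x ^ 2 + (z + y) * x + (-(y ^ 2 / 2))) := fun x => by
    have : Complex.exp (-(1 / 2) * x ^ 2 + (z + y) * x + (-(y ^ 2 / 2))) =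
        Complex.exp (z * x) * ((Real.exp (-(x - y) ^ 2 / 2) : ℝ) : ℂ) := by
      rw [Complex.ofReal_exp, ← Complex.exp_add]
      congr 1
      push_cast
      ring
    rw [this, gpdf]
    push_cast
    ring
  simp only [e]
  refine ⟨(integrable_cexp_quadratic' hb _ _).const_mul _, ?_⟩
  rw [integral_const_mul, integral_cexp_quadratic hb]
  have e2 : ((Real.pi : ℂ) / -(-(1 / 2))) ^ (1 / 2 : ℂ) = ((√(2 * Real.pi) : ℝ) : ℂ) := by
    rw [Real.sqrt_eq_rpow, Complex.ofReal_cpow (by positivity)]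
    push_cast
    congr 1
    ring
  rw [e2, ← mul_assoc, ← Complex.ofReal_mul, one_div_mul_cancel (by positivity : √(2 * Real.pi) ≠ 0),
    Complex.ofReal_one, one_mul, ← Complex.exp_add]
  congr 1
  ring

/-! ### Exponential moments by Gaussian smoothing and contour shift. -/

namespace StripExtension

variable {μ : Measure ℝ} [IsProbabilityMeasure μ] {f : ℂ → ℂ}

omit [IsProbabilityMeasure μ] in
lemma shifted_norm_le (h : StripExtension μ f) (x : ℝ) {z : ℂ} (h0 : 0 ≤ z.re) (h1 : z.re ≤ 1) :
    ‖Complex.exp (-(z * x) + z ^ 2 / 2) * f z‖ ≤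
      Real.exp (-(z.re * x)) * Real.exp (1 / 2) * Real.exp (-(z.im ^ 2 / 2)) := by
  rw [norm_mul, Complex.norm_exp, ← Real.exp_add, ← Real.exp_add]
  refine (mul_le_of_le_one_right (Real.exp_pos _).le (h.norm_le z h0 h1)).trans ?_
  refine Real.exp_le_exp.2 ?_
  have : (-(z * x) + z ^ 2 / 2).re = -(z.re * x) + (z.re * z.re - z.im * z.im) / 2 := by
    have e : (z ^ 2 / 2).re = (z.re * z.re - z.im * z.im) / 2 := by
      rw [sq, show z * z / 2 = z * z / ((2 : ℝ) : ℂ) by norm_num, Complex.div_ofReal_re,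
        Complex.mul_re]
    rw [Complex.add_re, e]
    simp
  rw [this]
  nlinarith

/-- Smoothing multiplies the transform by e^(z²/2). This decay on vertical lines makes the inversion
integral converge and lets the contour be moved without any decay of `f`. -/
lemma smoothed_eq (h : StripExtension μ f) (x : ℝ) :
    (smoothed μ x : ℂ) = 1 / (2 * Real.pi) *
      ∫ u : ℝ, Complex.exp (-((0 + u * Complex.I) * x) + (0 + u * Complex.I) ^ 2 / 2) *
        f (0 + u * Complex.I) := by
  have hg : Integrable fun u : ℝ => Complex.exp (-((u : ℂ) ^ 2 / 2)) := by
    have := integrable_cexp_quadratic (b := 1 / 2) (by norm_num) 0 0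
    refine this.congr (Eventually.of_forall fun u => ?_)
    simp only
    ring_nf
  have hprod : Integrable (fun p : ℝ × ℝ =>
      Complex.exp (-(Complex.I * p.2 * (x - p.1 : ℝ))) * Complex.exp (-((p.2 : ℂ) ^ 2 / 2)))
      (μ.prod volume) := by
    refine (hg.comp_snd μ).mono (by fun_prop) (Eventually.of_forall fun p => ?_)
    rw [norm_mul, norm_exp_I_mul, one_mul]
  rw [smoothed, ← integral_complex_ofReal]
  simp only [ofReal_gpdf]
  rw [integral_const_mul, integral_integral_swap hprod]
  congr 2
  ext u
  have e : ∀ y : ℝ, Complex.exp (-(Complex.I * u * (x - y : ℝ))) * Complex.exp (-((u : ℂ) ^ 2 / 2)) =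
      Complex.exp (-((0 + u * Complex.I) * x) + (0 + u * Complex.I) ^ 2 / 2) *
        Complex.exp (Complex.I * u * y) := fun y => by
    rw [← Complex.exp_add, ← Complex.exp_add]
    congr 1
    push_cast
    linear_combination (-(u : ℂ) ^ 2 / 2) * Complex.I_sq
  simp only [e]
  rw [integral_const_mul, h.charFun_eq, zero_add, mul_comm (u : ℂ)]

lemma smoothed_eq_vertical (h : StripExtension μ f) (x : ℝ) {a : ℝ} (ha0 : 0 ≤ a) (ha1 : a ≤ 1) :
    Integrable (fun u : ℝ =>
      Complex.exp (-((a + u * Complex.I) * x) + (a + u * Complex.I) ^ 2 / 2) *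
        f (a + u * Complex.I)) ∧
    (smoothed μ x : ℂ) = 1 / (2 * Real.pi) *
      ∫ u : ℝ, Complex.exp (-((a + u * Complex.I) * x) + (a + u * Complex.I) ^ 2 / 2) *
        f (a + u * Complex.I) := by
  have := integral_vertical_eq (H := fun z => Complex.exp (-(z * x) + z ^ 2 / 2) * f z)
    (K := Real.exp |x| * Real.exp (1 / 2)) ha0 ha1
    (ContinuousOn.mul (by fun_prop) h.cont) (DifferentiableOn.mul (by fun_prop) h.diff)
    (fun z h0 h1 => (h.shifted_norm_le x h0 h1).trans (by
      have : -(z.re * x) ≤ |x| := by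
        rw [← neg_mul]
        refine (le_abs_self _).trans ?_
        rw [abs_mul, abs_neg, abs_of_nonneg h0]
        exact mul_le_of_le_one_left (abs_nonneg x) h1
      gcongr))
  exact ⟨this.1, by rw [h.smoothed_eq, this.2]⟩

omit [IsProbabilityMeasure μ] in
lemma smoothed_nonneg (x : ℝ) : 0 ≤ smoothed μ x := integral_nonneg fun _ => (gpdf_pos _).le

/-- On the line Re z = a the integrand carries the factor e^(−ax), and the rest is bounded uniformly
in a. The values a = 0 and a = 1 show that the smoothed density is O(min(1, e^(−x))). -/
lemma exists_exp_mul_smoothed_le (h : StripExtension μ f) :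
    ∃ K, ∀ a, 0 ≤ a → a ≤ 1 → ∀ x, Real.exp (a * x) * smoothed μ x ≤ K := by
  have hgi : Integrable fun u : ℝ => Real.exp (1 / 2) * Real.exp (-(u ^ 2 / 2)) := by
    have := (integrable_exp_neg_mul_sq (by norm_num : (0 : ℝ) < 1 / 2)).const_mul (Real.exp (1 / 2))
    refine this.congr (Eventually.of_forall fun u => ?_)
    simp only
    ring_nf
  refine ⟨1 / (2 * Real.pi) * ∫ u : ℝ, Real.exp (1 / 2) * Real.exp (-(u ^ 2 / 2)),
    fun a ha0 ha1 x => ?_⟩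
  obtain ⟨hi, he⟩ := h.smoothed_eq_vertical x ha0 ha1
  have h1 : smoothed μ x ≤ 1 / (2 * Real.pi) * ∫ u : ℝ, Real.exp (-(a * x)) *
      (Real.exp (1 / 2) * Real.exp (-(u ^ 2 / 2))) := by
    rw [← Real.norm_of_nonneg (smoothed_nonneg (μ := μ) x), ← Complex.norm_real, he, norm_mul]
    have : ‖(1 / (2 * Real.pi) : ℂ)‖ = 1 / (2 * Real.pi) := by
      rw [show (1 / (2 * Real.pi) : ℂ) = ((1 / (2 * Real.pi) : ℝ) : ℂ) by push_cast; rfl,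
        Complex.norm_real, Real.norm_of_nonneg (by positivity)]
    rw [this]
    refine mul_le_mul_of_nonneg_left ?_ (by positivity)
    refine norm_integral_le_of_norm_le (hgi.const_mul _) (Eventually.of_forall fun u => ?_)
    have := h.shifted_norm_le x (z := a + u * Complex.I) (by simpa) (by simpa)
    simpa [mul_assoc] using this
  rw [integral_const_mul] at h1
  calc Real.exp (a * x) * smoothed μ x ≤ Real.exp (a * x) * _ :=
        mul_le_mul_of_nonneg_left h1 (Real.exp_pos _).le
    _ = (Real.exp (a * x) * Real.exp (-(a * x))) * (1 / (2 * Real.pi) *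
        ∫ u : ℝ, Real.exp (1 / 2) * Real.exp (-(u ^ 2 / 2))) := by ring
    _ = _ := by rw [← Real.exp_add, add_neg_cancel, Real.exp_zero, one_mul]

lemma continuous_smoothed : Continuous (smoothed μ) := by
  refine continuous_of_dominated (bound := fun _ => gpdf 0)
    (fun x => (continuous_gpdf.comp (by fun_prop)).aestronglyMeasurable)
    (fun x => Eventually.of_forall fun y => ?_) (integrable_const _)
    (Eventually.of_forall fun y => continuous_gpdf.comp (by fun_prop))
  rw [Real.norm_of_nonneg (gpdf_pos _).le]
  exact gpdf_le_zero _

lemma integrable_exp_mul_smoothed (h : StripExtension μ f) {a : ℝ} (ha0 : 0 < a) (ha1 : a < 1) :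
    Integrable fun x => Real.exp (a * x) * smoothed μ x := by
  obtain ⟨K, hK⟩ := h.exists_exp_mul_smoothed_le
  have hm : ∀ S : Set ℝ, AEStronglyMeasurable (fun x => Real.exp (a * x) * smoothed μ x)
      (volume.restrict S) := fun S =>
    (Continuous.mul (by fun_prop) continuous_smoothed).aestronglyMeasurable
  have hn : ∀ x, ‖Real.exp (a * x) * smoothed μ x‖ = Real.exp (a * x) * smoothed μ x := fun x =>
    Real.norm_of_nonneg (mul_nonneg (Real.exp_pos _).le (smoothed_nonneg x))
  rw [← integrableOn_univ, ← Set.Iic_union_Ioi (a := (0 : ℝ))]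
  refine IntegrableOn.union ?_ ?_
  · refine Integrable.mono' ((integrableOn_exp_mul_Iic ha0 0).const_mul K) (hm _)
      (Eventually.of_forall fun x => ?_)
    have := hK 0 le_rfl zero_le_one x
    rw [zero_mul, Real.exp_zero, one_mul] at this
    rw [hn, mul_comm]
    exact mul_le_mul_of_nonneg_right this (Real.exp_pos _).le
  · refine Integrable.mono' ((integrableOn_exp_mul_Ioi (by linarith : a - 1 < 0) 0).const_mul K)
      (hm _) (Eventually.of_forall fun x => ?_)
    have := hK 1 zero_le_one le_rfl x
    rw [one_mul] at this
    rw [hn]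
    calc Real.exp (a * x) * smoothed μ x =
          (Real.exp x * smoothed μ x) * Real.exp ((a - 1) * x) := by
            rw [mul_right_comm, ← Real.exp_add]; ring_nf
      _ ≤ _ := mul_le_mul_of_nonneg_right this (Real.exp_pos _).le

lemma integrable_exp_mul_gpdf_prod (h : StripExtension μ f) {a : ℝ} (ha0 : 0 < a) (ha1 : a < 1) :
    Integrable (fun p : ℝ × ℝ => Real.exp (a * p.1) * gpdf (p.1 - p.2)) (volume.prod μ) := by
  have hc : Continuous fun p : ℝ × ℝ => Real.exp (a * p.1) * gpdf (p.1 - p.2) :=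
    Continuous.mul (by fun_prop) (continuous_gpdf.comp (by fun_prop))
  rw [integrable_prod_iff hc.aestronglyMeasurable]
  constructor
  · refine Eventually.of_forall fun x => ?_
    show Integrable (fun y => Real.exp (a * x) * gpdf (x - y)) μ
    refine Integrable.const_mul ?_ _
    refine (integrable_const (gpdf 0)).mono'
      (continuous_gpdf.comp (by fun_prop)).aestronglyMeasurable (Eventually.of_forall fun y => ?_)
    rw [Real.norm_of_nonneg (gpdf_pos _).le]
    exact gpdf_le_zero _
  · refine (h.integrable_exp_mul_smoothed ha0 ha1).congr (Eventually.of_forall fun x => ?_)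
    simp only
    rw [smoothed, ← integral_const_mul]
    refine integral_congr_ae (Eventually.of_forall fun y => ?_)
    exact (Real.norm_of_nonneg (mul_nonneg (Real.exp_pos _).le (gpdf_pos _).le)).symm

/-- Integrating e^(ax)φ(x − y) over x gives e^(a²/2)e^(ay), so the exponential moment of the
smoothed law controls that of `μ`. -/
lemma integrable_exp_mul (h : StripExtension μ f) {a : ℝ} (ha0 : 0 < a) (ha1 : a < 1) :
    Integrable (fun y => Real.exp (a * y)) μ := by
  have h1 := (h.integrable_exp_mul_gpdf_prod ha0 ha1).integral_prod_right
  have h2 : ∀ y : ℝ, ∫ x : ℝ, Real.exp (a * x) * gpdf (x - y) =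
      Real.exp (a ^ 2 / 2) * Real.exp (a * y) := fun y => by
    have := (integral_exp_mul_gpdf a y).2
    have e : ∀ x : ℝ, Complex.exp (a * x) * gpdf (x - y) =
      ((Real.exp (a * x) * gpdf (x - y) : ℝ) : ℂ) := fun x => by push_cast; rfl
    simp only [e] at this
    rw [integral_complex_ofReal] at this
    exact_mod_cast this
  simp only [h2] at h1
  refine (h1.const_mul (Real.exp (a ^ 2 / 2))⁻¹).congr (Eventually.of_forall fun y => ?_)
  exact inv_mul_cancel_left₀ (Real.exp_pos _).ne' _

/-- The continuation is the Laplace transform of the law inside the strip. -/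
lemma integral_cexp_eq (h : StripExtension μ f) {a : ℝ} (ha0 : 0 < a) (ha1 : a < 1) (v : ℝ) :
    ∫ y : ℝ, Complex.exp ((a + v * Complex.I) * y) ∂μ = f (a + v * Complex.I) := by
  set z : ℂ := a + v * Complex.I with hz
  have hnz : ∀ x : ℝ, ‖Complex.exp (z * x)‖ = Real.exp (a * x) := fun x => by
    rw [Complex.norm_exp, Complex.re_mul_ofReal]
    simp [hz]
  -- the transform of the smoothed law
  have hF : ∫ x : ℝ, Complex.exp (z * x) * smoothed μ x =
      Complex.exp (z ^ 2 / 2) * ∫ y : ℝ, Complex.exp (z * y) ∂μ := by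
    have hprod : Integrable (fun p : ℝ × ℝ => Complex.exp (z * p.1) * gpdf (p.1 - p.2))
        (volume.prod μ) := by
      refine (h.integrable_exp_mul_gpdf_prod ha0 ha1).mono ?_ (Eventually.of_forall fun p => ?_)
      · refine Continuous.aestronglyMeasurable (Continuous.mul (by fun_prop) ?_)
        exact Complex.continuous_ofReal.comp (continuous_gpdf.comp (by fun_prop))
      · rw [norm_mul, hnz, Complex.norm_real, norm_mul, Real.norm_of_nonneg (Real.exp_pos _).le]
    have e : ∀ x : ℝ, Complex.exp (z * x) * smoothed μ x =
        ∫ y : ℝ, Complex.exp (z * x) * gpdf (x - y) ∂μ := fun x => by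
      rw [integral_const_mul, smoothed, integral_complex_ofReal]
    simp only [e]
    rw [integral_integral_swap hprod]
    simp only [(integral_exp_mul_gpdf z _).2]
    rw [integral_const_mul]
  -- inversion
  let hfun : ℝ → ℂ := fun u => Complex.exp ((a + u * Complex.I) ^ 2 / 2) * f (a + u * Complex.I)
  have hcont : Continuous hfun := by
    refine Continuous.mul (by fun_prop) (h.cont.comp_continuous (by fun_prop) fun u => ?_)
    simp [ha0.le, ha1.le]
  have hfi : Integrable hfun := by
    refine (h.smoothed_eq_vertical 0 ha0.le ha1.le).1.congr (Eventually.of_forall fun u => ?_)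
    simp [hfun]
  -- Up to scaling, the transform of e^(z²/2)f(z) along Re z = a is e^(ax) times the smoothed
  -- density. Inverting it and cancelling e^(z²/2) recovers `f` from the law.
  have hft : ∀ w : ℝ, FourierTransform.fourier hfun w =
      (2 * Real.pi : ℝ) * (Complex.exp (a * (2 * Real.pi * w : ℝ)) *
        smoothed μ (2 * Real.pi * w)) := by
    intro w
    rw [Real.fourier_real_eq_integral_exp_smul, (h.smoothed_eq_vertical _ ha0.le ha1.le).2,
      mul_left_comm, ← mul_assoc, ← mul_assoc]
    have hpi : ((2 * Real.pi : ℝ) : ℂ) * (1 / (2 * Real.pi)) = 1 := by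
      push_cast
      field_simp
    rw [mul_assoc (Complex.exp _), hpi, mul_one, ← integral_const_mul]
    refine integral_congr_ae (Eventually.of_forall fun u => ?_)
    simp only [hfun, smul_eq_mul]
    rw [← mul_assoc, ← mul_assoc, ← Complex.exp_add, ← Complex.exp_add]
    congr 2
    push_cast
    ring
  have hGi : Integrable fun x : ℝ => Complex.exp (a * x) * smoothed μ x := by
    refine (h.integrable_exp_mul_smoothed ha0 ha1).ofReal.congr (Eventually.of_forall fun x => ?_)
    simp only [RCLike.ofReal_mul]
    simp
  have hfti : Integrable (FourierTransform.fourier hfun) := by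
    have h1 := (hGi.comp_mul_left' (by positivity : (2 * Real.pi : ℝ) ≠ 0)).const_mul
      ((2 * Real.pi : ℝ) : ℂ)
    exact h1.congr (Eventually.of_forall fun w => (hft w).symm)
  have hinv := congrFun (hcont.fourierInv_fourier_eq hfi hfti) v
  rw [Real.fourierInv_eq'] at hinv
  have hlhs : ∫ w : ℝ, Complex.exp (((2 * Real.pi * inner ℝ w v : ℝ) : ℂ) * Complex.I) •
      FourierTransform.fourier hfun w = ∫ x : ℝ, Complex.exp (z * x) * smoothed μ x := by
    have hsub := Measure.integral_comp_mul_left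
      (fun x : ℝ => Complex.exp (z * x) * smoothed μ x) (2 * Real.pi)
    have e : ∀ w : ℝ, Complex.exp (((2 * Real.pi * inner ℝ w v : ℝ) : ℂ) * Complex.I) •
        FourierTransform.fourier hfun w = (2 * Real.pi : ℝ) *
          (Complex.exp (z * (2 * Real.pi * w : ℝ)) * smoothed μ (2 * Real.pi * w)) := fun w => by
      rw [hft, smul_eq_mul, mul_left_comm, ← mul_assoc (Complex.exp _), ← Complex.exp_add]
      congr 3
      simp [hz]
      ring
    simp only [e]
    rw [integral_const_mul, hsub, abs_of_pos (by positivity), Complex.real_smul, ← mul_assoc,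
      ← Complex.ofReal_mul, mul_inv_cancel₀ (by positivity), Complex.ofReal_one, one_mul]
  rw [hlhs, hF] at hinv
  exact mul_left_cancel₀ (Complex.exp_ne_zero _) hinv

lemma integral_exp_mul_eq (h : StripExtension μ f) {a : ℝ} (ha0 : 0 < a) (ha1 : a < 1) :
    ((∫ y : ℝ, Real.exp (a * y) ∂μ : ℝ) : ℂ) = f a := by
  have := h.integral_cexp_eq ha0 ha1 0
  rw [Complex.ofReal_zero, zero_mul, add_zero] at this
  rw [← this, ← integral_complex_ofReal]
  push_cast
  rfl

/-- The martingale condition. -/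
lemma integral_exp (h : StripExtension μ f) :
    Integrable Real.exp μ ∧ ∫ y, Real.exp y ∂μ = 1 := by
  let s : ℕ → ℝ := fun n => 1 - 1 / ((n : ℝ) + 2)
  have hs : ∀ n, 0 < s n ∧ s n < 1 := fun n => by
    have hn : (0 : ℝ) ≤ n := n.cast_nonneg
    have h1 : 0 < 1 / ((n : ℝ) + 2) := by positivity
    have h2 : 1 / ((n : ℝ) + 2) < 1 := by rw [div_lt_one (by positivity)]; linarith
    exact ⟨sub_pos.2 h2, by simp only [s]; linarith⟩
  have hst : Tendsto s atTop (𝓝 1) := by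
    have h1 : Tendsto (fun n : ℕ => 1 / ((n : ℝ) + 2)) atTop (𝓝 0) :=
      tendsto_const_nhds.div_atTop (tendsto_natCast_atTop_atTop.atTop_add tendsto_const_nhds)
    simpa [s] using h1.const_sub 1
  have hpt : ∀ y : ℝ, Tendsto (fun n => Real.exp (s n * y)) atTop (𝓝 (Real.exp y)) := fun y => by
    have := (Real.continuous_exp.tendsto _).comp (hst.mul_const y)
    rwa [one_mul] at this
  have hle : ∀ n, ∫ y, Real.exp (s n * y) ∂μ ≤ 1 := fun n => by
    have h1 := h.norm_le (s n) (by simpa using (hs n).1.le) (by simpa using (hs n).2.le)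
    rw [← h.integral_exp_mul_eq (hs n).1 (hs n).2, Complex.norm_real] at h1
    exact (le_abs_self _).trans h1
  have hint : Integrable Real.exp μ := by
    refine ⟨Real.continuous_exp.aestronglyMeasurable, ?_⟩
    -- Fatou along exponents increasing to 1: the moments inside the strip are at most 1 because `f`
    -- is bounded by 1 there.
    have h1 : ∫⁻ y, ‖Real.exp y‖ₑ ∂μ ≤
        liminf (fun n => ∫⁻ y, ENNReal.ofReal (Real.exp (s n * y)) ∂μ) atTop := by
      refine le_trans (le_of_eq ?_) (lintegral_liminf_le fun n => by fun_prop)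
      refine lintegral_congr fun y => ?_
      rw [← ofReal_norm, Real.norm_of_nonneg (Real.exp_pos _).le]
      exact ((ENNReal.continuous_ofReal.tendsto _).comp (hpt y)).liminf_eq.symm
    have h2 : liminf (fun n => ∫⁻ y, ENNReal.ofReal (Real.exp (s n * y)) ∂μ) atTop ≤ 1 := by
      refine liminf_le_of_le (by isBoundedDefault) fun b hb => ?_
      obtain ⟨n, hn⟩ := hb.exists
      refine hn.trans ?_
      rw [← ofReal_integral_eq_lintegral_ofReal (h.integrable_exp_mul (hs n).1 (hs n).2)
        (Eventually.of_forall fun y => (Real.exp_pos _).le)]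
      exact ENNReal.ofReal_le_one.2 (hle n)
    exact (h1.trans h2).trans_lt ENNReal.one_lt_top
  refine ⟨hint, ?_⟩
  have hlim : Tendsto (fun n => ∫ y, Real.exp (s n * y) ∂μ) atTop (𝓝 (∫ y, Real.exp y ∂μ)) := by
    refine tendsto_integral_of_dominated_convergence (fun y => 1 + Real.exp y)
      (fun n => by fun_prop) ((integrable_const _).add hint)
      (fun n => Eventually.of_forall fun y => ?_) (Eventually.of_forall hpt)
    rw [Real.norm_of_nonneg (Real.exp_pos _).le]
    rcases le_total 0 y with hy | hy
    · have : Real.exp (s n * y) ≤ Real.exp y :=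
        Real.exp_le_exp.2 (mul_le_of_le_one_left hy (hs n).2.le)
      linarith
    · have : Real.exp (s n * y) ≤ 1 :=
        Real.exp_le_one_iff.2 (mul_nonpos_of_nonneg_of_nonpos (hs n).1.le hy)
      linarith [Real.exp_pos y]
  -- Continuity of `f` up to the closed strip carries the value f(1) = 1 to the limit of the
  -- moments.
  have hlim2 : Tendsto (fun n => f (s n)) atTop (𝓝 1) := by
    have h1 : ContinuousWithinAt f {z | 0 ≤ z.re ∧ z.re ≤ 1} 1 := h.cont 1 (by simp)
    rw [ContinuousWithinAt, h.one] at h1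
    refine h1.comp (tendsto_nhdsWithin_iff.2 ⟨?_, Eventually.of_forall fun n => ?_⟩)
    · exact_mod_cast (Complex.continuous_ofReal.tendsto 1).comp hst
    · simpa using ⟨(hs n).1.le, (hs n).2.le⟩
  have hlim3 : Tendsto (fun n => ((∫ y, Real.exp (s n * y) ∂μ : ℝ) : ℂ)) atTop
      (𝓝 ((∫ y, Real.exp y ∂μ : ℝ) : ℂ)) := (Complex.continuous_ofReal.tendsto _).comp hlim
  have := tendsto_nhds_unique (hlim3.congr fun n => h.integral_exp_mul_eq (hs n).1 (hs n).2) hlim2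
  exact_mod_cast this

end StripExtension

/-! ### Powers on a vertical line -/

/-- The power `(k + i e u)^α` on a vertical line in the right half-plane. -/
def hpow (α k e u : ℝ) : ℂ := ((k : ℂ) + (e * u : ℝ) * Complex.I) ^ (α : ℂ)

section

variable {α k e : ℝ}

lemma continuous_hpow (hk : 0 < k) : Continuous (hpow α k e) := by
  refine continuous_iff_continuousAt.2 fun u => ?_
  have h1 : ContinuousAt (fun z : ℂ => z ^ (α : ℂ)) ((k : ℂ) + (e * u : ℝ) * Complex.I) :=
    continuousAt_cpow_const (Or.inl (by simpa))
  exact h1.comp (f := fun u : ℝ => (k : ℂ) + (e * u : ℝ) * Complex.I) (by fun_prop)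

lemma norm_hpow_le (hα : 0 ≤ α) (hk : 0 ≤ k) (he : e ^ 2 = 1) (u : ℝ) :
    ‖hpow α k e u‖ ≤ (k + 1) ^ α * (4 * u ^ 2 + 1) ^ (α / 2) := by
  have h1 : ‖(k : ℂ) + (e * u : ℝ) * Complex.I‖ ≤ (k + 1) * √(4 * u ^ 2 + 1) := by
    rw [Complex.norm_add_mul_I, ← Real.sqrt_sq (by linarith : 0 ≤ k + 1),
      ← Real.sqrt_mul (sq_nonneg _)]
    refine Real.sqrt_le_sqrt ?_
    rw [mul_pow, he]
    nlinarith [mul_nonneg hk (sq_nonneg u), mul_nonneg (mul_nonneg hk hk) (sq_nonneg u)]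
  rw [hpow, Complex.norm_cpow_real]
  refine (Real.rpow_le_rpow (norm_nonneg _) h1 hα).trans_eq ?_
  rw [Real.mul_rpow (by linarith) (Real.sqrt_nonneg _), Real.sqrt_eq_rpow,
    ← Real.rpow_mul (by positivity)]
  ring_nf

lemma hpow_neg (hk : 0 < k) (u : ℝ) : hpow α k e (-u) = starRingEnd ℂ (hpow α k e u) := by
  have h : (starRingEnd ℂ) ((k : ℂ) + (e * u : ℝ) * Complex.I) =
      (k : ℂ) + (e * -u : ℝ) * Complex.I := by
    simp only [map_add, map_mul, Complex.conj_ofReal, Complex.conj_I]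
    push_cast
    ring
  have harg : ((k : ℂ) + (e * u : ℝ) * Complex.I).arg ≠ Real.pi :=
    fun h => by
      rw [Complex.arg_eq_pi_iff] at h
      have h2 := h.1
      simp at h2
      linarith
  have := Complex.conj_cpow ((k : ℂ) + (e * u : ℝ) * Complex.I) (α : ℂ) harg
  rw [h, Complex.conj_ofReal] at this
  rw [hpow, this, hpow]

/-- Factoring out u > 0 leaves (k/u + ei)^α, which tends to (ei)^α = e^(ieπα/2) because the
principal power is continuous at ±i. -/
lemma tendsto_hpow_div (he : e = 1 ∨ e = -1) (hk : 0 < k) :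
    Tendsto (fun u : ℝ => hpow α k e u / (u ^ α : ℝ)) atTop
      (𝓝 (Complex.exp ((e * (Real.pi / 2) * α : ℝ) * Complex.I))) := by
  have he0 : (e : ℂ) * Complex.I ≠ 0 := by
    rcases he with rfl | rfl <;> simp
  have hlog : Complex.log (e * Complex.I) = (e * (Real.pi / 2) : ℝ) * Complex.I := by
    rcases he with rfl | rfl
    · simp [Complex.log_I]
    · simp [Complex.log_neg_I]
  have hval : ((e : ℂ) * Complex.I) ^ (α : ℂ) =
      Complex.exp ((e * (Real.pi / 2) * α : ℝ) * Complex.I) := by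
    rw [Complex.cpow_def_of_ne_zero he0, hlog]
    congr 1
    push_cast
    ring
  have hc : ContinuousAt (fun z : ℂ => z ^ (α : ℂ)) ((e : ℂ) * Complex.I) :=
    continuousAt_cpow_const (Or.inr (by rcases he with rfl | rfl <;> simp))
  have hk0 : Tendsto (fun u : ℝ => ((k / u : ℝ) : ℂ) + e * Complex.I) atTop
      (𝓝 ((e : ℂ) * Complex.I)) := by
    have h1 : Tendsto (fun u : ℝ => k / u) atTop (𝓝 0) := tendsto_const_nhds.div_atTop tendsto_id
    have h2 := ((Complex.continuous_ofReal.tendsto 0).comp h1).add_const ((e : ℂ) * Complex.I)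
    simpa using h2
  rw [← hval]
  refine (hc.tendsto.comp hk0).congr' ?_
  filter_upwards [eventually_gt_atTop 0] with u hu
  have hne : ((k / u : ℝ) : ℂ) + e * Complex.I ≠ 0 := fun h => by
    have := congrArg Complex.re h
    simp at this
    rcases this with h | h <;> linarith
  have h1 : (k : ℂ) + (e * u : ℝ) * Complex.I = (u : ℂ) * (((k / u : ℝ) : ℂ) + e * Complex.I) := by
    have : (u : ℂ) ≠ 0 := by exact_mod_cast hu.ne'
    push_cast
    field_simp
  have hu0 : (u : ℂ) ≠ 0 := by exact_mod_cast hu.ne'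
  have h2 : hpow α k e u = (u ^ α : ℝ) * (((k / u : ℝ) : ℂ) + e * Complex.I) ^ (α : ℂ) := by
    rw [hpow, h1, Complex.cpow_def_of_ne_zero (mul_ne_zero hu0 hne), Complex.log_ofReal_mul hu hne,
      add_mul, Complex.exp_add, ← Complex.cpow_def_of_ne_zero hne, Complex.ofReal_cpow hu.le,
      Complex.cpow_def_of_ne_zero hu0, Complex.ofReal_log hu.le]
  have hpos : ((u ^ α : ℝ) : ℂ) ≠ 0 := by exact_mod_cast (Real.rpow_pos_of_pos hu α).ne'
  rw [h2, mul_div_cancel_left₀ _ hpos]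
  rfl

end

/-! ### The tilted characteristic exponent -/

/-- Γ(−α) and cos(πα/2) both change sign as α crosses 1, so the product stays negative. This sign
gives p < 0 and hence the decay of the characteristic function. -/
lemma Gamma_neg_mul_cos_neg {α : ℝ} (h0 : 0 < α) (h2 : α < 2) (h1 : α ≠ 1) :
    Real.Gamma (-α) * Real.cos (Real.pi * α / 2) < 0 := by
  have hpi := Real.pi_pos
  have e1 : Real.Gamma (1 - α) = -α * Real.Gamma (-α) := by
    rw [← Real.Gamma_add_one (by linarith : -α ≠ 0)]
    ring_nf
  rcases lt_or_gt_of_ne h1 with h | h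
  · have h3 : 0 < Real.Gamma (1 - α) := Real.Gamma_pos_of_pos (by linarith)
    have h4 : 0 < Real.cos (Real.pi * α / 2) :=
      Real.cos_pos_of_mem_Ioo ⟨by nlinarith, by nlinarith⟩
    have h5 : Real.Gamma (-α) < 0 := by nlinarith
    exact mul_neg_of_neg_of_pos h5 h4
  · have e2 : Real.Gamma (2 - α) = (1 - α) * Real.Gamma (1 - α) := by
      rw [← Real.Gamma_add_one (by linarith : 1 - α ≠ 0)]
      ring_nf
    have h3 : 0 < Real.Gamma (2 - α) := Real.Gamma_pos_of_pos (by linarith)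
    have h4 : Real.cos (Real.pi * α / 2) < 0 :=
      Real.cos_neg_of_pi_div_two_lt_of_lt (by nlinarith) (by nlinarith)
    rw [e2, e1] at h3
    have h5 : 0 < Real.Gamma (-α) := by
      have h6 : 0 < (α - 1) * α := mul_pos (by linarith) h0
      have h7 : 0 < ((α - 1) * α) * Real.Gamma (-α) := by linarith
      exact (mul_pos_iff_of_pos_left h6).1 h7
    exact mul_neg_of_pos_of_neg h5 h4

namespace Params

variable (θ : Params)

lemma p_neg (h0 : 0 < θ.α) (h1 : θ.α ≠ 1) (hc : 0 < θ.cPos + θ.cNeg) : θ.p < 0 := by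
  have h := Gamma_neg_mul_cos_neg h0 θ.α_lt_two h1
  have : θ.p = (θ.cPos + θ.cNeg) * (Real.Gamma (-θ.α) * Real.cos (Real.pi * θ.α / 2)) := by
    rw [p, aPos, aNeg]; ring
  rw [this]
  exact mul_neg_of_pos_of_neg hc h

/-- The jump part of the exponent of `E exp ((1/2 + iu) X)`, without its drift. -/
def eta (u : ℝ) : ℂ := ((θ.δ + θ.γ / 2 : ℝ) : ℂ) +
  (θ.aPos * hpow θ.α (θ.κPos - 1 / 2) (-1) u + θ.aNeg * hpow θ.α (θ.κNeg + 1 / 2) 1 u)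

/-- The tilted characteristic function `E exp ((1/2 + iu) X(t))`. -/
def tchar (t u : ℝ) : ℂ := Complex.exp (t * θ.psi (1 / 2 + Complex.I * u))

lemma half_lt_κPos : 0 < θ.κPos - 1 / 2 := by linarith [θ.one_le_κPos]

lemma κNeg_add_half_pos : 0 < θ.κNeg + 1 / 2 := by linarith [θ.κNeg_nonneg]

lemma psi_half (h0 : 0 < θ.α) (h1 : θ.α ≠ 1) (u : ℝ) :
    θ.psi (1 / 2 + Complex.I * u) =
      -((θ.σ ^ 2 / 2 * (u ^ 2 + 1 / 4) : ℝ) : ℂ) + (Complex.I * (θ.γ * u : ℝ) + θ.eta u) := by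
  have e1 : (θ.κPos : ℂ) - (1 / 2 + Complex.I * u) =
      ((θ.κPos - 1 / 2 : ℝ) : ℂ) + (-1 * u : ℝ) * Complex.I := by push_cast; ring
  have e2 : (θ.κNeg : ℂ) + (1 / 2 + Complex.I * u) =
      ((θ.κNeg + 1 / 2 : ℝ) : ℂ) + (1 * u : ℝ) * Complex.I := by push_cast; ring
  rw [θ.psi_eq h0 h1 (by norm_num) (by norm_num), eta, hpow, hpow, e1, e2]
  push_cast
  linear_combination (1 / 2 * (θ.σ : ℂ) ^ 2 * u ^ 2) * Complex.I_sq

lemma continuous_eta : Continuous θ.eta := by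
  have h1 := continuous_hpow (α := θ.α) (e := -1) θ.half_lt_κPos
  have h2 := continuous_hpow (α := θ.α) (e := 1) θ.κNeg_add_half_pos
  unfold eta
  fun_prop

lemma eta_neg (u : ℝ) : θ.eta (-u) = starRingEnd ℂ (θ.eta u) := by
  rw [eta, eta, hpow_neg θ.half_lt_κPos, hpow_neg θ.κNeg_add_half_pos]
  simp only [map_add, map_mul, Complex.conj_ofReal]

lemma continuous_tchar (h0 : 0 < θ.α) (t : ℝ) : Continuous (θ.tchar t) := by
  have h1 : Continuous fun u : ℝ => θ.psi (1 / 2 + Complex.I * u) :=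
    (θ.continuousOn_psi h0).comp_continuous (by fun_prop) fun u => by norm_num
  unfold tchar
  fun_prop

lemma tchar_neg (h0 : 0 < θ.α) (h1 : θ.α ≠ 1) (t u : ℝ) :
    θ.tchar t (-u) = starRingEnd ℂ (θ.tchar t u) := by
  rw [tchar, tchar, ← Complex.exp_conj, map_mul, Complex.conj_ofReal, θ.psi_half h0 h1,
    θ.psi_half h0 h1, map_add, map_neg, map_add, map_mul, Complex.conj_ofReal, Complex.conj_I,
    Complex.conj_ofReal, eta_neg]
  congr 1
  push_cast
  ring

lemma norm_eta_le (h0 : 0 < θ.α) :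
    ∃ K, 0 < K ∧ ∀ u, ‖θ.eta u‖ ≤ K * (4 * u ^ 2 + 1) ^ (θ.α / 2) := by
  refine ⟨1 + |θ.δ + θ.γ / 2| + |θ.aPos| * (θ.κPos - 1 / 2 + 1) ^ θ.α +
    |θ.aNeg| * (θ.κNeg + 1 / 2 + 1) ^ θ.α, ?_, fun u => ?_⟩
  · have := θ.half_lt_κPos
    have := θ.κNeg_add_half_pos
    positivity
  · have h1 := norm_hpow_le h0.le θ.half_lt_κPos.le (by norm_num : (-1 : ℝ) ^ 2 = 1) u
    have h2 := norm_hpow_le h0.le θ.κNeg_add_half_pos.le (by norm_num : (1 : ℝ) ^ 2 = 1) u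
    have h3 : 1 ≤ (4 * u ^ 2 + 1) ^ (θ.α / 2) :=
      Real.one_le_rpow (by nlinarith [sq_nonneg u]) (by linarith)
    have h4 : ‖θ.eta u‖ ≤ |θ.δ + θ.γ / 2| +
        (|θ.aPos| * ‖hpow θ.α (θ.κPos - 1 / 2) (-1) u‖ +
          |θ.aNeg| * ‖hpow θ.α (θ.κNeg + 1 / 2) 1 u‖) := by
      rw [eta]
      refine (norm_add_le _ _).trans (add_le_add ?_ ((norm_add_le _ _).trans ?_))
      · rw [Complex.norm_real, Real.norm_eq_abs]
      · rw [norm_mul, norm_mul, Complex.norm_real, Complex.norm_real, Real.norm_eq_abs,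
          Real.norm_eq_abs]
    have h5 := mul_le_mul_of_nonneg_left h1 (abs_nonneg θ.aPos)
    have h6 := mul_le_mul_of_nonneg_left h2 (abs_nonneg θ.aNeg)
    have h7 := mul_le_mul_of_nonneg_left h3 (abs_nonneg (θ.δ + θ.γ / 2))
    nlinarith

/-- The exponent without its Gaussian part grows at most like a power of order `α₁ = max α 1`. -/
lemma norm_drift_add_eta_le (h0 : 0 < θ.α) {a : ℝ} (ha : θ.α ≤ a) (ha1 : 1 ≤ a) :
    ∃ K, 0 < K ∧ ∀ u : ℝ, ‖Complex.I * (θ.γ * u : ℝ) + θ.eta u‖ ≤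
      K * (4 * u ^ 2 + 1) ^ (a / 2) := by
  obtain ⟨K, hK, h⟩ := θ.norm_eta_le h0
  refine ⟨|θ.γ| + K, by positivity, fun u => ?_⟩
  have hbase : 1 ≤ 4 * u ^ 2 + 1 := by nlinarith [sq_nonneg u]
  have h1 : |u| ≤ (4 * u ^ 2 + 1) ^ (a / 2) := by
    calc |u| = √(u ^ 2) := (Real.sqrt_sq_eq_abs u).symm
      _ ≤ √(4 * u ^ 2 + 1) := Real.sqrt_le_sqrt (by nlinarith [sq_nonneg u])
      _ = (4 * u ^ 2 + 1) ^ (1 / 2 : ℝ) := Real.sqrt_eq_rpow _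
      _ ≤ _ := Real.rpow_le_rpow_of_exponent_le hbase (by linarith)
  have h2 : (4 * u ^ 2 + 1) ^ (θ.α / 2) ≤ (4 * u ^ 2 + 1) ^ (a / 2) :=
    Real.rpow_le_rpow_of_exponent_le hbase (by linarith)
  refine (norm_add_le _ _).trans ?_
  rw [norm_mul, Complex.norm_I, one_mul, Complex.norm_real, Real.norm_eq_abs, abs_mul, add_mul]
  exact add_le_add (mul_le_mul_of_nonneg_left h1 (abs_nonneg _))
    ((h u).trans (mul_le_mul_of_nonneg_left h2 hK.le))

lemma tendsto_eta_div (h0 : 0 < θ.α) :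
    Tendsto (fun u : ℝ => θ.eta u / (u ^ θ.α : ℝ)) atTop (𝓝 ((θ.p : ℂ) + θ.q * Complex.I)) := by
  have h1 := (tendsto_hpow_div (α := θ.α) (Or.inr rfl) θ.half_lt_κPos).const_mul (θ.aPos : ℂ)
  have h2 := (tendsto_hpow_div (α := θ.α) (Or.inl rfl) θ.κNeg_add_half_pos).const_mul (θ.aNeg : ℂ)
  have h3 : Tendsto (fun u : ℝ => ((θ.δ + θ.γ / 2 : ℝ) : ℂ) / (u ^ θ.α : ℝ)) atTop (𝓝 0) := by
    have : Tendsto (fun u : ℝ => (θ.δ + θ.γ / 2) / u ^ θ.α) atTop (𝓝 0) :=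
      tendsto_const_nhds.div_atTop (tendsto_rpow_atTop h0)
    have h4 := (Complex.continuous_ofReal.tendsto 0).comp this
    simpa [Function.comp_def] using h4
  have h4 := h3.add (h1.add h2)
  have e : (0 : ℂ) + (θ.aPos * Complex.exp ((-1 * (Real.pi / 2) * θ.α : ℝ) * Complex.I) +
      θ.aNeg * Complex.exp ((1 * (Real.pi / 2) * θ.α : ℝ) * Complex.I)) =
      (θ.p : ℂ) + θ.q * Complex.I := by
    rw [Complex.exp_ofReal_mul_I, Complex.exp_ofReal_mul_I, p, q,
      show -1 * (Real.pi / 2) * θ.α = -(Real.pi * θ.α / 2) by ring,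
      show 1 * (Real.pi / 2) * θ.α = Real.pi * θ.α / 2 by ring, Real.cos_neg, Real.sin_neg]
    push_cast
    ring
  rw [e] at h4
  refine h4.congr fun u => ?_
  rw [eta]
  ring

/-- Re η(u) behaves like p u^α with p < 0; using p/2 absorbs the error for large u, and the constant
covers the compact remainder. -/
lemma re_eta_le (h0 : 0 < θ.α) (h1 : θ.α ≠ 1) (hc : 0 < θ.cPos + θ.cNeg) :
    ∃ C, 0 ≤ C ∧ ∀ u : ℝ, 0 ≤ u → (θ.eta u).re ≤ C + θ.p / 2 * u ^ θ.α := by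
  have hp := θ.p_neg h0 h1 hc
  have hre : Tendsto (fun u : ℝ => (θ.eta u).re / u ^ θ.α) atTop (𝓝 θ.p) := by
    have := (Complex.continuous_re.tendsto _).comp (θ.tendsto_eta_div h0)
    simp only [Complex.add_re, Complex.ofReal_re, Complex.mul_re, Complex.I_re, mul_zero,
      Complex.ofReal_im, Complex.I_im, zero_mul, sub_self, add_zero] at this
    refine this.congr fun u => ?_
    rw [Function.comp_apply, Complex.div_ofReal_re]
  obtain ⟨U, hU⟩ := ((hre.eventually_lt_const (by linarith : θ.p < θ.p / 2)).and
    (eventually_gt_atTop 0)).exists_forall_of_atTop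
  obtain ⟨C, hC⟩ := (isCompact_Icc (a := (0 : ℝ)) (b := U)).exists_bound_of_continuousOn
    (f := fun u : ℝ => (θ.eta u).re - θ.p / 2 * u ^ θ.α)
    (((Complex.continuous_re.comp θ.continuous_eta).sub
      ((Real.continuous_rpow_const h0.le).const_mul _)).continuousOn)
  refine ⟨max C 0, le_max_right _ _, fun u hu => ?_⟩
  rcases le_total U u with h | h
  · obtain ⟨h2, h3⟩ := hU u h
    rw [div_lt_iff₀ (Real.rpow_pos_of_pos h3 _)] at h2
    linarith [le_max_right C 0]
  · have := (le_abs_self _).trans (hC u ⟨hu, h⟩)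
    linarith [le_max_left C 0]

lemma re_psi_half (h0 : 0 < θ.α) (h1 : θ.α ≠ 1) (u : ℝ) :
    (θ.psi (1 / 2 + Complex.I * u)).re = -(θ.σ ^ 2 / 2 * (u ^ 2 + 1 / 4)) + (θ.eta u).re := by
  rw [θ.psi_half h0 h1, Complex.add_re, Complex.neg_re, Complex.ofReal_re, Complex.add_re,
    mul_comm Complex.I, Complex.re_ofReal_mul, Complex.I_re, mul_zero, zero_add]

end Params

lemma integrable_of_symm {h : ℝ → ℂ} (hs : ∀ u, h (-u) = starRingEnd ℂ (h u))
    (hi : IntegrableOn h (Set.Ioi 0)) : Integrable h := by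
  have hN : IntegrableOn h (Set.Iic 0) := by
    rw [← (Measure.measurePreserving_neg (volume : Measure ℝ)).integrableOn_comp_preimage
      (Homeomorph.neg ℝ).measurableEmbedding]
    have e1 : Neg.neg ⁻¹' Set.Iic (0 : ℝ) = Set.Ici 0 := by ext; simp
    rw [e1, integrableOn_Ici_iff_integrableOn_Ioi]
    have e2 : h ∘ Neg.neg = fun u => starRingEnd ℂ (h u) := funext hs
    rw [e2]
    exact (Complex.conjLIE.toContinuousLinearEquiv.toContinuousLinearMap).integrable_comp hi
  rw [← integrableOn_univ, ← Set.Iic_union_Ioi (a := (0 : ℝ))]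
  exact hN.union hi

/-- Fourier integrals of Hermitian functions as integrals over a half-line. -/
lemma fint_eq_integral_Ioi {h : ℝ → ℂ} (hs : ∀ u, h (-u) = starRingEnd ℂ (h u))
    (hi : Integrable h) (k : ℝ) : fint h k =
      1 / Real.pi * ∫ u in Set.Ioi (0 : ℝ), (Complex.exp (-(Complex.I * u * k)) * h u).re := by
  have hI := integrable_exp_I_mul hi k
  have hre : Integrable fun u : ℝ => (Complex.exp (-(Complex.I * u * k)) * h u).re := hI.re
  have h1 : (∫ u : ℝ, Complex.exp (-(Complex.I * u * k)) * h u).re =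
      ∫ u : ℝ, (Complex.exp (-(Complex.I * u * k)) * h u).re := by
    have := integral_re (𝕜 := ℂ) hI
    simpa only [RCLike.re_to_complex] using this.symm
  have h2 : ∀ u : ℝ, (Complex.exp (-(Complex.I * (-u : ℝ) * k)) * h (-u)).re =
      (Complex.exp (-(Complex.I * u * k)) * h u).re := fun u => by
    rw [← Complex.conj_re (Complex.exp (-(Complex.I * u * k)) * h u), map_mul, ← Complex.exp_conj,
      hs]
    congr 3
    simp
  have h3 : ∫ u in Set.Iic (0 : ℝ), (Complex.exp (-(Complex.I * u * k)) * h u).re =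
      ∫ u in Set.Ioi (0 : ℝ), (Complex.exp (-(Complex.I * u * k)) * h u).re := by
    rw [← neg_zero, ← integral_comp_neg_Ioi
      (f := fun u : ℝ => (Complex.exp (-(Complex.I * u * k)) * h u).re)]
    simp only [h2, neg_zero]
  rw [fint, h1, ← setIntegral_univ, ← Set.Iic_union_Ioi (a := (0 : ℝ)),
    setIntegral_union (Set.Iic_disjoint_Ioi le_rfl) measurableSet_Ioi hre.integrableOn
      hre.integrableOn, h3]
  rw [← two_mul, ← mul_assoc]
  congr 1
  field_simp

lemma integrableOn_exp_neg_mul_rpow {α b : ℝ} (hα : 0 < α) (hb : 0 < b) :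
    IntegrableOn (fun x : ℝ => Real.exp (-b * x ^ α)) (Set.Ioi 0) := by
  have := integrableOn_rpow_mul_exp_neg_mul_rpow (p := α) (s := 0) (b := b) (by norm_num) hα hb
  simpa using this

namespace Params

variable (θ : Params)

/-- The jumps alone give decay e^(tpu^α/2), so no diffusion is needed for a continuous density. -/
lemma integrable_tchar (h0 : 0 < θ.α) (h1 : θ.α ≠ 1) (hc : 0 < θ.cPos + θ.cNeg) {t : ℝ}
    (ht : 0 < t) : Integrable (θ.tchar t) := by
  have hp := θ.p_neg h0 h1 hc
  obtain ⟨C, hC0, hC⟩ := θ.re_eta_le h0 h1 hc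
  refine integrable_of_symm (θ.tchar_neg h0 h1 t) ?_
  have hi := (integrableOn_exp_neg_mul_rpow (b := -(t * θ.p / 2)) h0 (by nlinarith)).const_mul
    (Real.exp (t * C))
  refine hi.mono' (θ.continuous_tchar h0 t).aestronglyMeasurable ?_
  filter_upwards [ae_restrict_mem measurableSet_Ioi] with u hu
  rw [tchar, Complex.norm_exp, Complex.re_ofReal_mul, θ.re_psi_half h0 h1, ← Real.exp_add,
    Real.exp_le_exp]
  have h2 := hC u (le_of_lt hu)
  have h3 : 0 ≤ θ.σ ^ 2 / 2 * (u ^ 2 + 1 / 4) := by positivity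
  nlinarith

variable {Ω : Type*} [MeasurableSpace Ω] {P : Measure Ω} [IsProbabilityMeasure P]
  {X : ℝ≥0 → Ω → ℝ}

omit [IsProbabilityMeasure P] in
lemma stripExtension {θ : Params} (hX : IsTSP θ X P) (h0 : 0 < θ.α) (h1 : θ.α ≠ 1) (t : ℝ≥0) :
    StripExtension (P.map (X t)) fun z => Complex.exp (t * θ.psi z) where
  cont := ((θ.continuousOn_psi h0).const_mul _).cexp
  diff := ((θ.differentiableOn_psi h0 h1).const_mul _).cexp
  norm_le z hz0 hz1 := by
    rw [Complex.norm_exp, Complex.re_ofReal_mul, Real.exp_le_one_iff]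
    exact mul_nonpos_of_nonneg_of_nonpos t.2 (θ.re_psi_nonpos h0 hz0 hz1)
  one := by rw [psi_one, mul_zero, Complex.exp_zero]
  charFun_eq u := by
    rw [← levyExponent_eq_psi, ← hX.charFun_eq, charFun_apply_real]
    congr 1
    ext x
    ring_nf

/-- Call prices in the tempered stable model as Fourier integrals. -/
theorem callPrice_eq_and_callCurve {θ : Params} (hX : IsTSP θ X P) (h0 : 0 < θ.α) (h1 : θ.α ≠ 1)
    (hc : 0 < θ.cPos + θ.cNeg) {τ : ℝ} (hτ : 0 < τ) :
    callPrice P X τ = fprice (θ.tchar τ) ∧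
    CallCurve (callPrice P X τ) (ftail (θ.tchar τ)) (fdens (θ.tchar τ)) := by
  have hm := hX.measurable τ.toNNReal
  have : IsProbabilityMeasure (P.map (X τ.toNNReal)) :=
    Measure.isProbabilityMeasure_map hm.aemeasurable
  have hS := stripExtension hX h0 h1 τ.toNNReal
  obtain ⟨hint, hone⟩ := hS.integral_exp
  have hφ : ∀ u : ℝ, ∫ x : ℝ, Complex.exp ((1 / 2 + Complex.I * u) * x) ∂(P.map (X τ.toNNReal)) =
      θ.tchar τ u := fun u => by
    have := hS.integral_cexp_eq (a := 1 / 2) (by norm_num) (by norm_num) u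
    rw [tchar]
    have e : ((1 / 2 : ℝ) : ℂ) + u * Complex.I = 1 / 2 + Complex.I * u := by push_cast; ring
    have e2 : (((τ.toNNReal : ℝ≥0) : ℝ) : ℂ) = (τ : ℂ) := by rw [Real.coe_toNNReal τ hτ.le]
    rw [e] at this
    rw [this, e2]
  have heq : callPrice P X τ = fprice (θ.tchar τ) := by
    ext k
    rw [callPrice, ← integral_payoff_eq_fprice hint hφ hone k, integral_map hm.aemeasurable]
    exact Continuous.aestronglyMeasurable (by fun_prop)
  refine ⟨heq, ?_⟩
  rw [heq]
  exact callCurve_of_law hint hφ hone (θ.integrable_tchar h0 h1 hc hτ)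

end Params

/-! ### Averages of powers against the kernel -/

lemma integrable_japanese {c : ℝ} (hc : c < -(1 / 2)) :
    Integrable fun u : ℝ => (4 * u ^ 2 + 1) ^ c := by
  have h := (integrable_rpow_neg_one_add_norm_sq (E := ℝ) (μ := volume) (r := -2 * c)
    (by simp; linarith)).comp_mul_left' (two_ne_zero : (2 : ℝ) ≠ 0)
  refine h.congr (Eventually.of_forall fun u => ?_)
  simp only
  rw [Real.norm_eq_abs, sq_abs]
  congr 1 <;> ring

lemma norm_kern_eq_rpow (u : ℝ) : ‖kern u‖ = 4 * (4 * u ^ 2 + 1) ^ (-1 : ℝ) := by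
  rw [norm_kern, Real.rpow_neg_one]
  field_simp

lemma rpow_mul_norm_kern (c u : ℝ) :
    (4 * u ^ 2 + 1) ^ c * ‖kern u‖ = 4 * (4 * u ^ 2 + 1) ^ (c - 1) := by
  rw [norm_kern_eq_rpow, sub_eq_add_neg, Real.rpow_add (by positivity)]
  ring

lemma fint_kern (y : ℝ) : fint kern y = Real.exp (-|y| / 2) := by
  have h := integral_exp_mul_kern (-y)
  have e : ∀ u : ℝ, Complex.exp (Complex.I * u * (-y : ℝ)) * kern u =
      Complex.exp (-(Complex.I * u * y)) * kern u := fun u => by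
    congr 2
    push_cast
    ring
  simp only [e] at h
  rw [fint, h, abs_neg, show (2 * Real.pi * Complex.exp (-(|y| : ℝ) / 2) : ℂ) =
    ((2 * Real.pi * Real.exp (-|y| / 2) : ℝ) : ℂ) by push_cast; rfl, Complex.ofReal_re]
  have := Real.pi_pos
  field_simp

/-- Write Γ(−α)s^α as the integral of (e^(−sx) − 1)x^(−α−1) and exchange integrals: averaging
e^(−sx) over the kernel gives e^(−(k + 1/2)x), so the average of s^α is (k + 1/2)^α. This produces
the constant ϱ. -/
lemma integral_hpow_mul_kern {α k e : ℝ} (h0 : 0 < α) (h1 : α < 1) (hk : 0 < k)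
    (he : e = 1 ∨ e = -1) : Integrable (fun u => hpow α k e u * kern u) ∧
    fint (fun u => hpow α k e u * kern u) 0 = (k + 1 / 2) ^ α := by
  have he2 : e ^ 2 = 1 := by rcases he with rfl | rfl <;> norm_num
  have hint : Integrable fun u => hpow α k e u * kern u := by
    refine ((integrable_japanese (c := α / 2 - 1) (by linarith)).const_mul ((k + 1) ^ α * 4)).mono'
      ((continuous_hpow hk).mul continuous_kern).aestronglyMeasurable
      (Eventually.of_forall fun u => ?_)
    rw [norm_mul, mul_assoc, ← rpow_mul_norm_kern, ← mul_assoc]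
    exact mul_le_mul_of_nonneg_right (norm_hpow_le h0.le hk.le he2 u) (norm_nonneg _)
  refine ⟨hint, ?_⟩
  have hc : ∀ s : ℂ, 0 < s.re →
      ∫ x in Set.Ioi (0 : ℝ), (Complex.exp (-s * x) - 1) * (x ^ (-α - 1) : ℝ) =
        Real.Gamma (-α) * s ^ (α : ℂ) := fun s hs => by
    have := (integral_cexpm h0 (by linarith) h1.ne (Or.inl hs)).2
    simpa [cexpm, not_lt.2 h1.le] using this
  let s : ℝ → ℂ := fun u => (k : ℂ) + (e * u : ℝ) * Complex.I
  have hs : ∀ u, 0 < (s u).re := fun u => by simpa [s]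
  -- integrability on the product
  set b := (1 + α) / 2 with hb
  have hb0 : 0 < b := by rw [hb]; linarith
  have hb1 : b < 1 := by rw [hb]; linarith
  have hx : IntegrableOn (fun x : ℝ => min (x ^ b) 1 * x ^ (-α - 1)) (Set.Ioi 0) := by
    have := integrableOn_of_norm_le_rpow (h := fun x : ℝ => ((min (x ^ b) 1 : ℝ) : ℂ)) (K := 1)
      (m := b) (n := 0) (b := α) (by fun_prop)
      (fun x hx => by
        rw [Complex.norm_real, Real.norm_of_nonneg (le_min (Real.rpow_nonneg hx.le _) zero_le_one),
          one_mul]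
        exact min_le_left _ _)
      (fun x hx => by
        rw [Complex.norm_real, Real.norm_of_nonneg (le_min (Real.rpow_nonneg hx.le _) zero_le_one),
          one_mul, Real.rpow_zero]
        exact min_le_right _ _)
      (by rw [hb]; linarith) h0
    refine this.re.congr (Eventually.of_forall fun x => ?_)
    simp only [← Complex.ofReal_mul]
    simp
  have hu : Integrable fun u : ℝ => 2 * (k + 1) ^ b * 4 * (4 * u ^ 2 + 1) ^ (b / 2 - 1) :=
    (integrable_japanese (c := b / 2 - 1) (by linarith)).const_mul _
  have hprod : Integrable (fun z : ℝ × ℝ =>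
      (Complex.exp (-s z.1 * z.2) - 1) * (z.2 ^ (-α - 1) : ℝ) * kern z.1)
      (volume.prod (volume.restrict (Set.Ioi 0))) := by
    refine (hu.mul_prod hx).mono' ?_ ?_
    · have := continuous_kern.measurable
      refine Measurable.aestronglyMeasurable ?_
      simp only [s]
      fun_prop
    · have hae : ∀ᵐ z ∂((volume : Measure ℝ).prod ((volume : Measure ℝ).restrict (Set.Ioi 0))),
          z.2 ∈ Set.Ioi (0 : ℝ) :=
        Measure.quasiMeasurePreserving_snd.ae (ae_restrict_mem measurableSet_Ioi)
      filter_upwards [hae] with z hz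
      have hz0 : (0 : ℝ) < z.2 := hz
      have hre : (-s z.1 * z.2).re ≤ 0 := by
        rw [Complex.re_mul_ofReal, Complex.neg_re]
        nlinarith [hs z.1]
      set J := (4 * z.1 ^ 2 + 1) ^ (b / 2) with hJ
      have hJ1 : 1 ≤ J := Real.one_le_rpow (by nlinarith [sq_nonneg z.1]) (by linarith)
      have hk1 : 1 ≤ (k + 1) ^ b := Real.one_le_rpow (by linarith) hb0.le
      have hsb : ‖s z.1‖ ^ b ≤ (k + 1) ^ b * J := by
        have := norm_hpow_le hb0.le hk.le he2 z.1
        rwa [hpow, Complex.norm_cpow_real] at this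
      have hE : ‖Complex.exp (-s z.1 * z.2) - 1‖ ≤ 2 * (k + 1) ^ b * J * min (z.2 ^ b) 1 := by
        have hP : 1 ≤ (k + 1) ^ b * J := one_le_mul_of_one_le_of_one_le hk1 hJ1
        have g1 : ‖Complex.exp (-s z.1 * z.2) - 1‖ ≤ 2 := norm_exp_sub_one_le_two hre
        have g2 : ‖Complex.exp (-s z.1 * z.2) - 1‖ ≤ 2 * (‖s z.1‖ * z.2) ^ b := by
          have g3 := norm_exp_sub_one_le_of_re_nonpos hre
          rw [norm_mul, norm_neg, Complex.norm_real, Real.norm_of_nonneg hz0.le] at g3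
          have hy : 0 ≤ ‖s z.1‖ * z.2 := by positivity
          rcases le_total (‖s z.1‖ * z.2) 1 with h | h
          · have : ‖s z.1‖ * z.2 ≤ (‖s z.1‖ * z.2) ^ b :=
              Real.self_le_rpow_of_le_one hy h hb1.le
            nlinarith
          · have : 1 ≤ (‖s z.1‖ * z.2) ^ b := Real.one_le_rpow h hb0.le
            linarith
        rcases le_total (z.2 ^ b) 1 with h | h
        · rw [min_eq_left h]
          refine g2.trans ?_
          rw [Real.mul_rpow (norm_nonneg _) hz0.le]
          have := mul_le_mul_of_nonneg_right hsb (Real.rpow_nonneg hz0.le b)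
          nlinarith
        · rw [min_eq_right h]
          nlinarith
      rw [norm_mul, norm_mul, Complex.norm_real, Real.norm_of_nonneg (Real.rpow_nonneg hz0.le _)]
      calc _ ≤ 2 * (k + 1) ^ b * J * min (z.2 ^ b) 1 * z.2 ^ (-α - 1) * ‖kern z.1‖ := by gcongr
        _ = 2 * (k + 1) ^ b * (J * ‖kern z.1‖) * (min (z.2 ^ b) 1 * z.2 ^ (-α - 1)) := by ring
        _ = _ := by rw [hJ, rpow_mul_norm_kern]; ring
  have hsw := integral_integral_swap (f := fun u x : ℝ =>
    (Complex.exp (-s u * x) - 1) * (x ^ (-α - 1) : ℝ) * kern u) hprod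
  have hL : ∀ u : ℝ, ∫ x in Set.Ioi (0 : ℝ),
      (Complex.exp (-s u * x) - 1) * (x ^ (-α - 1) : ℝ) * kern u =
      Real.Gamma (-α) * (hpow α k e u * kern u) := fun u => by
    rw [integral_mul_const, hc _ (hs u), mul_assoc]
    rfl
  have hR : ∀ x ∈ Set.Ioi (0 : ℝ), ∫ u : ℝ,
      (Complex.exp (-s u * x) - 1) * (x ^ (-α - 1) : ℝ) * kern u =
      2 * Real.pi * ((Complex.exp (-((k + 1 / 2 : ℝ) : ℂ) * x) - 1) * (x ^ (-α - 1) : ℝ)) :=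
      fun x hx => by
    have hx0 : (0 : ℝ) < x := hx
    have e1 : ∀ u : ℝ, (Complex.exp (-s u * x) - 1) * (x ^ (-α - 1) : ℝ) * kern u =
        (x ^ (-α - 1) : ℝ) * (Complex.exp (-k * x) *
          (Complex.exp (Complex.I * u * (-e * x : ℝ)) * kern u) -
            Complex.exp (Complex.I * u * (0 : ℝ)) * kern u) := fun u => by
      have : Complex.exp (-s u * x) = Complex.exp (-k * x) *
          Complex.exp (Complex.I * u * (-e * x : ℝ)) := by
        rw [← Complex.exp_add]
        congr 1
        simp only [s]
        push_cast
        ring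
      rw [this, Complex.ofReal_zero, mul_zero, Complex.exp_zero]
      ring
    have hi : ∀ y : ℝ, Integrable fun u : ℝ => Complex.exp (Complex.I * u * y) * kern u := fun y =>
      integrable_kern.bdd_mul (c := 1) (by fun_prop) (Eventually.of_forall fun u => by
        rw [Complex.norm_exp]; simp)
    simp only [e1]
    rw [integral_const_mul, integral_sub ((hi _).const_mul _) (hi _), integral_const_mul,
      integral_exp_mul_kern, integral_exp_mul_kern]
    have habs : |-e * x| = x := by
      rcases he with rfl | rfl
      · rw [neg_one_mul, abs_neg, abs_of_pos hx0]
      · rw [neg_neg, one_mul, abs_of_pos hx0]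
    have e2 : Complex.exp (-((k + 1 / 2 : ℝ) : ℂ) * x) =
        Complex.exp (-k * x) * Complex.exp (-(x : ℝ) / 2) := by
      rw [← Complex.exp_add]
      congr 1
      push_cast
      ring
    rw [habs, e2, abs_zero]
    simp only [Complex.ofReal_zero, neg_zero, zero_div, Complex.exp_zero]
    ring
  simp only [hL] at hsw
  rw [setIntegral_congr_fun measurableSet_Ioi hR, integral_const_mul, integral_const_mul,
    hc _ (by rw [Complex.ofReal_re]; linarith)] at hsw
  have hΓ : (Real.Gamma (-α) : ℂ) ≠ 0 := by
    have := Gamma_neg_mul_cos_neg h0 (by linarith) h1.ne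
    exact_mod_cast left_ne_zero_of_mul this.ne
  have hval : ∫ u : ℝ, hpow α k e u * kern u = ((2 * Real.pi * (k + 1 / 2) ^ α : ℝ) : ℂ) := by
    refine mul_left_cancel₀ hΓ (hsw.trans ?_)
    rw [← Complex.ofReal_cpow (by linarith)]
    push_cast
    ring
  rw [fint]
  simp only [Complex.ofReal_zero, mul_zero, neg_zero, Complex.exp_zero, one_mul]
  rw [hval, Complex.ofReal_re]
  have := Real.pi_pos
  field_simp

lemma norm_exp_sub_one_le_mul {w : ℂ} {M : ℝ} (hw : w.re ≤ M) (hM : 0 ≤ M) :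
    ‖Complex.exp w - 1‖ ≤ ‖w‖ * Real.exp M := by
  have := Convex.norm_image_sub_le_of_norm_hasDerivWithin_le
    (f := fun t : ℝ => Complex.exp (t * w)) (f' := fun t : ℝ => Complex.exp (t * w) * w)
    (C := ‖w‖ * Real.exp M) (s := Set.Icc 0 1) (x := 0) (y := 1)
    (fun t _ => by
      have h1 : HasDerivAt (fun t : ℝ => (t : ℂ) * w) (1 * w) t :=
        (hasDerivAt_id t).ofReal_comp.mul_const w
      rw [one_mul] at h1
      exact h1.cexp.hasDerivWithinAt)
    (fun t ht => by
      rw [norm_mul, Complex.norm_exp, Complex.re_ofReal_mul, mul_comm]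
      refine mul_le_mul_of_nonneg_left (Real.exp_le_exp.2 ?_) (norm_nonneg _)
      nlinarith [ht.1, ht.2])
    (convex_Icc 0 1) (Set.left_mem_Icc.2 zero_le_one) (Set.right_mem_Icc.2 zero_le_one)
  simpa using this

/-- A drift y in the exponent is a translation of the log-strike. -/
lemma fint_mul_exp {h : ℝ → ℂ} (y k : ℝ) :
    fint (fun u => Complex.exp (Complex.I * (y * u : ℝ)) * h u) k = fint h (k - y) := by
  rw [fint, fint]
  congr 3
  ext u
  rw [← mul_assoc, ← Complex.exp_add]
  congr 2
  push_cast
  ring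

namespace Params

variable (θ : Params)

lemma tchar_eq (h0 : 0 < θ.α) (h1 : θ.α ≠ 1) (t u : ℝ) : θ.tchar t u =
    bsChar (θ.σ ^ 2 * t) u * (Complex.exp (Complex.I * (θ.γ * t * u : ℝ)) *
      Complex.exp (t * θ.eta u)) := by
  rw [tchar, θ.psi_half h0 h1, bsChar, ← Complex.exp_add, ← Complex.exp_add]
  congr 1
  push_cast
  ring

/-! ### Expansion for α < 1: drift plus a remainder of order t. -/

section FiniteVariation

variable (h0 : 0 < θ.α) (h1 : θ.α < 1)
include h0 h1

lemma integrable_eta_mul_kern : Integrable fun u => θ.eta u * kern u := by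
  have g1 := (integral_hpow_mul_kern h0 h1 θ.half_lt_κPos (Or.inr rfl)).1
  have g2 := (integral_hpow_mul_kern h0 h1 θ.κNeg_add_half_pos (Or.inl rfl)).1
  refine ((integrable_kern.const_mul ((θ.δ + θ.γ / 2 : ℝ) : ℂ)).add
    ((g1.const_mul (θ.aPos : ℂ)).add (g2.const_mul (θ.aNeg : ℂ)))).congr
      (Eventually.of_forall fun u => ?_)
  simp only [Pi.add_apply, eta]
  ring

lemma fint_eta_mul_kern : fint (fun u => θ.eta u * kern u) 0 = θ.δ + θ.γ / 2 + θ.ϱ := by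
  obtain ⟨i1, g1⟩ := integral_hpow_mul_kern h0 h1 θ.half_lt_κPos (Or.inr rfl)
  obtain ⟨i2, g2⟩ := integral_hpow_mul_kern h0 h1 θ.κNeg_add_half_pos (Or.inl rfl)
  have e : (fun u => θ.eta u * kern u) = fun u => ((θ.δ + θ.γ / 2 : ℝ) : ℂ) * kern u +
      (θ.aPos * (hpow θ.α (θ.κPos - 1 / 2) (-1) u * kern u) +
        θ.aNeg * (hpow θ.α (θ.κNeg + 1 / 2) 1 u * kern u)) := by
    ext u
    rw [eta]
    ring
  have i12 : Integrable fun u => θ.aPos * (hpow θ.α (θ.κPos - 1 / 2) (-1) u * kern u) +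
      θ.aNeg * (hpow θ.α (θ.κNeg + 1 / 2) 1 u * kern u) := (i1.const_mul _).add (i2.const_mul _)
  rw [e, fint_add (integrable_kern.const_mul _) i12,
    fint_add (i1.const_mul _) (i2.const_mul _), fint_const_mul, fint_const_mul, fint_const_mul,
    g1, g2, fint_kern, abs_zero, neg_zero, zero_div, Real.exp_zero, ϱ, mul_one]
  ring_nf

omit h0 h1 in
/-- The remainder of the tilted characteristic function after splitting off the drift. -/
def remInt (t u : ℝ) : ℂ := bsChar (θ.σ ^ 2 * t) u *
  (Complex.exp (Complex.I * (θ.γ * t * u : ℝ)) * (Complex.exp (t * θ.eta u) - 1)) * kern u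

omit h0 h1 in
lemma norm_bsChar_le_one {v : ℝ} (hv : 0 ≤ v) (u : ℝ) : ‖bsChar v u‖ ≤ 1 := by
  rw [norm_bsChar, Real.exp_le_one_iff]
  exact neg_nonpos.2 (by positivity)

omit h0 h1 in
lemma continuous_remInt (t : ℝ) : Continuous (θ.remInt t) := by
  have := θ.continuous_eta
  have := continuous_kern
  have := continuous_bsChar (θ.σ ^ 2 * t)
  unfold remInt
  fun_prop

/-- Uses |e^(tη) − 1| ≤ t|η|e^C, where C bounds Re η. Since α < 1, the majorant |η·kern| is
integrable. -/
lemma norm_remInt_le (hc : 0 < θ.cPos + θ.cNeg) :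
    ∃ K, ∀ t, 0 < t → t ≤ 1 → ∀ u, ‖θ.remInt t u‖ ≤ t * (K * ‖θ.eta u * kern u‖) := by
  obtain ⟨C, hC0, hC⟩ := θ.re_eta_le h0 h1.ne hc
  have hp := θ.p_neg h0 h1.ne hc
  have hre : ∀ u, (θ.eta u).re ≤ C := fun u => by
    rcases le_total 0 u with h | h
    · have := hC u h
      have h2 := Real.rpow_nonneg h θ.α
      nlinarith
    · have := hC (-u) (by linarith)
      have h2 := Real.rpow_nonneg (neg_nonneg.2 h) θ.α
      rw [eta_neg, Complex.conj_re] at this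
      nlinarith
  refine ⟨Real.exp C, fun t ht ht1 u => ?_⟩
  have g1 : ‖Complex.exp (t * θ.eta u) - 1‖ ≤ t * ‖θ.eta u‖ * Real.exp C := by
    have := norm_exp_sub_one_le_mul (w := t * θ.eta u) (M := C)
      (by rw [Complex.re_ofReal_mul]; nlinarith [hre u]) hC0
    rwa [norm_mul, Complex.norm_real, Real.norm_of_nonneg ht.le] at this
  have g2 : ‖Complex.exp (Complex.I * (θ.γ * t * u : ℝ))‖ = 1 := Complex.norm_exp_I_mul_ofReal _
  rw [remInt, norm_mul, norm_mul, norm_mul, g2, one_mul, norm_mul]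
  calc _ ≤ 1 * (t * ‖θ.eta u‖ * Real.exp C) * ‖kern u‖ := by
        gcongr
        exact norm_bsChar_le_one (by positivity) u
    _ = _ := by ring

lemma integrable_remInt (hc : 0 < θ.cPos + θ.cNeg) {t : ℝ} (ht : 0 < t) (ht1 : t ≤ 1) :
    Integrable (θ.remInt t) := by
  obtain ⟨K, hK⟩ := θ.norm_remInt_le h0 h1 hc
  exact (((θ.integrable_eta_mul_kern h0 h1).norm.const_mul K).const_mul t).mono'
    (θ.continuous_remInt t).aestronglyMeasurable (Eventually.of_forall (hK t ht ht1))

lemma exists_abs_fint_remInt_le (hc : 0 < θ.cPos + θ.cNeg) :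
    ∃ K, ∀ t, 0 < t → t ≤ 1 → ∀ k, |fint (θ.remInt t) k| ≤ K * t := by
  obtain ⟨K, hK⟩ := θ.norm_remInt_le h0 h1 hc
  refine ⟨1 / (2 * Real.pi) * ∫ u, K * ‖θ.eta u * kern u‖, fun t ht ht1 k => ?_⟩
  refine (abs_fint_le k).trans ?_
  rw [mul_assoc, mul_comm _ t, ← integral_const_mul t]
  exact mul_le_mul_of_nonneg_left (integral_mono (θ.integrable_remInt h0 h1 hc ht ht1).norm
    (((θ.integrable_eta_mul_kern h0 h1).norm.const_mul K).const_mul t) (hK t ht ht1))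
    (by positivity)

/-- Dominated convergence with (e^(tη) − 1)/t → η; Gaussian factor, drift and strike phase all tend
to 1, so the kernel average of η remains. -/
lemma tendsto_fint_remInt (hc : 0 < θ.cPos + θ.cNeg) {k : ℝ → ℝ}
    (hk : Tendsto k (𝓝[>] 0) (𝓝 0)) :
    Tendsto (fun t => fint (θ.remInt t) (k t) / t) (𝓝[>] 0) (𝓝 (θ.δ + θ.γ / 2 + θ.ϱ)) := by
  obtain ⟨K, hK⟩ := θ.norm_remInt_le h0 h1 hc
  have ht1 : ∀ᶠ t : ℝ in 𝓝[>] 0, t ≤ 1 := nhdsWithin_le_nhds (ge_mem_nhds one_pos)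
  have hid : Tendsto (fun t : ℝ => t) (𝓝[>] 0) (𝓝 0) := tendsto_nhdsWithin_of_tendsto_nhds tendsto_id
  have key : Tendsto (fun t : ℝ => ∫ u : ℝ, Complex.exp (-(Complex.I * u * k t)) *
      ((t⁻¹ : ℝ) * θ.remInt t u)) (𝓝[>] 0)
      (𝓝 (∫ u : ℝ, Complex.exp (-(Complex.I * u * (0 : ℝ))) * (θ.eta u * kern u))) := by
    refine tendsto_integral_filter_of_dominated_convergence
      (fun u => K * ‖θ.eta u * kern u‖) (Eventually.of_forall fun t => ?_) ?_
      ((θ.integrable_eta_mul_kern h0 h1).norm.const_mul K) (Eventually.of_forall fun u => ?_)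
    · have := θ.continuous_remInt t
      exact Continuous.aestronglyMeasurable (by fun_prop)
    · filter_upwards [ht1, self_mem_nhdsWithin] with t h h'
      have h'' : (0 : ℝ) < t := h'
      refine Eventually.of_forall fun u => ?_
      rw [norm_mul, norm_exp_I_mul, one_mul, norm_mul, Complex.norm_real,
        Real.norm_of_nonneg (inv_pos.2 h'').le, inv_mul_le_iff₀ h'']
      exact hK t h' h u
    · have l1 : Tendsto (fun t => Complex.exp (-(Complex.I * u * k t))) (𝓝[>] 0)
          (𝓝 (Complex.exp (-(Complex.I * u * (0 : ℝ))))) := by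
        have : Continuous fun x : ℝ => Complex.exp (-(Complex.I * u * x)) := by fun_prop
        exact (this.tendsto 0).comp hk
      have l2 : Tendsto (fun t : ℝ => bsChar (θ.σ ^ 2 * t) u *
          Complex.exp (Complex.I * (θ.γ * t * u : ℝ))) (𝓝[>] 0) (𝓝 1) := by
        have : Continuous fun t : ℝ => bsChar (θ.σ ^ 2 * t) u *
            Complex.exp (Complex.I * (θ.γ * t * u : ℝ)) := by
          unfold bsChar
          fun_prop
        have h3 := (this.tendsto 0).comp hid
        simpa [bsChar, Function.comp_def] using h3
      have l3 : Tendsto (fun t : ℝ => ((t⁻¹ : ℝ) : ℂ) * (Complex.exp (t * θ.eta u) - 1)) (𝓝[>] 0)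
          (𝓝 (θ.eta u)) := by
        have hd : HasDerivAt (fun t : ℝ => Complex.exp (t * θ.eta u)) (θ.eta u) 0 := by
          have h3 : HasDerivAt (fun t : ℝ => (t : ℂ) * θ.eta u) (1 * θ.eta u) (0 : ℝ) :=
            (hasDerivAt_id (0 : ℝ)).ofReal_comp.mul_const _
          have := h3.cexp
          simpa using this
        have h4 := hd.tendsto_slope_zero_right
        simpa [Complex.real_smul] using h4
      have := l1.mul ((l2.mul l3).mul_const (kern u))
      rw [one_mul] at this
      refine this.congr fun t => ?_
      rw [remInt]
      ring
  have h2 := ((Complex.continuous_re.tendsto _).comp key).const_mul (1 / (2 * Real.pi))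
  rw [← θ.fint_eta_mul_kern h0 h1]
  refine Tendsto.congr' ?_ h2
  filter_upwards [self_mem_nhdsWithin] with t h
  have e : fint (fun u => (t⁻¹ : ℝ) * θ.remInt t u) (k t) = fint (θ.remInt t) (k t) / t := by
    rw [fint_const_mul, inv_mul_eq_div]
  rw [← e]
  rfl

/-- Prices split into the contribution of the drift and diffusion and a remainder. -/
lemma fprice_tchar (hc : 0 < θ.cPos + θ.cNeg) {t : ℝ} (ht : 0 < t) (ht1 : t ≤ 1) (k : ℝ) :
    fprice (θ.tchar t) k = 1 - Real.exp (k / 2) *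
      (fint (fun u => bsChar (θ.σ ^ 2 * t) u * kern u) (k - θ.γ * t) + fint (θ.remInt t) k) := by
  have hi : Integrable fun u : ℝ => Complex.exp (Complex.I * (θ.γ * t * u : ℝ)) *
      (bsChar (θ.σ ^ 2 * t) u * kern u) := by
    refine integrable_kern.mono ?_ (Eventually.of_forall fun u => ?_)
    · have := continuous_kern
      have := continuous_bsChar (θ.σ ^ 2 * t)
      exact Continuous.aestronglyMeasurable (by fun_prop)
    · rw [norm_mul, norm_mul, Complex.norm_exp_I_mul_ofReal, one_mul]
      exact mul_le_of_le_one_left (norm_nonneg _) (norm_bsChar_le_one (by positivity) u)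
  rw [fprice, ← fint_mul_exp, ← fint_add hi (θ.integrable_remInt h0 h1 hc ht ht1)]
  congr 3
  ext u
  rw [θ.tchar_eq h0 h1.ne, remInt]
  ring

end FiniteVariation

end Params

/-! ### Limits for jumps of finite variation -/

/-- As a function of the strike K = e^k the price is convex with derivative −T, so each chord slope
lies between the slopes at its ends. This turns price limits into tail limits without Fourier
analysis of the tail. -/
lemma tail_mul_le_of_convexOn {C T g : ℝ → ℝ} (hg : ConvexOn ℝ Set.univ g)
    (hgC : ∀ k, g (Real.exp k) = C k) (hd : ∀ k, HasDerivAt C (-(Real.exp k * T k)) k)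
    {k l : ℝ} (hkl : k < l) :
    T l * (Real.exp l - Real.exp k) ≤ C k - C l ∧
    C k - C l ≤ T k * (Real.exp l - Real.exp k) := by
  have hder : ∀ k, HasDerivAt g (-T k) (Real.exp k) := fun k => by
    have h1 : HasDerivAt Real.log (Real.exp k)⁻¹ (Real.exp k) :=
      Real.hasDerivAt_log (Real.exp_pos k).ne'
    have h2 : HasDerivAt C (-(Real.exp k * T k)) (Real.log (Real.exp k)) := by
      rw [Real.log_exp]
      exact hd k
    have h3 := h2.comp (Real.exp k) h1
    have h4 : -(Real.exp k * T k) * (Real.exp k)⁻¹ = -T k := by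
      have := (Real.exp_pos k).ne'
      field_simp
    rw [h4] at h3
    refine h3.congr_of_eventuallyEq ?_
    filter_upwards [lt_mem_nhds (Real.exp_pos k)] with x hx
    rw [Function.comp_apply, ← hgC, Real.exp_log hx]
  have hlt := Real.exp_lt_exp.2 hkl
  have hpos : 0 < Real.exp l - Real.exp k := sub_pos.2 hlt
  constructor
  · have := hg.slope_le_of_hasDerivAt trivial trivial hlt (hder l)
    rw [slope_def_field, div_le_iff₀ hpos, hgC, hgC] at this
    linarith
  · have := hg.le_slope_of_hasDerivAt trivial trivial hlt (hder k)
    rw [slope_def_field, le_div_iff₀ hpos, hgC, hgC] at this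
    linarith

lemma tendsto_exp_mul_sub_one_div (c : ℝ) :
    Tendsto (fun t : ℝ => (Real.exp (c * t) - 1) / t) (𝓝[>] 0) (𝓝 c) := by
  have hd : HasDerivAt (fun t : ℝ => Real.exp (c * t)) c 0 := by
    have := ((hasDerivAt_id (0 : ℝ)).const_mul c).exp
    simpa using this
  have := hd.tendsto_slope_zero_right
  simpa [div_eq_inv_mul] using this

section Model

variable {Ω : Type*} [MeasurableSpace Ω] {P : Measure Ω} [IsProbabilityMeasure P]
  {X : ℝ≥0 → Ω → ℝ} {θ : Params} (hX : IsTSP θ X P) (h0 : 0 < θ.α)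
include hX h0

lemma callPrice_tail_mul_le (h1 : θ.α ≠ 1) (hc : 0 < θ.cPos + θ.cNeg) {τ : ℝ} (hτ : 0 < τ)
    {k l : ℝ} (hkl : k < l) :
    ftail (θ.tchar τ) l * (Real.exp l - Real.exp k) ≤ callPrice P X τ k - callPrice P X τ l ∧
    callPrice P X τ k - callPrice P X τ l ≤
      ftail (θ.tchar τ) k * (Real.exp l - Real.exp k) := by
  have hm := hX.measurable τ.toNNReal
  have : IsProbabilityMeasure (P.map (X τ.toNNReal)) :=
    Measure.isProbabilityMeasure_map hm.aemeasurable
  have hint : Integrable (fun ω => Real.exp (X τ.toNNReal ω)) P :=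
    ((Params.stripExtension hX h0 h1 τ.toNNReal).integral_exp.1).comp_measurable hm
  have hi : ∀ K : ℝ, Integrable (fun ω => max (Real.exp (X τ.toNNReal ω) - K) 0) P := fun K =>
    (hint.sub (integrable_const K)).pos_part
  refine tail_mul_le_of_convexOn
    (g := fun K => ∫ ω, max (Real.exp (X τ.toNNReal ω) - K) 0 ∂P) ⟨convex_univ, ?_⟩
    (fun k => rfl) (Params.callPrice_eq_and_callCurve hX h0 h1 hc hτ).2.hasDerivAt_price hkl
  intro x _ y _ a b ha hb hab
  simp only [smul_eq_mul]
  rw [← integral_const_mul, ← integral_const_mul,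
    ← integral_add ((hi x).const_mul a) ((hi y).const_mul b)]
  refine integral_mono (hi _) (((hi x).const_mul a).add ((hi y).const_mul b)) fun ω => ?_
  beta_reduce
  have e1 := mul_le_mul_of_nonneg_left (le_max_left (Real.exp (X τ.toNNReal ω) - x) 0) ha
  have e2 := mul_le_mul_of_nonneg_left (le_max_left (Real.exp (X τ.toNNReal ω) - y) 0) hb
  have e3 := mul_nonneg ha (le_max_right (Real.exp (X τ.toNNReal ω) - x) 0)
  have e4 := mul_nonneg hb (le_max_right (Real.exp (X τ.toNNReal ω) - y) 0)
  refine max_le ?_ (by linarith)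
  have : Real.exp (X τ.toNNReal ω) = a * Real.exp (X τ.toNNReal ω) +
    b * Real.exp (X τ.toNNReal ω) := by rw [← add_mul, hab, one_mul]
  linarith

/-- Call prices at strikes of order `t`, in the case of finite variation without diffusion. -/
lemma tendsto_callPrice_div (h1 : θ.α < 1) (hσ : θ.σ = 0) (hc : 0 < θ.cPos + θ.cNeg) (c : ℝ) :
    Tendsto (fun t => callPrice P X t (c * t) / t) (𝓝[>] 0)
      (𝓝 ((|c - θ.γ| - c) / 2 - (θ.δ + θ.γ / 2 + θ.ϱ))) := by
  have hid : Tendsto (fun t : ℝ => c * t) (𝓝[>] 0) (𝓝 0) := by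
    have : Tendsto (fun t : ℝ => c * t) (𝓝 0) (𝓝 (c * 0)) := tendsto_id.const_mul c
    rw [mul_zero] at this
    exact this.mono_left nhdsWithin_le_nhds
  have hR := θ.tendsto_fint_remInt h0 h1 hc hid
  have hE := tendsto_exp_mul_sub_one_div ((c - |c - θ.γ|) / 2)
  have hexp : Tendsto (fun t : ℝ => Real.exp (c * t / 2)) (𝓝[>] 0) (𝓝 1) := by
    have := (Real.continuous_exp.tendsto _).comp (hid.div_const 2)
    simpa [Function.comp_def] using this
  have main := (hE.neg).sub (hexp.mul hR)
  have e : -((c - |c - θ.γ|) / 2) - 1 * (θ.δ + θ.γ / 2 + θ.ϱ) =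
    (|c - θ.γ| - c) / 2 - (θ.δ + θ.γ / 2 + θ.ϱ) := by ring
  rw [e] at main
  refine main.congr' ?_
  filter_upwards [self_mem_nhdsWithin, nhdsWithin_le_nhds (ge_mem_nhds one_pos)] with t ht ht1
  have ht0 : (0 : ℝ) < t := ht
  -- Without diffusion the first Fourier integral is that of the bare kernel, so the drift enters
  -- through e^(−|k − γt|/2).
  have e2 : (fun u => bsChar (θ.σ ^ 2 * t) u * kern u) = kern := by
    ext u
    simp [hσ, bsChar]
  rw [(Params.callPrice_eq_and_callCurve hX h0 h1.ne hc ht0).1, θ.fprice_tchar h0 h1 hc ht0 ht1, e2,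
    fint_kern, ← sub_mul, abs_mul, abs_of_pos ht0]
  have e3 : Real.exp ((c - |c - θ.γ|) / 2 * t) =
      Real.exp (c * t / 2) * Real.exp (-(|c - θ.γ| * t) / 2) := by
    rw [← Real.exp_add]
    ring_nf
  rw [e3]
  field_simp
  ring

/-- The smile of a process of finite variation without diffusion. -/
theorem asymptotics_of_caseA (hA : θ.CaseA) (hc : 0 < θ.cPos + θ.cNeg) :
    (θ.γ ≠ 0 → LeadingTerm (slopeRR P X) (-√(2 * Real.pi ^ 3) * θ.LA * θ.MA) (1 / 2)) ∧
    HasRate (RR P X) (1 / 2) := by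
  obtain ⟨-, h1, hσ⟩ := hA
  have hC := fun τ hτ => (Params.callPrice_eq_and_callCurve hX h0 h1.ne hc (τ := τ) hτ).2
  have hlim := tendsto_callPrice_div hX h0 h1 hσ hc
  have hL : Tendsto (fun τ => callPrice P X τ 0 / τ ^ (1 : ℝ)) (𝓝[>] 0) (𝓝 θ.LA) := by
    have := hlim 0
    have e : (|0 - θ.γ| - 0) / 2 - (θ.δ + θ.γ / 2 + θ.ϱ) = θ.LA := by
      rw [Params.LA, zero_sub, abs_neg, sub_zero]
      rcases le_total θ.γ 0 with h | h
      · rw [min_eq_left h, abs_of_nonpos h]; ring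
      · rw [min_eq_right h, abs_of_nonneg h]; ring
    rw [e] at this
    simpa using this
  have hhalf : (1 : ℝ) - 1 / 2 = 1 / 2 := by norm_num
  refine ⟨fun hγ => ?_, ?_⟩
  swap
  · have := hasRate_RR_of_isBigO hC one_pos (by
      refine isBigO_of_div_tendsto_nhds ?_ _ hL
      filter_upwards [self_mem_nhdsWithin] with τ hτ h
      rw [Real.rpow_one] at h
      exact absurd h (ne_of_gt hτ))
    rwa [hhalf] at this
  have hw := tendsto_volAt_zero hC one_pos hL
  simp only [Real.rpow_one] at hw
  have hid : Tendsto (fun t : ℝ => t) (𝓝[>] 0) (𝓝 0) := tendsto_nhdsWithin_of_tendsto_nhds tendsto_id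
  set k : ℝ → ℝ := fun t => volAt (callPrice P X t) 0 ^ 2 / 2 with hk
  have hkt : Tendsto (fun t => k t / t) (𝓝[>] 0) (𝓝 0) := by
    have := ((hw.pow 2).mul hid).div_const 2
    rw [mul_zero, zero_div] at this
    refine this.congr' ?_
    filter_upwards [self_mem_nhdsWithin] with t ht
    have : (t : ℝ) ≠ 0 := ne_of_gt ht
    simp only [hk]
    field_simp
  have hk0 : Tendsto k (𝓝[>] 0) (𝓝 0) := by
    have := hkt.mul hid
    rw [mul_zero] at this
    refine this.congr' ?_
    filter_upwards [self_mem_nhdsWithin] with t ht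
    exact div_mul_cancel₀ _ (ne_of_gt ht)
  have hke : Tendsto (fun t => (Real.exp (k t) - 1) / t) (𝓝[>] 0) (𝓝 0) := by
    have h2 : (fun x : ℝ => Real.exp x - 1) =O[𝓝 0] fun x => x := by
      have := (Real.hasDerivAt_exp 0).isBigO_sub
      simpa using this
    have h3 := ((h2.comp_tendsto hk0).mul (isBigO_refl (fun t : ℝ => t⁻¹) (𝓝[>] 0)))
    exact h3.trans_tendsto (by simpa [Function.comp_def, div_eq_mul_inv] using hkt)
  -- difference quotients of the price at the scale of the drift
  obtain ⟨c, hcdef⟩ : ∃ c, c = |θ.γ| / 2 := ⟨_, rfl⟩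
  -- With c = |γ|/2 the kink at γ of the limiting price c ↦ (|c − γ| − c)/2 + const stays outside
  -- [−c, c]. There the limit is affine with slope −(1/2 − M), so the chords on both sides have the
  -- same limiting slope.
  have hcpos : 0 < c := by rw [hcdef]; positivity
  have hlow : Tendsto (fun t => (callPrice P X t 0 / t - (Real.exp (k t) - 1) / t -
      callPrice P X t (c * t) / t) / ((Real.exp (c * t) - 1) / t)) (𝓝[>] 0)
      (𝓝 (1 / 2 - θ.MA)) := by
    have l1 := hlim 0
    simp only [zero_mul] at l1
    have := ((l1.sub hke).sub (hlim c)).div (tendsto_exp_mul_sub_one_div c) hcpos.ne'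
    suffices hval : ((|0 - θ.γ| - 0) / 2 - (θ.δ + θ.γ / 2 + θ.ϱ) - 0 -
        ((|c - θ.γ| - c) / 2 - (θ.δ + θ.γ / 2 + θ.ϱ))) / c = 1 / 2 - θ.MA by
      rw [hval] at this
      exact this
    rw [Params.MA]
    rcases lt_or_gt_of_ne hγ with h | h
    · have e : |c - θ.γ| = c - θ.γ := abs_of_pos (by linarith)
      rw [Real.sign_of_neg h, e, zero_sub, abs_neg, hcdef, abs_of_neg h]
      field_simp
      ring
    · have e : |c - θ.γ| = θ.γ - c := by
        rw [abs_sub_comm]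
        exact abs_of_pos (by rw [hcdef, abs_of_pos h]; linarith)
      rw [Real.sign_of_pos h, e, zero_sub, abs_neg, hcdef, abs_of_pos h]
      field_simp
      ring
  have hupp : Tendsto (fun t => (callPrice P X t (-c * t) / t + (Real.exp (k t) - 1) / t -
      callPrice P X t 0 / t) / (-((Real.exp (-c * t) - 1) / t))) (𝓝[>] 0)
      (𝓝 (1 / 2 - θ.MA)) := by
    have l1 := hlim 0
    simp only [zero_mul] at l1
    have := (((hlim (-c)).add hke).sub l1).div (tendsto_exp_mul_sub_one_div (-c)).neg
      (by rw [neg_neg]; exact hcpos.ne')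
    suffices hval : ((|-c - θ.γ| - -c) / 2 - (θ.δ + θ.γ / 2 + θ.ϱ) + 0 -
        ((|0 - θ.γ| - 0) / 2 - (θ.δ + θ.γ / 2 + θ.ϱ))) / -(-c) = 1 / 2 - θ.MA by
      rw [hval] at this
      exact this
    rw [Params.MA]
    rcases lt_or_gt_of_ne hγ with h | h
    · have e : |-c - θ.γ| = -c - θ.γ := abs_of_pos (by rw [hcdef, abs_of_neg h]; linarith)
      rw [Real.sign_of_neg h, e, zero_sub, abs_neg, hcdef, abs_of_neg h]
      field_simp
      ring
    · have e : |-c - θ.γ| = c + θ.γ := by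
        rw [← abs_neg]
        rw [abs_of_pos (by linarith)]
        ring
      rw [Real.sign_of_pos h, e, zero_sub, abs_neg, hcdef, abs_of_pos h]
      field_simp
      ring
  have hM : Tendsto (fun t => ftail (θ.tchar t) (k t)) (𝓝[>] 0) (𝓝 (1 / 2 - θ.MA)) := by
    have hklt : ∀ᶠ t in 𝓝[>] 0, k t / t < c := hkt.eventually_lt_const hcpos
    -- The tail at k lies between the chord slopes from k to ct and from −ct to k. Replacing C(k) by
    -- C(0) costs at most e^k − 1, which is o(t).
    refine tendsto_of_tendsto_of_tendsto_of_le_of_le' hlow hupp ?_ ?_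
    · filter_upwards [hklt, self_mem_nhdsWithin] with t h ht
      have ht0 : (0 : ℝ) < t := ht
      have hkpos : 0 ≤ k t := by positivity
      rw [div_lt_iff₀ ht0] at h
      have b1 := (callPrice_tail_mul_le hX h0 h1.ne hc ht0 h).2
      have b2 := abs_le.1 ((hC t ht0).abs_price_sub_zero_le hkpos)
      have b3 := (hC t ht0).tail_nonneg (k t)
      have b4 := Real.one_le_exp hkpos
      have b5 : 0 < Real.exp (c * t) - 1 := by
        have := Real.add_one_lt_exp (mul_pos hcpos ht0).ne'
        have := mul_pos hcpos ht0
        linarith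
      rw [← sub_div, ← sub_div, div_div_div_cancel_right₀ ht0.ne', div_le_iff₀ b5]
      nlinarith [b2.1]
    · filter_upwards [self_mem_nhdsWithin] with t ht
      have ht0 : (0 : ℝ) < t := ht
      have hkpos : 0 ≤ k t := by positivity
      have hneg : -c * t < 0 := by nlinarith
      have b1 := (callPrice_tail_mul_le hX h0 h1.ne hc ht0 (hneg.trans_le hkpos)).1
      have b2 := abs_le.1 ((hC t ht0).abs_price_sub_zero_le hkpos)
      have b3 := (hC t ht0).tail_nonneg (k t)
      have b4 := Real.one_le_exp hkpos
      have b5 : 0 < -(Real.exp (-c * t) - 1) := by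
        have := Real.exp_lt_exp.2 hneg
        rw [Real.exp_zero] at this
        linarith
      rw [← add_div, ← sub_div, ← neg_div, div_div_div_cancel_right₀ ht0.ne', le_div_iff₀ b5]
      nlinarith [b2.1]
  have := slopeRR_leadingTerm_of_tendsto hC one_pos hL hM
  rwa [hhalf] at this

end Model

/-! ### The price expansion for finite variation with diffusion -/

lemma fint_bsChar_mul_kern {w : ℝ} (hw : 0 < w) (y : ℝ) :
    fint (fun u => bsChar (w ^ 2) u * kern u) y = Real.exp (-y / 2) * (1 - bsw w y) := by
  have h := fprice_bsChar hw y
  rw [fprice] at h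
  have e : Real.exp (-y / 2) * Real.exp (y / 2) = 1 := by
    rw [← Real.exp_add, show -y / 2 + y / 2 = 0 by ring, Real.exp_zero]
  linear_combination (-Real.exp (-y / 2)) * h -
    (fint (fun u => bsChar (w ^ 2) u * kern u) y) * e

lemma bsw_lt_one {w : ℝ} (k : ℝ) : bsw w k < 1 := by
  have h1 := Phi_lt_one (-k / w + w / 2)
  have h2 := mul_pos (Real.exp_pos k) (Phi_pos (-k / w - w / 2))
  rw [bsw]
  linarith

lemma exists_bsw_strike_sub_eq {w : ℝ} (hw : 0 < w) (k y : ℝ) :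
    ∃ ξ, |ξ - k| ≤ |y| ∧
      bsw w (k - y) - bsw w k = y * (Real.exp ξ * Phi (-ξ / w - w / 2)) := by
  have key : ∀ a b : ℝ, a < b → ∃ ξ ∈ Set.Ioo a b,
      bsw w b - bsw w a = -(Real.exp ξ * Phi (-ξ / w - w / 2)) * (b - a) := by
    intro a b hab
    obtain ⟨x, hx, hxe⟩ := exists_hasDerivAt_eq_slope (fun k => bsw w k)
      (fun k => -(Real.exp k * Phi (-k / w - w / 2))) hab
      (fun x _ => (hasDerivAt_bsw_strike hw.ne' x).continuousAt.continuousWithinAt)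
      (fun x _ => hasDerivAt_bsw_strike hw.ne' x)
    exact ⟨x, hx, by rw [hxe, div_mul_cancel₀ _ (sub_pos.2 hab).ne']⟩
  rcases lt_trichotomy y 0 with h | h | h
  · obtain ⟨ξ, hξ, e⟩ := key k (k - y) (by linarith)
    refine ⟨ξ, ?_, by rw [e]; ring⟩
    rw [abs_of_neg h, abs_of_pos (sub_pos.2 hξ.1)]
    linarith [hξ.2]
  · exact ⟨k, by simp, by simp [h]⟩
  · obtain ⟨ξ, hξ, e⟩ := key (k - y) k (by linarith)
    refine ⟨ξ, ?_, by linear_combination -e⟩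
    rw [abs_of_pos h, abs_of_neg (sub_neg.2 hξ.2)]
    linarith [hξ.1]

section Diffusion

variable {θ : Params} (h0 : 0 < θ.α) (h1 : θ.α < 1) (hσ : 0 < θ.σ) (hc : 0 < θ.cPos + θ.cNeg)
include h0 h1 hσ hc

/-- Separates three effects of order t: the factor e^(γt/2), the strike shift by γt in the
Black–Scholes price, and the jump remainder. -/
lemma fprice_sub_bsw {t : ℝ} (ht : 0 < t) (ht1 : t ≤ 1) (k : ℝ) :
    fprice (θ.tchar t) k - bsw (θ.σ * √t) k =
      -((1 - bsw (θ.σ * √t) k) * (Real.exp (θ.γ / 2 * t) - 1)) +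
      Real.exp (θ.γ / 2 * t) * (bsw (θ.σ * √t) (k - θ.γ * t) - bsw (θ.σ * √t) k) -
      Real.exp (k / 2) * fint (θ.remInt t) k := by
  have hw : 0 < θ.σ * √t := mul_pos hσ (Real.sqrt_pos.2 ht)
  have e1 : θ.σ ^ 2 * t = (θ.σ * √t) ^ 2 := by rw [mul_pow, Real.sq_sqrt ht.le]
  rw [θ.fprice_tchar h0 h1 hc ht ht1, e1, fint_bsChar_mul_kern hw]
  have e2 : Real.exp (k / 2) * Real.exp (-(k - θ.γ * t) / 2) = Real.exp (θ.γ / 2 * t) := by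
    rw [← Real.exp_add]
    ring_nf
  linear_combination (-(1 - bsw (θ.σ * √t) (k - θ.γ * t))) * e2

lemma exists_abs_fprice_sub_bsw_le :
    ∃ K, ∀ᶠ t in 𝓝[>] 0, ∀ k, |k| ≤ 1 → |fprice (θ.tchar t) k - bsw (θ.σ * √t) k| ≤ K * t := by
  obtain ⟨K, hK⟩ := θ.exists_abs_fint_remInt_le h0 h1 hc
  have hE : Tendsto (fun t : ℝ => |(Real.exp (θ.γ / 2 * t) - 1) / t|) (𝓝[>] 0) (𝓝 |θ.γ / 2|) :=
    (tendsto_exp_mul_sub_one_div _).abs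
  have hg : Tendsto (fun t : ℝ => |θ.γ * t|) (𝓝[>] 0) (𝓝 0) := by
    have : Tendsto (fun t : ℝ => |θ.γ * t|) (𝓝 0) (𝓝 |θ.γ * 0|) :=
      (tendsto_id.const_mul θ.γ).abs
    rw [mul_zero, abs_zero] at this
    exact this.mono_left nhdsWithin_le_nhds
  refine ⟨(|θ.γ / 2| + 1) + Real.exp 1 * (|θ.γ| * Real.exp 2) + Real.exp 1 * |K|, ?_⟩
  filter_upwards [hE.eventually_lt_const (lt_add_one _), hg.eventually_lt_const one_pos,
    self_mem_nhdsWithin, nhdsWithin_le_nhds (ge_mem_nhds one_pos)] with t hEt hgt ht ht1 k hk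
  have ht0 : (0 : ℝ) < t := ht
  have hw : 0 < θ.σ * √t := mul_pos hσ (Real.sqrt_pos.2 ht0)
  obtain ⟨ξ, hξ, hξe⟩ := exists_bsw_strike_sub_eq hw k (θ.γ * t)
  have b1 : |(1 - bsw (θ.σ * √t) k) * (Real.exp (θ.γ / 2 * t) - 1)| ≤ (|θ.γ / 2| + 1) * t := by
    have g1 := bsw_lt_one (w := θ.σ * √t) k
    have g2 := (le_max_right _ _).trans_lt (intrinsic_lt_bsw hw k)
    rw [abs_div, abs_of_pos ht0, div_lt_iff₀ ht0] at hEt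
    rw [abs_mul, abs_of_pos (by linarith)]
    calc _ ≤ 1 * |Real.exp (θ.γ / 2 * t) - 1| := by gcongr; linarith
      _ ≤ _ := by rw [one_mul]; exact hEt.le
  have b2 : |Real.exp (θ.γ / 2 * t) * (bsw (θ.σ * √t) (k - θ.γ * t) - bsw (θ.σ * √t) k)| ≤
      Real.exp 1 * (|θ.γ| * Real.exp 2) * t := by
    have g1 : ξ ≤ 2 := by
      have := (abs_le.1 hξ).2
      have := (abs_le.1 hk).2
      linarith
    have g2 : θ.γ / 2 * t ≤ 1 := by
      have := le_abs_self (θ.γ * t)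
      linarith
    have g3 := Phi_lt_one (-ξ / (θ.σ * √t) - θ.σ * √t / 2)
    have g4 := Phi_pos (-ξ / (θ.σ * √t) - θ.σ * √t / 2)
    rw [hξe, abs_mul, abs_mul, abs_mul, abs_mul, abs_of_pos (Real.exp_pos _),
      abs_of_pos (Real.exp_pos _), abs_of_pos g4, abs_of_pos ht0]
    calc _ ≤ Real.exp 1 * (|θ.γ| * t * (Real.exp 2 * 1)) := by gcongr
      _ = _ := by ring
  have b3 : |Real.exp (k / 2) * fint (θ.remInt t) k| ≤ Real.exp 1 * |K| * t := by
    have g1 : k / 2 ≤ 1 := by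
      have := (abs_le.1 hk).2
      linarith
    rw [abs_mul, abs_of_pos (Real.exp_pos _), mul_assoc]
    have g2 := (hK t ht0 ht1 k).trans (mul_le_mul_of_nonneg_right (le_abs_self K) ht0.le)
    gcongr
  rw [fprice_sub_bsw h0 h1 hσ hc ht0 ht1]
  have c1 := abs_le.1 b1
  have c2 := abs_le.1 b2
  have c3 := abs_le.1 b3
  rw [abs_le]
  constructor <;> linarith [c1.1, c1.2, c2.1, c2.2, c3.1, c3.2]

/-- The three terms of `fprice_sub_bsw` contribute −γ/2 (the Black–Scholes price vanishes), γ/2 (as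
Φ(d₋) → 1/2) and −(δ + γ/2 + ϱ). -/
lemma tendsto_fprice_sub_bsw_div {k : ℝ → ℝ}
    (hk : Tendsto (fun t => k t / √t) (𝓝[>] 0) (𝓝 0)) :
    Tendsto (fun t => (fprice (θ.tchar t) (k t) - bsw (θ.σ * √t) (k t)) / t) (𝓝[>] 0)
      (𝓝 θ.LC) := by
  have hk0 : Tendsto k (𝓝[>] 0) (𝓝 0) := by
    have := hk.mul tendsto_sqrt_zero
    rw [mul_zero] at this
    refine this.congr' ?_
    filter_upwards [self_mem_nhdsWithin] with t ht
    exact div_mul_cancel₀ _ (Real.sqrt_pos.2 ht).ne'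
  have hE : Tendsto (fun t : ℝ => (Real.exp (θ.γ / 2 * t) - 1) / t) (𝓝[>] 0) (𝓝 (θ.γ / 2)) :=
    tendsto_exp_mul_sub_one_div _
  have hs0 : Tendsto (fun t : ℝ => θ.σ * √t) (𝓝[>] 0) (𝓝 0) := by
    simpa using tendsto_sqrt_zero.const_mul θ.σ
  have hid : Tendsto (fun t : ℝ => t) (𝓝[>] 0) (𝓝 0) := tendsto_nhdsWithin_of_tendsto_nhds tendsto_id
  have hexpg : Tendsto (fun t : ℝ => Real.exp (θ.γ / 2 * t)) (𝓝[>] 0) (𝓝 1) := by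
    have := (Real.continuous_exp.tendsto _).comp (hid.const_mul (θ.γ / 2))
    simpa [Function.comp_def] using this
  have hexpk : Tendsto (fun t : ℝ => Real.exp (k t / 2)) (𝓝[>] 0) (𝓝 1) := by
    have := (Real.continuous_exp.tendsto _).comp (hk0.div_const 2)
    simpa [Function.comp_def] using this
  have hPhi0 : ∀ {x : ℝ → ℝ}, Tendsto x (𝓝[>] 0) (𝓝 0) →
      Tendsto (fun t => Phi (x t)) (𝓝[>] 0) (𝓝 (1 / 2)) := fun {x} hx => by
    have := (continuous_Phi.tendsto 0).comp hx
    rwa [Phi_zero] at this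
  have hratio : ∀ {x : ℝ → ℝ}, Tendsto (fun t => x t / √t) (𝓝[>] 0) (𝓝 0) → ∀ a : ℝ,
      Tendsto (fun t => -x t / (θ.σ * √t) + a * (θ.σ * √t)) (𝓝[>] 0) (𝓝 0) := fun {x} hx a => by
    have := ((hx.div_const θ.σ).neg).add (hs0.const_mul a)
    rw [zero_div, neg_zero, mul_zero, add_zero] at this
    refine this.congr fun t => ?_
    rw [div_div, mul_comm √t, neg_div]
  have hbs : Tendsto (fun t => bsw (θ.σ * √t) (k t)) (𝓝[>] 0) (𝓝 0) := by
    have hexpk' : Tendsto (fun t : ℝ => Real.exp (k t)) (𝓝[>] 0) (𝓝 1) := by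
      have := (Real.continuous_exp.tendsto _).comp hk0
      simpa [Function.comp_def] using this
    have := (hPhi0 (hratio hk (1 / 2))).sub (hexpk'.mul (hPhi0 (hratio hk (-(1 / 2)))))
    rw [one_mul, sub_self] at this
    refine this.congr fun t => ?_
    rw [bsw]
    ring_nf
  have hdiff : Tendsto (fun t => (bsw (θ.σ * √t) (k t - θ.γ * t) - bsw (θ.σ * √t) (k t)) / t)
      (𝓝[>] 0) (𝓝 (θ.γ * (1 * (1 / 2)))) := by
    have hex : ∀ t : ℝ, ∃ ξ, 0 < t → (|ξ - k t| ≤ |θ.γ * t| ∧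
        bsw (θ.σ * √t) (k t - θ.γ * t) - bsw (θ.σ * √t) (k t) =
          θ.γ * t * (Real.exp ξ * Phi (-ξ / (θ.σ * √t) - θ.σ * √t / 2))) := fun t => by
      by_cases ht : 0 < t
      · obtain ⟨ξ, h⟩ := exists_bsw_strike_sub_eq (mul_pos hσ (Real.sqrt_pos.2 ht)) (k t) (θ.γ * t)
        exact ⟨ξ, fun _ => h⟩
      · exact ⟨0, fun h => absurd h ht⟩
    choose ξ hξ using hex
    have hξs : Tendsto (fun t => ξ t / √t) (𝓝[>] 0) (𝓝 0) := by
      have l1 : Tendsto (fun t => (ξ t - k t) / √t) (𝓝[>] 0) (𝓝 0) := by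
        have l2 : Tendsto (fun t : ℝ => |θ.γ| * √t) (𝓝[>] 0) (𝓝 0) := by
          simpa using tendsto_sqrt_zero.const_mul |θ.γ|
        refine squeeze_zero_norm' ?_ l2
        filter_upwards [self_mem_nhdsWithin] with t ht
        have ht0 : (0 : ℝ) < t := ht
        have hs := Real.sqrt_pos.2 ht0
        rw [Real.norm_eq_abs, abs_div, abs_of_pos hs, div_le_iff₀ hs, mul_assoc,
          Real.mul_self_sqrt ht0.le]
        have := (hξ t ht0).1
        rwa [abs_mul, abs_of_pos ht0] at this
      have := l1.add hk
      rw [add_zero] at this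
      refine this.congr fun t => ?_
      rw [← add_div, sub_add_cancel]
    have hξ0 : Tendsto ξ (𝓝[>] 0) (𝓝 0) := by
      have := hξs.mul tendsto_sqrt_zero
      rw [mul_zero] at this
      refine this.congr' ?_
      filter_upwards [self_mem_nhdsWithin] with t ht
      exact div_mul_cancel₀ _ (Real.sqrt_pos.2 ht).ne'
    have hexp : Tendsto (fun t => Real.exp (ξ t)) (𝓝[>] 0) (𝓝 1) := by
      have := (Real.continuous_exp.tendsto _).comp hξ0
      simpa [Function.comp_def] using this
    refine ((hexp.mul (hPhi0 (hratio hξs (-(1 / 2))))).const_mul θ.γ).congr' ?_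
    filter_upwards [self_mem_nhdsWithin] with t ht
    have ht0 : (0 : ℝ) < t := ht
    rw [(hξ t ht0).2]
    have : -ξ t / (θ.σ * √t) + -(1 / 2) * (θ.σ * √t) = -ξ t / (θ.σ * √t) - θ.σ * √t / 2 := by ring
    rw [this]
    field_simp
  have hR := θ.tendsto_fint_remInt h0 h1 hc hk0
  have main := (((hbs.const_sub 1).mul hE).neg.add (hexpg.mul hdiff)).sub (hexpk.mul hR)
  have e : -((1 - 0) * (θ.γ / 2)) + 1 * (θ.γ * (1 * (1 / 2))) - 1 * (θ.δ + θ.γ / 2 + θ.ϱ) =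
      θ.LC := by rw [Params.LC]; ring
  rw [e] at main
  refine main.congr' ?_
  filter_upwards [self_mem_nhdsWithin, nhdsWithin_le_nhds (ge_mem_nhds one_pos)] with t ht ht1
  have ht0 : (0 : ℝ) < t := ht
  rw [fprice_sub_bsw h0 h1 hσ hc ht0 ht1]
  field_simp

end Diffusion

/-! ### Comparison with the Black–Scholes model at the scale of the diffusion -/

/-- The substitution u = v/s on the half-line. Applied with s a square root, it brings the dominant
part of the exponent to order one. -/
lemma fint_eq_scaled {h : ℝ → ℂ} (hs : ∀ u, h (-u) = starRingEnd ℂ (h u)) (hi : Integrable h)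
    {s : ℝ} (hs0 : 0 < s) (k : ℝ) : fint h k = 1 / Real.pi *
      ∫ v in Set.Ioi (0 : ℝ),
        (Complex.exp (-(Complex.I * (v / s : ℝ) * k)) * (h (v / s) * (s⁻¹ : ℝ))).re := by
  rw [fint_eq_integral_Ioi hs hi]
  have := integral_comp_mul_left_Ioi
    (fun u : ℝ => (Complex.exp (-(Complex.I * u * k)) * h u).re) 0 (inv_pos.2 hs0)
  rw [mul_zero, inv_inv, smul_eq_mul] at this
  have e : ∫ u in Set.Ioi (0 : ℝ), (Complex.exp (-(Complex.I * u * k)) * h u).re =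
      s⁻¹ * ∫ v in Set.Ioi (0 : ℝ), (Complex.exp (-(Complex.I * (s⁻¹ * v : ℝ) * k)) *
        h (s⁻¹ * v)).re := by
    rw [this, inv_mul_cancel_left₀ hs0.ne']
  rw [e, ← integral_const_mul]
  congr 2
  ext v
  rw [show s⁻¹ * v = v / s from inv_mul_eq_div s v, ← mul_assoc, Complex.re_mul_ofReal, mul_comm]

lemma kern_neg (u : ℝ) : kern (-u) = starRingEnd ℂ (kern u) := by
  rw [kern, kern, map_inv₀, Complex.conj_ofReal, neg_sq]

lemma inv_half_add_neg (u : ℝ) : (1 / 2 + Complex.I * (-u : ℝ) : ℂ)⁻¹ =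
    starRingEnd ℂ (1 / 2 + Complex.I * u : ℂ)⁻¹ := by
  rw [map_inv₀]
  congr 1
  simp [Complex.conj_ofNat]

lemma bsChar_neg (w u : ℝ) : bsChar w (-u) = starRingEnd ℂ (bsChar w u) := by
  rw [bsChar, bsChar, ← Complex.exp_conj]
  congr 1
  simp [Complex.conj_ofNat]

lemma kern_scaled {t : ℝ} (ht : 0 < t) (v : ℝ) :
    kern (v / √t) * ((√t)⁻¹ : ℝ) = ((√t * (4 * (4 * v ^ 2 + t)⁻¹) : ℝ) : ℂ) := by
  have hs := Real.sqrt_pos.2 ht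
  rw [kern, ← Complex.ofReal_inv, ← Complex.ofReal_mul]
  congr 1
  have h3 : 0 < v ^ 2 * 4 + t := by positivity
  have h5 := Real.sq_sqrt ht.le
  have h4 : (v / √t) ^ 2 + 1 / 4 = (4 * v ^ 2 + t) / (4 * t) := by
    rw [div_pow, h5]
    field_simp
  rw [h4, inv_div]
  have h6 : t = √t * √t := (Real.mul_self_sqrt ht.le).symm
  nth_rewrite 1 [h6]
  have h7 : 4 * v ^ 2 + t ≠ 0 := by positivity
  field_simp

namespace Params

variable (θ : Params)

/-- The exponent of the tilted characteristic function without its Gaussian part. -/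
def jexp (u : ℝ) : ℂ := Complex.I * (θ.γ * u : ℝ) + θ.eta u

/-- Difference from the tilted characteristic function of the Black–Scholes model. -/
def tdiff (t u : ℝ) : ℂ := θ.tchar t u - bsChar (θ.σ ^ 2 * t) u

lemma continuous_jexp : Continuous θ.jexp := by
  have := θ.continuous_eta
  unfold jexp
  fun_prop

lemma continuous_tdiff (h0 : 0 < θ.α) (t : ℝ) : Continuous (θ.tdiff t) :=
  (θ.continuous_tchar h0 t).sub (continuous_bsChar _)

lemma tdiff_neg (h0 : 0 < θ.α) (h1 : θ.α ≠ 1) (t u : ℝ) :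
    θ.tdiff t (-u) = starRingEnd ℂ (θ.tdiff t u) := by
  rw [tdiff, tdiff, map_sub, θ.tchar_neg h0 h1, bsChar_neg]

lemma tdiff_eq (h0 : 0 < θ.α) (h1 : θ.α ≠ 1) (t u : ℝ) :
    θ.tdiff t u = bsChar (θ.σ ^ 2 * t) u * (Complex.exp (t * θ.jexp u) - 1) := by
  rw [tdiff, θ.tchar_eq h0 h1, ← Complex.exp_add, mul_sub, mul_one, jexp]
  congr 3
  push_cast
  ring

lemma re_eta_le_const (h0 : 0 < θ.α) (h1 : θ.α ≠ 1) (hc : 0 < θ.cPos + θ.cNeg) :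
    ∃ C, 0 ≤ C ∧ ∀ u, (θ.eta u).re ≤ C := by
  obtain ⟨C, hC0, hC⟩ := θ.re_eta_le h0 h1 hc
  have hp := θ.p_neg h0 h1 hc
  refine ⟨C, hC0, fun u => ?_⟩
  rcases le_total 0 u with h | h
  · have := hC u h
    have h2 := Real.rpow_nonneg h θ.α
    nlinarith
  · have := hC (-u) (by linarith)
    have h2 := Real.rpow_nonneg (neg_nonneg.2 h) θ.α
    rw [eta_neg, Complex.conj_re] at this
    nlinarith

lemma re_jexp (u : ℝ) : (θ.jexp u).re = (θ.eta u).re := by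
  rw [jexp, Complex.add_re, mul_comm Complex.I, Complex.re_ofReal_mul, Complex.I_re, mul_zero,
    zero_add]

lemma rpow_scaled {t : ℝ} (ht : 0 < t) (v b : ℝ) :
    (4 * (v / √t) ^ 2 + 1) ^ b = (4 * v ^ 2 + t) ^ b * t ^ (-b) := by
  have e : 4 * (v / √t) ^ 2 + 1 = (4 * v ^ 2 + t) / t := by
    rw [div_pow, Real.sq_sqrt ht.le]
    field_simp
  rw [e, Real.div_rpow (by positivity) ht.le, Real.rpow_neg ht.le, div_eq_mul_inv]

lemma norm_bsChar_scaled_le {t : ℝ} (ht : 0 < t) (v : ℝ) :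
    ‖bsChar (θ.σ ^ 2 * t) (v / √t)‖ ≤ Real.exp (-(θ.σ ^ 2 / 2) * v ^ 2) := by
  rw [norm_bsChar, Real.exp_le_exp, div_pow, Real.sq_sqrt ht.le]
  have e : θ.σ ^ 2 * t / 2 * (v ^ 2 / t + 1 / 4) = θ.σ ^ 2 / 2 * v ^ 2 + θ.σ ^ 2 * t / 8 := by
    field_simp
    ring
  rw [e]
  have : 0 ≤ θ.σ ^ 2 * t / 8 := by positivity
  linarith

/-! ### Estimates and limits at frequencies v/√t. -/

section Scaled

variable (h0 : 0 < θ.α) (h1 : θ.α ≠ 1) (hc : 0 < θ.cPos + θ.cNeg) {a : ℝ} (ha : θ.α ≤ a)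
  (ha1 : 1 ≤ a) (ha2 : a < 2)

-- Here a is a growth order of the non-Gaussian exponent j: a = 1 when the drift dominates (case C)
-- and a = α in case D. Since |e^(tj) − 1| ≤ t|j|e^C and |j(v/√t)| ≤ K(4v² + t)^(a/2) t^(−a/2), the
-- powers of t cancel exactly.
include h0 h1 hc ha ha1 in
lemma exists_norm_tdiff_le : ∃ K, 0 < K ∧ ∀ t, 0 < t → t ≤ 1 → ∀ v,
    ‖((t ^ (-(1 - a / 2)) : ℝ) : ℂ) * θ.tdiff t (v / √t)‖ ≤
      K * (Real.exp (-(θ.σ ^ 2 / 2) * v ^ 2) * (4 * v ^ 2 + t) ^ (a / 2)) := by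
  obtain ⟨C, hC0, hC⟩ := θ.re_eta_le_const h0 h1 hc
  obtain ⟨K, hK0, hK⟩ := θ.norm_drift_add_eta_le h0 ha ha1
  refine ⟨K * Real.exp C, by positivity, fun t ht ht1 v => ?_⟩
  have g1 : ‖Complex.exp (t * θ.jexp (v / √t)) - 1‖ ≤ t * ‖θ.jexp (v / √t)‖ * Real.exp C := by
    have := norm_exp_sub_one_le_mul (w := t * θ.jexp (v / √t)) (M := C)
      (by rw [Complex.re_ofReal_mul, re_jexp]; nlinarith [hC (v / √t)]) hC0
    rwa [norm_mul, Complex.norm_real, Real.norm_of_nonneg ht.le] at this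
  have g2 := hK (v / √t)
  rw [rpow_scaled ht] at g2
  have g3 := θ.norm_bsChar_scaled_le ht v
  rw [θ.tdiff_eq h0 h1, norm_mul, Complex.norm_real,
    Real.norm_of_nonneg (Real.rpow_nonneg ht.le _), norm_mul]
  calc _ ≤ t ^ (-(1 - a / 2)) * (Real.exp (-(θ.σ ^ 2 / 2) * v ^ 2) *
        (t * (K * ((4 * v ^ 2 + t) ^ (a / 2) * t ^ (-(a / 2)))) * Real.exp C)) := by
        refine mul_le_mul_of_nonneg_left (mul_le_mul g3 (g1.trans ?_) (norm_nonneg _)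
          (Real.exp_pos _).le) (Real.rpow_nonneg ht.le _)
        exact mul_le_mul_of_nonneg_right (mul_le_mul_of_nonneg_left g2 ht.le) (Real.exp_pos _).le
    _ = (t ^ (-(1 - a / 2)) * t ^ (1 : ℝ) * t ^ (-(a / 2))) * (K * Real.exp C *
        (Real.exp (-(θ.σ ^ 2 / 2) * v ^ 2) * (4 * v ^ 2 + t) ^ (a / 2))) := by
        rw [Real.rpow_one]; ring
    _ = _ := by
        rw [← Real.rpow_add ht, ← Real.rpow_add ht,
          show -(1 - a / 2) + 1 + -(a / 2) = 0 by ring, Real.rpow_zero, one_mul]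

variable {Λ : ℝ → ℂ}
  (hΛ : ∀ v, 0 < v → Tendsto (fun t : ℝ => ((t ^ (a / 2) : ℝ) : ℂ) * θ.jexp (v / √t)) (𝓝[>] 0)
    (𝓝 (Λ v)))

include h0 h1 ha2 hΛ in
lemma tendsto_tdiff_scaled {v : ℝ} (hv : 0 < v) :
    Tendsto (fun t : ℝ => ((t ^ (-(1 - a / 2)) : ℝ) : ℂ) * θ.tdiff t (v / √t)) (𝓝[>] 0)
      (𝓝 ((Real.exp (-(θ.σ ^ 2 / 2) * v ^ 2) : ℝ) * Λ v)) := by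
  have hb : Tendsto (fun t : ℝ => bsChar (θ.σ ^ 2 * t) (v / √t)) (𝓝[>] 0)
      (𝓝 ((Real.exp (-(θ.σ ^ 2 / 2) * v ^ 2) : ℝ) : ℂ)) := by
    have hcont : Continuous fun t : ℝ =>
        ((Real.exp (-(θ.σ ^ 2 / 2) * v ^ 2 - θ.σ ^ 2 * t / 8) : ℝ) : ℂ) := by fun_prop
    have h2 := (hcont.tendsto 0).mono_left (nhdsWithin_le_nhds (s := Set.Ioi (0 : ℝ)))
    rw [mul_zero, zero_div, sub_zero] at h2
    refine h2.congr' ?_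
    filter_upwards [self_mem_nhdsWithin] with t ht
    have ht0 : (0 : ℝ) < t := ht
    rw [bsChar, Complex.ofReal_exp]
    congr 1
    have e : θ.σ ^ 2 * t / 2 * ((v / √t) ^ 2 + 1 / 4) = θ.σ ^ 2 / 2 * v ^ 2 + θ.σ ^ 2 * t / 8 := by
      rw [div_pow, Real.sq_sqrt ht0.le]
      field_simp
      ring
    have e' := congrArg (fun x : ℝ => (x : ℂ)) e
    push_cast at e' ⊢
    rw [e']
    ring
  have he : 0 < 1 - a / 2 := by linarith
  have hz : Tendsto (fun t : ℝ => (t : ℂ) * θ.jexp (v / √t)) (𝓝[>] 0) (𝓝 0) := by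
    have h2 : Tendsto (fun t : ℝ => ((t ^ (1 - a / 2) : ℝ) : ℂ)) (𝓝[>] 0) (𝓝 0) := by
      have := (Complex.continuous_ofReal.tendsto 0).comp (tendsto_rpow_zero he)
      simpa [Function.comp_def] using this
    have h3 := h2.mul (hΛ v hv)
    rw [zero_mul] at h3
    refine h3.congr' ?_
    filter_upwards [self_mem_nhdsWithin] with t ht
    rw [← mul_assoc, ← Complex.ofReal_mul, ← Real.rpow_add ht, show 1 - a / 2 + a / 2 = 1 by ring,
      Real.rpow_one]
  -- `dslope` extends (e^z − 1)/z continuously by 1 at z = 0, so the exponent need not be nonzero.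
  have hq : Tendsto (fun t : ℝ => dslope (fun z : ℂ => Complex.exp z - 1) 0
      (t * θ.jexp (v / √t))) (𝓝[>] 0) (𝓝 1) := by
    have hd : HasDerivAt (fun z : ℂ => Complex.exp z - 1) 1 0 := by
      simpa using (Complex.hasDerivAt_exp 0).sub_const 1
    have hcs : ContinuousAt (dslope (fun z : ℂ => Complex.exp z - 1) 0) 0 :=
      continuousAt_dslope_same.2 hd.differentiableAt
    have := hcs.tendsto.comp hz
    rwa [dslope_same, hd.deriv] at this
  have main := hb.mul ((hΛ v hv).mul hq)
  rw [mul_one] at main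
  refine main.congr' ?_
  filter_upwards [self_mem_nhdsWithin] with t ht
  have ht0 : (0 : ℝ) < t := ht
  have e1 : Complex.exp (t * θ.jexp (v / √t)) - 1 = (t * θ.jexp (v / √t)) *
      dslope (fun z : ℂ => Complex.exp z - 1) 0 (t * θ.jexp (v / √t)) := by
    have := sub_smul_dslope (fun z : ℂ => Complex.exp z - 1) 0 (t * θ.jexp (v / √t))
    simpa using this.symm
  have e2 : ((t ^ (-(1 - a / 2)) : ℝ) : ℂ) * t = ((t ^ (a / 2) : ℝ) : ℂ) := by
    rw [← Complex.ofReal_mul, ← Real.rpow_add_one ht0.ne']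
    congr 2
    ring
  rw [θ.tdiff_eq h0 h1, e1, ← e2]
  ring

variable {m : ℝ → ℝ → ℂ} {m0 : ℝ → ℂ} {B : ℝ → ℝ} (hB : IntegrableOn B (Set.Ioi 0))
  (hm : ∀ t, 0 < t → t ≤ 1 → ∀ v, 0 < v →
    Real.exp (-(θ.σ ^ 2 / 2) * v ^ 2) * (4 * v ^ 2 + t) ^ (a / 2) * ‖m t v‖ ≤ B v)
  (hmc : ∀ t, Measurable (m t))

/-- The integrals over the scaled half-line that represent prices, tails and densities. -/
def scaledInt (a : ℝ) (m : ℝ → ℝ → ℂ) (t k : ℝ) : ℝ := ∫ v in Set.Ioi (0 : ℝ),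
  (Complex.exp (-(Complex.I * (v / √t : ℝ) * k)) *
    (((t ^ (-(1 - a / 2)) : ℝ) * θ.tdiff t (v / √t)) * m t v)).re

include h0 h1 hc ha ha1 hB hm in
lemma exists_abs_scaledInt_le : ∃ K, ∀ t, 0 < t → t ≤ 1 → ∀ k, |θ.scaledInt a m t k| ≤ K := by
  obtain ⟨K, hK0, hK⟩ := θ.exists_norm_tdiff_le h0 h1 hc ha ha1
  refine ⟨∫ v in Set.Ioi (0 : ℝ), K * B v, fun t ht ht1 k => ?_⟩
  rw [← Real.norm_eq_abs, scaledInt]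
  refine norm_integral_le_of_norm_le (hB.const_mul K) ?_
  filter_upwards [ae_restrict_mem measurableSet_Ioi] with v hv
  refine (Complex.abs_re_le_norm _).trans ?_
  rw [norm_mul, norm_exp_I_mul, one_mul, norm_mul]
  calc _ ≤ K * (Real.exp (-(θ.σ ^ 2 / 2) * v ^ 2) * (4 * v ^ 2 + t) ^ (a / 2)) * ‖m t v‖ :=
        mul_le_mul_of_nonneg_right (hK t ht ht1 v) (norm_nonneg _)
    _ ≤ _ := by
        rw [mul_assoc]
        exact mul_le_mul_of_nonneg_left (hm t ht ht1 v hv) hK0.le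

include h0 h1 hc ha ha1 ha2 hΛ hB hm hmc in
lemma tendsto_scaledInt
    (hm0 : ∀ v, 0 < v → Tendsto (fun t => m t v) (𝓝[>] 0) (𝓝 (m0 v)))
    {k : ℝ → ℝ} (hk : Tendsto (fun t => k t / √t) (𝓝[>] 0) (𝓝 0)) :
    Tendsto (fun t => θ.scaledInt a m t (k t)) (𝓝[>] 0)
      (𝓝 (∫ v in Set.Ioi (0 : ℝ),
        ((Real.exp (-(θ.σ ^ 2 / 2) * v ^ 2) : ℝ) * Λ v * m0 v).re)) := by
  obtain ⟨K, hK0, hK⟩ := θ.exists_norm_tdiff_le h0 h1 hc ha ha1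
  refine tendsto_integral_filter_of_dominated_convergence (fun v => K * B v)
    (Eventually.of_forall fun t => ?_) ?_ (hB.const_mul K) ?_
  · have g1 := (θ.continuous_tdiff h0 t).measurable
    have g3 : Measurable fun v : ℝ => θ.tdiff t (v / √t) := g1.comp (by fun_prop)
    have g4 : Measurable fun v : ℝ => Complex.exp (-(Complex.I * (v / √t : ℝ) * k t)) := by fun_prop
    exact (Complex.measurable_re.comp
      (g4.mul ((measurable_const.mul g3).mul (hmc t)))).aestronglyMeasurable
  · filter_upwards [self_mem_nhdsWithin, nhdsWithin_le_nhds (ge_mem_nhds one_pos)] with t ht ht1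
    filter_upwards [ae_restrict_mem measurableSet_Ioi] with v hv
    refine (Complex.abs_re_le_norm _).trans ?_
    rw [norm_mul, norm_exp_I_mul, one_mul, norm_mul]
    calc _ ≤ K * (Real.exp (-(θ.σ ^ 2 / 2) * v ^ 2) * (4 * v ^ 2 + t) ^ (a / 2)) * ‖m t v‖ :=
          mul_le_mul_of_nonneg_right (hK t ht ht1 v) (norm_nonneg _)
      _ ≤ _ := by
          rw [mul_assoc]
          exact mul_le_mul_of_nonneg_left (hm t ht ht1 v hv) hK0.le
  · filter_upwards [ae_restrict_mem measurableSet_Ioi] with v hv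
    have hv0 : 0 < v := hv
    have l1 : Tendsto (fun t => Complex.exp (-(Complex.I * (v / √t : ℝ) * k t))) (𝓝[>] 0)
        (𝓝 1) := by
      have hcont : Continuous fun x : ℝ => Complex.exp (-(Complex.I * v * x)) := by fun_prop
      have := (hcont.tendsto 0).comp hk
      rw [Complex.ofReal_zero, mul_zero, neg_zero, Complex.exp_zero] at this
      refine this.congr fun t => ?_
      simp only [Function.comp_apply]
      congr 2
      push_cast
      ring
    have := l1.mul ((θ.tendsto_tdiff_scaled h0 h1 ha2 hΛ hv0).mul (hm0 v hv0))
    rw [one_mul] at this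
    exact (Complex.continuous_re.tendsto _).comp this

end Scaled

/-! ### Deviations from Black–Scholes as scaled integrals. -/

section Represent

variable (h0 : 0 < θ.α) (h1 : θ.α ≠ 1) (hσ : 0 < θ.σ) (hc : 0 < θ.cPos + θ.cNeg) (a : ℝ)
include h0 h1 hσ hc

lemma integrable_tdiff {t : ℝ} (ht : 0 < t) : Integrable (θ.tdiff t) :=
  (θ.integrable_tchar h0 h1 hc ht).sub (integrable_bsChar (by positivity))

lemma ftail_sub_eq {t : ℝ} (ht : 0 < t) (k : ℝ) :
    (ftail (θ.tchar t) k - Phi (-k / (θ.σ * √t) - θ.σ * √t / 2)) / t ^ (1 - a / 2) =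
      Real.exp (-k / 2) * (1 / Real.pi *
        θ.scaledInt a (fun t v => ((√t / 2 : ℝ) + Complex.I * v)⁻¹) t k) := by
  have hs := Real.sqrt_pos.2 ht
  have hw : 0 < θ.σ * √t := mul_pos hσ hs
  have e1 : θ.σ ^ 2 * t = (θ.σ * √t) ^ 2 := by rw [mul_pow, Real.sq_sqrt ht.le]
  have hT := θ.integrable_tchar h0 h1 hc ht
  have hBS : Integrable (bsChar (θ.σ ^ 2 * t)) := integrable_bsChar (by positivity)
  have hD := θ.integrable_tdiff h0 h1 hσ hc ht
  rw [← ftail_bsChar hw, ← e1, ftail, ftail, ← mul_sub,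
    ← fint_sub (integrable_mul_inv_half_add hT) (integrable_mul_inv_half_add hBS), mul_div_assoc]
  congr 1
  have e2 : (fun u : ℝ => θ.tchar t u * (1 / 2 + Complex.I * u)⁻¹ -
      bsChar (θ.σ ^ 2 * t) u * (1 / 2 + Complex.I * u)⁻¹) =
      fun u : ℝ => θ.tdiff t u * (1 / 2 + Complex.I * u)⁻¹ := by
    ext u
    rw [tdiff]
    ring
  rw [e2, fint_eq_scaled (fun u => by rw [θ.tdiff_neg h0 h1, inv_half_add_neg, map_mul])
    (integrable_mul_inv_half_add hD) hs, mul_div_assoc, ← integral_div, scaledInt]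
  congr 2
  ext v
  have hne : ((√t : ℝ) : ℂ) ≠ 0 := by exact_mod_cast hs.ne'
  have e3 : (1 / 2 + Complex.I * (v / √t : ℝ))⁻¹ * ((√t)⁻¹ : ℝ) =
      (((√t / 2 : ℝ) : ℂ) + Complex.I * v)⁻¹ := by
    rw [Complex.ofReal_inv, ← mul_inv]
    congr 1
    push_cast
    field_simp
  rw [← e3, Real.rpow_neg ht.le, ← Complex.div_ofReal_re]
  congr 1
  push_cast
  ring

lemma fdens_sub_eq {t : ℝ} (ht : 0 < t) (k : ℝ) :
    t ^ (1 / 2 - (1 - a / 2)) *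
      (fdens (θ.tchar t) k - gpdf (-k / (θ.σ * √t) - θ.σ * √t / 2) / (θ.σ * √t)) =
      Real.exp (-k / 2) * (1 / Real.pi * θ.scaledInt a (fun _ _ => 1) t k) := by
  have hs := Real.sqrt_pos.2 ht
  have hw : 0 < θ.σ * √t := mul_pos hσ hs
  have e1 : θ.σ ^ 2 * t = (θ.σ * √t) ^ 2 := by rw [mul_pow, Real.sq_sqrt ht.le]
  have hT := θ.integrable_tchar h0 h1 hc ht
  have hBS : Integrable (bsChar (θ.σ ^ 2 * t)) := integrable_bsChar (by positivity)
  have hD := θ.integrable_tdiff h0 h1 hσ hc ht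
  rw [← fdens_bsChar hw, ← e1, fdens, fdens, ← mul_sub, ← fint_sub hT hBS, mul_left_comm]
  congr 1
  have e2 : (fun u : ℝ => θ.tchar t u - bsChar (θ.σ ^ 2 * t) u) = θ.tdiff t := rfl
  rw [e2, fint_eq_scaled (θ.tdiff_neg h0 h1 t) hD hs, mul_left_comm, ← integral_const_mul,
    scaledInt]
  congr 2
  ext v
  rw [← Complex.re_ofReal_mul, sub_eq_add_neg (1 / 2), Real.rpow_add ht, ← Real.sqrt_eq_rpow]
  have hne : ((√t : ℝ) : ℂ) ≠ 0 := by exact_mod_cast hs.ne'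
  congr 1
  push_cast
  field_simp

lemma fprice_sub_eq {t : ℝ} (ht : 0 < t) (k : ℝ) :
    (fprice (θ.tchar t) k - bsw (θ.σ * √t) k) / t ^ (1 / 2 + (1 - a / 2)) =
      -(Real.exp (k / 2) * (1 / Real.pi *
        θ.scaledInt a (fun t v => ((4 * (4 * v ^ 2 + t)⁻¹ : ℝ) : ℂ)) t k)) := by
  have hs := Real.sqrt_pos.2 ht
  have hw : 0 < θ.σ * √t := mul_pos hσ hs
  have e1 : θ.σ ^ 2 * t = (θ.σ * √t) ^ 2 := by rw [mul_pow, Real.sq_sqrt ht.le]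
  have hT := θ.integrable_tchar h0 h1 hc ht
  have hBS : Integrable (bsChar (θ.σ ^ 2 * t)) := integrable_bsChar (by positivity)
  have hD := θ.integrable_tdiff h0 h1 hσ hc ht
  rw [← fprice_bsChar hw, ← e1, fprice, fprice, sub_sub_sub_cancel_left, ← mul_sub, ← neg_sub,
    mul_neg, neg_div,
    ← fint_sub (integrable_mul_kern hT) (integrable_mul_kern hBS), mul_div_assoc]
  congr 2
  have e2 : (fun u : ℝ => θ.tchar t u * kern u - bsChar (θ.σ ^ 2 * t) u * kern u) =
      fun u : ℝ => θ.tdiff t u * kern u := by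
    ext u
    rw [tdiff]
    ring
  rw [e2, fint_eq_scaled (fun u => by rw [θ.tdiff_neg h0 h1, kern_neg, map_mul])
    (integrable_mul_kern hD) hs, mul_div_assoc, ← integral_div, scaledInt]
  congr 2
  ext v
  have hne : ((√t : ℝ) : ℂ) ≠ 0 := by exact_mod_cast hs.ne'
  rw [mul_assoc (θ.tdiff t _), kern_scaled ht, rpow_half_add ht, Real.rpow_neg ht.le, ← Complex.div_ofReal_re]
  congr 1
  have hte : (((t ^ (1 - a / 2) : ℝ)) : ℂ) ≠ 0 := by
    exact_mod_cast (Real.rpow_pos_of_pos ht _).ne'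
  rw [Complex.ofReal_mul, Complex.ofReal_mul √t, Complex.ofReal_inv]
  field_simp

end Represent

end Params

/-! ### The cases with a Brownian component -/

lemma integrableOn_rpow_mul_gaussian {σ s : ℝ} (hσ : 0 < σ) (hs : 0 < s) :
    IntegrableOn (fun v : ℝ => v ^ (s - 1) * Real.exp (-(σ ^ 2 / 2) * v ^ 2)) (Set.Ioi 0) :=
  integrableOn_rpow_mul_exp_neg_mul_sq (by positivity) (by linarith)

lemma integral_rpow_mul_gaussian {σ s : ℝ} (hσ : 0 < σ) (hs : 0 < s) :
    ∫ v in Set.Ioi (0 : ℝ), v ^ (s - 1) * Real.exp (-(σ ^ 2 / 2) * v ^ 2) =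
      2 ^ ((s - 2) / 2) * Real.Gamma (s / 2) * σ ^ (-s) := by
  have := integral_rpow_mul_exp_neg_mul_rpow (p := 2) (q := s - 1) (b := σ ^ 2 / 2) two_pos
    (by linarith) (by positivity)
  simp_rw [Real.rpow_two] at this
  rw [this, sub_add_cancel, Real.div_rpow (by positivity) zero_le_two, ← Real.rpow_two,
    ← Real.rpow_mul hσ.le, show (2 : ℝ) * (-s / 2) = -s by ring,
    show (s - 2) / 2 = -1 - -s / 2 by ring, Real.rpow_sub two_pos, Real.rpow_neg_one]
  ring

lemma integrableOn_sq_add_mul_gaussian {σ : ℝ} (hσ : 0 < σ) (c : ℝ) :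
    IntegrableOn (fun v : ℝ => c * ((4 * v ^ 2 + 1) * Real.exp (-(σ ^ 2 / 2) * v ^ 2)))
      (Set.Ioi 0) := by
  have h1 := integrableOn_rpow_mul_gaussian (s := 3) hσ (by norm_num)
  have h2 := integrableOn_rpow_mul_gaussian (s := 1) hσ (by norm_num)
  refine IntegrableOn.congr_fun (((h1.const_mul 4).add h2).const_mul c) (fun v _ => ?_)
    measurableSet_Ioi
  simp only [Pi.add_apply]
  rw [show (3 : ℝ) - 1 = 2 by norm_num, Real.rpow_two, sub_self, Real.rpow_zero]
  ring

lemma sq_add_rpow_le {t b : ℝ} (ht : 0 < t) (ht1 : t ≤ 1) (hb0 : 0 ≤ b) (hb1 : b ≤ 1) (v : ℝ) :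
    (4 * v ^ 2 + t) ^ b ≤ 4 * v ^ 2 + 1 := by
  have h := sq_nonneg v
  calc (4 * v ^ 2 + t) ^ b ≤ (4 * v ^ 2 + 1) ^ b :=
        Real.rpow_le_rpow (by positivity) (by linarith) hb0
    _ ≤ (4 * v ^ 2 + 1) ^ (1 : ℝ) := Real.rpow_le_rpow_of_exponent_le (by linarith) hb1
    _ = _ := Real.rpow_one _

lemma norm_inv_half_add_scaled {t : ℝ} (ht : 0 < t) (v : ℝ) :
    ‖(((√t / 2 : ℝ) : ℂ) + Complex.I * v)⁻¹‖ = 2 * (4 * v ^ 2 + t) ^ (-(1 / 2) : ℝ) := by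
  have h4 : √4 = (2 : ℝ) := by rw [show (4 : ℝ) = 2 ^ 2 by norm_num, Real.sqrt_sq zero_le_two]
  rw [norm_inv, mul_comm Complex.I, Complex.norm_add_mul_I, div_pow, Real.sq_sqrt ht.le,
    Real.rpow_neg (by positivity), ← Real.sqrt_eq_rpow,
    show t / 2 ^ 2 + v ^ 2 = (4 * v ^ 2 + t) / 4 by ring, Real.sqrt_div (by positivity), h4, inv_div,
    div_eq_mul_inv]

namespace Params

variable (θ : Params)

/-- The free exponent b serves both regimes: b = α/2 keeps the jump exponent (L = 1), and b = 1/2 >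
α/2 makes it negligible against the drift (L = 0). -/
lemma tendsto_rpow_mul_eta_scaled (h0 : 0 < θ.α) {b : ℝ} {v : ℝ} (hv : 0 < v) {L : ℝ}
    (hL : Tendsto (fun t : ℝ => t ^ (b - θ.α / 2)) (𝓝[>] 0) (𝓝 L)) :
    Tendsto (fun t : ℝ => ((t ^ b : ℝ) : ℂ) * θ.eta (v / √t)) (𝓝[>] 0)
      (𝓝 ((L : ℂ) * ((v ^ θ.α : ℝ) * (θ.p + θ.q * Complex.I)))) := by
  have hu : Tendsto (fun t : ℝ => v / √t) (𝓝[>] 0) atTop := by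
    have h1 : Tendsto (fun t : ℝ => √t) (𝓝[>] 0) (𝓝[>] 0) :=
      tendsto_nhdsWithin_iff.2 ⟨tendsto_sqrt_zero, by
        filter_upwards [self_mem_nhdsWithin] with t ht using Real.sqrt_pos.2 ht⟩
    exact (tendsto_inv_nhdsGT_zero.comp h1).const_mul_atTop hv
  have h2 := (θ.tendsto_eta_div h0).comp hu
  have h3 : Tendsto (fun t : ℝ => ((t ^ (b - θ.α / 2) : ℝ) : ℂ)) (𝓝[>] 0) (𝓝 L) :=
    (Complex.continuous_ofReal.tendsto L).comp hL
  refine (h3.mul (h2.const_mul ((v ^ θ.α : ℝ) : ℂ))).congr' ?_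
  filter_upwards [self_mem_nhdsWithin] with t ht
  have ht0 : (0 : ℝ) < t := ht
  have hs := Real.sqrt_pos.2 ht0
  have e1 : (v / √t) ^ θ.α = v ^ θ.α * t ^ (-(θ.α / 2)) := by
    rw [Real.div_rpow hv.le hs.le, Real.sqrt_eq_rpow, ← Real.rpow_mul ht0.le,
      show 1 / 2 * θ.α = θ.α / 2 by ring, Real.rpow_neg ht0.le, div_eq_mul_inv]
  have e2 : t ^ b = t ^ (b - θ.α / 2) * (t ^ (-(θ.α / 2)))⁻¹ := by
    rw [Real.rpow_neg ht0.le, inv_inv, ← Real.rpow_add ht0, sub_add_cancel]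
  have g1 : ((v ^ θ.α : ℝ) : ℂ) ≠ 0 := by exact_mod_cast (Real.rpow_pos_of_pos hv _).ne'
  have g2 : ((t ^ (-(θ.α / 2)) : ℝ) : ℂ) ≠ 0 := by exact_mod_cast (Real.rpow_pos_of_pos ht0 _).ne'
  rw [Function.comp_apply, e1, e2, Complex.ofReal_mul, Complex.ofReal_mul, Complex.ofReal_inv]
  field_simp

lemma tendsto_rpow_mul_jexp_scaled (h1 : 1 < θ.α) {v : ℝ} (hv : 0 < v) :
    Tendsto (fun t : ℝ => ((t ^ (θ.α / 2) : ℝ) : ℂ) * θ.jexp (v / √t)) (𝓝[>] 0)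
      (𝓝 ((v ^ θ.α : ℝ) * (θ.p + θ.q * Complex.I))) := by
  have h0 : 0 < θ.α := by linarith
  have l1 := θ.tendsto_rpow_mul_eta_scaled h0 (b := θ.α / 2) hv (L := 1) (by
    rw [sub_self]; simp only [Real.rpow_zero]; exact tendsto_const_nhds)
  rw [Complex.ofReal_one, one_mul] at l1
  have l2 : Tendsto (fun t : ℝ => ((t ^ (θ.α / 2 - 1 / 2) : ℝ) : ℂ)) (𝓝[>] 0) (𝓝 0) := by
    have := (Complex.continuous_ofReal.tendsto 0).comp
      (tendsto_rpow_zero (by linarith : 0 < θ.α / 2 - 1 / 2))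
    simpa [Function.comp_def] using this
  have l3 := (l2.mul_const (Complex.I * (θ.γ * v : ℝ))).add l1
  rw [zero_mul, zero_add] at l3
  refine l3.congr' ?_
  filter_upwards [self_mem_nhdsWithin] with t ht
  have hs : ((√t : ℝ) : ℂ) ≠ 0 := by exact_mod_cast (Real.sqrt_pos.2 ht).ne'
  rw [Params.jexp, mul_add, Real.rpow_sub ht, ← Real.sqrt_eq_rpow]
  congr 1
  push_cast
  field_simp

section Limits

variable (h0 : 0 < θ.α) (h1 : θ.α ≠ 1) (hσ : 0 < θ.σ) (hc : 0 < θ.cPos + θ.cNeg) {a : ℝ}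
  (ha : θ.α ≤ a) (ha1 : 1 ≤ a) (ha2 : a < 2) {Λ : ℝ → ℂ}
  (hΛ : ∀ v, 0 < v → Tendsto (fun t : ℝ => ((t ^ (a / 2) : ℝ) : ℂ) * θ.jexp (v / √t)) (𝓝[>] 0)
    (𝓝 (Λ v)))
  {k : ℝ → ℝ} (hk : Tendsto (fun t => k t / √t) (𝓝[>] 0) (𝓝 0))

include hk in
lemma tendsto_exp_const_mul_strike (c : ℝ) :
    Tendsto (fun t => Real.exp (c * k t)) (𝓝[>] 0) (𝓝 1) := by
  have hk0 : Tendsto k (𝓝[>] 0) (𝓝 0) := by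
    have := hk.mul tendsto_sqrt_zero
    rw [mul_zero] at this
    refine this.congr' ?_
    filter_upwards [self_mem_nhdsWithin] with t ht
    exact div_mul_cancel₀ _ (Real.sqrt_pos.2 ht).ne'
  have := (Real.continuous_exp.tendsto _).comp (hk0.const_mul c)
  simpa [Function.comp_def] using this

include h0 h1 hσ hc ha ha1 ha2 hΛ hk

lemma tendsto_ftail_sub_div :
    Tendsto (fun t => (ftail (θ.tchar t) (k t) - Phi (-k t / (θ.σ * √t) - θ.σ * √t / 2)) /
      t ^ (1 - a / 2)) (𝓝[>] 0) (𝓝 (1 / Real.pi * ∫ v in Set.Ioi (0 : ℝ),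
        ((Real.exp (-(θ.σ ^ 2 / 2) * v ^ 2) : ℝ) * Λ v * (Complex.I * v)⁻¹).re)) := by
  have hlim := θ.tendsto_scaledInt h0 h1 hc ha ha1 ha2 hΛ
    (m := fun t v => (((√t / 2 : ℝ) : ℂ) + Complex.I * v)⁻¹) (m0 := fun v => (Complex.I * v)⁻¹)
    (integrableOn_sq_add_mul_gaussian hσ 2) ?_ ?_ ?_ hk
  · have := (tendsto_exp_const_mul_strike hk (-(1 / 2))).mul (hlim.const_mul (1 / Real.pi))
    rw [one_mul] at this
    refine this.congr' ?_
    filter_upwards [self_mem_nhdsWithin] with t ht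
    rw [θ.ftail_sub_eq h0 h1 hσ hc a ht, show -k t / 2 = -(1 / 2) * k t by ring]
  · intro t ht ht1 v hv
    have h := sq_nonneg v
    have hpos : 0 < 4 * v ^ 2 + t := by positivity
    rw [norm_inv_half_add_scaled ht]
    calc _ = 2 * (((4 * v ^ 2 + t) ^ (a / 2) * (4 * v ^ 2 + t) ^ (-(1 / 2) : ℝ)) *
          Real.exp (-(θ.σ ^ 2 / 2) * v ^ 2)) := by ring
      _ ≤ _ := by
        rw [← Real.rpow_add hpos]
        have := sq_add_rpow_le ht ht1 (b := a / 2 + -(1 / 2)) (by linarith) (by linarith) v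
        gcongr
  · intro t
    fun_prop
  · intro v hv
    have hcont : ContinuousAt (fun s : ℝ => (((s / 2 : ℝ) : ℂ) + Complex.I * v)⁻¹) 0 := by
      refine ContinuousAt.inv₀ (by fun_prop) ?_
      simpa using hv.ne'
    have := hcont.tendsto.comp tendsto_sqrt_zero
    simpa [Function.comp_def] using this

lemma tendsto_rpow_mul_fdens_sub :
    Tendsto (fun t => t ^ (1 / 2 - (1 - a / 2)) * (fdens (θ.tchar t) (k t) -
      gpdf (-k t / (θ.σ * √t) - θ.σ * √t / 2) / (θ.σ * √t))) (𝓝[>] 0)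
      (𝓝 (1 / Real.pi * ∫ v in Set.Ioi (0 : ℝ),
        ((Real.exp (-(θ.σ ^ 2 / 2) * v ^ 2) : ℝ) * Λ v).re)) := by
  have hlim := θ.tendsto_scaledInt h0 h1 hc ha ha1 ha2 hΛ
    (m := fun _ _ => 1) (m0 := fun _ => 1)
    (integrableOn_sq_add_mul_gaussian hσ 1) ?_ (fun _ => measurable_const)
    (fun _ _ => tendsto_const_nhds) hk
  · have := (tendsto_exp_const_mul_strike hk (-(1 / 2))).mul (hlim.const_mul (1 / Real.pi))
    rw [one_mul] at this
    simp_rw [mul_one] at this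
    refine this.congr' ?_
    filter_upwards [self_mem_nhdsWithin] with t ht
    rw [θ.fdens_sub_eq h0 h1 hσ hc a ht, show -k t / 2 = -(1 / 2) * k t by ring]
  · intro t ht ht1 v hv
    rw [norm_one, mul_one, one_mul, mul_comm]
    have := sq_add_rpow_le ht ht1 (b := a / 2) (by linarith) (by linarith) v
    gcongr

-- The scaled price kernel is singular like v^(−2), so the majorant v^(a−2) is integrable at 0 only
-- for a > 1. For this reason the price in case C, where a = 1, comes from `fprice_sub_bsw`.
omit h0 h1 hc hΛ hk ha ha1 in
lemma price_multiplier_bound (ha' : 1 < a) :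
    IntegrableOn (fun v : ℝ => 4 * 4 ^ (a / 2 - 1) *
      (v ^ (a - 1 - 1) * Real.exp (-(θ.σ ^ 2 / 2) * v ^ 2))) (Set.Ioi 0) ∧
    ∀ t, 0 < t → t ≤ 1 → ∀ v : ℝ, 0 < v →
      Real.exp (-(θ.σ ^ 2 / 2) * v ^ 2) * (4 * v ^ 2 + t) ^ (a / 2) *
        ‖((4 * (4 * v ^ 2 + t)⁻¹ : ℝ) : ℂ)‖ ≤
      4 * 4 ^ (a / 2 - 1) * (v ^ (a - 1 - 1) * Real.exp (-(θ.σ ^ 2 / 2) * v ^ 2)) := by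
  refine ⟨(integrableOn_rpow_mul_gaussian hσ (by linarith)).const_mul _, fun t ht ht1 v hv => ?_⟩
  have hpos : 0 < 4 * v ^ 2 + t := by positivity
  rw [Complex.norm_real, Real.norm_of_nonneg (by positivity)]
  have e1 : v ^ (a - 1 - 1) * 4 ^ (a / 2 - 1) = (4 * v ^ 2) ^ (a / 2 - 1) := by
    rw [Real.mul_rpow (by norm_num) (by positivity), ← Real.rpow_two, ← Real.rpow_mul hv.le,
      mul_comm]
    congr 2
    ring
  have e2 : (4 * v ^ 2 + t) ^ (a / 2 - 1) ≤ (4 * v ^ 2) ^ (a / 2 - 1) :=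
    Real.rpow_le_rpow_of_nonpos (by positivity) (by linarith) (by linarith)
  rw [← e1, Real.rpow_sub_one hpos.ne'] at e2
  have e3 : 0 < Real.exp (-(θ.σ ^ 2 / 2) * v ^ 2) := Real.exp_pos _
  calc _ = 4 * Real.exp (-(θ.σ ^ 2 / 2) * v ^ 2) * ((4 * v ^ 2 + t) ^ (a / 2) / (4 * v ^ 2 + t)) := by
        ring
    _ ≤ 4 * Real.exp (-(θ.σ ^ 2 / 2) * v ^ 2) * (v ^ (a - 1 - 1) * 4 ^ (a / 2 - 1)) := by gcongr
    _ = _ := by ring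

omit ha1 in
lemma tendsto_fprice_sub_div (ha' : 1 < a) :
    Tendsto (fun t => (fprice (θ.tchar t) (k t) - bsw (θ.σ * √t) (k t)) /
      t ^ (1 / 2 + (1 - a / 2))) (𝓝[>] 0) (𝓝 (-(1 / Real.pi * ∫ v in Set.Ioi (0 : ℝ),
        ((Real.exp (-(θ.σ ^ 2 / 2) * v ^ 2) : ℝ) * Λ v *
          ((4 * (4 * v ^ 2)⁻¹ : ℝ) : ℂ)).re))) := by
  obtain ⟨hB, hm⟩ := θ.price_multiplier_bound hσ ha2 ha'
  have hlim := θ.tendsto_scaledInt h0 h1 hc ha ha'.le ha2 hΛ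
    (m := fun t v => ((4 * (4 * v ^ 2 + t)⁻¹ : ℝ) : ℂ))
    (m0 := fun v => ((4 * (4 * v ^ 2)⁻¹ : ℝ) : ℂ)) hB hm ?_ ?_ hk
  · have := ((tendsto_exp_const_mul_strike hk (1 / 2)).mul (hlim.const_mul (1 / Real.pi))).neg
    rw [one_mul] at this
    refine this.congr' ?_
    filter_upwards [self_mem_nhdsWithin] with t ht
    rw [θ.fprice_sub_eq h0 h1 hσ hc a ht, show k t / 2 = 1 / 2 * k t by ring]
  · intro t
    fun_prop
  · intro v hv
    have hcont : ContinuousAt (fun s : ℝ => ((4 * (4 * v ^ 2 + s)⁻¹ : ℝ) : ℂ)) 0 := by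
      refine Complex.continuous_ofReal.continuousAt.comp (ContinuousAt.mul (by fun_prop)
        (ContinuousAt.inv₀ (by fun_prop) ?_))
      rw [add_zero]
      positivity
    have := hcont.tendsto.mono_left (nhdsWithin_le_nhds (s := Set.Ioi (0 : ℝ)))
    simpa only [add_zero] using this

omit hΛ hk ha1 in
lemma exists_abs_fprice_sub_bsw_le_rpow (ha' : 1 < a) :
    ∃ K, ∀ᶠ t in 𝓝[>] 0, ∀ k, |k| ≤ 1 →
      |fprice (θ.tchar t) k - bsw (θ.σ * √t) k| ≤ K * t ^ (1 / 2 + (1 - a / 2)) := by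
  obtain ⟨hB, hm⟩ := θ.price_multiplier_bound hσ ha2 ha'
  obtain ⟨K, hK⟩ := θ.exists_abs_scaledInt_le h0 h1 hc ha ha'.le
    (m := fun t v => ((4 * (4 * v ^ 2 + t)⁻¹ : ℝ) : ℂ)) hB hm
  refine ⟨Real.exp 1 * (1 / Real.pi * K), ?_⟩
  filter_upwards [self_mem_nhdsWithin, nhdsWithin_le_nhds (ge_mem_nhds one_pos)] with t ht ht1 k hk
  have ht0 : (0 : ℝ) < t := ht
  have hp := Real.rpow_pos_of_pos ht0 (1 / 2 + (1 - a / 2))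
  rw [← div_le_iff₀ hp]
  nth_rewrite 1 [← abs_of_pos hp]
  rw [← abs_div,
    θ.fprice_sub_eq h0 h1 hσ hc a ht, abs_neg, abs_mul, abs_mul, abs_of_pos (Real.exp_pos _),
    abs_of_pos (by positivity : 0 < 1 / Real.pi)]
  have g := hK t ht0 ht1 k
  have g2 : k / 2 ≤ 1 := by linarith [(abs_le.1 hk).2]
  gcongr

end Limits

end Params

section Cases

variable {Ω : Type*} [MeasurableSpace Ω] {P : Measure Ω} [IsProbabilityMeasure P] {θ : Params}
  {X : ℝ≥0 → Ω → ℝ} (hX : IsTSP θ X P)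
include hX

/-- Since α < 1 the drift dominates the exponent at frequency 1/√t. It determines M, while the jumps
enter only through the price constant L. -/
theorem asymptotics_of_caseC (hC : θ.CaseC) (hc : 0 < θ.cPos + θ.cNeg) :
    LeadingTerm (slopeRR P X) (-Real.pi * θ.σ * θ.MC) (1 / 2) ∧
    LeadingTerm (convexityBF P X) (√(2 * Real.pi ^ 3) / 16 * θ.LC) (1 / 2) ∧
    HasRate (RR P X) (1 / 2) ∧ HasRate (BF P X) (1 / 2) := by
  obtain ⟨h0, h1, hσ⟩ := hC
  have hcc := fun τ (hτ : 0 < τ) => Params.callPrice_eq_and_callCurve hX h0 h1.ne hc hτ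
  have hC := fun τ hτ => (hcc τ hτ).2
  have hunif : ∃ K, ∀ᶠ τ in 𝓝[>] 0, ∀ k, |k| ≤ 1 →
      |callPrice P X τ k - bsw (θ.σ * √τ) k| ≤ K * τ ^ (1 / 2 + 1 / 2 : ℝ) := by
    obtain ⟨K, hK⟩ := exists_abs_fprice_sub_bsw_le h0 h1 hσ hc
    refine ⟨K, ?_⟩
    filter_upwards [hK, self_mem_nhdsWithin] with τ h hτ k hk
    rw [(hcc τ hτ).1, add_halves, Real.rpow_one]
    exact h k hk
  have hk := tendsto_volAt_sq_div_sqrt hC hσ one_half_pos hunif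
  have hΛ : ∀ v : ℝ, 0 < v → Tendsto (fun t : ℝ => ((t ^ ((1 : ℝ) / 2) : ℝ) : ℂ) *
      θ.jexp (v / √t)) (𝓝[>] 0) (𝓝 (Complex.I * (θ.γ * v : ℝ))) := by
    intro v hv
    have h2 := θ.tendsto_rpow_mul_eta_scaled h0 (b := 1 / 2) hv
      (tendsto_rpow_zero (by linarith : 0 < 1 / 2 - θ.α / 2))
    rw [Complex.ofReal_zero, zero_mul] at h2
    have h3 := h2.const_add (Complex.I * (θ.γ * v : ℝ))
    rw [add_zero] at h3
    refine h3.congr' ?_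
    filter_upwards [self_mem_nhdsWithin] with t ht
    have hs : ((√t : ℝ) : ℂ) ≠ 0 := by exact_mod_cast (Real.sqrt_pos.2 ht).ne'
    rw [Params.jexp, mul_add, ← Real.sqrt_eq_rpow]
    congr 1
    push_cast
    field_simp
  have hM := θ.tendsto_ftail_sub_div h0 h1.ne hσ hc h1.le le_rfl one_lt_two hΛ hk
  have hN := θ.tendsto_rpow_mul_fdens_sub h0 h1.ne hσ hc h1.le le_rfl one_lt_two hΛ hk
  have hL := tendsto_fprice_sub_bsw_div h0 h1 hσ hc hk
  rw [show (1 : ℝ) - 1 / 2 = 1 / 2 by norm_num] at hM hN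
  have hL' : Tendsto (fun τ => (callPrice P X τ (volAt (callPrice P X τ) 0 ^ 2 / 2) -
      bsw (θ.σ * √τ) (volAt (callPrice P X τ) 0 ^ 2 / 2)) / τ ^ (1 / 2 + 1 / 2 : ℝ)) (𝓝[>] 0)
      (𝓝 θ.LC) := by
    refine hL.congr' ?_
    filter_upwards [self_mem_nhdsWithin] with τ hτ
    rw [(hcc τ hτ).1, add_halves, Real.rpow_one]
  have eM : 1 / Real.pi * ∫ v in Set.Ioi (0 : ℝ), ((Real.exp (-(θ.σ ^ 2 / 2) * v ^ 2) : ℝ) *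
      (Complex.I * (θ.γ * v : ℝ)) * (Complex.I * v)⁻¹).re = -θ.MC := by
    have e1 : ∫ v in Set.Ioi (0 : ℝ), ((Real.exp (-(θ.σ ^ 2 / 2) * v ^ 2) : ℝ) *
        (Complex.I * (θ.γ * v : ℝ)) * (Complex.I * v)⁻¹).re =
        θ.γ * ∫ v in Set.Ioi (0 : ℝ), v ^ ((1 : ℝ) - 1) * Real.exp (-(θ.σ ^ 2 / 2) * v ^ 2) := by
      rw [← integral_const_mul]
      refine setIntegral_congr_fun measurableSet_Ioi fun v hv => ?_
      have hv0 : (v : ℂ) ≠ 0 := by exact_mod_cast (ne_of_gt hv)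
      have : (Real.exp (-(θ.σ ^ 2 / 2) * v ^ 2) : ℂ) * (Complex.I * (θ.γ * v : ℝ)) *
          (Complex.I * v)⁻¹ = ((θ.γ * Real.exp (-(θ.σ ^ 2 / 2) * v ^ 2) : ℝ) : ℂ) := by
        push_cast
        field_simp
      simp only [this, Complex.ofReal_re, sub_self, Real.rpow_zero, one_mul]
    rw [e1, integral_rpow_mul_gaussian hσ one_pos, Real.Gamma_one_half_eq, Params.MC,
      Real.rpow_neg_one, show ((1 : ℝ) - 2) / 2 = -(1 / 2) by norm_num, Real.rpow_neg zero_le_two,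
      ← Real.sqrt_eq_rpow, Real.sqrt_mul zero_le_two]
    have := Real.mul_self_sqrt Real.pi_pos.le
    have h2 : √Real.pi ≠ 0 := (Real.sqrt_pos.2 Real.pi_pos).ne'
    nth_rewrite 1 [← this]
    field_simp
  -- The drift exponent is purely imaginary, so the density has no correction at this order.
  have eN : 1 / Real.pi * ∫ v in Set.Ioi (0 : ℝ), ((Real.exp (-(θ.σ ^ 2 / 2) * v ^ 2) : ℝ) *
      (Complex.I * (θ.γ * v : ℝ))).re = 0 := by
    have : ∀ v : ℝ, ((Real.exp (-(θ.σ ^ 2 / 2) * v ^ 2) : ℝ) *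
        (Complex.I * (θ.γ * v : ℝ)) : ℂ).re = 0 := fun v => by
      rw [Complex.re_ofReal_mul, mul_comm Complex.I, Complex.re_ofReal_mul, Complex.I_re, mul_zero,
        mul_zero]
    simp only [this, integral_zero, mul_zero]
  rw [eM] at hM
  rw [eN] at hN
  refine ⟨slopeRR_leadingTerm_of_diffusive hC hσ one_half_pos hunif hL' hM, ?_,
    hasRate_RR_of_diffusive hC hσ one_half_pos hunif,
    hasRate_BF_of_diffusive hC hσ one_half_pos hunif⟩
  have := convexityBF_leadingTerm_of_diffusive hC hσ one_half_pos hunif hL' hM hN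
  rwa [mul_zero, add_zero] at this

/-- The limiting exponent is v^α(p + iq). Its real part enters price and density, its imaginary part
the tail, through Gaussian moments of orders α − 2, α and α − 1. -/
theorem asymptotics_of_caseD (hD : θ.CaseD) (hc : 0 < θ.cPos + θ.cNeg) :
    LeadingTerm (slopeRR P X) (-Real.pi * θ.σ * θ.MD) ((2 - θ.α) / 2) ∧
    LeadingTerm (convexityBF P X) (√(2 * Real.pi ^ 3) / 16 * (θ.LD + θ.σ ^ 2 * θ.ND))
      ((2 - θ.α) / 2) ∧
    HasRate (RR P X) ((2 - θ.α) / 2) ∧ HasRate (BF P X) ((2 - θ.α) / 2) := by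
  obtain ⟨h1, h2, hσ⟩ := hD
  have h0 : 0 < θ.α := by linarith
  have he : 0 < 1 - θ.α / 2 := by linarith
  rw [show (2 - θ.α) / 2 = 1 - θ.α / 2 by ring]
  have hcc := fun τ (hτ : 0 < τ) => Params.callPrice_eq_and_callCurve hX h0 h1.ne' hc hτ
  have hC := fun τ hτ => (hcc τ hτ).2
  have hunif : ∃ K, ∀ᶠ τ in 𝓝[>] 0, ∀ k, |k| ≤ 1 →
      |callPrice P X τ k - bsw (θ.σ * √τ) k| ≤ K * τ ^ (1 / 2 + (1 - θ.α / 2)) := by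
    obtain ⟨K, hK⟩ := θ.exists_abs_fprice_sub_bsw_le_rpow h0 h1.ne' hσ hc le_rfl h2 h1
    refine ⟨K, ?_⟩
    filter_upwards [hK, self_mem_nhdsWithin] with τ h hτ k hk
    rw [(hcc τ hτ).1]
    exact h k hk
  have hk := tendsto_volAt_sq_div_sqrt hC hσ he hunif
  have hΛ := fun v hv => θ.tendsto_rpow_mul_jexp_scaled h1 (v := v) hv
  have hM := θ.tendsto_ftail_sub_div h0 h1.ne' hσ hc le_rfl h1.le h2 hΛ hk
  have hN := θ.tendsto_rpow_mul_fdens_sub h0 h1.ne' hσ hc le_rfl h1.le h2 hΛ hk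
  have hL := θ.tendsto_fprice_sub_div h0 h1.ne' hσ hc le_rfl h2 hΛ hk h1
  have hL' : Tendsto (fun τ => (callPrice P X τ (volAt (callPrice P X τ) 0 ^ 2 / 2) -
      bsw (θ.σ * √τ) (volAt (callPrice P X τ) 0 ^ 2 / 2)) / τ ^ (1 / 2 + (1 - θ.α / 2)))
      (𝓝[>] 0) (𝓝 θ.LD) := by
    have eL : -(1 / Real.pi * ∫ v in Set.Ioi (0 : ℝ), ((Real.exp (-(θ.σ ^ 2 / 2) * v ^ 2) : ℝ) *
        ((v ^ θ.α : ℝ) * (θ.p + θ.q * Complex.I)) * ((4 * (4 * v ^ 2)⁻¹ : ℝ) : ℂ)).re) = θ.LD := by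
      have e1 : ∫ v in Set.Ioi (0 : ℝ), ((Real.exp (-(θ.σ ^ 2 / 2) * v ^ 2) : ℝ) *
          ((v ^ θ.α : ℝ) * (θ.p + θ.q * Complex.I)) * ((4 * (4 * v ^ 2)⁻¹ : ℝ) : ℂ)).re =
          θ.p * ∫ v in Set.Ioi (0 : ℝ), v ^ (θ.α - 1 - 1) *
            Real.exp (-(θ.σ ^ 2 / 2) * v ^ 2) := by
        rw [← integral_const_mul]
        refine setIntegral_congr_fun measurableSet_Ioi fun v hv => ?_
        have hv0 : (0 : ℝ) < v := hv
        simp only [Complex.re_ofReal_mul, Complex.re_mul_ofReal, Complex.add_re, Complex.ofReal_re,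
          Complex.I_re, mul_zero, add_zero]
        rw [Real.rpow_sub_one hv0.ne', Real.rpow_sub_one hv0.ne']
        field_simp
      rw [e1, integral_rpow_mul_gaussian hσ (by linarith), Params.LD,
        show θ.α - 1 - 2 = θ.α - 3 by ring]
      ring
    rw [← eL]
    refine hL.congr' ?_
    filter_upwards [self_mem_nhdsWithin] with τ hτ
    rw [(hcc τ hτ).1]
  have eM : 1 / Real.pi * ∫ v in Set.Ioi (0 : ℝ), ((Real.exp (-(θ.σ ^ 2 / 2) * v ^ 2) : ℝ) *
      ((v ^ θ.α : ℝ) * (θ.p + θ.q * Complex.I)) * (Complex.I * v)⁻¹).re = -θ.MD := by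
    have e1 : ∫ v in Set.Ioi (0 : ℝ), ((Real.exp (-(θ.σ ^ 2 / 2) * v ^ 2) : ℝ) *
        ((v ^ θ.α : ℝ) * (θ.p + θ.q * Complex.I)) * (Complex.I * v)⁻¹).re =
        θ.q * ∫ v in Set.Ioi (0 : ℝ), v ^ (θ.α - 1) * Real.exp (-(θ.σ ^ 2 / 2) * v ^ 2) := by
      rw [← integral_const_mul]
      refine setIntegral_congr_fun measurableSet_Ioi fun v hv => ?_
      have hv0 : (0 : ℝ) < v := hv
      have e2 : (Complex.I * v)⁻¹ = -Complex.I * (v⁻¹ : ℝ) := by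
        rw [mul_inv, Complex.inv_I, Complex.ofReal_inv]
      simp only [e2, ← mul_assoc, Complex.re_mul_ofReal]
      simp only [mul_assoc, Complex.re_ofReal_mul]
      rw [Real.rpow_sub_one hv0.ne']
      simp
      field_simp
    rw [e1, integral_rpow_mul_gaussian hσ h0, Params.MD]
    ring
  have eN : 1 / Real.pi * ∫ v in Set.Ioi (0 : ℝ), ((Real.exp (-(θ.σ ^ 2 / 2) * v ^ 2) : ℝ) *
      ((v ^ θ.α : ℝ) * (θ.p + θ.q * Complex.I))).re = θ.ND := by
    have e1 : ∫ v in Set.Ioi (0 : ℝ), ((Real.exp (-(θ.σ ^ 2 / 2) * v ^ 2) : ℝ) *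
        ((v ^ θ.α : ℝ) * (θ.p + θ.q * Complex.I))).re =
        θ.p * ∫ v in Set.Ioi (0 : ℝ), v ^ (θ.α + 1 - 1) *
          Real.exp (-(θ.σ ^ 2 / 2) * v ^ 2) := by
      rw [← integral_const_mul]
      refine setIntegral_congr_fun measurableSet_Ioi fun v hv => ?_
      simp only [Complex.re_ofReal_mul, Complex.add_re, Complex.ofReal_re,
          Complex.I_re, mul_zero, add_zero, add_sub_cancel_right]
      ring
    rw [e1, integral_rpow_mul_gaussian hσ (by linarith), Params.ND,
      show θ.α + 1 - 2 = θ.α - 1 by ring]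
    ring
  rw [eM] at hM
  rw [eN] at hN
  exact ⟨slopeRR_leadingTerm_of_diffusive hC hσ he hunif hL' hM,
    convexityBF_leadingTerm_of_diffusive hC hσ he hunif hL' hM hN,
    hasRate_RR_of_diffusive hC hσ he hunif, hasRate_BF_of_diffusive hC hσ he hunif⟩

end Cases

/-! ### Limits at the scale of a stable process -/

lemma abs_im_exp_le (w : ℂ) : |(Complex.exp w).im| ≤ Real.exp w.re * |w.im| := by
  rw [Complex.exp_im, abs_mul, abs_of_pos (Real.exp_pos _)]
  exact mul_le_mul_of_nonneg_left Real.abs_sin_le_abs (Real.exp_pos _).le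

lemma integrableOn_min_rpow {a b c d : ℝ} (ha : -1 < a) (hb : b < -1) (hc : 0 ≤ c) (hd : 0 ≤ d) :
    IntegrableOn (fun v : ℝ => min (c * v ^ a) (d * v ^ b)) (Set.Ioi 0) := by
  have hm : AEStronglyMeasurable (fun v : ℝ => min (c * v ^ a) (d * v ^ b)) :=
    Measurable.aestronglyMeasurable (by fun_prop)
  have hn : ∀ v : ℝ, 0 < v → ‖min (c * v ^ a) (d * v ^ b)‖ = min (c * v ^ a) (d * v ^ b) :=
    fun v hv => Real.norm_of_nonneg (by positivity)
  rw [← Set.Ioc_union_Ioi_eq_Ioi zero_le_one, integrableOn_union]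
  constructor
  · have hi : IntegrableOn (fun v : ℝ => c * v ^ a) (Set.Ioc 0 1) :=
      ((intervalIntegrable_iff_integrableOn_Ioc_of_le zero_le_one).1
        (intervalIntegral.intervalIntegrable_rpow' ha)).const_mul c
    refine hi.mono' hm.restrict ?_
    filter_upwards [ae_restrict_mem measurableSet_Ioc] with v hv
    rw [hn v hv.1]
    exact min_le_left _ _
  · refine ((integrableOn_Ioi_rpow_of_lt hb one_pos).const_mul d).mono' hm.restrict ?_
    filter_upwards [ae_restrict_mem measurableSet_Ioi] with v hv
    rw [hn v (one_pos.trans hv)]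
    exact min_le_right _ _

namespace Params

variable (θ : Params)

/-- The exponent of the tilted characteristic function at time `τ ^ (α / 2)` and frequency
`v / √τ`. -/
def scaledExp (τ v : ℝ) : ℂ := ((τ ^ (θ.α / 2) : ℝ) : ℂ) * θ.jexp (v / √τ)

/-- The exponent of the characteristic function of the limiting stable law. -/
def stableExp (v : ℝ) : ℂ := (v ^ θ.α : ℝ) * (θ.p + θ.q * Complex.I)

lemma continuous_scaledExp (τ : ℝ) : Continuous (θ.scaledExp τ) :=
  continuous_const.mul (θ.continuous_jexp.comp (by fun_prop))

/-! ### Pure jumps with α > 1: convergence to a stable law. -/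

section Pure

variable (h1 : 1 < θ.α) (hσ : θ.σ = 0)

-- Time is parametrized as t = τ^(α/2), so the stable scale t^(1/α) is √τ and the estimates at
-- frequencies v/√τ can be reused.
include h1 hσ in
lemma tchar_scaled (τ v : ℝ) :
    θ.tchar (τ ^ (θ.α / 2)) (v / √τ) = Complex.exp (θ.scaledExp τ v) := by
  rw [tchar, θ.psi_half (by linarith) h1.ne', hσ, scaledExp, jexp]
  simp

include h1 in
lemma exists_norm_scaledExp_le : ∃ K, 0 < K ∧ ∀ τ, 0 < τ → ∀ v,
    ‖θ.scaledExp τ v‖ ≤ K * (4 * v ^ 2 + τ) ^ (θ.α / 2) := by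
  obtain ⟨K, hK0, hK⟩ := θ.norm_drift_add_eta_le (by linarith) le_rfl h1.le
  refine ⟨K, hK0, fun τ hτ v => ?_⟩
  have g := hK (v / √τ)
  have hp := Real.rpow_pos_of_pos hτ (θ.α / 2)
  rw [rpow_scaled hτ] at g
  rw [scaledExp, norm_mul, Complex.norm_real, Real.norm_of_nonneg hp.le]
  refine (mul_le_mul_of_nonneg_left g hp.le).trans_eq ?_
  rw [Real.rpow_neg hτ.le]
  field_simp

-- Without diffusion this is the bound of the characteristic function by 1 on the strip, so it holds
-- at every time and not only for small ones.
include h1 hσ in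
lemma re_scaledExp_nonpos {τ : ℝ} (hτ : 0 < τ) (v : ℝ) : (θ.scaledExp τ v).re ≤ 0 := by
  have h0 : 0 < θ.α := by linarith
  have := θ.re_psi_nonpos h0 (z := 1 / 2 + Complex.I * (v / √τ : ℝ)) (by norm_num) (by norm_num)
  rw [θ.re_psi_half h0 h1.ne', hσ] at this
  rw [scaledExp, Complex.re_ofReal_mul, re_jexp]
  exact mul_nonpos_of_nonneg_of_nonpos (Real.rpow_nonneg hτ.le _) (by simpa using this)

include h1 in
lemma exists_re_scaledExp_le (hc : 0 < θ.cPos + θ.cNeg) : ∃ C, ∀ τ, 0 < τ → τ ≤ 1 → ∀ v, 0 < v →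
    (θ.scaledExp τ v).re ≤ C + θ.p / 2 * v ^ θ.α := by
  have h0 : 0 < θ.α := by linarith
  obtain ⟨C, hC0, hC⟩ := θ.re_eta_le h0 h1.ne' hc
  refine ⟨C, fun τ hτ hτ1 v hv => ?_⟩
  have hp := Real.rpow_pos_of_pos hτ (θ.α / 2)
  have hp1 : τ ^ (θ.α / 2) ≤ 1 := Real.rpow_le_one hτ.le hτ1 (by linarith)
  have hs := Real.sqrt_pos.2 hτ
  have g := mul_le_mul_of_nonneg_left (hC (v / √τ) (by positivity)) hp.le
  have e : (v / √τ) ^ θ.α = v ^ θ.α / τ ^ (θ.α / 2) := by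
    rw [Real.div_rpow hv.le hs.le, Real.sqrt_eq_rpow, ← Real.rpow_mul hτ.le,
      show 1 / 2 * θ.α = θ.α / 2 by ring]
  rw [e] at g
  rw [scaledExp, Complex.re_ofReal_mul, re_jexp]
  refine g.trans ?_
  have : τ ^ (θ.α / 2) * (C + θ.p / 2 * (v ^ θ.α / τ ^ (θ.α / 2))) =
      τ ^ (θ.α / 2) * C + θ.p / 2 * v ^ θ.α := by
    field_simp
  rw [this]
  nlinarith

include h1 in
lemma tendsto_scaledExp {v : ℝ} (hv : 0 < v) :
    Tendsto (fun τ => θ.scaledExp τ v) (𝓝[>] 0) (𝓝 (θ.stableExp v)) :=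
  θ.tendsto_rpow_mul_jexp_scaled h1 hv

/-- Dominating function for option prices. -/
def priceBound (K v : ℝ) : ℝ := min (K * 4 ^ (θ.α / 2) * v ^ (θ.α - 2)) (2 * v ^ (-2 : ℝ))

include h1 in
lemma integrableOn_priceBound {K : ℝ} (hK : 0 < K) :
    IntegrableOn (θ.priceBound K) (Set.Ioi 0) :=
  integrableOn_min_rpow (by linarith) (by norm_num) (by positivity) (by norm_num)

lemma sq_add_rpow_sub_one_le {τ v : ℝ} (hτ : 0 < τ) (hv : 0 < v) :
    (4 * v ^ 2 + τ) ^ (θ.α / 2) * (4 * (4 * v ^ 2 + τ)⁻¹) ≤ 4 ^ (θ.α / 2) * v ^ (θ.α - 2) := by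
  have hpos : 0 < 4 * v ^ 2 + τ := by positivity
  have e1 : (4 * v ^ 2 : ℝ) ^ (θ.α / 2 - 1) * 4 = 4 ^ (θ.α / 2) * v ^ (θ.α - 2) := by
    rw [Real.mul_rpow (by norm_num) (by positivity), ← Real.rpow_two, ← Real.rpow_mul hv.le,
      Real.rpow_sub_one (by norm_num : (4 : ℝ) ≠ 0), show 2 * (θ.α / 2 - 1) = θ.α - 2 by ring]
    ring
  have e2 : (4 * v ^ 2 + τ) ^ (θ.α / 2 - 1) ≤ (4 * v ^ 2) ^ (θ.α / 2 - 1) :=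
    Real.rpow_le_rpow_of_nonpos (by positivity) (by linarith) (by linarith [θ.α_lt_two])
  rw [← e1]
  refine le_trans (le_of_eq ?_) (mul_le_mul_of_nonneg_right e2 (by norm_num))
  rw [Real.rpow_sub_one hpos.ne']
  ring

-- For small v, |1 − e^w| ≤ |w| yields v^(α−2), integrable at 0 because α > 1; for large v, |1 −
-- e^w| ≤ 2 yields v^(−2).
include h1 hσ in
lemma exists_norm_one_sub_exp_le : ∃ K, 0 < K ∧ ∀ τ, 0 < τ → ∀ v, 0 < v →
    ‖(1 - Complex.exp (θ.scaledExp τ v)) * ((4 * (4 * v ^ 2 + τ)⁻¹ : ℝ) : ℂ)‖ ≤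
      θ.priceBound K v := by
  obtain ⟨K, hK0, hK⟩ := θ.exists_norm_scaledExp_le h1
  refine ⟨K, hK0, fun τ hτ v hv => ?_⟩
  have hpos : 0 < 4 * v ^ 2 + τ := by positivity
  have hre := θ.re_scaledExp_nonpos h1 hσ hτ v
  have hq : 0 ≤ 4 * (4 * v ^ 2 + τ)⁻¹ := by positivity
  rw [norm_mul, norm_sub_rev, Complex.norm_real, Real.norm_of_nonneg hq, priceBound, le_min_iff]
  constructor
  · have g := norm_exp_sub_one_le_mul hre le_rfl
    rw [Real.exp_zero, mul_one] at g
    calc _ ≤ K * (4 * v ^ 2 + τ) ^ (θ.α / 2) * (4 * (4 * v ^ 2 + τ)⁻¹) :=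
          mul_le_mul_of_nonneg_right (g.trans (hK τ hτ v)) hq
      _ ≤ K * (4 ^ (θ.α / 2) * v ^ (θ.α - 2)) := by
          rw [mul_assoc]
          exact mul_le_mul_of_nonneg_left (θ.sq_add_rpow_sub_one_le hτ hv) hK0.le
      _ = _ := by ring
  · have g : ‖Complex.exp (θ.scaledExp τ v) - 1‖ ≤ 2 := by
      refine (norm_sub_le _ _).trans ?_
      rw [norm_one, Complex.norm_exp]
      linarith [Real.exp_le_one_iff.2 hre]
    have g2 : 4 * (4 * v ^ 2 + τ)⁻¹ ≤ v ^ (-2 : ℝ) := by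
      rw [Real.rpow_neg hv.le, Real.rpow_two, ← div_eq_mul_inv, div_le_iff₀ hpos]
      have : (v ^ 2)⁻¹ * (4 * v ^ 2 + τ) = 4 + (v ^ 2)⁻¹ * τ := by field_simp
      rw [this]
      have : 0 ≤ (v ^ 2)⁻¹ * τ := by positivity
      linarith
    exact mul_le_mul g g2 hq zero_le_two

variable (hc : 0 < θ.cPos + θ.cNeg)

include h1 hσ hc

/-- At k = 0 the left side is the at-the-money price, because the kernel has mean 1. Collecting both
integrals into 1 − e^w compensates the kernel, which becomes singular at v = 0 in the limit. -/
lemma fint_kern_sub_eq {τ : ℝ} (hτ : 0 < τ) (k : ℝ) :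
    fint kern k - fint (fun u => θ.tchar (τ ^ (θ.α / 2)) u * kern u) k = √τ * (1 / Real.pi *
      ∫ v in Set.Ioi (0 : ℝ), (Complex.exp (-(Complex.I * (v / √τ : ℝ) * k)) *
        ((1 - Complex.exp (θ.scaledExp τ v)) * ((4 * (4 * v ^ 2 + τ)⁻¹ : ℝ) : ℂ))).re) := by
  have h0 : 0 < θ.α := by linarith
  have ht := Real.rpow_pos_of_pos hτ (θ.α / 2)
  have hT := integrable_mul_kern (θ.integrable_tchar h0 h1.ne' hc ht)
  rw [← fint_sub integrable_kern hT, fint_eq_scaled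
    (h := fun u => kern u - θ.tchar (τ ^ (θ.α / 2)) u * kern u) (fun u => by
    rw [θ.tchar_neg h0 h1.ne', kern_neg, map_sub, map_mul]) (integrable_kern.sub hT)
    (Real.sqrt_pos.2 hτ), mul_left_comm (√τ), ← integral_const_mul (√τ)]
  congr 2
  ext v
  rw [← Complex.re_ofReal_mul, θ.tchar_scaled h1 hσ]
  congr 1
  have e := kern_scaled hτ v
  rw [Complex.ofReal_mul] at e
  linear_combination (Complex.exp (-(Complex.I * (v / √τ : ℝ) * k)) *
    (1 - Complex.exp (θ.scaledExp τ v))) * e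

lemma exists_abs_fint_kern_sub_le : ∃ K, ∀ τ, 0 < τ → ∀ k,
    |fint kern k - fint (fun u => θ.tchar (τ ^ (θ.α / 2)) u * kern u) k| ≤ K * √τ := by
  obtain ⟨K, hK0, hK⟩ := θ.exists_norm_one_sub_exp_le h1 hσ
  refine ⟨1 / Real.pi * ∫ v in Set.Ioi (0 : ℝ), θ.priceBound K v, fun τ hτ k => ?_⟩
  rw [θ.fint_kern_sub_eq h1 hσ hc hτ, abs_mul, abs_mul, abs_of_nonneg (Real.sqrt_nonneg τ),
    abs_of_pos (by positivity : 0 < 1 / Real.pi), mul_comm (√τ)]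
  gcongr
  rw [← Real.norm_eq_abs]
  refine norm_integral_le_of_norm_le (θ.integrableOn_priceBound h1 hK0) ?_
  filter_upwards [ae_restrict_mem measurableSet_Ioi] with v hv
  refine (Complex.abs_re_le_norm _).trans ?_
  rw [norm_mul, norm_exp_I_mul, one_mul]
  exact hK τ hτ v hv

/-- The at-the-money price. -/
lemma tendsto_fprice_zero_div :
    Tendsto (fun τ => fprice (θ.tchar (τ ^ (θ.α / 2))) 0 / √τ) (𝓝[>] 0)
      (𝓝 (1 / Real.pi * ∫ v in Set.Ioi (0 : ℝ),
        (1 - Complex.exp (θ.stableExp v)).re * v ^ (-2 : ℝ))) := by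
  obtain ⟨K, hK0, hK⟩ := θ.exists_norm_one_sub_exp_le h1 hσ
  have hlim : Tendsto (fun τ => ∫ v in Set.Ioi (0 : ℝ),
      ((1 - Complex.exp (θ.scaledExp τ v)) * ((4 * (4 * v ^ 2 + τ)⁻¹ : ℝ) : ℂ)).re) (𝓝[>] 0)
      (𝓝 (∫ v in Set.Ioi (0 : ℝ), (1 - Complex.exp (θ.stableExp v)).re * v ^ (-2 : ℝ))) := by
    refine tendsto_integral_filter_of_dominated_convergence (θ.priceBound K)
      (Eventually.of_forall fun τ => ?_) ?_ (θ.integrableOn_priceBound h1 hK0) ?_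
    · have g := (θ.continuous_scaledExp τ).measurable
      refine (Complex.measurable_re.comp
        ((measurable_const.sub (Complex.measurable_exp.comp g)).mul ?_)).aestronglyMeasurable
      fun_prop
    · filter_upwards [self_mem_nhdsWithin] with τ hτ
      filter_upwards [ae_restrict_mem measurableSet_Ioi] with v hv
      exact (Complex.abs_re_le_norm _).trans (hK τ hτ v hv)
    · filter_upwards [ae_restrict_mem measurableSet_Ioi] with v hv
      have hv0 : (0 : ℝ) < v := hv
      have l1 := (Complex.continuous_re.tendsto _).comp
        (((Complex.continuous_exp.tendsto _).comp (θ.tendsto_scaledExp h1 hv0)).const_sub 1)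
      have l2 : Tendsto (fun τ : ℝ => 4 * (4 * v ^ 2 + τ)⁻¹) (𝓝[>] 0) (𝓝 (v ^ (-2 : ℝ))) := by
        have hcont : ContinuousAt (fun τ : ℝ => 4 * (4 * v ^ 2 + τ)⁻¹) 0 := by
          refine ContinuousAt.mul (by fun_prop) (ContinuousAt.inv₀ (by fun_prop) ?_)
          rw [add_zero]
          positivity
        have := hcont.tendsto.mono_left (nhdsWithin_le_nhds (s := Set.Ioi (0 : ℝ)))
        rw [add_zero, mul_inv, mul_inv_cancel_left₀ (by norm_num)] at this
        rwa [Real.rpow_neg hv0.le, Real.rpow_two]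
      refine (l1.mul l2).congr fun τ => ?_
      rw [Complex.re_mul_ofReal]
      rfl
  refine (hlim.const_mul (1 / Real.pi)).congr' ?_
  filter_upwards [self_mem_nhdsWithin] with τ hτ
  have hs := (Real.sqrt_pos.2 (hτ : (0 : ℝ) < τ)).ne'
  have e := θ.fint_kern_sub_eq h1 hσ hc hτ 0
  have e0 : fint kern 0 = 1 := by rw [fint_kern, abs_zero, neg_zero, zero_div, Real.exp_zero]
  rw [e0] at e
  rw [fprice, zero_div, Real.exp_zero, one_mul, e, mul_div_cancel_left₀ _ hs]
  simp

variable {k : ℝ → ℝ} (hk : Tendsto (fun τ => k τ / √τ) (𝓝[>] 0) (𝓝 0))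
include hk

omit h1 hσ hc in
lemma tendsto_exp_I_scaled_strike (v : ℝ) :
    Tendsto (fun τ => Complex.I * (v / √τ : ℝ) * k τ) (𝓝[>] 0) (𝓝 0) := by
  have hcont : Continuous fun x : ℝ => Complex.I * v * x := by fun_prop
  have := (hcont.tendsto 0).comp hk
  rw [Complex.ofReal_zero, mul_zero] at this
  refine this.congr fun t => ?_
  simp only [Function.comp_apply]
  push_cast
  ring

/-- The density near the money. -/
lemma tendsto_sqrt_mul_fdens :
    Tendsto (fun τ => √τ * fdens (θ.tchar (τ ^ (θ.α / 2))) (k τ)) (𝓝[>] 0)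
      (𝓝 (1 / Real.pi * ∫ v in Set.Ioi (0 : ℝ), (Complex.exp (θ.stableExp v)).re)) := by
  have h0 : 0 < θ.α := by linarith
  have hp := θ.p_neg h0 h1.ne' hc
  obtain ⟨C, hC⟩ := θ.exists_re_scaledExp_le h1 hc
  have hlim : Tendsto (fun τ => ∫ v in Set.Ioi (0 : ℝ),
      (Complex.exp (-(Complex.I * (v / √τ : ℝ) * k τ)) * Complex.exp (θ.scaledExp τ v)).re) (𝓝[>] 0)
      (𝓝 (∫ v in Set.Ioi (0 : ℝ), (Complex.exp (θ.stableExp v)).re)) := by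
    refine tendsto_integral_filter_of_dominated_convergence
      (fun v => Real.exp C * Real.exp (-(-θ.p / 2) * v ^ θ.α))
      (Eventually.of_forall fun τ => ?_) ?_
      ((integrableOn_exp_neg_mul_rpow h0 (by linarith)).const_mul _) ?_
    · have g := θ.continuous_scaledExp τ
      refine Continuous.aestronglyMeasurable ?_
      fun_prop
    · filter_upwards [self_mem_nhdsWithin, nhdsWithin_le_nhds (ge_mem_nhds one_pos)] with τ hτ hτ1
      filter_upwards [ae_restrict_mem measurableSet_Ioi] with v hv
      refine (Complex.abs_re_le_norm _).trans ?_
      rw [norm_mul, norm_exp_I_mul, one_mul, Complex.norm_exp, ← Real.exp_add, Real.exp_le_exp]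
      linarith [hC τ hτ hτ1 v hv]
    · filter_upwards [ae_restrict_mem measurableSet_Ioi] with v hv
      have l1 := (tendsto_exp_I_scaled_strike hk v).neg
      rw [neg_zero] at l1
      have l2 := ((Complex.continuous_exp.tendsto _).comp l1).mul
        ((Complex.continuous_exp.tendsto _).comp (θ.tendsto_scaledExp h1 hv))
      rw [Complex.exp_zero, one_mul] at l2
      exact (Complex.continuous_re.tendsto _).comp l2
  have main := (tendsto_exp_const_mul_strike hk (-(1 / 2))).mul (hlim.const_mul (1 / Real.pi))
  rw [one_mul] at main
  refine main.congr' ?_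
  filter_upwards [self_mem_nhdsWithin] with τ hτ
  have hs := Real.sqrt_pos.2 (hτ : (0 : ℝ) < τ)
  have ht := Real.rpow_pos_of_pos (hτ : (0 : ℝ) < τ) (θ.α / 2)
  rw [fdens, fint_eq_scaled (θ.tchar_neg h0 h1.ne' _) (θ.integrable_tchar h0 h1.ne' hc ht) hs,
    mul_left_comm (√τ), mul_left_comm (√τ), ← integral_const_mul (√τ),
    show -k τ / 2 = -(1 / 2) * k τ by ring]
  congr 3
  ext v
  rw [θ.tchar_scaled h1 hσ, ← Complex.re_ofReal_mul]
  have hne : ((√τ : ℝ) : ℂ) ≠ 0 := by exact_mod_cast hs.ne'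
  congr 1
  push_cast
  field_simp

-- Since 1/(1/2 + iu) = (1/2 − iu)·kern(u), the tail splits into half a kernel average, which tends
-- to 1/2, and an integral of Im e^w against a kernel tending to 1/v.
omit hk in
lemma ftail_eq_add {τ : ℝ} (hτ : 0 < τ) (k : ℝ) :
    ftail (θ.tchar (τ ^ (θ.α / 2))) k = Real.exp (-k / 2) *
      (1 / 2 * fint (fun u => θ.tchar (τ ^ (θ.α / 2)) u * kern u) k +
      1 / Real.pi * ∫ v in Set.Ioi (0 : ℝ),
        (Complex.exp (θ.scaledExp τ v - Complex.I * (v / √τ : ℝ) * k)).im *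
          (v * (4 * (4 * v ^ 2 + τ)⁻¹))) := by
  have h0 : 0 < θ.α := by linarith
  have hs := Real.sqrt_pos.2 hτ
  have ht := Real.rpow_pos_of_pos hτ (θ.α / 2)
  have hT := θ.integrable_tchar h0 h1.ne' hc ht
  have hTk := integrable_mul_kern hT
  have hTu := (integrable_id_mul_kern hT).const_mul (-Complex.I)
  have e1 : (fun u : ℝ => θ.tchar (τ ^ (θ.α / 2)) u * (1 / 2 + Complex.I * u : ℂ)⁻¹) =
      fun u : ℝ => ((1 / 2 : ℝ) : ℂ) * (θ.tchar (τ ^ (θ.α / 2)) u * kern u) +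
        -Complex.I * (u * (θ.tchar (τ ^ (θ.α / 2)) u * kern u)) := by
    ext u
    rw [← half_sub_mul_kern]
    push_cast
    ring
  rw [ftail, e1, fint_add (hTk.const_mul _) hTu, fint_const_mul,
    fint_eq_scaled (h := fun u : ℝ => -Complex.I * (u * (θ.tchar (τ ^ (θ.α / 2)) u * kern u)))
    (fun u => by
      rw [θ.tchar_neg h0 h1.ne', kern_neg, map_mul, map_mul, map_mul, Complex.ofReal_neg, map_neg,
        Complex.conj_I, Complex.conj_ofReal]
      ring) hTu hs]
  congr 4
  ext v
  have e := kern_scaled hτ v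
  have hne : ((√τ : ℝ) : ℂ) ≠ 0 := by exact_mod_cast hs.ne'
  have e2 : Complex.exp (-(Complex.I * (v / √τ : ℝ) * k)) *
      (-Complex.I * ((v / √τ : ℝ) * (θ.tchar (τ ^ (θ.α / 2)) (v / √τ) * kern (v / √τ))) *
        ((√τ)⁻¹ : ℝ)) = -Complex.I * Complex.exp (θ.scaledExp τ v - Complex.I * (v / √τ : ℝ) * k) *
          ((v * (4 * (4 * v ^ 2 + τ)⁻¹) : ℝ) : ℂ) := by
    have e3 : ((v * (4 * (4 * v ^ 2 + τ)⁻¹) : ℝ) : ℂ) =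
        (v / √τ : ℝ) * (kern (v / √τ) * ((√τ)⁻¹ : ℝ)) := by
      rw [e, ← Complex.ofReal_mul]
      congr 1
      field_simp
    rw [e3, θ.tchar_scaled h1 hσ, sub_eq_add_neg, Complex.exp_add]
    ring
  rw [e2, Complex.re_mul_ofReal]
  simp

/-- The tail near the money. -/
lemma tendsto_ftail :
    Tendsto (fun τ => ftail (θ.tchar (τ ^ (θ.α / 2))) (k τ)) (𝓝[>] 0)
      (𝓝 (1 / 2 + 1 / Real.pi *
        ∫ v in Set.Ioi (0 : ℝ), (Complex.exp (θ.stableExp v)).im * v⁻¹)) := by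
  have h0 : 0 < θ.α := by linarith
  have hp := θ.p_neg h0 h1.ne' hc
  obtain ⟨C, hC⟩ := θ.exists_re_scaledExp_le h1 hc
  obtain ⟨K, hK0, hK⟩ := θ.exists_norm_scaledExp_le h1
  have hlim : Tendsto (fun τ => ∫ v in Set.Ioi (0 : ℝ),
      (Complex.exp (θ.scaledExp τ v - Complex.I * (v / √τ : ℝ) * k τ)).im *
        (v * (4 * (4 * v ^ 2 + τ)⁻¹))) (𝓝[>] 0)
      (𝓝 (∫ v in Set.Ioi (0 : ℝ), (Complex.exp (θ.stableExp v)).im * v⁻¹)) := by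
    refine tendsto_integral_filter_of_dominated_convergence
      (fun v => Real.exp C * ((K * 4 ^ (θ.α / 2)) * (v ^ (θ.α - 1) *
        Real.exp (-(-θ.p / 2) * v ^ θ.α)) + Real.exp (-(-θ.p / 2) * v ^ θ.α)))
      (Eventually.of_forall fun τ => ?_) ?_
      ((((integrableOn_rpow_mul_exp_neg_mul_rpow (by linarith) h0 (by linarith)).const_mul _).add
        (integrableOn_exp_neg_mul_rpow h0 (by linarith))).const_mul _) ?_
    · have g := (θ.continuous_scaledExp τ).measurable
      refine Measurable.aestronglyMeasurable (Measurable.mul (Complex.measurable_im.comp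
        (Complex.measurable_exp.comp (g.sub ?_))) ?_) <;> fun_prop
    · filter_upwards [self_mem_nhdsWithin, nhdsWithin_le_nhds (ge_mem_nhds one_pos),
        hk.abs.eventually_lt_const (by simp : |(0 : ℝ)| < 1)] with τ hτ hτ1 hkτ
      filter_upwards [ae_restrict_mem measurableSet_Ioi] with v hv
      have hv0 : (0 : ℝ) < v := hv
      have hτ0 : (0 : ℝ) < τ := hτ
      have hq : 0 ≤ 4 * (4 * v ^ 2 + τ)⁻¹ := by positivity
      have e1 : Complex.I * (v / √τ : ℝ) * k τ = ((v * (k τ / √τ) : ℝ) : ℂ) * Complex.I := by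
        push_cast
        ring
      -- The factor |Im w| supplies the smallness at v = 0 that offsets the limiting kernel 1/v.
      have g1 := abs_im_exp_le (θ.scaledExp τ v - Complex.I * (v / √τ : ℝ) * k τ)
      rw [e1, Complex.sub_re, Complex.sub_im, Complex.re_ofReal_mul, Complex.im_ofReal_mul,
        Complex.I_re, Complex.I_im, mul_zero, mul_one, sub_zero, ← e1] at g1
      have g2 : |(θ.scaledExp τ v).im - v * (k τ / √τ)| ≤
          K * (4 * v ^ 2 + τ) ^ (θ.α / 2) + v := by
        refine (abs_sub _ _).trans (add_le_add
          ((Complex.abs_im_le_norm _).trans (hK τ hτ v)) ?_)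
        rw [abs_mul, abs_of_pos hv0]
        nlinarith
      have g3 : v * (4 * (4 * v ^ 2 + τ)⁻¹) * v ≤ 1 := by
        rw [← div_eq_mul_inv, mul_div_assoc', div_mul_eq_mul_div, div_le_one (by positivity)]
        nlinarith
      have g4 := θ.sq_add_rpow_sub_one_le hτ0 hv0
      have e2 : v ^ (θ.α - 1) = v ^ (θ.α - 2) * v := by
        rw [← Real.rpow_add_one hv0.ne']
        congr 1
        ring
      rw [norm_mul, Real.norm_eq_abs, Real.norm_of_nonneg (mul_nonneg hv0.le hq)]
      calc _ ≤ Real.exp (C + θ.p / 2 * v ^ θ.α) * (K * (4 * v ^ 2 + τ) ^ (θ.α / 2) + v) *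
            (v * (4 * (4 * v ^ 2 + τ)⁻¹)) := by
            refine mul_le_mul_of_nonneg_right (g1.trans (mul_le_mul
              (Real.exp_le_exp.2 (hC τ hτ hτ1 v hv)) g2 (abs_nonneg _) (Real.exp_pos _).le))
              (mul_nonneg hv0.le hq)
        _ = Real.exp (C + θ.p / 2 * v ^ θ.α) * (K * ((4 * v ^ 2 + τ) ^ (θ.α / 2) *
            (4 * (4 * v ^ 2 + τ)⁻¹)) * v + v * (4 * (4 * v ^ 2 + τ)⁻¹) * v) := by ring
        _ ≤ Real.exp (C + θ.p / 2 * v ^ θ.α) * (K * (4 ^ (θ.α / 2) * v ^ (θ.α - 2)) * v + 1) := by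
            gcongr
        _ = _ := by
            rw [Real.exp_add, e2, show -(-θ.p / 2) * v ^ θ.α = θ.p / 2 * v ^ θ.α by ring]
            ring
    · filter_upwards [ae_restrict_mem measurableSet_Ioi] with v hv
      have hv0 : (0 : ℝ) < v := hv
      have l1 := (θ.tendsto_scaledExp h1 hv0).sub (tendsto_exp_I_scaled_strike hk v)
      rw [sub_zero] at l1
      have l2 := (Complex.continuous_im.tendsto _).comp ((Complex.continuous_exp.tendsto _).comp l1)
      have l3 : Tendsto (fun τ : ℝ => v * (4 * (4 * v ^ 2 + τ)⁻¹)) (𝓝[>] 0) (𝓝 v⁻¹) := by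
        have hcont : ContinuousAt (fun τ : ℝ => v * (4 * (4 * v ^ 2 + τ)⁻¹)) 0 := by
          refine ContinuousAt.mul (by fun_prop) (ContinuousAt.mul (by fun_prop)
            (ContinuousAt.inv₀ (by fun_prop) ?_))
          rw [add_zero]
          positivity
        have := hcont.tendsto.mono_left (nhdsWithin_le_nhds (s := Set.Ioi (0 : ℝ)))
        rw [add_zero] at this
        convert this using 2
        field_simp
      exact l2.mul l3
  have hhalf : Tendsto (fun τ => fint (fun u => θ.tchar (τ ^ (θ.α / 2)) u * kern u) (k τ)) (𝓝[>] 0)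
      (𝓝 1) := by
    obtain ⟨M, hM⟩ := θ.exists_abs_fint_kern_sub_le h1 hσ hc
    have l1 : Tendsto (fun τ : ℝ => M * √τ) (𝓝[>] 0) (𝓝 0) := by
      simpa using tendsto_sqrt_zero.const_mul M
    have l2 : Tendsto (fun τ => fint kern (k τ) -
        fint (fun u => θ.tchar (τ ^ (θ.α / 2)) u * kern u) (k τ)) (𝓝[>] 0) (𝓝 0) := by
      refine squeeze_zero_norm' ?_ l1
      filter_upwards [self_mem_nhdsWithin] with τ hτ using hM τ hτ (k τ)
    have hk0 : Tendsto k (𝓝[>] 0) (𝓝 0) := by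
      have := hk.mul tendsto_sqrt_zero
      rw [mul_zero] at this
      refine this.congr' ?_
      filter_upwards [self_mem_nhdsWithin] with t ht
      exact div_mul_cancel₀ _ (Real.sqrt_pos.2 ht).ne'
    have l3 : Tendsto (fun τ => fint kern (k τ)) (𝓝[>] 0) (𝓝 1) := by
      have := ((continuous_fint integrable_kern).tendsto 0).comp hk0
      rwa [fint_kern, abs_zero, neg_zero, zero_div, Real.exp_zero] at this
    have := l3.sub l2
    rw [sub_zero] at this
    exact this.congr fun τ => by ring
  have main := (tendsto_exp_const_mul_strike hk (-(1 / 2))).mul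
    ((hhalf.const_mul (1 / 2)).add (hlim.const_mul (1 / Real.pi)))
  rw [one_mul, mul_one] at main
  refine main.congr' ?_
  filter_upwards [self_mem_nhdsWithin] with τ hτ
  rw [θ.ftail_eq_add h1 hσ hc hτ, show -k τ / 2 = -(1 / 2) * k τ by ring]

end Pure

end Params

/-! ### Integrals of stable characteristic functions -/

lemma arg_eq_arctan_of_re_pos {s : ℂ} (hs : 0 < s.re) : s.arg = Real.arctan (s.im / s.re) := by
  have h := abs_lt.1 (Complex.abs_arg_lt_pi_div_two_iff.2 (Or.inl hs))
  rw [← Complex.tan_arg, Real.arctan_tan h.1 h.2]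

lemma integral_Ioi_eq_of_comp_rpow {f g : ℝ → ℝ} {α : ℝ} (hα : 0 < α)
    (h : ∀ v, 0 < v → f v = α * v ^ (α - 1) * g (v ^ α)) :
    ∫ v in Set.Ioi (0 : ℝ), f v = ∫ y in Set.Ioi (0 : ℝ), g y := by
  rw [← integral_comp_rpow_Ioi_of_pos (g := g) hα]
  exact setIntegral_congr_fun measurableSet_Ioi fun v hv => h v hv

/-- Differentiation in b removes the factor 1/y and gives a/(a² + b²), the derivative of
arctan(b/a); both sides vanish at b = 0. -/
lemma integral_exp_neg_mul_mul_sin_div {a : ℝ} (ha : 0 < a) (b : ℝ) :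
    ∫ y in Set.Ioi (0 : ℝ), Real.exp (-a * y) * Real.sin (b * y) * y⁻¹ = Real.arctan (b / a) := by
  have hi : IntegrableOn (fun y : ℝ => Real.exp (-a * y)) (Set.Ioi 0) := by
    have := integrableOn_exp_neg_mul_rpow one_pos ha
    simpa using this
  have hm : ∀ x : ℝ, AEStronglyMeasurable
      (fun y : ℝ => Real.exp (-a * y) * Real.sin (x * y) * y⁻¹) (volume.restrict (Set.Ioi 0)) :=
    fun x => Measurable.aestronglyMeasurable (by fun_prop)
  have hd : ∀ x : ℝ, HasDerivAt
      (fun x => ∫ y in Set.Ioi (0 : ℝ), Real.exp (-a * y) * Real.sin (x * y) * y⁻¹)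
      (a / (a ^ 2 + x ^ 2)) x := by
    intro x
    have key := (hasDerivAt_integral_of_dominated_loc_of_deriv_le
      (μ := volume.restrict (Set.Ioi (0 : ℝ)))
      (F := fun x y => Real.exp (-a * y) * Real.sin (x * y) * y⁻¹)
      (F' := fun x y => Real.exp (-a * y) * Real.cos (x * y))
      (bound := fun y => Real.exp (-a * y)) (x₀ := x) (s := Set.univ) univ_mem
      (Eventually.of_forall hm) ?_ ?_ ?_ hi ?_).2
    · have e : ∫ y in Set.Ioi (0 : ℝ), Real.exp (-a * y) * Real.cos (x * y) =
          a / (a ^ 2 + x ^ 2) := by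
        have hs : 0 < ((a : ℂ) + x * Complex.I).re := by simpa
        obtain ⟨g1, g2⟩ := integral_exp_mul_rpow one_pos hs
        have g3 := congrArg Complex.re g2
        rw [← RCLike.re_to_complex, ← integral_re g1] at g3
        have e1 : ∀ y : ℝ, RCLike.re (Complex.exp (-((a : ℂ) + x * Complex.I) * y) *
            ((y ^ ((1 : ℝ) - 1) : ℝ) : ℂ)) = Real.exp (-a * y) * Real.cos (x * y) := fun y => by
          rw [sub_self, Real.rpow_zero, Complex.ofReal_one, mul_one, RCLike.re_to_complex,
            Complex.exp_re]
          simp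
        simp_rw [e1] at g3
        rw [g3, Real.Gamma_one, Complex.ofReal_one, one_mul, Complex.cpow_neg_one,
          Complex.inv_re, Complex.normSq_add_mul_I]
        simp
      rwa [e] at key
    · refine (hi.mul_const |x|).mono' (hm x) ?_
      filter_upwards [ae_restrict_mem measurableSet_Ioi] with y hy
      have hy0 : (0 : ℝ) < y := hy
      rw [mul_assoc, norm_mul, Real.norm_of_nonneg (Real.exp_pos _).le, norm_mul, norm_inv,
        Real.norm_of_nonneg hy0.le]
      refine mul_le_mul_of_nonneg_left ?_ (Real.exp_pos _).le
      rw [← div_eq_mul_inv, div_le_iff₀ hy0, Real.norm_eq_abs]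
      refine Real.abs_sin_le_abs.trans_eq ?_
      rw [abs_mul, abs_of_pos hy0]
    · exact Measurable.aestronglyMeasurable (by fun_prop)
    · refine Eventually.of_forall fun y z _ => ?_
      rw [norm_mul, Real.norm_of_nonneg (Real.exp_pos _).le]
      exact mul_le_of_le_one_right (Real.exp_pos _).le (Real.abs_cos_le_one _)
    · filter_upwards [ae_restrict_mem measurableSet_Ioi] with y hy z _
      have hy0 : y ≠ 0 := ne_of_gt hy
      have h1 : HasDerivAt (fun z : ℝ => z * y) y z := by simpa using (hasDerivAt_id z).mul_const y
      have := ((h1.sin).const_mul (Real.exp (-a * y))).mul_const y⁻¹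
      rwa [mul_assoc (Real.exp _), mul_assoc (Real.cos _), mul_inv_cancel₀ hy0, mul_one] at this
  have hA : ∀ x : ℝ, HasDerivAt (fun x => Real.arctan (x / a)) (a / (a ^ 2 + x ^ 2)) x := by
    intro x
    have h := ((hasDerivAt_id x).div_const a).arctan
    have e : 1 / (1 + (x / a) ^ 2) * (1 / a) = a / (a ^ 2 + x ^ 2) := by field_simp
    rwa [id, e] at h
  have hsub := fun x => (hd x).sub (hA x)
  simp only [sub_self] at hsub
  have := is_const_of_deriv_eq_zero (fun x => (hsub x).differentiableAt) (fun x => (hsub x).deriv)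
    b 0
  simp only [Pi.sub_apply, zero_mul, Real.sin_zero, mul_zero, integral_zero, zero_div,
    Real.arctan_zero, sub_self] at this
  linarith

section Stable

variable {α : ℝ} (h1 : 1 < α) {s : ℂ} (hs : 0 < s.re)
include h1 hs

/-- The substitution y = v^α turns the stable exponent into a linear one, and the integral becomes
`integral_cexpm` of order 1/α < 1. -/
lemma integral_re_one_sub_exp_rpow :
    ∫ v in Set.Ioi (0 : ℝ), (1 - Complex.exp (-s * (v ^ α : ℝ))).re * v ^ (-2 : ℝ) =
      Real.Gamma (1 - 1 / α) * ‖s‖ ^ (1 / α) * Real.cos (1 / α * s.arg) := by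
  have h0 : 0 < α := by linarith
  have hb0 : 0 < 1 / α := by positivity
  have hb1 : 1 / α < 1 := by rw [div_lt_one h0]; exact h1
  obtain ⟨g1, g2⟩ := integral_cexpm hb0 (by linarith) hb1.ne (Or.inl hs)
  rw [integral_Ioi_eq_of_comp_rpow (g := fun y => -(1 / α) *
    (cexpm (1 / α) s y * (y ^ (-(1 / α) - 1) : ℝ)).re) h0, integral_const_mul]
  · have g3 := congrArg Complex.re g2
    rw [← RCLike.re_to_complex, ← integral_re g1] at g3
    simp only [RCLike.re_to_complex] at g3
    rw [g3, Complex.re_ofReal_mul, Complex.cpow_ofReal_re, show 1 - 1 / α = -(1 / α) + 1 by ring,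
      Real.Gamma_add_one (neg_ne_zero.2 hb0.ne'), mul_comm s.arg]
    ring
  · intro v hv
    have e1 : (v ^ α) ^ (-(1 / α) - 1) = v ^ (-2 : ℝ) * (v ^ (α - 1))⁻¹ := by
      rw [← Real.rpow_mul hv.le, ← Real.rpow_neg hv.le, ← Real.rpow_add hv]
      congr 1
      field_simp
      ring
    have hp := (Real.rpow_pos_of_pos hv (α - 1)).ne'
    rw [cexpm, if_neg (not_lt.2 hb1.le), add_zero, Complex.re_mul_ofReal, e1,
      ← neg_sub (Complex.exp _) 1, Complex.neg_re]
    field_simp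

lemma integral_re_exp_rpow :
    ∫ v in Set.Ioi (0 : ℝ), (Complex.exp (-s * (v ^ α : ℝ))).re =
      Real.Gamma (1 + 1 / α) * ‖s‖ ^ (-(1 / α)) * Real.cos (1 / α * s.arg) := by
  have h0 : 0 < α := by linarith
  have hb0 : 0 < 1 / α := by positivity
  obtain ⟨g1, g2⟩ := integral_exp_mul_rpow hb0 hs
  rw [integral_Ioi_eq_of_comp_rpow (g := fun y => 1 / α *
    (Complex.exp (-s * y) * (y ^ (1 / α - 1) : ℝ)).re) h0, integral_const_mul]
  · have g3 := congrArg Complex.re g2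
    rw [← RCLike.re_to_complex, ← integral_re g1] at g3
    simp only [RCLike.re_to_complex] at g3
    rw [g3, Complex.re_ofReal_mul, ← Complex.ofReal_neg, Complex.cpow_ofReal_re, add_comm 1,
      Real.Gamma_add_one hb0.ne', mul_comm s.arg, neg_mul, Real.cos_neg]
    ring
  · intro v hv
    have e1 : (v ^ α) ^ (1 / α - 1) = (v ^ (α - 1))⁻¹ := by
      rw [← Real.rpow_mul hv.le, ← Real.rpow_neg hv.le]
      congr 1
      field_simp
      ring
    have hp := (Real.rpow_pos_of_pos hv (α - 1)).ne'
    rw [Complex.re_mul_ofReal, e1]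
    field_simp

/-- The measure dv/v is scale invariant, so y = v^α only brings out 1/α; the remaining integral is
an arctangent, which equals the argument of s since Re s > 0. -/
lemma integral_im_exp_rpow_div :
    ∫ v in Set.Ioi (0 : ℝ), (Complex.exp (-s * (v ^ α : ℝ))).im * v⁻¹ = -(1 / α) * s.arg := by
  have h0 : 0 < α := by linarith
  rw [integral_Ioi_eq_of_comp_rpow (g := fun y => -(1 / α) *
    (Real.exp (-s.re * y) * Real.sin (s.im * y) * y⁻¹)) h0, integral_const_mul,
    integral_exp_neg_mul_mul_sin_div hs, arg_eq_arctan_of_re_pos hs]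
  intro v hv
  have hp := (Real.rpow_pos_of_pos hv α).ne'
  rw [Complex.exp_im, Real.rpow_sub_one hv.ne']
  simp only [neg_mul, Complex.neg_re, Complex.neg_im, Complex.re_mul_ofReal, Complex.im_mul_ofReal,
    Real.sin_neg]
  field_simp

end Stable

section Cases

variable {Ω : Type*} [MeasurableSpace Ω] {P : Measure Ω} [IsProbabilityMeasure P] {θ : Params}
  {X : ℝ≥0 → Ω → ℝ} (hX : IsTSP θ X P)
include hX

/-- The limiting law has exponent −s v^α with s = −(p + iq). Since p < 0, Re s > 0, |s| = r and arg
s = −χ, so the three stable integrals evaluate to the constants L, M and N. -/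
theorem asymptotics_of_caseB (hB : θ.CaseB) (hc : 0 < θ.cPos + θ.cNeg) :
    LeadingTerm (slopeRR P X) (-√(2 * Real.pi ^ 3) * θ.LB * θ.MB) (1 / θ.α - 1 / 2) ∧
    LeadingTerm (convexityBF P X) (√(2 * Real.pi ^ 3) / 16 * θ.LB *
      (-1 + 2 * Real.pi * θ.LB * θ.NB + 4 * Real.pi * θ.MB ^ 2)) (1 / θ.α - 1 / 2) ∧
    HasRate (RR P X) (1 / θ.α - 1 / 2) ∧ HasRate (BF P X) (1 / θ.α - 1 / 2) := by
  obtain ⟨h1, h2, hσ⟩ := hB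
  have h0 : 0 < θ.α := by linarith
  have hβ : 0 < 1 / θ.α := by positivity
  have hp := θ.p_neg h0 h1.ne' hc
  have hcc := fun τ (hτ : 0 < τ) => Params.callPrice_eq_and_callCurve hX h0 h1.ne' hc hτ
  have hC := fun τ hτ => (hcc τ hτ).2
  -- the limiting stable law
  set s : ℂ := ((-θ.p : ℝ) : ℂ) + (-θ.q : ℝ) * Complex.I with hs
  have hsre : s.re = -θ.p := by simp [hs]
  have hsim : s.im = -θ.q := by simp [hs]
  have hs0 : 0 < s.re := by rw [hsre]; linarith
  have hst : ∀ v, θ.stableExp v = -s * (v ^ θ.α : ℝ) := fun v => by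
    rw [Params.stableExp, hs]
    push_cast
    ring
  have hr : ‖s‖ = θ.r := by
    rw [hs, Complex.norm_add_mul_I, neg_sq, neg_sq, Params.r]
  have harg : s.arg = -θ.χ := by
    rw [arg_eq_arctan_of_re_pos hs0, hsre, hsim, Params.χ, neg_div_neg_eq, neg_div,
      Real.arctan_neg, neg_neg]
  have hcos : Real.cos (1 / θ.α * s.arg) = Real.cos (1 / θ.α * θ.χ) := by
    rw [harg, mul_neg, Real.cos_neg]
  -- passage between the time `t` and the scale `τ = t ^ (2 / α)`
  have hscale : Tendsto (fun t : ℝ => t ^ (2 / θ.α)) (𝓝[>] 0) (𝓝[>] 0) :=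
    tendsto_nhdsWithin_iff.2 ⟨tendsto_rpow_zero (by positivity), by
      filter_upwards [self_mem_nhdsWithin] with t ht using Real.rpow_pos_of_pos ht _⟩
  have hscale' : Tendsto (fun τ : ℝ => τ ^ (θ.α / 2)) (𝓝[>] 0) (𝓝[>] 0) :=
    tendsto_nhdsWithin_iff.2 ⟨tendsto_rpow_zero (by positivity), by
      filter_upwards [self_mem_nhdsWithin] with t ht using Real.rpow_pos_of_pos ht _⟩
  have hinv : ∀ t : ℝ, 0 < t → (t ^ (2 / θ.α)) ^ (θ.α / 2) = t := fun t ht => by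
    rw [← Real.rpow_mul ht.le, show 2 / θ.α * (θ.α / 2) = 1 by field_simp, Real.rpow_one]
  have hsqrt : ∀ t : ℝ, 0 < t → √(t ^ (2 / θ.α)) = t ^ (1 / θ.α) := fun t ht => by
    rw [Real.sqrt_eq_rpow, ← Real.rpow_mul ht.le]
    congr 1
    field_simp
  have hL : Tendsto (fun τ => callPrice P X τ 0 / τ ^ (1 / θ.α)) (𝓝[>] 0) (𝓝 θ.LB) := by
    have l1 := (θ.tendsto_fprice_zero_div h1 hσ hc).comp hscale
    simp_rw [hst] at l1
    rw [integral_re_one_sub_exp_rpow h1 hs0, hr, hcos, ← mul_assoc, ← mul_assoc] at l1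
    refine l1.congr' ?_
    filter_upwards [self_mem_nhdsWithin] with τ hτ
    rw [Function.comp_apply, hinv τ hτ, hsqrt τ hτ, (hcc τ hτ).1]
  have hb : (fun τ => callPrice P X τ 0) =O[𝓝[>] 0] fun τ => τ ^ (1 / θ.α) := by
    refine isBigO_of_div_tendsto_nhds ?_ θ.LB hL
    filter_upwards [self_mem_nhdsWithin] with τ hτ h
    exact absurd h (Real.rpow_pos_of_pos hτ _).ne'
  have hk : Tendsto (fun τ : ℝ => volAt (callPrice P X (τ ^ (θ.α / 2))) 0 ^ 2 / 2 / √τ) (𝓝[>] 0)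
      (𝓝 0) := by
    have l1 := tendsto_volAt_zero hC hβ hL
    have l2 := (((l1.pow 2).mul (tendsto_rpow_zero hβ)).div_const 2).comp hscale'
    rw [mul_zero, zero_div] at l2
    refine l2.congr' ?_
    filter_upwards [self_mem_nhdsWithin] with τ hτ
    have hτ0 : (0 : ℝ) < τ := hτ
    have hs := Real.sqrt_pos.2 hτ0
    have e : (τ ^ (θ.α / 2)) ^ (1 / θ.α) = √τ := by
      rw [Real.sqrt_eq_rpow, ← Real.rpow_mul hτ0.le]
      congr 1
      field_simp
    rw [Function.comp_apply, e]
    field_simp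
  have hM : Tendsto (fun τ => ftail (θ.tchar τ) (volAt (callPrice P X τ) 0 ^ 2 / 2)) (𝓝[>] 0)
      (𝓝 (1 / 2 - θ.MB)) := by
    have l1 := (θ.tendsto_ftail h1 hσ hc hk).comp hscale
    simp_rw [hst] at l1
    rw [integral_im_exp_rpow_div h1 hs0, harg] at l1
    have e : 1 / 2 + 1 / Real.pi * (-(1 / θ.α) * -θ.χ) = 1 / 2 - θ.MB := by rw [Params.MB]; ring
    rw [e] at l1
    refine l1.congr' ?_
    filter_upwards [self_mem_nhdsWithin] with τ hτ
    rw [Function.comp_apply, hinv τ hτ]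
  have hN : Tendsto (fun τ => τ ^ (1 / θ.α) *
      fdens (θ.tchar τ) (volAt (callPrice P X τ) 0 ^ 2 / 2)) (𝓝[>] 0) (𝓝 θ.NB) := by
    have l1 := (θ.tendsto_sqrt_mul_fdens h1 hσ hc hk).comp hscale
    simp_rw [hst] at l1
    rw [integral_re_exp_rpow h1 hs0, hr, hcos, ← mul_assoc, ← mul_assoc] at l1
    refine l1.congr' ?_
    filter_upwards [self_mem_nhdsWithin] with τ hτ
    rw [Function.comp_apply, hinv τ hτ, hsqrt τ hτ]
  exact ⟨slopeRR_leadingTerm_of_tendsto hC hβ hL hM,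
    convexityBF_leadingTerm_of_tendsto hC hβ hL hM hN, hasRate_RR_of_isBigO hC hβ hb,
    hasRate_BF_of_isBigO hC hβ hb⟩

end Cases

end TSP

end

theorem mainTheorem3 {Ω : Type*} [MeasurableSpace Ω] (P : MeasureTheory.Measure Ω)
    [MeasureTheory.IsProbabilityMeasure P] (θ : TSP.Params) (X : NNReal → Ω → ℝ)
    (hX : TSP.IsTSP θ X P) (hc : 0 < θ.cPos + θ.cNeg) :
    (θ.CaseA ∨ θ.CaseB ∨ θ.CaseC ∨ θ.CaseD → TSP.SmileWellDefined P X) ∧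
    (θ.CaseA →
      (θ.γ ≠ 0 →
        TSP.LeadingTerm (TSP.slopeRR P X)
          (-√(2 * Real.pi ^ 3) * θ.LA * θ.MA) (1 / 2)) ∧
      TSP.HasRate (TSP.RR P X) (1 / 2)) ∧
    (θ.CaseB →
      TSP.LeadingTerm (TSP.slopeRR P X)
        (-√(2 * Real.pi ^ 3) * θ.LB * θ.MB) (1 / θ.α - 1 / 2) ∧
      TSP.LeadingTerm (TSP.convexityBF P X)
        (√(2 * Real.pi ^ 3) / 16 * θ.LB *
          (-1 + 2 * Real.pi * θ.LB * θ.NB + 4 * Real.pi * θ.MB ^ 2)) (1 / θ.α - 1 / 2) ∧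
      TSP.HasRate (TSP.RR P X) (1 / θ.α - 1 / 2) ∧
      TSP.HasRate (TSP.BF P X) (1 / θ.α - 1 / 2)) ∧
    (θ.CaseC →
      TSP.LeadingTerm (TSP.slopeRR P X) (-Real.pi * θ.σ * θ.MC) (1 / 2) ∧
      TSP.LeadingTerm (TSP.convexityBF P X) (√(2 * Real.pi ^ 3) / 16 * θ.LC) (1 / 2) ∧
      TSP.HasRate (TSP.RR P X) (1 / 2) ∧
      TSP.HasRate (TSP.BF P X) (1 / 2)) ∧
    (θ.CaseD →
      TSP.LeadingTerm (TSP.slopeRR P X) (-Real.pi * θ.σ * θ.MD) ((2 - θ.α) / 2) ∧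
      TSP.LeadingTerm (TSP.convexityBF P X)
        (√(2 * Real.pi ^ 3) / 16 * (θ.LD + θ.σ ^ 2 * θ.ND)) ((2 - θ.α) / 2) ∧
      TSP.HasRate (TSP.RR P X) ((2 - θ.α) / 2) ∧
      TSP.HasRate (TSP.BF P X) ((2 - θ.α) / 2)) ∧
    (θ.CaseB ∨ θ.CaseC ∨ θ.CaseD →
      TSP.Vanishes (TSP.slopeRR P X) ∧ TSP.Vanishes (TSP.convexityBF P X) ∧
      TSP.Vanishes (TSP.RR P X) ∧ TSP.Vanishes (TSP.BF P X)) := by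
  have hα : ∀ t, 0 < t → θ.CaseA ∨ θ.CaseB ∨ θ.CaseC ∨ θ.CaseD →
      ∃ T f, TSP.CallCurve (TSP.callPrice P X t) T f := by
    intro t ht h
    have h0 : 0 < θ.α := by
      rcases h with h | h | h | h
      exacts [h.1, one_pos.trans h.1, h.1, one_pos.trans h.1]
    have h1 : θ.α ≠ 1 := by
      rcases h with h | h | h | h
      exacts [h.2.1.ne, h.1.ne', h.2.1.ne, h.1.ne']
    exact ⟨_, _, (TSP.Params.callPrice_eq_and_callCurve hX h0 h1 hc ht).2⟩
  refine ⟨fun h => TSP.smileWellDefined_of_callCurve fun t ht => hα t ht h,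
    fun h => TSP.asymptotics_of_caseA hX h.1 h hc, fun h => TSP.asymptotics_of_caseB hX h hc, fun h => TSP.asymptotics_of_caseC hX h hc,
    fun h => TSP.asymptotics_of_caseD hX h hc, ?_⟩
  rintro (h | h | h)
  · obtain ⟨h1, h2, h3, h4⟩ := TSP.asymptotics_of_caseB hX h hc
    have he : 0 < 1 / θ.α - 1 / 2 :=
      sub_pos.2 (one_div_lt_one_div_of_lt (one_pos.trans h.1) h.2.1)
    exact ⟨h1.vanishes he, h2.vanishes he, h3.vanishes he, h4.vanishes he⟩
  · obtain ⟨h1, h2, h3, h4⟩ := TSP.asymptotics_of_caseC hX h hc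
    exact ⟨h1.vanishes one_half_pos, h2.vanishes one_half_pos, h3.vanishes one_half_pos,
      h4.vanishes one_half_pos⟩
  · obtain ⟨h1, h2, h3, h4⟩ := TSP.asymptotics_of_caseD hX h hc
    have he : 0 < (2 - θ.α) / 2 := by linarith [h.2.1]
    exact ⟨h1.vanishes he, h2.vanishes he, h3.vanishes he, h4.vanishes he⟩
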